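/- Let $k$ be an algebraically closed field of characteristic $0$. For an algebraic supergroup $G$ over $k$, $\mathrm{Rep}(G)$ denotes the $k$-linear rigid symmetric monoidal category of representations of $G$ on finite-dimensional vector superspaces, with parity-preserving equivariant maps as morphisms; $\Pi$ denotes the parity shift. A tensor category is an abelian rigid symmetric monoidal $k$-linear category with biexact tensor product and $\mathrm{End}(\mathbb 1)=k$; a tensor equivalence is an exact $k$-linear symmetric monoidal functor that is an equivalence of categories. The semisimplification of a rigid symmetric monoidal $k$-linear category $\mathcal C$ is the quotient functor $\mathcal C\to\overline{\mathcal C}=\mathcal C/\mathcal N$, where $\mathcal N$ is the tensor ideal of negligible morphisms, that is, of the morphisms $f:X\to Y$ such that $\mathrm{tr}(g\circ f)=0$ for all $g:Y\to X$. Let $OSp(1|2)$ be the supergroup of automorphisms of $k^{1|2}$ that preserve a fixed non-degenerate supersymmetric bilinear form and have Berezinian $1$, and let $\mathbb G_a^{(1|1)}$ be the $(1|1)$-dimensional supergroup with even part $\mathbb G_a$ whose Lie superalgebra has basis $x,[x,x]$ with $x$ odd. Embed $\mathbb G_a^{(1|1)}$ into $OSp(1|2)$ by an odd $x\in\mathfrak{osp}(1|2)$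 such that $x^2=\frac12[x,x]$ is the matrix $\begin{pmatrix}0&0\\1&0\end{pmatrix}\in\mathfrak{sl}_2$, and let $S^*:\mathrm{Rep}(OSp(1|2))\to\mathcal U=\mathrm{Rep}(\mathbb G_a^{(1|1)})$ be the restriction functor. Let $S:\mathcal U\to\overline{\mathcal U}$ be the semisimplification of $\mathcal U$, and for $n\ge 0$ let $M_n\in\mathcal U$ be the representation with basis $a_0,\dots,a_n$, where $a_j$ has parity $j$ mod $2$, $x a_j=a_{j+1}$ for $j<n$ and $x a_n=0$. Then: (a) $\mathrm{Rep}(OSp(1|2))$ and $\overline{\mathcal U}$ are tensor categories and $S\circ S^*:\mathrm{Rep}(OSp(1|2))\to\overline{\mathcal U}$ is a tensor equivalence. (b) For all $n\ge 0$, $S(M_{2n+1})=0=S(\Pi M_{2n+1})$, and $S(M_{2n})$ and $S(\Pi M_{2n})$ are simple. Every simple object of $\overline{\mathcal U}$ is isomorphic to some $S(M_{2n})$ or $S(\Pi M_{2n})$, and these objects are pairwise non-isomorphic: $S(M_{2m})\cong S(M_{2n})$ only if $m=n$, and $S(M_{2m})\not\cong S(\Pi M_{2n})$ for all $m,n$.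 (c) Hence $\mathrm{Rep}(OSp(1|2))$ is the semisimplification of $\mathcal U$: there is a $k$-linear symmetric monoidal functor $T:\mathcal U\to\mathrm{Rep}(OSp(1|2))$ with a monoidal isomorphism $S\circ S^*\circ T\cong S$ such that, for all $n\ge 0$, $T(M_{2n+1})=0$ and $T(M_{2n})$ is a simple representation of super dimension $(n+1|n)$ with $S^*(T(M_{2n}))\cong M_{2n}$, and such that every simple object of $\mathrm{Rep}(OSp(1|2))$ is isomorphic to some $T(M_{2n})$ or $\Pi T(M_{2n})$. -/

import Mathlib

open CategoryTheory MonoidalCategory TensorProduct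

universe u

noncomputable section

set_option linter.unusedSectionVars false
set_option linter.unusedVariables false
set_option linter.unusedSimpArgs false

namespace SuperRep

section

variable (k : Type u) [Field k]

/-! ### Vector superspaces -/

/-- The Koszul sign `(-1)^{ij}` of two parities. -/
def koszul (i j : ZMod 2) : k := if i = 1 ∧ j = 1 then -1 else 1

/-- A `ℤ/2`-grading on a vector space. -/
class SuperSpace (V : Type u) [AddCommGroup V] [Module k V] where
  grade : ZMod 2 → Submodule k V
  isCompl : IsCompl (grade 0) (grade 1)

/-- The homogeneous component `Vᵢ`. -/
abbrev gr (k : Type u) [Field k] (V : Type u) [AddCommGroup V] [Module k V] [SuperSpace k V]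
    (i : ZMod 2) : Submodule k V := SuperSpace.grade i

/-- Supercommutative superalgebras: `|1| = 0`, `|ab| = |a| + |b|`, `ab = (-1)^{|a||b|} ba`. -/
class SuperCommAlgebra (A : Type u) [Ring A] [Algebra k A] extends SuperSpace k A where
  one_mem : (1 : A) ∈ grade 0
  mul_mem : ∀ {i j : ZMod 2} {a b : A}, a ∈ grade i → b ∈ grade j → a * b ∈ grade (i + j)
  super_comm : ∀ {i j : ZMod 2} {a b : A}, a ∈ grade i → b ∈ grade j → a * b = koszul k i j • (b * a)

section koszul

lemma zmod_two (i : ZMod 2) : i = 0 ∨ i = 1 := by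
  revert i; decide

lemma koszul_zero_left (j : ZMod 2) : koszul k 0 j = 1 := by simp [koszul]
lemma koszul_zero_right (j : ZMod 2) : koszul k j 0 = 1 := by simp [koszul]
lemma koszul_one_one : koszul k 1 1 = -1 := by simp [koszul]

lemma koszul_symm (i j : ZMod 2) : koszul k i j = koszul k j i := by
  simp [koszul, and_comm]

lemma koszul_mul_self (i j : ZMod 2) : koszul k i j * koszul k i j = 1 := by
  unfold koszul; split_ifs <;> simp

lemma one_add_one : (1 + 1 : ZMod 2) = 0 := by decide

lemma koszul_add_left (i i' j : ZMod 2) :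
    koszul k (i + i') j = koszul k i j * koszul k i' j := by
  rcases zmod_two i with rfl | rfl <;> rcases zmod_two i' with rfl | rfl <;>
    rcases zmod_two j with rfl | rfl <;>
    simp [koszul_zero_left, koszul_zero_right, koszul_one_one, one_add_one]

lemma koszul_add_right (i j j' : ZMod 2) :
    koszul k i (j + j') = koszul k i j * koszul k i j' := by
  rw [koszul_symm, koszul_add_left, koszul_symm k j, koszul_symm k j']

end koszul

variable {k}
variable {V W U : Type u} [AddCommGroup V] [Module k V] [AddCommGroup W] [Module k W]
  [AddCommGroup U] [Module k U]

section basics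
variable [SuperSpace k V] [SuperSpace k W] [SuperSpace k U]

variable (k V) in
/-- The projection onto the odd part, along the even part. -/
def oddProj : V →ₗ[k] V := Submodule.projection _ _ (SuperSpace.isCompl (k := k) (V := V)).symm

lemma oddProj_of_even {v : V} (hv : v ∈ gr k V 0) : oddProj k V v = 0 :=
  Submodule.projection_apply_of_mem_right _ hv

lemma oddProj_of_odd {v : V} (hv : v ∈ gr k V 1) : oddProj k V v = v :=
  Submodule.projection_apply_of_mem_left _ hv

lemma exists_decomp (v : V) :
    ∃ v₀ ∈ gr k V 0, ∃ v₁ ∈ gr k V 1, v₀ + v₁ = v := by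
  have h := (SuperSpace.isCompl (k := k) (V := V)).sup_eq_top
  have : v ∈ gr k V 0 ⊔ gr k V 1 := by rw [h]; trivial
  exact Submodule.mem_sup.1 this

lemma hom_induction {p : V → Prop} (hadd : ∀ a b, p a → p b → p (a + b))
    (hom : ∀ (i : ZMod 2), ∀ v ∈ gr k V i, p v) (v : V) : p v := by
  obtain ⟨a, ha, b, hb, rfl⟩ := exists_decomp (k := k) v
  exact hadd _ _ (hom _ _ ha) (hom _ _ hb)

lemma super_ext {X : Type*} [AddCommGroup X] [Module k X] {f g : V →ₗ[k] X}
    (h : ∀ (i : ZMod 2), ∀ v ∈ gr k V i, f v = g v) : f = g :=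
  LinearMap.ext fun v => hom_induction (k := k) (p := fun v => f v = g v)
    (fun a b ha hb => by rw [map_add, map_add, ha, hb]) h v

/-- A parity-preserving linear map. -/
def IsEven (f : V →ₗ[k] W) : Prop :=
  ∀ (i : ZMod 2), ∀ v ∈ gr k V i, f v ∈ gr k W i

/-- `(V ⊗ W)ₙ` is spanned by the `v ⊗ w` with `|v| + |w| = n`. -/
instance tensorSuper : SuperSpace k (V ⊗[k] W) where
  grade n := Submodule.span k {t | ∃ i j : ZMod 2, i + j = n ∧ ∃ v ∈ gr k V i,
    ∃ w ∈ gr k W j, v ⊗ₜ[k] w = t}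
  isCompl := by
    constructor
    · rw [Submodule.disjoint_def]
      intro x h0 h1
      let q : V ⊗[k] W →ₗ[k] V ⊗[k] W :=
        TensorProduct.map (oddProj k V) (.id - oddProj k W)
          + TensorProduct.map (.id - oddProj k V) (oddProj k W)
      have e0 : q x = 0 := by
        clear h1
        induction h0 using Submodule.span_induction with
        | mem t ht =>
          obtain ⟨i, j, hij, v, hv, w, hw, rfl⟩ := ht
          rcases zmod_two i with rfl | rfl <;> rcases zmod_two j with rfl | rfl
          · simp [q, oddProj_of_even hv, oddProj_of_even hw]
          · simp at hij
          · simp at hij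
          · simp [q, oddProj_of_odd hv, oddProj_of_odd hw]
        | zero => simp
        | add a b _ _ ha hb => rw [map_add, ha, hb, add_zero]
        | smul c a _ ha => rw [map_smul, ha, smul_zero]
      have e1 : q x = x := by
        clear e0 h0
        induction h1 using Submodule.span_induction with
        | mem t ht =>
          obtain ⟨i, j, hij, v, hv, w, hw, rfl⟩ := ht
          rcases zmod_two i with rfl | rfl <;> rcases zmod_two j with rfl | rfl
          · simp at hij
          · simp [q, oddProj_of_even hv, oddProj_of_odd hw]
          · simp [q, oddProj_of_odd hv, oddProj_of_even hw]
          · simp [one_add_one] at hij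
        | zero => simp
        | add a b _ _ ha hb => rw [map_add, ha, hb]
        | smul c a _ ha => rw [map_smul, ha]
      rw [← e1, e0]
    · rw [codisjoint_iff, eq_top_iff]
      intro x _
      induction x using TensorProduct.induction_on with
      | zero => exact zero_mem _
      | add a b ha hb => exact add_mem (ha trivial) (hb trivial)
      | tmul v w =>
        refine hom_induction (k := k) (p := fun v => v ⊗ₜ[k] w ∈ _)
          (fun a b ha hb => ?_) (fun i v hv => ?_) v
        · rw [TensorProduct.add_tmul]; exact add_mem ha hb
        · refine hom_induction (k := k) (p := fun w => v ⊗ₜ[k] w ∈ _)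
            (fun a b ha hb => ?_) (fun j w hw => ?_) w
          · rw [TensorProduct.tmul_add]; exact add_mem ha hb
          · rcases zmod_two (i + j) with h | h
            · exact Submodule.mem_sup_left (Submodule.subset_span ⟨i, j, h, v, hv, w, hw, rfl⟩)
            · exact Submodule.mem_sup_right (Submodule.subset_span ⟨i, j, h, v, hv, w, hw, rfl⟩)

lemma tmul_mem {i j n : ZMod 2} (h : i + j = n) {v : V} {w : W}
    (hv : v ∈ gr k V i) (hw : w ∈ gr k W j) :
    v ⊗ₜ[k] w ∈ gr k (V ⊗[k] W) n :=
  Submodule.subset_span ⟨i, j, h, v, hv, w, hw, rfl⟩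

lemma tensor_super_ext {X : Type*} [AddCommGroup X] [Module k X] {f g : V ⊗[k] W →ₗ[k] X}
    (h : ∀ (i j : ZMod 2), ∀ v ∈ gr k V i, ∀ w ∈ gr k W j,
      f (v ⊗ₜ w) = g (v ⊗ₜ w)) : f = g := by
  refine TensorProduct.ext' fun v w => ?_
  refine hom_induction (k := k) (p := fun v => f (v ⊗ₜ[k] w) = g (v ⊗ₜ w))
    (fun a b ha hb => by rw [TensorProduct.add_tmul, map_add, map_add, ha, hb]) (fun i v hv => ?_) v
  exact hom_induction (k := k) (p := fun w => f (v ⊗ₜ[k] w) = g (v ⊗ₜ w))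
    (fun a b ha hb => by rw [TensorProduct.tmul_add, map_add, map_add, ha, hb])
    (fun j w hw => h i j v hv w hw) w

lemma isEven_tensor {f : V ⊗[k] W →ₗ[k] U}
    (h : ∀ (i j : ZMod 2), ∀ v ∈ gr k V i, ∀ w ∈ gr k W j,
      f (v ⊗ₜ w) ∈ gr k U (i + j)) : IsEven f := by
  intro n x hx
  induction hx using Submodule.span_induction with
  | mem t ht =>
    obtain ⟨i, j, rfl, v, hv, w, hw, rfl⟩ := ht
    exact h i j v hv w hw
  | zero => simp
  | add a b _ _ ha hb => rw [map_add]; exact add_mem ha hb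
  | smul c a _ ha => rw [map_smul]; exact Submodule.smul_mem _ _ ha

/-- Induction for elements of `(V ⊗ W)ₙ`. -/
lemma tensor_gr_induction {n : ZMod 2} {p : V ⊗[k] W → Prop} (h0 : p 0)
    (hadd : ∀ a b, p a → p b → p (a + b))
    (hsmul : ∀ (c : k) a, p a → p (c • a))
    (ht : ∀ (i j : ZMod 2), i + j = n → ∀ v ∈ gr k V i,
      ∀ w ∈ gr k W j, p (v ⊗ₜ w))
    {x : V ⊗[k] W} (hx : x ∈ gr k (V ⊗[k] W) n) : p x := by
  induction hx using Submodule.span_induction with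
  | mem t h =>
    obtain ⟨i, j, hij, v, hv, w, hw, rfl⟩ := h
    exact ht i j hij v hv w hw
  | zero => exact h0
  | add a b _ _ ha hb => exact hadd _ _ ha hb
  | smul c a _ ha => exact hsmul _ _ ha

lemma IsEven.id : IsEven (LinearMap.id : V →ₗ[k] V) := fun _ _ h => h

lemma IsEven.comp {f : V →ₗ[k] W} {g : W →ₗ[k] U} (hg : IsEven g) (hf : IsEven f) :
    IsEven (g ∘ₗ f) := fun i v hv => hg i _ (hf i v hv)

lemma IsEven.tensorMap {V' W' : Type u} [AddCommGroup V'] [Module k V'] [AddCommGroup W']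
    [Module k W'] [SuperSpace k V'] [SuperSpace k W'] {f : V →ₗ[k] V'} {g : W →ₗ[k] W'}
    (hf : IsEven f) (hg : IsEven g) : IsEven (TensorProduct.map f g) :=
  isEven_tensor fun i j v hv w hw => by
    rw [TensorProduct.map_tmul]
    exact tmul_mem rfl (hf i v hv) (hg j w hw)

/-- The sign operator `v ⊗ w ↦ (-1)^{|v||w|} v ⊗ w`. -/
def signOp : V ⊗[k] W →ₗ[k] V ⊗[k] W :=
  LinearMap.id - (2 : k) • TensorProduct.map (oddProj k V) (oddProj k W)

lemma signOp_tmul {i j : ZMod 2} {v : V} {w : W} (hv : v ∈ gr k V i)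
    (hw : w ∈ gr k W j) : signOp (k := k) (v ⊗ₜ w) = koszul k i j • v ⊗ₜ[k] w := by
  rcases zmod_two i with rfl | rfl <;> rcases zmod_two j with rfl | rfl <;>
    simp [signOp, koszul_zero_left, koszul_zero_right, koszul_one_one, oddProj_of_even,
      oddProj_of_odd, hv, hw]
  module

lemma signOp_signOp (x : V ⊗[k] W) : signOp (k := k) (signOp (k := k) x) = x := by
  have : signOp (k := k) ∘ₗ signOp = (LinearMap.id : V ⊗[k] W →ₗ[k] V ⊗[k] W) := by
    refine tensor_super_ext fun i j v hv w hw => ?_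
    simp [signOp_tmul hv hw, smul_smul, koszul_mul_self]
  exact LinearMap.congr_fun this x

lemma signOp_isEven : IsEven (signOp (k := k) (V := V) (W := W)) :=
  isEven_tensor fun i j v hv w hw => by
    rw [signOp_tmul hv hw]; exact Submodule.smul_mem _ _ (tmul_mem rfl hv hw)

variable (k V W) in
/-- The symmetry `v ⊗ w ↦ (-1)^{|v||w|} w ⊗ v`. -/
def superBraid : V ⊗[k] W →ₗ[k] W ⊗[k] V :=
  (TensorProduct.comm k V W).toLinearMap ∘ₗ signOp

lemma superBraid_tmul {i j : ZMod 2} {v : V} {w : W} (hv : v ∈ gr k V i)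
    (hw : w ∈ gr k W j) : superBraid k V W (v ⊗ₜ w) = koszul k i j • w ⊗ₜ[k] v := by
  simp [superBraid, signOp_tmul hv hw]

lemma superBraid_isEven : IsEven (superBraid k V W) :=
  isEven_tensor fun i j v hv w hw => by
    rw [superBraid_tmul hv hw]; exact Submodule.smul_mem _ _ (tmul_mem (add_comm _ _) hw hv)

lemma superBraid_superBraid (x : V ⊗[k] W) : superBraid k W V (superBraid k V W x) = x := by
  have : superBraid k W V ∘ₗ superBraid k V W = LinearMap.id := by
    refine tensor_super_ext fun i j v hv w hw => ?_
    simp [superBraid_tmul hv hw, superBraid_tmul hw hv, smul_smul, koszul_symm k j i,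
      koszul_mul_self]
  exact LinearMap.congr_fun this x

/-- The ground field, placed in even degree. -/
instance unitSuper : SuperSpace k k where
  grade i := if i = 0 then ⊤ else ⊥
  isCompl := by simpa using isCompl_top_bot

lemma mem_unit_zero (c : k) : c ∈ gr k k 0 := by
  simp [gr, SuperSpace.grade]

lemma mem_unit_one {c : k} : c ∈ gr k k 1 ↔ c = 0 := by
  simp [gr, SuperSpace.grade]

/-- The dual superspace: `(V*)ᵢ` consists of the functionals that vanish on `V_{i+1}`. -/
instance dualSuper : SuperSpace k (Module.Dual k V) where
  grade i := (gr k V (i + 1)).dualAnnihilator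
  isCompl := by
    have h := SuperSpace.isCompl (k := k) (V := V)
    rw [show (0 : ZMod 2) + 1 = 1 from rfl, show (1 : ZMod 2) + 1 = 0 from rfl]
    constructor
    · rw [Submodule.disjoint_def]
      intro ξ h1 h0
      rw [Submodule.mem_dualAnnihilator] at h1 h0
      ext v
      obtain ⟨a, ha, b, hb, rfl⟩ := exists_decomp (k := k) v
      simp [h0 a ha, h1 b hb]
    · rw [codisjoint_iff, eq_top_iff]
      intro ξ _
      rw [Submodule.mem_sup]
      refine ⟨ξ ∘ₗ (.id - oddProj k V), ?_, ξ ∘ₗ oddProj k V, ?_, ?_⟩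
      · rw [Submodule.mem_dualAnnihilator]
        intro v hv
        simp [oddProj_of_odd hv]
      · rw [Submodule.mem_dualAnnihilator]
        intro v hv
        simp [oddProj_of_even hv]
      · ext v; simp

lemma dual_apply_eq_zero {i j : ZMod 2} (hij : i ≠ j) {ξ : Module.Dual k V}
    (hξ : ξ ∈ gr k (Module.Dual k V) i) {v : V} (hv : v ∈ gr k V j) :
    ξ v = 0 := by
  have hj : j = i + 1 := by
    clear hξ hv
    revert i j; decide
  subst hj
  exact (Submodule.mem_dualAnnihilator ξ).1 hξ v hv

lemma contractLeft_isEven : IsEven (k := k) (V := Module.Dual k V ⊗[k] V) (W := k) (contractLeft k V) :=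
  isEven_tensor fun i j ξ hξ v hv => by
    rw [contractLeft_apply]
    by_cases h : i = j
    · subst h
      rw [show i + i = 0 by clear hξ hv; revert i; decide]
      exact mem_unit_zero _
    · rw [dual_apply_eq_zero h hξ hv]; exact zero_mem _

end basics

end

section

variable {k : Type u} [Field k]
variable {V V' V'' W W' U : Type u} [AddCommGroup V] [Module k V] [AddCommGroup V'] [Module k V']
  [AddCommGroup V''] [Module k V''] [AddCommGroup W] [Module k W]
  [AddCommGroup W'] [Module k W'] [AddCommGroup U] [Module k U]
variable {A B : Type u} [Ring A] [Algebra k A] [Ring B] [Algebra k B]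

section extend

/-- The right `A`-linear extension `V ⊗ A → V' ⊗ A`, `v ⊗ a ↦ φ(v) a`, of `φ : V → V' ⊗ A`. -/
def extend (φ : V →ₗ[k] V' ⊗[k] A) : V ⊗[k] A →ₗ[k] V' ⊗[k] A :=
  (LinearMap.mul' k A).lTensor V' ∘ₗ (TensorProduct.assoc k V' A A).toLinearMap ∘ₗ φ.rTensor A

variable (k V A) in
/-- The map `v ↦ v ⊗ 1`. -/
def unitMap : V →ₗ[k] V ⊗[k] A := (TensorProduct.mk k V A).flip 1

@[simp] lemma unitMap_apply (v : V) : unitMap k V A v = v ⊗ₜ 1 := rfl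

/-- Right multiplication by `a` on `V ⊗ A`. -/
def rmul (a : A) : V ⊗[k] A →ₗ[k] V ⊗[k] A := (LinearMap.mulRight k a).lTensor V

@[simp] lemma rmul_tmul (v : V) (a b : A) : rmul (k := k) b (v ⊗ₜ[k] a) = v ⊗ₜ (a * b) := rfl

lemma rmul_rmul (a b : A) (x : V ⊗[k] A) : rmul b (rmul a x) = rmul (a * b) x := by
  induction x using TensorProduct.induction_on with
  | zero => simp
  | tmul v c => simp [mul_assoc]
  | add x y hx hy => rw [map_add, map_add, map_add, hx, hy]

@[simp] lemma rmul_one (x : V ⊗[k] A) : rmul (k := k) (1 : A) x = x := by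
  induction x using TensorProduct.induction_on with
  | zero => simp
  | tmul v c => simp
  | add x y hx hy => rw [map_add, hx, hy]

lemma rTensor_rmul (f : V →ₗ[k] V') (a : A) (x : V ⊗[k] A) :
    f.rTensor A (rmul a x) = rmul a (f.rTensor A x) := by
  induction x using TensorProduct.induction_on with
  | zero => simp
  | tmul v c => simp
  | add x y hx hy => rw [map_add, map_add, map_add, map_add, hx, hy]

@[simp] lemma extend_tmul (φ : V →ₗ[k] V' ⊗[k] A) (v : V) (a : A) :
    extend φ (v ⊗ₜ a) = rmul a (φ v) := by
  simp only [extend, LinearMap.comp_apply, LinearMap.rTensor_tmul, LinearEquiv.coe_coe]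
  induction φ v using TensorProduct.induction_on with
  | zero => simp
  | tmul v c => simp
  | add x y hx hy => rw [TensorProduct.add_tmul, map_add, map_add, map_add, hx, hy]

lemma extend_rmul (φ : V →ₗ[k] V' ⊗[k] A) (a : A) (x : V ⊗[k] A) :
    extend φ (rmul a x) = rmul a (extend φ x) := by
  induction x using TensorProduct.induction_on with
  | zero => simp
  | tmul v c => simp [rmul_rmul]
  | add x y hx hy => rw [map_add, map_add, map_add, map_add, hx, hy]

lemma extend_extend (φ : V' →ₗ[k] V'' ⊗[k] A) (ψ : V →ₗ[k] V' ⊗[k] A) (x : V ⊗[k] A) :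
    extend φ (extend ψ x) = extend (extend φ ∘ₗ ψ) x := by
  induction x using TensorProduct.induction_on with
  | zero => simp
  | tmul v c => simp [extend_rmul]
  | add x y hx hy => rw [map_add, map_add, map_add, hx, hy]

@[simp] lemma extend_unitMap (x : V ⊗[k] A) : extend (unitMap k V A) x = x := by
  induction x using TensorProduct.induction_on with
  | zero => simp
  | tmul v c => simp
  | add x y hx hy => rw [map_add, hx, hy]

lemma rTensor_extend (f : V' →ₗ[k] V'') (φ : V →ₗ[k] V' ⊗[k] A) (x : V ⊗[k] A) :
    f.rTensor A (extend φ x) = extend (f.rTensor A ∘ₗ φ) x := by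
  induction x using TensorProduct.induction_on with
  | zero => simp
  | tmul v c => simp [rTensor_rmul]
  | add x y hx hy => rw [map_add, map_add, map_add, hx, hy]

lemma extend_rTensor (f : V →ₗ[k] V') (φ : V' →ₗ[k] V'' ⊗[k] A) (x : V ⊗[k] A) :
    extend φ (f.rTensor A x) = extend (φ ∘ₗ f) x := by
  induction x using TensorProduct.induction_on with
  | zero => simp
  | tmul v c => simp
  | add x y hx hy => rw [map_add, map_add, map_add, hx, hy]

lemma lTensor_rmul (f : A →ₐ[k] B) (a : A) (x : V ⊗[k] A) :
    f.toLinearMap.lTensor V (rmul a x) = rmul (f a) (f.toLinearMap.lTensor V x) := by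
  induction x using TensorProduct.induction_on with
  | zero => simp
  | tmul v c => simp
  | add x y hx hy => rw [map_add, map_add, map_add, map_add, hx, hy]

lemma lTensor_extend (f : A →ₐ[k] B) (φ : V →ₗ[k] V' ⊗[k] A) (x : V ⊗[k] A) :
    f.toLinearMap.lTensor V' (extend φ x)
      = extend (f.toLinearMap.lTensor V' ∘ₗ φ) (f.toLinearMap.lTensor V x) := by
  induction x using TensorProduct.induction_on with
  | zero => simp
  | tmul v c => simp [lTensor_rmul]
  | add x y hx hy => rw [map_add, map_add, map_add, map_add, hx, hy]

end extend

section superMul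

variable [SuperSpace k V] [SuperSpace k V'] [SuperSpace k W] [SuperSpace k W'] [SuperSpace k U]
  [SuperCommAlgebra k A] [SuperCommAlgebra k B]

lemma rmul_mem {i j : ZMod 2} {a : A} (ha : a ∈ gr k A j) {x : V ⊗[k] A}
    (hx : x ∈ gr k (V ⊗[k] A) i) : rmul a x ∈ gr k (V ⊗[k] A) (i + j) := by
  refine tensor_gr_induction (k := k)
    (p := fun x => rmul (k := k) a x ∈ gr k (V ⊗[k] A) (i + j))
    (by rw [map_zero]; exact zero_mem _) (fun a b ha hb => by rw [map_add]; exact add_mem ha hb)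
    (fun c a ha => by rw [map_smul]; exact Submodule.smul_mem _ _ ha) ?_ hx
  rintro i' j' rfl v hv b hb
  rw [rmul_tmul]
  exact tmul_mem (add_assoc _ _ _).symm hv (SuperCommAlgebra.mul_mem hb ha)

lemma extend_isEven {φ : V →ₗ[k] V' ⊗[k] A} (hφ : IsEven φ) : IsEven (extend φ) :=
  isEven_tensor fun i j v hv a ha => by
    rw [extend_tmul]; exact rmul_mem ha (hφ i v hv)

lemma unitMap_isEven : IsEven (unitMap k V A) := fun _ _ hv =>
  tmul_mem (add_zero _) hv SuperCommAlgebra.one_mem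

variable (k V W A) in
/-- The product `(V ⊗ A) ⊗ (W ⊗ A) → (V ⊗ W) ⊗ A`,
`(v ⊗ a) ⊗ (w ⊗ b) ↦ (-1)^{|a||w|} (v ⊗ w) ⊗ ab`, which identifies
`(V ⊗ A) ⊗_A (W ⊗ A)` with `(V ⊗ W) ⊗ A`. -/
def superMul : (V ⊗[k] A) ⊗[k] (W ⊗[k] A) →ₗ[k] (V ⊗[k] W) ⊗[k] A :=
  (LinearMap.mul' k A).lTensor (V ⊗[k] W) ∘ₗ
    (TensorProduct.tensorTensorTensorComm k V A W A).toLinearMap ∘ₗ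
      (LinearMap.id - (2 : k) • TensorProduct.map ((oddProj k A).lTensor V)
        ((oddProj k W).rTensor A))

lemma superMul_tmul {i j : ZMod 2} (v : V) {a : A} (ha : a ∈ gr k A i) {w : W}
    (hw : w ∈ gr k W j) (b : A) :
    superMul k V W A ((v ⊗ₜ a) ⊗ₜ (w ⊗ₜ b)) = koszul k i j • (v ⊗ₜ[k] w) ⊗ₜ[k] (a * b) := by
  rcases zmod_two i with rfl | rfl <;> rcases zmod_two j with rfl | rfl <;>
    simp [superMul, koszul_zero_left, koszul_zero_right, koszul_one_one, oddProj_of_even,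
      oddProj_of_odd, ha, hw]
  module

/-- To prove an identity between linear maps on `(V ⊗ A) ⊗ (W ⊗ A)`, test on homogeneous tensors. -/
lemma superMul_ext {X : Type*} [AddCommGroup X] [Module k X]
    {f g : (V ⊗[k] A) ⊗[k] (W ⊗[k] A) →ₗ[k] X}
    (h : ∀ (i j i' j' : ZMod 2), ∀ v ∈ gr k V i, ∀ a ∈ gr k A j,
      ∀ w ∈ gr k W i', ∀ b ∈ gr k A j',
      f ((v ⊗ₜ a) ⊗ₜ (w ⊗ₜ b)) = g ((v ⊗ₜ a) ⊗ₜ (w ⊗ₜ b))) : f = g := by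
  apply TensorProduct.ext
  refine tensor_super_ext (k := k) fun i j v hv a ha => ?_
  exact tensor_super_ext (k := k) fun i' j' w hw b hb => h i j i' j' v hv a ha w hw b hb

lemma superMul_isEven : IsEven (superMul k V W A) := by
  refine isEven_tensor fun i j x hx y hy => ?_
  refine tensor_gr_induction (k := k) (p := fun x => superMul k V W A (x ⊗ₜ y) ∈ gr k _ (i + j))
    (by simp) (fun a b ha hb => by rw [TensorProduct.add_tmul, map_add]; exact add_mem ha hb)
    (fun c a ha => by
      rw [← TensorProduct.smul_tmul', map_smul]; exact Submodule.smul_mem _ _ ha) ?_ hx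
  rintro i₁ i₂ rfl v hv a ha
  refine tensor_gr_induction (k := k)
    (p := fun y => superMul k V W A ((v ⊗ₜ a) ⊗ₜ y) ∈ gr k _ (i₁ + i₂ + j))
    (by simp) (fun a b ha hb => by rw [TensorProduct.tmul_add, map_add]; exact add_mem ha hb)
    (fun c a ha => by
      rw [TensorProduct.tmul_smul, map_smul]; exact Submodule.smul_mem _ _ ha) ?_ hy
  rintro j₁ j₂ rfl w hw b hb
  rw [superMul_tmul v ha hw]
  exact Submodule.smul_mem _ _ (tmul_mem (by abel) (tmul_mem rfl hv hw)
    (SuperCommAlgebra.mul_mem ha hb))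

lemma superMul_rmul_right (x : V ⊗[k] A) (y : W ⊗[k] A) (a : A) :
    superMul k V W A (x ⊗ₜ rmul a y) = rmul a (superMul k V W A (x ⊗ₜ y)) := by
  have : superMul k V W A ∘ₗ (rmul (k := k) a).lTensor (V ⊗[k] A)
      = rmul (k := k) a ∘ₗ superMul k V W A := by
    refine superMul_ext fun i j i' j' v hv c hc w hw b hb => ?_
    simp [superMul_tmul v hc hw, mul_assoc]
  exact LinearMap.congr_fun this (x ⊗ₜ y)

lemma superMul_rmul_left {i j : ZMod 2} (x : V ⊗[k] A) {y : W ⊗[k] A}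
    (hy : y ∈ gr k (W ⊗[k] A) j) {a : A} (ha : a ∈ gr k A i) :
    superMul k V W A (rmul a x ⊗ₜ y) = koszul k i j • rmul a (superMul k V W A (x ⊗ₜ y)) := by
  refine tensor_gr_induction (k := k) (p := fun y => superMul k V W A (rmul a x ⊗ₜ y)
    = koszul k i j • rmul a (superMul k V W A (x ⊗ₜ y))) (by simp)
    (fun y z hy hz => by
      rw [TensorProduct.tmul_add, TensorProduct.tmul_add, map_add, map_add, map_add, hy, hz,
        smul_add])
    (fun c y hy => by
      rw [TensorProduct.tmul_smul, TensorProduct.tmul_smul, map_smul, map_smul, map_smul, hy,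
        smul_comm]) ?_ hy
  rintro j₁ j₂ rfl w hw b hb
  have : (superMul k V W A ∘ₗ (TensorProduct.mk k _ _).flip (w ⊗ₜ b)) ∘ₗ rmul (k := k) a
      = koszul k i (j₁ + j₂) • (rmul (k := k) a ∘ₗ
        (superMul k V W A ∘ₗ (TensorProduct.mk k _ _).flip (w ⊗ₜ b))) := by
    refine tensor_super_ext fun i₁ i₂ v hv c hc => ?_
    simp only [LinearMap.comp_apply, LinearMap.smul_apply, rmul_tmul, LinearMap.flip_apply,
      TensorProduct.mk_apply]
    rw [superMul_tmul v (SuperCommAlgebra.mul_mem hc ha) hw, superMul_tmul v hc hw, map_smul,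
      rmul_tmul, mul_assoc, SuperCommAlgebra.super_comm ha hb, mul_smul_comm, ← mul_assoc,
      TensorProduct.tmul_smul, smul_smul, smul_smul, koszul_add_left, koszul_add_right]
    congr 1; ring
  exact LinearMap.congr_fun this x

lemma extend_superMul {φ : V →ₗ[k] V' ⊗[k] A} {ψ : W →ₗ[k] W' ⊗[k] A}
    (hψ : IsEven ψ) (x : V ⊗[k] A) (y : W ⊗[k] A) :
    extend (superMul k V' W' A ∘ₗ TensorProduct.map φ ψ) (superMul k V W A (x ⊗ₜ y))
      = superMul k V' W' A (extend φ x ⊗ₜ extend ψ y) := by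
  have : extend (superMul k V' W' A ∘ₗ TensorProduct.map φ ψ) ∘ₗ superMul k V W A
      = superMul k V' W' A ∘ₗ TensorProduct.map (extend φ) (extend ψ) := by
    refine superMul_ext fun i j i' j' v hv a ha w hw b hb => ?_
    simp only [LinearMap.comp_apply, superMul_tmul v ha hw, map_smul, extend_tmul,
      TensorProduct.map_tmul]
    rw [superMul_rmul_right, superMul_rmul_left _ (hψ _ _ hw) ha, map_smul, rmul_rmul]
  exact LinearMap.congr_fun this (x ⊗ₜ y)

lemma rTensor_superMul {f : V →ₗ[k] V'} {g : W →ₗ[k] W'} (hg : IsEven g)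
    (x : V ⊗[k] A) (y : W ⊗[k] A) :
    (TensorProduct.map f g).rTensor A (superMul k V W A (x ⊗ₜ y))
      = superMul k V' W' A (f.rTensor A x ⊗ₜ g.rTensor A y) := by
  have : (TensorProduct.map f g).rTensor A ∘ₗ superMul k V W A
      = superMul k V' W' A ∘ₗ TensorProduct.map (f.rTensor A) (g.rTensor A) := by
    refine superMul_ext fun i j i' j' v hv a ha w hw b hb => ?_
    simp [superMul_tmul v ha hw, superMul_tmul (f v) ha (hg _ _ hw)]
  exact LinearMap.congr_fun this (x ⊗ₜ y)

lemma lTensor_superMul {f : A →ₐ[k] B} (hf : IsEven (k := k) f.toLinearMap)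
    (x : V ⊗[k] A) (y : W ⊗[k] A) :
    f.toLinearMap.lTensor (V ⊗[k] W) (superMul k V W A (x ⊗ₜ y))
      = superMul k V W B (f.toLinearMap.lTensor V x ⊗ₜ f.toLinearMap.lTensor W y) := by
  have : f.toLinearMap.lTensor (V ⊗[k] W) ∘ₗ superMul k V W A
      = superMul k V W B ∘ₗ
        TensorProduct.map (f.toLinearMap.lTensor V) (f.toLinearMap.lTensor W) := by
    refine superMul_ext fun i j i' j' v hv a ha w hw b hb => ?_
    have hfa : f a ∈ gr k B j := hf _ _ ha
    simp [superMul_tmul v ha hw, superMul_tmul v hfa hw]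
  exact LinearMap.congr_fun this (x ⊗ₜ y)

lemma superMul_assoc (x : V ⊗[k] A) (y : W ⊗[k] A) (z : U ⊗[k] A) :
    (TensorProduct.assoc k V W U).toLinearMap.rTensor A
        (superMul k (V ⊗[k] W) U A (superMul k V W A (x ⊗ₜ y) ⊗ₜ z))
      = superMul k V (W ⊗[k] U) A (x ⊗ₜ superMul k W U A (y ⊗ₜ z)) := by
  have : TensorProduct.curry ((TensorProduct.assoc k V W U).toLinearMap.rTensor A ∘ₗ
        superMul k (V ⊗[k] W) U A ∘ₗ (superMul k V W A).rTensor (U ⊗[k] A))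
      = TensorProduct.curry (superMul k V (W ⊗[k] U) A ∘ₗ (superMul k W U A).lTensor (V ⊗[k] A) ∘ₗ
        (TensorProduct.assoc k (V ⊗[k] A) (W ⊗[k] A) (U ⊗[k] A)).toLinearMap) := by
    refine superMul_ext (k := k) (V := V) (W := W) (A := A)
      (X := U ⊗[k] A →ₗ[k] (V ⊗[k] (W ⊗[k] U)) ⊗[k] A) fun i j i' j' v hv a ha w hw b hb => ?_
    refine tensor_super_ext (k := k) fun i'' j'' u hu c hc => ?_
    simp only [TensorProduct.curry_apply, LinearMap.comp_apply,
      LinearMap.rTensor_tmul, LinearMap.lTensor_tmul, LinearEquiv.coe_coe,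
      TensorProduct.assoc_tmul]
    rw [superMul_tmul v ha hw, superMul_tmul w hb hu, ← TensorProduct.smul_tmul',
      TensorProduct.tmul_smul, map_smul, map_smul, map_smul,
      superMul_tmul (v ⊗ₜ[k] w) (SuperCommAlgebra.mul_mem ha hb) hu,
      superMul_tmul v ha (tmul_mem rfl hw hu), map_smul, LinearMap.rTensor_tmul,
      LinearEquiv.coe_coe, TensorProduct.assoc_tmul, smul_smul, smul_smul, koszul_add_left,
      koszul_add_right, mul_assoc]
    congr 1; ring
  exact LinearMap.congr_fun (LinearMap.congr_fun this (x ⊗ₜ y)) z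

lemma superBraid_superMul {i j : ZMod 2} {x : V ⊗[k] A} {y : W ⊗[k] A}
    (hx : x ∈ gr k (V ⊗[k] A) i) (hy : y ∈ gr k (W ⊗[k] A) j) :
    (superBraid k V W).rTensor A (superMul k V W A (x ⊗ₜ y))
      = koszul k i j • superMul k W V A (y ⊗ₜ x) := by
  refine tensor_gr_induction (k := k)
    (p := fun x => (superBraid k V W).rTensor A (superMul k V W A (x ⊗ₜ y))
      = koszul k i j • superMul k W V A (y ⊗ₜ x)) (by simp)
    (fun a b ha hb => by
      simp only [TensorProduct.add_tmul, TensorProduct.tmul_add, map_add, ha, hb, smul_add])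
    (fun c a ha => by
      rw [← TensorProduct.smul_tmul', TensorProduct.tmul_smul, map_smul, map_smul, map_smul, ha,
        smul_comm]) ?_ hx
  rintro i₁ i₂ rfl v hv a ha
  refine tensor_gr_induction (k := k)
    (p := fun y => (superBraid k V W).rTensor A (superMul k V W A ((v ⊗ₜ a) ⊗ₜ y))
      = koszul k (i₁ + i₂) j • superMul k W V A (y ⊗ₜ (v ⊗ₜ a))) (by simp)
    (fun a b ha hb => by
      simp only [TensorProduct.add_tmul, TensorProduct.tmul_add, map_add, ha, hb, smul_add])
    (fun c a ha => by
      rw [← TensorProduct.smul_tmul', TensorProduct.tmul_smul, map_smul, map_smul, map_smul, ha,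
        smul_comm]) ?_ hy
  rintro j₁ j₂ rfl w hw b hb
  rw [superMul_tmul v ha hw, superMul_tmul w hb hv, map_smul, LinearMap.rTensor_tmul,
    superBraid_tmul hv hw, SuperCommAlgebra.super_comm ha hb, ← TensorProduct.smul_tmul',
    TensorProduct.tmul_smul, smul_smul, smul_smul, smul_smul, koszul_add_left, koszul_add_right,
    koszul_add_right, koszul_symm k j₂ i₁]
  congr 1
  have := koszul_mul_self k i₁ j₂
  linear_combination (-(koszul k i₁ j₁ * koszul k i₂ j₁ * koszul k i₂ j₂)) * this
end superMul

end

section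

variable (k : Type u) [Field k]

/-! ### Supergroups and their representations -/

/-- The category of supercommutative superalgebras and parity-preserving algebra morphisms. -/
structure SAlg where
  carrier : Type u
  [ring : Ring carrier]
  [algebra : Algebra k carrier]
  [super : SuperCommAlgebra k carrier]

attribute [instance] SAlg.ring SAlg.algebra SAlg.super

instance : CoeSort (SAlg k) (Type u) := ⟨SAlg.carrier⟩

variable {k}

@[ext]
structure SAlg.Hom (A B : SAlg k) where
  toAlgHom : A →ₐ[k] B
  even : IsEven (k := k) toAlgHom.toLinearMap

instance : Category (SAlg k) where
  Hom := SAlg.Hom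
  id A := ⟨AlgHom.id k A, fun _ _ h => h⟩
  comp f g := ⟨g.toAlgHom.comp f.toAlgHom, fun i v h => g.even i _ (f.even i v h)⟩

/-- The algebra morphism underlying a morphism of `SAlg k`. -/
def SAlg.algHom {A B : SAlg k} (f : A ⟶ B) : A →ₐ[k] B := SAlg.Hom.toAlgHom f

lemma SAlg.algHom_even {A B : SAlg k} (f : A ⟶ B) : IsEven (k := k) (SAlg.algHom f).toLinearMap :=
  SAlg.Hom.even f

variable (k) in
/-- A supergroup, given by its functor of points on supercommutative superalgebras. -/
abbrev Supergroup := SAlg k ⥤ GrpCat.{u}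

/-- A representation of the supergroup `G` on a finite-dimensional superspace `V`: a homomorphism,
natural in `A`, from `G(A)` to the group of parity-preserving right `A`-linear automorphisms of
`V ⊗ A`. The automorphism given by `g ∈ G(A)` is `extend (act A g)`: it is recorded by its
restriction `act A g : V → V ⊗ A` to `V = V ⊗ 1`, which determines it. -/
structure SRep (G : Supergroup k) where
  V : Type u
  [addCommGroup : AddCommGroup V]
  [module : Module k V]
  [finite : Module.Finite k V]
  [super : SuperSpace k V]
  act : ∀ A : SAlg k, G.obj A → (V →ₗ[k] V ⊗[k] A)
  act_even : ∀ (A : SAlg k) (g : G.obj A), IsEven (act A g)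
  act_one : ∀ A : SAlg k, act A 1 = unitMap k V A
  act_mul : ∀ (A : SAlg k) (g h : G.obj A), act A (g * h) = extend (act A g) ∘ₗ act A h
  act_map : ∀ {A B : SAlg k} (f : A ⟶ B) (g : G.obj A),
    act B (G.map f g) = (SAlg.algHom f).toLinearMap.lTensor V ∘ₗ act A g

attribute [instance] SRep.addCommGroup SRep.module SRep.finite SRep.super

namespace SRep

variable {G : Supergroup k}

/-- Morphisms of representations: parity-preserving equivariant linear maps. -/
@[ext]
structure Hom (M N : SRep G) where
  lin : M.V →ₗ[k] N.V
  even : IsEven lin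
  equivariant : ∀ (A : SAlg k) (g : G.obj A), lin.rTensor A ∘ₗ M.act A g = N.act A g ∘ₗ lin

instance : Category (SRep G) where
  Hom := Hom
  id M := ⟨.id, .id, fun A g => by simp⟩
  comp {L M N} f g := ⟨g.lin ∘ₗ f.lin, g.even.comp f.even, fun A x => by
    rw [LinearMap.rTensor_comp, LinearMap.comp_assoc, f.equivariant, ← LinearMap.comp_assoc,
      g.equivariant, LinearMap.comp_assoc]⟩

/-- The linear map underlying a morphism of representations. -/
def lin {M N : SRep G} (f : M ⟶ N) : M.V →ₗ[k] N.V := Hom.lin f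

lemma lin_even {M N : SRep G} (f : M ⟶ N) : IsEven (lin f) := Hom.even f

lemma lin_equivariant {M N : SRep G} (f : M ⟶ N) (A : SAlg k) (g : G.obj A) :
    (lin f).rTensor A ∘ₗ M.act A g = N.act A g ∘ₗ lin f := Hom.equivariant f A g

/-- Constructor for morphisms. -/
def mkHom {M N : SRep G} (f : M.V →ₗ[k] N.V) (he : IsEven f)
    (h : ∀ (A : SAlg k) (g : G.obj A), f.rTensor A ∘ₗ M.act A g = N.act A g ∘ₗ f) : M ⟶ N :=
  Hom.mk f he h

@[simp] lemma lin_mkHom {M N : SRep G} (f : M.V →ₗ[k] N.V) (he : IsEven f) (h) :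
    lin (mkHom (M := M) (N := N) f he h) = f := rfl

@[simp] lemma lin_id (M : SRep G) : lin (𝟙 M) = .id := rfl
@[simp] lemma lin_comp {L M N : SRep G} (f : L ⟶ M) (g : M ⟶ N) :
    lin (f ≫ g) = lin g ∘ₗ lin f := rfl

lemma lin_injective {M N : SRep G} : Function.Injective (lin (M := M) (N := N)) :=
  fun _ _ h => Hom.ext h

@[ext] lemma hom_ext {M N : SRep G} {f g : M ⟶ N} (h : lin f = lin g) : f = g := lin_injective h

/-- Constructor for isomorphisms. -/
def mkIso {M N : SRep G} (e : M.V ≃ₗ[k] N.V) (he : IsEven e.toLinearMap)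
    (he' : IsEven e.symm.toLinearMap)
    (h : ∀ (A : SAlg k) (g : G.obj A),
      e.toLinearMap.rTensor A ∘ₗ M.act A g = N.act A g ∘ₗ e.toLinearMap) : M ≅ N where
  hom := mkHom e.toLinearMap he h
  inv := mkHom e.symm.toLinearMap he' fun A g => by
    have h1 := h A g
    have h2 : e.symm.toLinearMap.rTensor A ∘ₗ e.toLinearMap.rTensor A = LinearMap.id := by
      rw [← LinearMap.rTensor_comp]; simp
    calc e.symm.toLinearMap.rTensor A ∘ₗ N.act A g
        = e.symm.toLinearMap.rTensor A ∘ₗ (N.act A g ∘ₗ e.toLinearMap) ∘ₗ e.symm.toLinearMap := by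
          rw [LinearMap.comp_assoc]; simp
      _ = (e.symm.toLinearMap.rTensor A ∘ₗ e.toLinearMap.rTensor A) ∘ₗ
            M.act A g ∘ₗ e.symm.toLinearMap := by
          rw [← h1]; simp only [LinearMap.comp_assoc]
      _ = _ := by rw [h2, LinearMap.id_comp]
  hom_inv_id := hom_ext (by simp)
  inv_hom_id := hom_ext (by simp)

section linear

variable (M N : SRep G)

/-- The subspace of morphisms inside all linear maps. -/
def homSubmodule : Submodule k (M.V →ₗ[k] N.V) where
  carrier := {f | IsEven f ∧
    ∀ (A : SAlg k) (g : G.obj A), f.rTensor A ∘ₗ M.act A g = N.act A g ∘ₗ f}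
  add_mem' {f f'} hf hf' := ⟨fun i v hv => add_mem (hf.1 i v hv) (hf'.1 i v hv), fun A g => by
    rw [LinearMap.rTensor_add, LinearMap.add_comp, LinearMap.comp_add, hf.2, hf'.2]⟩
  zero_mem' := ⟨fun i v hv => zero_mem _, fun A g => by simp⟩
  smul_mem' c f hf := ⟨fun i v hv => Submodule.smul_mem _ c (hf.1 i v hv), fun A g => by
    rw [LinearMap.rTensor_smul, LinearMap.smul_comp, LinearMap.comp_smul, hf.2]⟩

variable {M N} in
/-- Morphisms as a subspace of the linear maps. -/
def homEquiv : (M ⟶ N) ≃ homSubmodule M N where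
  toFun f := ⟨lin f, lin_even f, lin_equivariant f⟩
  invFun f := mkHom f.1 f.2.1 f.2.2
  left_inv _ := rfl
  right_inv _ := rfl

instance : AddCommGroup (M ⟶ N) := homEquiv.addCommGroup
instance : Module k (M ⟶ N) := homEquiv.module k

variable {M N}
@[simp] lemma lin_add (f g : M ⟶ N) : lin (f + g) = lin f + lin g := rfl
@[simp] lemma lin_smul (c : k) (f : M ⟶ N) : lin (c • f) = c • lin f := rfl
@[simp] lemma lin_zero : lin (0 : M ⟶ N) = 0 := rfl

instance : Preadditive (SRep G) where
  homGroup _ _ := inferInstance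
  add_comp _ _ _ f f' g := hom_ext (by simp [LinearMap.comp_add])
  comp_add _ _ _ f g g' := hom_ext (by simp [LinearMap.add_comp])

instance : Linear k (SRep G) where
  homModule _ _ := inferInstance
  smul_comp _ _ _ r f g := hom_ext (by simp [LinearMap.comp_smul])
  comp_smul _ _ _ f r g := hom_ext (by simp [LinearMap.smul_comp])

end linear

section monoidal

/-- The tensor product of representations: `g (v ⊗ w) = gv ⊗ gw` in
`(V ⊗ A) ⊗_A (W ⊗ A) = (V ⊗ W) ⊗ A`. -/
@[reducible] def tensor (M N : SRep G) : SRep G where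
  V := M.V ⊗[k] N.V
  act A g := superMul k M.V N.V A ∘ₗ TensorProduct.map (M.act A g) (N.act A g)
  act_even A g := superMul_isEven.comp ((M.act_even A g).tensorMap (N.act_even A g))
  act_one A := by
    refine tensor_super_ext fun i j v hv w hw => ?_
    simp [act_one, superMul_tmul v SuperCommAlgebra.one_mem hw, koszul_zero_left]
  act_mul A g h := by
    refine TensorProduct.ext' fun v w => ?_
    simp only [LinearMap.comp_apply, TensorProduct.map_tmul, act_mul]
    rw [extend_superMul (N.act_even A g)]
  act_map f g := by
    refine TensorProduct.ext' fun v w => ?_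
    simp only [LinearMap.comp_apply, TensorProduct.map_tmul, act_map]
    rw [lTensor_superMul (SAlg.algHom_even f)]

variable (G) in
/-- The trivial representation `k`. -/
@[reducible] def unit : SRep G where
  V := k
  act A _ := unitMap k k A
  act_even _ _ := unitMap_isEven
  act_one _ := rfl
  act_mul A _ _ := by ext; simp
  act_map f g := by ext; simp

/-- The tensor product of morphisms. -/
def tensorMor {M M' N N' : SRep G} (f : M ⟶ M') (g : N ⟶ N') : tensor M N ⟶ tensor M' N' :=
  mkHom (M := tensor M N) (N := tensor M' N') (TensorProduct.map (lin f) (lin g))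
    ((lin_even f).tensorMap (lin_even g)) fun A x => by
      refine TensorProduct.ext' fun v w => ?_
      have h1 := LinearMap.congr_fun (lin_equivariant f A x) v
      have h2 := LinearMap.congr_fun (lin_equivariant g A x) w
      simp only [LinearMap.comp_apply] at h1 h2
      simp only [tensor, LinearMap.comp_apply, TensorProduct.map_tmul]
      rw [rTensor_superMul (lin_even g), h1, h2]

lemma assoc_isEven {V W U : Type u} [AddCommGroup V] [Module k V] [AddCommGroup W] [Module k W]
    [AddCommGroup U] [Module k U] [SuperSpace k V] [SuperSpace k W] [SuperSpace k U] :
    IsEven (TensorProduct.assoc k V W U).toLinearMap := by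
  refine isEven_tensor fun i j x hx u hu => ?_
  refine tensor_gr_induction (k := k)
    (p := fun x => TensorProduct.assoc k V W U (x ⊗ₜ u) ∈ gr k (V ⊗[k] (W ⊗[k] U)) (i + j))
    (by simp) (fun a b ha hb => by rw [TensorProduct.add_tmul, map_add]; exact add_mem ha hb)
    (fun c a ha => by
      rw [← TensorProduct.smul_tmul', map_smul]; exact Submodule.smul_mem _ _ ha) ?_ hx
  rintro i₁ i₂ rfl v hv w hw
  exact tmul_mem (add_assoc _ _ _).symm hv (tmul_mem rfl hw hu)

lemma assoc_symm_isEven {V W U : Type u} [AddCommGroup V] [Module k V] [AddCommGroup W]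
    [Module k W] [AddCommGroup U] [Module k U] [SuperSpace k V] [SuperSpace k W]
    [SuperSpace k U] : IsEven (TensorProduct.assoc k V W U).symm.toLinearMap := by
  refine isEven_tensor fun i j v hv x hx => ?_
  refine tensor_gr_induction (k := k)
    (p := fun x => (TensorProduct.assoc k V W U).symm (v ⊗ₜ x)
      ∈ gr k ((V ⊗[k] W) ⊗[k] U) (i + j))
    (by simp) (fun a b ha hb => by rw [TensorProduct.tmul_add, map_add]; exact add_mem ha hb)
    (fun c a ha => by
      rw [TensorProduct.tmul_smul, map_smul]; exact Submodule.smul_mem _ _ ha) ?_ hx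
  rintro i₁ i₂ rfl w hw u hu
  exact tmul_mem (add_assoc _ _ _) (tmul_mem rfl hv hw) hu

/-- The associator. -/
def assocIso (L M N : SRep G) : tensor (tensor L M) N ≅ tensor L (tensor M N) :=
  mkIso (M := tensor (tensor L M) N) (N := tensor L (tensor M N))
    (TensorProduct.assoc k L.V M.V N.V) assoc_isEven assoc_symm_isEven fun A g => by
      refine TensorProduct.ext_threefold fun u v w => ?_
      simp only [tensor, LinearMap.comp_apply, TensorProduct.map_tmul, superMul_assoc,
        LinearEquiv.coe_coe, TensorProduct.assoc_tmul]

lemma lid_isEven {V : Type u} [AddCommGroup V] [Module k V] [SuperSpace k V] :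
    IsEven (k := k) (V := k ⊗[k] V) (TensorProduct.lid k V).toLinearMap :=
  isEven_tensor (k := k) (V := k) fun i j c hc v hv => by
    rcases zmod_two i with rfl | rfl
    · simpa using Submodule.smul_mem _ c hv
    · rw [mem_unit_one.1 hc]; simp

lemma rid_isEven {V : Type u} [AddCommGroup V] [Module k V] [SuperSpace k V] :
    IsEven (k := k) (V := V ⊗[k] k) (TensorProduct.rid k V).toLinearMap :=
  isEven_tensor (k := k) (W := k) fun j i v hv c hc => by
    rcases zmod_two i with rfl | rfl
    · simpa using Submodule.smul_mem _ c hv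
    · rw [mem_unit_one.1 hc]; simp

/-- The left unitor. -/
def leftUnitorIso (M : SRep G) : tensor (unit G) M ≅ M :=
  mkIso (M := tensor (unit G) M) (TensorProduct.lid k M.V) lid_isEven
    (fun i v hv => tmul_mem (V := k) (zero_add i) (mem_unit_zero (1 : k)) hv) fun A g => by
      refine TensorProduct.ext' (M := k) fun c v => ?_
      have key : ∀ y : M.V ⊗[k] A, (TensorProduct.lid k M.V).toLinearMap.rTensor A
          (superMul k k M.V A ((c ⊗ₜ[k] (1 : A)) ⊗ₜ y)) = c • y := by
        intro y
        have : (TensorProduct.lid k M.V).toLinearMap.rTensor A ∘ₗ superMul k k M.V A ∘ₗ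
            TensorProduct.mk k _ _ (c ⊗ₜ[k] (1 : A)) = c • LinearMap.id := by
          refine tensor_super_ext fun i j w hw a _ => ?_
          simp [superMul_tmul c SuperCommAlgebra.one_mem hw, koszul_zero_left,
            TensorProduct.smul_tmul']
        exact LinearMap.congr_fun this y
      have := key (M.act A g v)
      simpa [tensor, unit] using this

/-- The right unitor. -/
def rightUnitorIso (M : SRep G) : tensor M (unit G) ≅ M :=
  mkIso (M := tensor M (unit G)) (TensorProduct.rid k M.V) rid_isEven
    (fun i v hv => tmul_mem (W := k) (add_zero i) hv (mem_unit_zero (1 : k))) fun A g => by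
      refine TensorProduct.ext' (N := k) fun v c => ?_
      have key : ∀ y : M.V ⊗[k] A, (TensorProduct.rid k M.V).toLinearMap.rTensor A
          (superMul k M.V k A (y ⊗ₜ (c ⊗ₜ[k] (1 : A)))) = c • y := by
        intro y
        have : (TensorProduct.rid k M.V).toLinearMap.rTensor A ∘ₗ superMul k M.V k A ∘ₗ
            (TensorProduct.mk k _ _).flip (c ⊗ₜ[k] (1 : A)) = c • LinearMap.id := by
          refine tensor_super_ext fun i j w hw a ha => ?_
          simp [superMul_tmul w ha (mem_unit_zero c), koszul_zero_right,
            TensorProduct.smul_tmul']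
        exact LinearMap.congr_fun this y
      have := key (M.act A g v)
      simpa [tensor, unit] using this

instance : MonoidalCategoryStruct (SRep G) where
  tensorObj := tensor
  tensorUnit := unit G
  tensorHom f g := tensorMor f g
  whiskerLeft M _ _ f := tensorMor (𝟙 M) f
  whiskerRight f N := tensorMor f (𝟙 N)
  associator := assocIso
  leftUnitor := leftUnitorIso
  rightUnitor := rightUnitorIso

lemma lin_tensorHom {M M' N N' : SRep G} (f : M ⟶ M') (g : N ⟶ N') :
    lin (f ⊗ₘ g) = TensorProduct.map (lin f) (lin g) := rfl
lemma lin_whiskerLeft (M : SRep G) {N N' : SRep G} (f : N ⟶ N') :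
    lin (M ◁ f) = TensorProduct.map .id (lin f) := rfl
lemma lin_whiskerRight {M M' : SRep G} (f : M ⟶ M') (N : SRep G) :
    lin (f ▷ N) = TensorProduct.map (lin f) .id := rfl
lemma lin_associator_hom (L M N : SRep G) :
    lin (α_ L M N).hom = (TensorProduct.assoc k L.V M.V N.V).toLinearMap := rfl
lemma lin_associator_inv (L M N : SRep G) :
    lin (α_ L M N).inv = (TensorProduct.assoc k L.V M.V N.V).symm.toLinearMap := rfl
lemma lin_leftUnitor_hom (M : SRep G) :
    lin (λ_ M).hom = (TensorProduct.lid k M.V).toLinearMap := rfl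
lemma lin_rightUnitor_hom (M : SRep G) :
    lin (ρ_ M).hom = (TensorProduct.rid k M.V).toLinearMap := rfl

instance : MonoidalCategory (SRep G) where
  tensorHom_def f g := hom_ext (TensorProduct.ext' fun _ _ => rfl)
  id_tensorHom_id M N := hom_ext (TensorProduct.ext' fun _ _ => rfl)
  tensorHom_comp_tensorHom f₁ f₂ g₁ g₂ := hom_ext (TensorProduct.ext' fun _ _ => rfl)
  whiskerLeft_id M N := hom_ext (TensorProduct.ext' fun _ _ => rfl)
  id_whiskerRight M N := hom_ext (TensorProduct.ext' fun _ _ => rfl)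
  associator_naturality f g h := hom_ext (TensorProduct.ext_threefold fun _ _ _ => rfl)
  leftUnitor_naturality {M N} f := hom_ext (TensorProduct.ext' (M := k) fun c v =>
    ((lin f).map_smul c v).symm)
  rightUnitor_naturality {M N} f := hom_ext (TensorProduct.ext' (N := k) fun v c =>
    ((lin f).map_smul c v).symm)
  pentagon K L M N := hom_ext (TensorProduct.ext_fourfold fun _ _ _ _ => rfl)
  triangle M N := hom_ext (TensorProduct.ext_threefold (N := k) fun v c w =>
    (TensorProduct.smul_tmul c v w).symm)

/-- The symmetry. -/
def braidIso (M N : SRep G) : tensor M N ≅ tensor N M :=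
  mkIso (M := tensor M N) (N := tensor N M)
    (LinearEquiv.ofLinearMap (superBraid k M.V N.V) (superBraid k N.V M.V)
      (LinearMap.ext superBraid_superBraid) (LinearMap.ext superBraid_superBraid))
    superBraid_isEven superBraid_isEven fun A g => by
      refine tensor_super_ext fun i j v hv w hw => ?_
      have := superBraid_superMul (M.act_even A g i v hv) (N.act_even A g j w hw)
      simpa [tensor, superBraid_tmul hv hw] using this

instance : SymmetricCategory (SRep G) where
  braiding := braidIso
  braiding_naturality_right M {N N'} f := hom_ext (tensor_super_ext fun i j v hv w hw => by
    change superBraid k M.V N'.V (v ⊗ₜ lin f w)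
      = TensorProduct.map (lin f) .id (superBraid k M.V N.V (v ⊗ₜ w))
    simp [superBraid_tmul hv hw, superBraid_tmul hv (lin_even f _ _ hw)])
  braiding_naturality_left {M M'} f N := hom_ext (tensor_super_ext fun i j v hv w hw => by
    change superBraid k M'.V N.V (lin f v ⊗ₜ w)
      = TensorProduct.map .id (lin f) (superBraid k M.V N.V (v ⊗ₜ w))
    simp [superBraid_tmul hv hw, superBraid_tmul (lin_even f _ _ hv) hw])
  hexagon_forward L M N := hom_ext <| TensorProduct.ext <|
    tensor_super_ext (k := k) (V := L.V) (W := M.V)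
      (X := N.V →ₗ[k] (M.V ⊗[k] (N.V ⊗[k] L.V))) fun i j u hu v hv =>
    super_ext (k := k) (V := N.V) fun l w hw => by
      change TensorProduct.assoc k M.V N.V L.V (superBraid k L.V (M.V ⊗[k] N.V) (u ⊗ₜ (v ⊗ₜ w)))
        = TensorProduct.map .id (superBraid k L.V N.V) (TensorProduct.assoc k M.V L.V N.V
          (superBraid k L.V M.V (u ⊗ₜ v) ⊗ₜ w))
      rw [superBraid_tmul hu (tmul_mem rfl hv hw), superBraid_tmul hu hv,
        ← TensorProduct.smul_tmul']
      simp [superBraid_tmul hu hw, smul_smul, koszul_add_right]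
  hexagon_reverse L M N := hom_ext <| LinearMap.ext fun x => by
    obtain ⟨x, rfl⟩ := (TensorProduct.assoc k L.V M.V N.V).surjective x
    revert x
    refine LinearMap.congr_fun (f := lin ((α_ L M N).hom ≫ (α_ L M N).inv ≫
      (braidIso (tensor L M) N).hom ≫ (α_ N L M).inv)) (g := lin ((α_ L M N).hom ≫
      L ◁ (braidIso M N).hom ≫ (α_ L N M).inv ≫ (braidIso L N).hom ▷ M)) ?_
    refine TensorProduct.ext <|
      tensor_super_ext (k := k) (V := L.V) (W := M.V)
      (X := N.V →ₗ[k] ((N.V ⊗[k] L.V) ⊗[k] M.V)) fun i j u hu v hv =>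
      super_ext (k := k) (V := N.V) fun l w hw => ?_
    change (TensorProduct.assoc k N.V L.V M.V).symm
        (superBraid k (L.V ⊗[k] M.V) N.V ((u ⊗ₜ v) ⊗ₜ w))
      = TensorProduct.map (superBraid k L.V N.V) .id ((TensorProduct.assoc k L.V N.V M.V).symm
          (u ⊗ₜ superBraid k M.V N.V (v ⊗ₜ w)))
    rw [superBraid_tmul (tmul_mem rfl hu hv) hw, superBraid_tmul hv hw, TensorProduct.tmul_smul]
    simp [superBraid_tmul hu hw, smul_smul, koszul_add_left, mul_comm, ← TensorProduct.smul_tmul']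
  symmetry M N := hom_ext (LinearMap.ext superBraid_superBraid)

lemma lin_braiding_hom (M N : SRep G) : lin (β_ M N).hom = superBraid k M.V N.V := rfl

instance : MonoidalPreadditive (SRep G) where
  whiskerLeft_zero := hom_ext (TensorProduct.ext' fun v _ => TensorProduct.tmul_zero _ v)
  zero_whiskerRight := hom_ext (TensorProduct.ext' fun _ w => TensorProduct.zero_tmul _ w)
  whiskerLeft_add f g := hom_ext (TensorProduct.ext' fun v w =>
    TensorProduct.tmul_add v (lin f w) (lin g w))
  add_whiskerRight f g := hom_ext (TensorProduct.ext' fun v w =>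
    TensorProduct.add_tmul (lin f v) (lin g v) w)

instance : MonoidalLinear k (SRep G) where
  whiskerLeft_smul _ {_ _} c f := hom_ext (TensorProduct.ext' fun v w =>
    TensorProduct.tmul_smul c v (lin f w))
  smul_whiskerRight c {_ _} f _ := hom_ext (TensorProduct.ext' fun _ _ => rfl)

end monoidal

end SRep

end

section

variable {k : Type u} [Field k]

section dual

variable {V W : Type u} [AddCommGroup V] [Module k V] [SuperSpace k V]
  [AddCommGroup W] [Module k W] [SuperSpace k W]
variable {A B : Type u} [Ring A] [Algebra k A] [SuperCommAlgebra k A]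
  [Ring B] [Algebra k B] [SuperCommAlgebra k B]

lemma eq_zero_of_mem_gr {i j : ZMod 2} (hij : i ≠ j) {v : V} (hi : v ∈ gr k V i)
    (hj : v ∈ gr k V j) : v = 0 := by
  have h := Submodule.disjoint_def.1 (SuperSpace.isCompl (k := k) (V := V)).disjoint
  rcases zmod_two i with rfl | rfl <;> rcases zmod_two j with rfl | rfl
  · exact absurd rfl hij
  · exact h v hi hj
  · exact h v hj hi
  · exact absurd rfl hij

lemma dualTensorHom_mem {i l : ZMod 2} {x : Module.Dual k V ⊗[k] W}
    (hx : x ∈ gr k (Module.Dual k V ⊗[k] W) i) {v : V} (hv : v ∈ gr k V l) :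
    dualTensorHom k V W x v ∈ gr k W (i + l) := by
  refine tensor_gr_induction (k := k) (p := fun x => dualTensorHom k V W x v ∈ gr k W (i + l))
    (by simp) (fun a b ha hb => by rw [map_add]; exact add_mem ha hb)
    (fun c a ha => by rw [map_smul]; exact Submodule.smul_mem _ _ ha) ?_ hx
  rintro i₁ i₂ rfl ξ hξ w hw
  rw [dualTensorHom_apply]
  by_cases h : i₁ = l
  · subst h
    rw [show i₁ + i₂ + i₁ = i₂ by clear hξ hw hx hv; revert i₁ i₂; decide]
    exact Submodule.smul_mem _ _ hw
  · rw [dual_apply_eq_zero h hξ hv, zero_smul]; exact zero_mem _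

lemma dualTensorHomEquiv_symm_mem [Module.Finite k V] {i : ZMod 2} {φ : V →ₗ[k] W}
    (hφ : ∀ l, ∀ v ∈ gr k V l, φ v ∈ gr k W (i + l)) :
    (dualTensorHomEquiv k V W).symm φ ∈ gr k (Module.Dual k V ⊗[k] W) i := by
  obtain ⟨y, hy, z, hz, hyz⟩ : ∃ y ∈ gr k (Module.Dual k V ⊗[k] W) i,
      ∃ z ∈ gr k (Module.Dual k V ⊗[k] W) (i + 1), y + z = (dualTensorHomEquiv k V W).symm φ := by
    obtain ⟨a, ha, b, hb, hab⟩ := exists_decomp (k := k) ((dualTensorHomEquiv k V W).symm φ)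
    rcases zmod_two i with rfl | rfl
    · exact ⟨a, ha, b, hb, hab⟩
    · exact ⟨b, hb, a, by rwa [one_add_one], by rw [add_comm, hab]⟩
  have h1 : dualTensorHom k V W (y + z) = φ := by
    rw [hyz]; exact (dualTensorHomEquiv k V W).apply_symm_apply φ
  have hz0 : dualTensorHom k V W z = 0 := by
    refine super_ext (k := k) fun l v hv => ?_
    refine eq_zero_of_mem_gr (k := k) (i := i + 1 + l) (j := i + l)
      (by clear hv hy hz hφ; revert i l; decide) (dualTensorHom_mem hz hv) ?_
    have : dualTensorHom k V W z v = φ v - dualTensorHom k V W y v := by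
      rw [← h1, map_add, LinearMap.add_apply, add_sub_cancel_left]
    rw [this]
    exact sub_mem (hφ l v hv) (dualTensorHom_mem hy hv)
  have : z = 0 := (dualTensorHomEquiv k V W).injective (by
    rw [map_zero]; exact hz0)
  rw [← hyz, this, add_zero]
  exact hy

/-- The pairing `(V* ⊗ V) ⊗ A → A`. -/
def evA : (Module.Dual k V ⊗[k] V) ⊗[k] A →ₗ[k] A :=
  (TensorProduct.lid k A).toLinearMap ∘ₗ (contractLeft k V).rTensor A

lemma evA_tmul (ξ : Module.Dual k V) (v : V) (a : A) : evA ((ξ ⊗ₜ[k] v) ⊗ₜ[k] a) = ξ v • a := by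
  simp [evA]

lemma evA_rmul (a : A) (x : (Module.Dual k V ⊗[k] V) ⊗[k] A) : evA (rmul (k := k) (V := Module.Dual k V ⊗[k] V) a x) = evA x * a := by
  have : evA ∘ₗ rmul (k := k) (V := Module.Dual k V ⊗[k] V) a
      = LinearMap.mulRight k a ∘ₗ (evA : (Module.Dual k V ⊗[k] V) ⊗[k] A →ₗ[k] A) := by
    refine TensorProduct.ext_threefold fun ξ v b => ?_
    simp [evA_tmul]
  exact LinearMap.congr_fun this x

/-- The right `A`-linear extension `V ⊗ A → A` of `φ : V → A`. -/
def extF (φ : V →ₗ[k] A) : V ⊗[k] A →ₗ[k] A := LinearMap.mul' k A ∘ₗ φ.rTensor A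

@[simp] lemma extF_tmul (φ : V →ₗ[k] A) (v : V) (a : A) : extF φ (v ⊗ₜ a) = φ v * a := by
  simp [extF]

variable (A) in
/-- The right `A`-linear extension `V ⊗ A → A` of a functional. -/
def hat (ξ : Module.Dual k V) : V ⊗[k] A →ₗ[k] A :=
  (TensorProduct.lid k A).toLinearMap ∘ₗ LinearMap.rTensor A ξ

@[simp] lemma hat_tmul (ξ : Module.Dual k V) (v : V) (a : A) : hat A ξ (v ⊗ₜ a) = ξ v • a := by
  simp [hat]

lemma hat_rmul (ξ : Module.Dual k V) (a : A) (x : V ⊗[k] A) :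
    hat A ξ (rmul a x) = hat A ξ x * a := by
  have : hat A ξ ∘ₗ rmul (k := k) a = LinearMap.mulRight k a ∘ₗ hat A ξ :=
    TensorProduct.ext' fun v b => by simp
  exact LinearMap.congr_fun this x

lemma extF_hat_comp (ξ : Module.Dual k V) (φ : W →ₗ[k] V ⊗[k] A) (x : W ⊗[k] A) :
    extF (hat A ξ ∘ₗ φ) x = hat A ξ (extend φ x) := by
  have : extF (hat A ξ ∘ₗ φ) = hat A ξ ∘ₗ extend φ :=
    TensorProduct.ext' fun v b => by simp [hat_rmul]
  exact LinearMap.congr_fun this x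

lemma hat_mem {i l : ZMod 2} {ξ : Module.Dual k V} (hξ : ξ ∈ gr k (Module.Dual k V) i)
    {x : V ⊗[k] A} (hx : x ∈ gr k (V ⊗[k] A) l) : hat A ξ x ∈ gr k A (i + l) := by
  refine tensor_gr_induction (k := k) (p := fun x => hat A ξ x ∈ gr k A (i + l))
    (by simp) (fun a b ha hb => by rw [map_add]; exact add_mem ha hb)
    (fun c a ha => by rw [map_smul]; exact Submodule.smul_mem _ _ ha) ?_ hx
  rintro i₁ i₂ rfl v hv a ha
  rw [hat_tmul]
  by_cases h : i = i₁
  · subst h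
    rw [show i + (i + i₂) = i₂ by clear hξ hv hx ha; revert i i₂; decide]
    exact Submodule.smul_mem _ _ ha
  · rw [dual_apply_eq_zero h hξ hv, zero_smul]; exact zero_mem _

lemma hat_lTensor (f : A →ₐ[k] B) (ξ : Module.Dual k V) (x : V ⊗[k] A) :
    hat B ξ (f.toLinearMap.lTensor V x) = f (hat A ξ x) := by
  have : hat B ξ ∘ₗ f.toLinearMap.lTensor V = f.toLinearMap ∘ₗ hat A ξ :=
    TensorProduct.ext' fun v b => by simp
  exact LinearMap.congr_fun this x

/-- The functional `V → A`, `v ↦ ⟨x, v⟩`, of `x ∈ V* ⊗ A`. -/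
def theta (x : Module.Dual k V ⊗[k] A) : V →ₗ[k] A :=
  evA ∘ₗ superMul k (Module.Dual k V) V A ∘ₗ TensorProduct.mk k _ _ x ∘ₗ unitMap k V A

lemma theta_apply (x : Module.Dual k V ⊗[k] A) (v : V) :
    theta x v = evA (superMul k (Module.Dual k V) V A (x ⊗ₜ (v ⊗ₜ 1))) := rfl

lemma theta_tmul (ξ : Module.Dual k V) {j l : ZMod 2} {a : A} (ha : a ∈ gr k A j) {v : V}
    (hv : v ∈ gr k V l) : theta (ξ ⊗ₜ[k] a) v = koszul k j l • (ξ v • a) := by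
  rw [theta_apply, superMul_tmul ξ ha hv, map_smul, mul_one, evA_tmul]

lemma theta_eq (x : Module.Dual k V ⊗[k] A) : theta x = dualTensorHom k V A (signOp x) := by
  refine super_ext (k := k) fun l v hv => ?_
  have : evA ∘ₗ superMul k (Module.Dual k V) V A ∘ₗ (TensorProduct.mk k _ _).flip (v ⊗ₜ[k] (1 : A))
      = LinearMap.applyₗ v ∘ₗ dualTensorHom k V A ∘ₗ signOp := by
    refine tensor_super_ext (k := k) fun i j ξ hξ a ha => ?_
    change theta (ξ ⊗ₜ[k] a) v = dualTensorHom k V A (signOp (ξ ⊗ₜ a)) v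
    rw [theta_tmul ξ ha hv, signOp_tmul hξ ha, map_smul, LinearMap.smul_apply, dualTensorHom_apply]
    by_cases h : i = l
    · subst h; rw [koszul_symm]
    · rw [dual_apply_eq_zero h hξ hv]; simp
  exact LinearMap.congr_fun this x

lemma theta_injective [Module.Finite k V] :
    Function.Injective (theta : Module.Dual k V ⊗[k] A → V →ₗ[k] A) := fun x y h => by
  rw [theta_eq, theta_eq] at h
  have := (dualTensorHomEquiv k V A).injective h
  rw [← signOp_signOp x, this, signOp_signOp]

lemma evA_superMul (x : Module.Dual k V ⊗[k] A) (y : V ⊗[k] A) :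
    evA (superMul k (Module.Dual k V) V A (x ⊗ₜ y)) = extF (theta x) y := by
  have : evA ∘ₗ superMul k (Module.Dual k V) V A ∘ₗ TensorProduct.mk k _ _ x = extF (theta x) := by
    refine TensorProduct.ext' fun v a => ?_
    rw [extF_tmul, theta_apply, ← evA_rmul, ← superMul_rmul_right, rmul_tmul, one_mul]
    rfl
  exact LinearMap.congr_fun this y

lemma theta_lTensor {f : A →ₐ[k] B} (hf : IsEven (k := k) f.toLinearMap)
    (x : Module.Dual k V ⊗[k] A) (v : V) :
    theta (f.toLinearMap.lTensor (Module.Dual k V) x) v = f (theta x v) := by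
  rw [theta_apply, theta_apply]
  have h : v ⊗ₜ[k] (1 : B) = f.toLinearMap.lTensor V (v ⊗ₜ[k] (1 : A)) := by simp
  rw [h, ← lTensor_superMul hf]
  have : evA ∘ₗ f.toLinearMap.lTensor (Module.Dual k V ⊗[k] V) = f.toLinearMap ∘ₗ evA :=
    TensorProduct.ext_threefold fun ξ v a => by simp [evA_tmul]
  exact LinearMap.congr_fun this _

/-- The contragredient of `φ : V → V ⊗ A`: `⟨φ* ξ, v⟩ = ⟨ξ, φ v⟩`. -/
def contra [Module.Finite k V] (φ : V →ₗ[k] V ⊗[k] A) :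
    Module.Dual k V →ₗ[k] Module.Dual k V ⊗[k] A where
  toFun ξ := signOp ((dualTensorHomEquiv k V A).symm (hat A ξ ∘ₗ φ))
  map_add' ξ η := by
    rw [← map_add, ← map_add]
    congr 2
    ext v
    simp [hat, LinearMap.rTensor_add]
  map_smul' c ξ := by
    rw [RingHom.id_apply, ← map_smul, ← map_smul]
    congr 2
    ext v
    simp [hat, LinearMap.rTensor_smul]

lemma theta_contra [Module.Finite k V] (φ : V →ₗ[k] V ⊗[k] A) (ξ : Module.Dual k V) :
    theta (contra φ ξ) = hat A ξ ∘ₗ φ := by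
  rw [theta_eq]
  change dualTensorHom k V A (signOp (signOp _)) = _
  rw [signOp_signOp]
  exact (dualTensorHomEquiv k V A).apply_symm_apply _

lemma contra_isEven [Module.Finite k V] {φ : V →ₗ[k] V ⊗[k] A} (hφ : IsEven φ) :
    IsEven (k := k) (V := Module.Dual k V) (W := Module.Dual k V ⊗[k] A) (contra φ) := fun i ξ hξ =>
  signOp_isEven i _ (dualTensorHomEquiv_symm_mem fun l v hv => hat_mem hξ (hφ l v hv))

lemma extF_theta_tmul (ξ : Module.Dual k V) {j l : ZMod 2} {a : A} (ha : a ∈ gr k A j)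
    {y : V ⊗[k] A} (hy : y ∈ gr k (V ⊗[k] A) l) :
    extF (theta (ξ ⊗ₜ[k] a)) y = koszul k j l • (hat A ξ y * a) := by
  refine tensor_gr_induction (k := k)
    (p := fun y => extF (theta (ξ ⊗ₜ[k] a)) y = koszul k j l • (hat A ξ y * a)) (by simp)
    (fun x y hx hy => by rw [map_add, map_add, hx, hy, add_mul, smul_add])
    (fun c x hx => by rw [map_smul, map_smul, hx, smul_mul_assoc, smul_comm]) ?_ hy
  rintro l₁ l₂ rfl v hv b hb
  rw [extF_tmul, theta_tmul ξ ha hv, hat_tmul, smul_mul_assoc, smul_mul_assoc,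
    SuperCommAlgebra.super_comm ha hb, koszul_add_right, smul_mul_assoc, mul_smul, smul_comm (ξ v)]

lemma theta_extend_contra [Module.Finite k V] {φ : V →ₗ[k] V ⊗[k] A} (hφ : IsEven φ)
    (x : Module.Dual k V ⊗[k] A) : theta (extend (contra φ) x) = extF (theta x) ∘ₗ φ := by
  refine super_ext (k := k) fun l v hv => ?_
  have : evA ∘ₗ superMul k (Module.Dual k V) V A ∘ₗ
      (TensorProduct.mk k _ _).flip (v ⊗ₜ[k] (1 : A)) ∘ₗ extend (contra φ)
      = evA ∘ₗ superMul k (Module.Dual k V) V A ∘ₗ (TensorProduct.mk k _ _).flip (φ v) := by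
    refine tensor_super_ext (k := k) fun i j ξ hξ a ha => ?_
    change theta (extend (contra φ) (ξ ⊗ₜ a)) v
      = evA (superMul k (Module.Dual k V) V A ((ξ ⊗ₜ a) ⊗ₜ φ v))
    rw [evA_superMul, extF_theta_tmul ξ ha (hφ l v hv), extend_tmul, theta_apply,
      superMul_rmul_left _ (tmul_mem (add_zero l) hv SuperCommAlgebra.one_mem) ha, map_smul,
      evA_rmul, ← theta_apply, theta_contra]
    rfl
  have := LinearMap.congr_fun this x
  change theta (extend (contra φ) x) v = evA (superMul k (Module.Dual k V) V A (x ⊗ₜ φ v)) at this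
  rw [this, evA_superMul]
  rfl

lemma contra_unitMap [Module.Finite k V] :
    contra (unitMap k V A) = unitMap k (Module.Dual k V) A := by
  refine LinearMap.ext fun ξ => theta_injective ?_
  rw [theta_contra]
  refine super_ext (k := k) fun l v hv => ?_
  simp [theta_tmul ξ (SuperCommAlgebra.one_mem (k := k) (A := A)) hv, koszul_zero_left]

lemma contra_comp [Module.Finite k V] {φ ψ : V →ₗ[k] V ⊗[k] A} (hφ : IsEven φ) :
    contra (extend ψ ∘ₗ φ) = extend (contra φ) ∘ₗ contra ψ := by
  refine LinearMap.ext fun ξ => theta_injective ?_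
  rw [theta_contra, LinearMap.comp_apply, theta_extend_contra hφ, theta_contra]
  refine LinearMap.ext fun v => ?_
  simp [extF_hat_comp]

lemma contra_map [Module.Finite k V] {f : A →ₐ[k] B} (hf : IsEven (k := k) f.toLinearMap)
    (φ : V →ₗ[k] V ⊗[k] A) :
    contra (f.toLinearMap.lTensor V ∘ₗ φ)
      = f.toLinearMap.lTensor (Module.Dual k V) ∘ₗ contra φ := by
  refine LinearMap.ext fun ξ => theta_injective ?_
  refine LinearMap.ext fun v => ?_
  rw [theta_contra]
  change _ = theta (f.toLinearMap.lTensor (Module.Dual k V) (contra φ ξ)) v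
  rw [theta_lTensor hf, theta_contra]
  simp [hat_lTensor]

/-! #### Coevaluation -/

lemma dualTensorHom_comm_coevaluation [Module.Finite k V] :
    dualTensorHom k V V (TensorProduct.comm k V (Module.Dual k V) (coevaluation k V 1))
      = LinearMap.id := by
  refine LinearMap.ext fun v => ?_
  rw [coevaluation_apply_one]
  simp only [map_sum, TensorProduct.comm_tmul, LinearMap.sum_apply, dualTensorHom_apply,
    Module.Basis.coord_apply]
  exact (Module.Basis.ofVectorSpace k V).sum_repr v

lemma coevaluation_mem [Module.Finite k V] :
    coevaluation k V 1 ∈ gr k (V ⊗[k] Module.Dual k V) 0 := by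
  have h := dualTensorHomEquiv_symm_mem (k := k) (V := V) (W := V) (i := 0) (φ := LinearMap.id)
    (fun l v hv => by rwa [zero_add])
  rw [← dualTensorHom_comm_coevaluation] at h
  have h2 : (dualTensorHomEquiv k V V).symm (dualTensorHom k V V
      (TensorProduct.comm k V (Module.Dual k V) (coevaluation k V 1)))
      = TensorProduct.comm k V (Module.Dual k V) (coevaluation k V 1) :=
    (dualTensorHomEquiv k V V).symm_apply_apply _
  rw [h2] at h
  have hc : IsEven (TensorProduct.comm k (Module.Dual k V) V).toLinearMap :=
    isEven_tensor fun i j ξ hξ v hv => tmul_mem (add_comm _ _) hv hξ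
  have := hc 0 _ h
  simpa using this

variable (k V) in
/-- `(V ⊗ V*) ⊗ V → V`. -/
def contr3 : (V ⊗[k] Module.Dual k V) ⊗[k] V →ₗ[k] V :=
  (TensorProduct.rid k V).toLinearMap ∘ₗ TensorProduct.map LinearMap.id (contractLeft k V) ∘ₗ
    (TensorProduct.assoc k V (Module.Dual k V) V).toLinearMap

lemma contr3_coevaluation [Module.Finite k V] (v : V) :
    contr3 k V (coevaluation k V 1 ⊗ₜ v) = v := by
  have := LinearMap.congr_fun (contractLeft_assoc_coevaluation' k V) ((1 : k) ⊗ₜ v)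
  simp only [LinearMap.comp_apply, LinearEquiv.coe_coe, LinearMap.rTensor_tmul,
    TensorProduct.lid_tmul, one_smul] at this
  have h2 := congrArg (TensorProduct.rid k V) this
  rw [LinearEquiv.apply_symm_apply] at h2
  exact h2

/-- The map `V → V ⊗ A` obtained from `x ∈ (V ⊗ V*) ⊗ A` by contraction. -/
def gam (x : (V ⊗[k] Module.Dual k V) ⊗[k] A) : V →ₗ[k] V ⊗[k] A :=
  (contr3 k V).rTensor A ∘ₗ superMul k (V ⊗[k] Module.Dual k V) V A ∘ₗ
    TensorProduct.mk k _ _ x ∘ₗ unitMap k V A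

lemma gam_apply (x : (V ⊗[k] Module.Dual k V) ⊗[k] A) (v : V) :
    gam x v = (contr3 k V).rTensor A
      (superMul k (V ⊗[k] Module.Dual k V) V A (x ⊗ₜ (v ⊗ₜ 1))) := rfl

lemma gam_eq (x : (V ⊗[k] Module.Dual k V) ⊗[k] A) :
    gam x = dualTensorHom k V (V ⊗[k] A) (TensorProduct.leftComm k V (Module.Dual k V) A
      ((signOp (k := k) (V := Module.Dual k V) (W := A)).lTensor V
        (TensorProduct.assoc k V (Module.Dual k V) A x))) := by
  refine super_ext (k := k) fun l v hv => ?_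
  have : (contr3 k V).rTensor A ∘ₗ superMul k (V ⊗[k] Module.Dual k V) V A ∘ₗ
      (TensorProduct.mk k _ _).flip (v ⊗ₜ[k] (1 : A))
      = LinearMap.applyₗ v ∘ₗ dualTensorHom k V (V ⊗[k] A) ∘ₗ
        (TensorProduct.leftComm k V (Module.Dual k V) A).toLinearMap ∘ₗ
        (signOp (k := k) (V := Module.Dual k V) (W := A)).lTensor V ∘ₗ
        (TensorProduct.assoc k V (Module.Dual k V) A).toLinearMap := by
    refine TensorProduct.ext ?_
    refine tensor_super_ext (k := k) (V := V) (W := Module.Dual k V) (X := A →ₗ[k] V ⊗[k] A)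
      fun i₁ i u hu ξ hξ => ?_
    refine super_ext (k := k) (V := A) fun j a ha => ?_
    change (contr3 k V).rTensor A (superMul k (V ⊗[k] Module.Dual k V) V A
        (((u ⊗ₜ ξ) ⊗ₜ a) ⊗ₜ (v ⊗ₜ 1)))
      = dualTensorHom k V (V ⊗[k] A) (TensorProduct.leftComm k V (Module.Dual k V) A
        (u ⊗ₜ signOp (ξ ⊗ₜ a))) v
    rw [superMul_tmul _ ha hv, signOp_tmul hξ ha, map_smul, TensorProduct.tmul_smul, map_smul,
      map_smul, LinearMap.smul_apply, TensorProduct.leftComm_tmul, dualTensorHom_apply]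
    simp only [LinearMap.rTensor_tmul, mul_one, contr3, LinearMap.comp_apply, LinearEquiv.coe_coe,
      TensorProduct.assoc_tmul, TensorProduct.map_tmul, contractLeft_apply,
      TensorProduct.rid_tmul, LinearMap.id_apply]
    by_cases h : i = l
    · subst h; rw [koszul_symm]; simp only [← TensorProduct.smul_tmul']
    · rw [dual_apply_eq_zero h hξ hv]; simp
  exact LinearMap.congr_fun this x

lemma gam_injective [Module.Finite k V] :
    Function.Injective (gam : (V ⊗[k] Module.Dual k V) ⊗[k] A → V →ₗ[k] V ⊗[k] A) := by
  intro x y h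
  rw [gam_eq, gam_eq] at h
  have h1 := (TensorProduct.leftComm k V (Module.Dual k V) A).injective
    ((dualTensorHomEquiv k V (V ⊗[k] A)).injective h)
  have h2 : ∀ z, (signOp (k := k) (V := Module.Dual k V) (W := A)).lTensor V
      ((signOp (k := k) (V := Module.Dual k V) (W := A)).lTensor V z) = z := by
    intro z
    rw [← LinearMap.lTensor_comp_apply]
    have : (signOp (k := k) (V := Module.Dual k V) (W := A)) ∘ₗ signOp = LinearMap.id :=
      LinearMap.ext signOp_signOp
    rw [this]; simp
  have h3 := congrArg ((signOp (k := k) (V := Module.Dual k V) (W := A)).lTensor V) h1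
  rw [h2, h2] at h3
  exact (TensorProduct.assoc k V (Module.Dual k V) A).injective h3

lemma rTensor_contr3_superMul (x : (V ⊗[k] Module.Dual k V) ⊗[k] A) (y : V ⊗[k] A) :
    (contr3 k V).rTensor A (superMul k (V ⊗[k] Module.Dual k V) V A (x ⊗ₜ y))
      = extend (gam x) y := by
  have : (contr3 k V).rTensor A ∘ₗ superMul k (V ⊗[k] Module.Dual k V) V A ∘ₗ
      TensorProduct.mk k _ _ x = extend (gam x) := by
    refine TensorProduct.ext' fun v a => ?_
    rw [extend_tmul, gam_apply, ← rTensor_rmul, ← superMul_rmul_right, rmul_tmul, one_mul]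
    rfl
  exact LinearMap.congr_fun this y

lemma gam_tmul_one (x : V ⊗[k] Module.Dual k V) (v : V) :
    gam (A := A) (x ⊗ₜ 1) v = contr3 k V (x ⊗ₜ v) ⊗ₜ 1 := by
  revert v
  refine LinearMap.congr_fun (g := (unitMap k V A) ∘ₗ contr3 k V ∘ₗ TensorProduct.mk k _ _ x) ?_
  refine super_ext (k := k) fun l v hv => ?_
  rw [gam_apply, superMul_tmul x SuperCommAlgebra.one_mem hv, koszul_zero_left]
  simp

end dual

namespace SRep

variable {G : Supergroup k}

lemma extend_act_inv_act (M : SRep G) (A : SAlg k) (g : G.obj A) (v : M.V) :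
    extend (M.act A g⁻¹) (M.act A g v) = v ⊗ₜ 1 := by
  have := LinearMap.congr_fun (M.act_mul A g⁻¹ g) v
  rw [inv_mul_cancel, M.act_one] at this
  exact this.symm

lemma extend_act_act_inv (M : SRep G) (A : SAlg k) (g : G.obj A) (v : M.V) :
    extend (M.act A g) (M.act A g⁻¹ v) = v ⊗ₜ 1 := by
  have := LinearMap.congr_fun (M.act_mul A g g⁻¹) v
  rw [mul_inv_cancel, M.act_one] at this
  exact this.symm

/-- The dual representation. -/
@[reducible] def dual (M : SRep G) : SRep G where
  V := Module.Dual k M.V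
  act A g := contra (M.act A g⁻¹)
  act_even A g := contra_isEven (M.act_even A g⁻¹)
  act_one A := by rw [inv_one, M.act_one, contra_unitMap]
  act_mul A g h := by rw [mul_inv_rev, M.act_mul, contra_comp (M.act_even A g⁻¹)]
  act_map f g := by rw [← map_inv, M.act_map, contra_map (SAlg.algHom_even f)]

/-- The evaluation `M* ⊗ M → k`. -/
def ev (M : SRep G) : tensor (dual M) M ⟶ unit G :=
  mkHom (M := tensor (dual M) M) (N := unit G) (contractLeft k M.V) contractLeft_isEven
    fun A g => TensorProduct.ext' (M := Module.Dual k M.V) fun ξ v => by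
      apply (TensorProduct.lid k A).injective
      change evA (superMul k (Module.Dual k M.V) M.V A
        (contra (M.act A g⁻¹) ξ ⊗ₜ M.act A g v)) = TensorProduct.lid k A (ξ v ⊗ₜ 1)
      rw [evA_superMul, theta_contra, extF_hat_comp, extend_act_inv_act, hat_tmul,
        TensorProduct.lid_tmul]

/-- The coevaluation `k → M ⊗ M*`. -/
def coev (M : SRep G) : unit G ⟶ tensor M (dual M) :=
  mkHom (M := unit G) (N := tensor M (dual M)) (coevaluation k M.V)
    (fun i c hc => by
      rcases zmod_two i with rfl | rfl
      · rw [← mul_one c, ← smul_eq_mul, map_smul]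
        exact Submodule.smul_mem _ _ coevaluation_mem
      · rw [mem_unit_one.1 hc, map_zero]; exact zero_mem _)
    fun A g => by
      refine LinearMap.ext_ring ?_
      set z := coevaluation k M.V 1 with hz
      change z ⊗ₜ (1 : A) = (tensor M (dual M)).act A g z
      apply gam_injective
      refine LinearMap.ext fun v => ?_
      rw [gam_tmul_one, contr3_coevaluation]
      let c : tensor (tensor M (dual M)) M ⟶ M :=
        (α_ M (dual M) M).hom ≫ M ◁ (show dual M ⊗ M ⟶ 𝟙_ (SRep G) from ev M) ≫ (ρ_ M).hom
      have hc : ∀ w : M.V, extend (gam ((tensor M (dual M)).act A g z)) (M.act A g w)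
          = M.act A g w := by
        intro w
        have := LinearMap.congr_fun (lin_equivariant c A g) (z ⊗ₜ w)
        rw [← rTensor_contr3_superMul]
        refine this.trans ?_
        change M.act A g (contr3 k M.V (z ⊗ₜ w)) = _
        rw [contr3_coevaluation]
      have h1 : extend (gam ((tensor M (dual M)).act A g z)) ∘ₗ M.act A g = M.act A g :=
        LinearMap.ext hc
      have h2 := extend_extend (gam ((tensor M (dual M)).act A g z)) (M.act A g)
        (M.act A g⁻¹ v)
      rw [h1, extend_act_act_inv, extend_tmul, rmul_one] at h2
      exact h2.symm

instance (M : SRep G) : ExactPairing M (dual M) where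
  coevaluation' := coev M
  evaluation' := ev M
  coevaluation_evaluation' := hom_ext (contractLeft_assoc_coevaluation k M.V)
  evaluation_coevaluation' := hom_ext (contractLeft_assoc_coevaluation' k M.V)

instance : RightRigidCategory (SRep G) where
  rightDual M := { rightDual := dual M }

end SRep

end

section

variable {k : Type u} [Field k]

namespace SRep

variable {G H : Supergroup k}

/-! ### Restriction along a homomorphism, parity shift -/

/-- The restriction of a representation along `φ : H ⟶ G`. -/
@[reducible] def resObj (φ : H ⟶ G) (M : SRep G) : SRep H where
  V := M.V
  act A h := M.act A (φ.app A h)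
  act_even A h := M.act_even A _
  act_one A := by rw [map_one, M.act_one]
  act_mul A g h := by rw [map_mul, M.act_mul]
  act_map {A B} f h := by
    rw [← M.act_map]
    congr 1
    exact ConcreteCategory.congr_hom (φ.naturality f) h

/-- The restriction functor along `φ : H ⟶ G`. -/
def res (φ : H ⟶ G) : SRep G ⥤ SRep H where
  obj M := resObj φ M
  map {M N} f := mkHom (M := resObj φ M) (N := resObj φ N) (lin (M := M) (N := N) f)
    (lin_even (M := M) (N := N) f) fun A h => lin_equivariant (M := M) (N := N) f A _

lemma lin_res_map (φ : H ⟶ G) {M N : SRep G} (f : M ⟶ N) :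
    lin ((res φ).map f) = lin (M := M) (N := N) f := rfl

instance (φ : H ⟶ G) : (res φ).Additive where
  map_add {M N f g} := hom_ext (M := resObj φ M) (N := resObj φ N) rfl

instance (φ : H ⟶ G) : (res φ).Linear k where
  map_smul {M N} _ _ := hom_ext (M := resObj φ M) (N := resObj φ N) rfl

/-- Restriction commutes with the unit. -/
def resUnitIso (φ : H ⟶ G) : unit H ≅ resObj φ (unit G) :=
  mkIso (M := unit H) (N := resObj φ (unit G)) (LinearEquiv.refl k k)
    (fun _ _ h => h) (fun _ _ h => h) fun A g => by
      refine LinearMap.ext_ring ?_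
      change LinearMap.rTensor A (LinearMap.id (R := k) (M := k)) ((1 : k) ⊗ₜ[k] (1 : A))
        = (1 : k) ⊗ₜ[k] (1 : A)
      rw [LinearMap.rTensor_id]; rfl

/-- Restriction commutes with tensor products. -/
def resTensorIso (φ : H ⟶ G) (M N : SRep G) :
    tensor (resObj φ M) (resObj φ N) ≅ resObj φ (tensor M N) :=
  mkIso (M := tensor (resObj φ M) (resObj φ N)) (N := resObj φ (tensor M N))
    (LinearEquiv.refl k (M.V ⊗[k] N.V)) (fun _ _ h => h) (fun _ _ h => h) fun A g => by
      refine TensorProduct.ext' fun v w => ?_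
      change LinearMap.rTensor A (LinearMap.id (R := k) (M := M.V ⊗[k] N.V)) _ = _
      rw [LinearMap.rTensor_id]; rfl

/-- Restriction is a monoidal functor. -/
def resCore (φ : H ⟶ G) : (res φ).CoreMonoidal where
  εIso := resUnitIso φ
  μIso M N := resTensorIso φ M N
  μIso_hom_natural_left {X Y} f Z :=
    hom_ext (M := tensor (resObj φ X) (resObj φ Z)) (N := resObj φ (tensor Y Z))
      (TensorProduct.ext' fun _ _ => rfl)
  μIso_hom_natural_right {X Y} Z f :=
    hom_ext (M := tensor (resObj φ Z) (resObj φ X)) (N := resObj φ (tensor Z Y))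
      (TensorProduct.ext' fun _ _ => rfl)
  associativity L M N :=
    hom_ext (M := tensor (tensor (resObj φ L) (resObj φ M)) (resObj φ N))
      (N := resObj φ (tensor L (tensor M N))) (TensorProduct.ext_threefold fun _ _ _ => rfl)
  left_unitality M :=
    hom_ext (M := tensor (unit H) (resObj φ M)) (N := resObj φ M)
      (TensorProduct.ext' (M := k) fun _ _ => rfl)
  right_unitality M :=
    hom_ext (M := tensor (resObj φ M) (unit H)) (N := resObj φ M)
      (TensorProduct.ext' (N := k) fun _ _ => rfl)

instance (φ : H ⟶ G) : (res φ).Monoidal := (resCore φ).toMonoidal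

instance (φ : H ⟶ G) : (res φ).Braided where
  braided M N :=
    hom_ext (M := tensor (resObj φ M) (resObj φ N)) (N := resObj φ (tensor N M))
      (TensorProduct.ext' fun _ _ => rfl)

section shift
variable (V : Type u) [AddCommGroup V] [Module k V] [SuperSpace k V]

/-- The parity shift `ΠV`: `(ΠV)ᵢ = V_{i+1}`. -/
@[reducible] def shiftSuper : SuperSpace k V where
  grade i := gr k V (i + 1)
  isCompl := (SuperSpace.isCompl (k := k) (V := V)).symm

lemma shift_tensor_mem {A : Type u} [Ring A] [Algebra k A] [SuperCommAlgebra k A] {i : ZMod 2}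
    {x : V ⊗[k] A} (hx : x ∈ gr k (V ⊗[k] A) (i + 1)) :
    x ∈ @gr k _ (V ⊗[k] A) _ _ (@tensorSuper k _ V A _ _ _ _ (shiftSuper V) _) i := by
  refine tensor_gr_induction (k := k)
    (p := fun x => x ∈ @gr k _ (V ⊗[k] A) _ _ (@tensorSuper k _ V A _ _ _ _ (shiftSuper V) _) i)
    (zero_mem _) (fun a b ha hb => add_mem ha hb)
    (fun c a ha => Submodule.smul_mem _ _ ha) ?_ hx
  intro i₁ j h v hv a ha
  refine @tmul_mem k _ V A _ _ _ _ (shiftSuper V) _ (i₁ + 1) j i ?_ v a ?_ ha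
  · clear hx hv ha; revert i i₁ j; decide
  · change v ∈ gr k V (i₁ + 1 + 1)
    rwa [add_assoc, one_add_one, add_zero]

end shift

/-- The parity shift of a representation. -/
@[reducible] def parityShift (M : SRep G) : SRep G where
  V := M.V
  super := shiftSuper M.V
  act := M.act
  act_even A g i v hv := shift_tensor_mem M.V (M.act_even A g (i + 1) v hv)
  act_one := M.act_one
  act_mul := M.act_mul
  act_map := M.act_map

/-- The super dimension is `(m|n)`. -/
def HasSuperDim (M : SRep G) (m n : ℕ) : Prop :=
  Module.finrank k (gr k M.V 0) = m ∧ Module.finrank k (gr k M.V 1) = n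

end SRep

end

section

/-! ### Semisimplification -/

section semisimplification

universe v w

variable (k : Type u) [Field k] {C : Type v} [Category.{w} C] [Preadditive C] [Linear k C]
  [MonoidalCategory C] [SymmetricCategory C] [MonoidalPreadditive C] [MonoidalLinear k C]
  [RightRigidCategory C]

section trace
/-- The categorical trace `𝟙 → X ⊗ X* → X ⊗ X* → X* ⊗ X → 𝟙` of an endomorphism of `X`. -/
def trace {X : C} (f : X ⟶ X) : 𝟙_ C ⟶ 𝟙_ C :=
  η_ X Xᘁ ≫ f ▷ Xᘁ ≫ (β_ X Xᘁ).hom ≫ ε_ X Xᘁ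

/-- `f : X ⟶ Y` is negligible if `f ≫ g` has trace zero for every `g : Y ⟶ X`. -/
def Negligible {X Y : C} (f : X ⟶ Y) : Prop := ∀ g : Y ⟶ X, trace (f ≫ g) = 0

lemma negligible_iff {X Y : C} (f : X ⟶ Y) :
    Negligible f ↔ ∀ (W : C) (u : 𝟙_ C ⟶ X ⊗ W) (φ : Y ⊗ W ⟶ 𝟙_ C), u ≫ f ▷ W ≫ φ = 0 := by
  constructor
  · intro hf W u φ
    obtain ⟨u, rfl⟩ := (tensorLeftHomEquiv (𝟙_ C) X Xᘁ W).surjective u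
    let _ : ExactPairing Xᘁ X := BraidedCategory.exactPairing_swap X Xᘁ
    obtain ⟨g, hg⟩ := (tensorRightHomEquiv Y Xᘁ X (𝟙_ C)).symm.surjective
      (Y ◁ ((ρ_ Xᘁ).inv ≫ u) ≫ φ)
    have h := hf (g ≫ (λ_ X).hom)
    have key : (g ≫ (λ_ X).hom) ▷ Xᘁ ≫ (β_ X Xᘁ).hom ≫ ε_ X Xᘁ
        = Y ◁ ((ρ_ Xᘁ).inv ≫ u) ≫ φ := by
      rw [← hg]
      change _ = g ▷ Xᘁ ≫ (α_ _ _ _).hom ≫ 𝟙_ C ◁ ((β_ X Xᘁ).hom ≫ ε_ X Xᘁ) ≫ (ρ_ _).hom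
      rw [← unitors_equal, leftUnitor_naturality]
      simp
    unfold trace at h
    rw [comp_whiskerRight, Category.assoc, key] at h
    change ((λ_ _).inv ≫ η_ _ _ ▷ _ ≫ (α_ _ _ _).hom ≫ _ ◁ u) ≫ _ = 0
    rw [← h]
    rw [unitors_inv_equal, ← rightUnitor_inv_naturality_assoc]
    simp [whisker_exchange_assoc]
  · intro h g
    have := h Xᘁ (η_ X Xᘁ) (g ▷ Xᘁ ≫ (β_ X Xᘁ).hom ≫ ε_ X Xᘁ)
    simpa [trace] using this

end trace

lemma Negligible.comp {X Y Z : C} {f : X ⟶ Y} (hf : Negligible f) (g : Y ⟶ Z) :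
    Negligible (f ≫ g) := by
  rw [negligible_iff] at hf ⊢
  intro W u φ
  simpa using hf W u (g ▷ W ≫ φ)

lemma Negligible.precomp {X Y Z : C} {f : X ⟶ Y} (hf : Negligible f) (g : Z ⟶ X) :
    Negligible (g ≫ f) := by
  rw [negligible_iff] at hf ⊢
  intro W u φ
  simpa using hf W (u ≫ g ▷ W) φ

lemma Negligible.whiskerRight {X Y : C} {f : X ⟶ Y} (hf : Negligible f) (Z : C) :
    Negligible (f ▷ Z) := by
  rw [negligible_iff] at hf ⊢
  intro W u φ
  simpa using hf (Z ⊗ W) (u ≫ (α_ _ _ _).hom) ((α_ _ _ _).inv ≫ φ)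

lemma Negligible.whiskerLeft {X Y : C} {f : X ⟶ Y} (hf : Negligible f) (Z : C) :
    Negligible (Z ◁ f) := by
  have : Z ◁ f = (β_ Z X).hom ≫ f ▷ Z ≫ (β_ Z Y).inv := by
    rw [← BraidedCategory.braiding_naturality_right_assoc]; simp
  rw [this]
  exact ((hf.whiskerRight Z).comp _).precomp _

/-- The subspace of negligible morphisms. -/
def negligible (X Y : C) : Submodule k (X ⟶ Y) where
  carrier := {f | Negligible f}
  add_mem' {f g} hf hg h := by
    have h1 := hf h
    have h2 := hg h
    unfold trace at *
    rw [Preadditive.add_comp, MonoidalPreadditive.add_whiskerRight, Preadditive.add_comp, Preadditive.comp_add, h1, h2,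
      add_zero]
  zero_mem' h := by simp [trace]
  smul_mem' c f hf h := by
    have h1 := hf h
    unfold trace at *
    rw [Linear.smul_comp, MonoidalLinear.smul_whiskerRight, Linear.smul_comp, Linear.comp_smul, h1, smul_zero]

/-- The semisimplification of `C`: the quotient of `C` by the tensor ideal of negligible
morphisms. It has the same objects as `C`. -/
structure Semisimplification (k : Type u) (C : Type v) where
  as : C

variable {k}

/-- The class of a morphism modulo the negligible ones. -/
def cls (k : Type u) [Field k] [Linear k C] [MonoidalLinear k C] {X Y : C} (f : X ⟶ Y) :
    (X ⟶ Y) ⧸ negligible k X Y := Submodule.Quotient.mk f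

lemma cls_surjective {X Y : C} (f : (X ⟶ Y) ⧸ negligible k X Y) : ∃ f', cls k f' = f :=
  Submodule.Quotient.mk_surjective _ f

lemma cls_eq {X Y : C} {f g : X ⟶ Y} : cls k f = cls k g ↔ Negligible (f - g) :=
  Submodule.Quotient.eq _

/-- Composition of classes. -/
def clsComp {X Y Z : C} (f : (X ⟶ Y) ⧸ negligible k X Y) (g : (Y ⟶ Z) ⧸ negligible k Y Z) :
    (X ⟶ Z) ⧸ negligible k X Z :=
  Quotient.liftOn₂' f g (fun f g => cls k (f ≫ g)) fun f g f' g' hf hg => by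
    have hf' : Negligible (f - f') := (Submodule.quotientRel_def _).1 hf
    have hg' : Negligible (g - g') := (Submodule.quotientRel_def _).1 hg
    refine cls_eq.2 ?_
    have : f ≫ g - f' ≫ g' = (f - f') ≫ g + f' ≫ (g - g') := by
      simp
    rw [this]
    exact (negligible k X Z).add_mem (hf'.comp _) (hg'.precomp _)

lemma clsComp_cls {X Y Z : C} (f : X ⟶ Y) (g : Y ⟶ Z) :
    clsComp (cls k f) (cls k g) = cls k (f ≫ g) := rfl

instance : Category (Semisimplification k C) where
  Hom X Y := (X.as ⟶ Y.as) ⧸ negligible k X.as Y.as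
  id X := cls k (𝟙 X.as)
  comp f g := clsComp f g
  id_comp f := by
    obtain ⟨f, rfl⟩ := cls_surjective f
    exact congrArg (cls k) (Category.id_comp f)
  comp_id f := by
    obtain ⟨f, rfl⟩ := cls_surjective f
    exact congrArg (cls k) (Category.comp_id f)
  assoc f g h := by
    obtain ⟨f, rfl⟩ := cls_surjective f
    obtain ⟨g, rfl⟩ := cls_surjective g
    obtain ⟨h, rfl⟩ := cls_surjective h
    exact congrArg (cls k) (Category.assoc f g h)

variable (k C) in
/-- The semisimplification functor. -/
def semisimplify : C ⥤ Semisimplification k C where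
  obj X := ⟨X⟩
  map f := cls k f
  map_id _ := rfl
  map_comp _ _ := rfl

lemma semisimplify_map_surjective {X Y : Semisimplification k C} (f : X ⟶ Y) :
    ∃ f' : X.as ⟶ Y.as, (semisimplify k C).map f' = f := cls_surjective f

lemma semisimplify_map_eq_iff {X Y : C} (f g : X ⟶ Y) :
    (semisimplify k C).map f = (semisimplify k C).map g ↔ Negligible (f - g) := cls_eq

instance : Preadditive (Semisimplification k C) where
  homGroup X Y := inferInstanceAs (AddCommGroup ((X.as ⟶ Y.as) ⧸ negligible k X.as Y.as))
  add_comp X Y Z f f' g := by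
    obtain ⟨f, rfl⟩ := cls_surjective f
    obtain ⟨f', rfl⟩ := cls_surjective f'
    obtain ⟨g, rfl⟩ := cls_surjective g
    exact congrArg (cls k) (Preadditive.add_comp _ _ _ f f' g)
  comp_add X Y Z f g g' := by
    obtain ⟨f, rfl⟩ := cls_surjective f
    obtain ⟨g, rfl⟩ := cls_surjective g
    obtain ⟨g', rfl⟩ := cls_surjective g'
    exact congrArg (cls k) (Preadditive.comp_add _ _ _ f g g')

instance : Linear k (Semisimplification k C) where
  homModule X Y := inferInstanceAs (Module k ((X.as ⟶ Y.as) ⧸ negligible k X.as Y.as))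
  smul_comp X Y Z c f g := by
    obtain ⟨f, rfl⟩ := cls_surjective f
    obtain ⟨g, rfl⟩ := cls_surjective g
    exact congrArg (cls k) (Linear.smul_comp _ _ _ c f g)
  comp_smul X Y Z f c g := by
    obtain ⟨f, rfl⟩ := cls_surjective f
    obtain ⟨g, rfl⟩ := cls_surjective g
    exact congrArg (cls k) (Linear.comp_smul _ _ _ f c g)

instance : (semisimplify k C).Additive where
  map_add := rfl

instance : (semisimplify k C).Linear k where
  map_smul _ _ := rfl

/-- Whiskering of classes. -/
def clsWhiskerLeft (Z : C) {X Y : C} (f : (X ⟶ Y) ⧸ negligible k X Y) :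
    (Z ⊗ X ⟶ Z ⊗ Y) ⧸ negligible k (Z ⊗ X) (Z ⊗ Y) :=
  Quotient.liftOn' f (fun f => cls k (Z ◁ f)) fun f f' hf => by
    have hf' : Negligible (f - f') := (Submodule.quotientRel_def _).1 hf
    refine cls_eq.2 ?_
    have h : Z ◁ f - Z ◁ f' = Z ◁ (f - f') := ((tensorLeft Z).map_sub).symm
    rw [h]
    exact hf'.whiskerLeft Z

/-- Whiskering of classes. -/
def clsWhiskerRight {X Y : C} (f : (X ⟶ Y) ⧸ negligible k X Y) (Z : C) :
    (X ⊗ Z ⟶ Y ⊗ Z) ⧸ negligible k (X ⊗ Z) (Y ⊗ Z) :=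
  Quotient.liftOn' f (fun f => cls k (f ▷ Z)) fun f f' hf => by
    have hf' : Negligible (f - f') := (Submodule.quotientRel_def _).1 hf
    refine cls_eq.2 ?_
    have h : f ▷ Z - f' ▷ Z = (f - f') ▷ Z := ((tensorRight Z).map_sub).symm
    rw [h]
    exact hf'.whiskerRight Z

instance : MonoidalCategoryStruct (Semisimplification k C) where
  tensorObj X Y := ⟨X.as ⊗ Y.as⟩
  tensorUnit := ⟨𝟙_ C⟩
  whiskerLeft X _ _ f := clsWhiskerLeft X.as f
  whiskerRight f X := clsWhiskerRight f X.as
  associator X Y Z := (semisimplify k C).mapIso (α_ X.as Y.as Z.as)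
  leftUnitor X := (semisimplify k C).mapIso (λ_ X.as)
  rightUnitor X := (semisimplify k C).mapIso (ρ_ X.as)

instance : MonoidalCategory (Semisimplification k C) where
  tensorHom_def f g := rfl
  id_tensorHom_id X Y :=
    congrArg (cls k) (by simp : 𝟙 X.as ▷ Y.as ≫ X.as ◁ 𝟙 Y.as = 𝟙 (X.as ⊗ Y.as))
  tensorHom_comp_tensorHom f₁ f₂ g₁ g₂ := by
    obtain ⟨f₁, rfl⟩ := cls_surjective f₁
    obtain ⟨f₂, rfl⟩ := cls_surjective f₂
    obtain ⟨g₁, rfl⟩ := cls_surjective g₁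
    obtain ⟨g₂, rfl⟩ := cls_surjective g₂
    refine congrArg (cls k) ?_
    simp [whisker_exchange_assoc]
  whiskerLeft_id X Y := congrArg (cls k) (MonoidalCategory.whiskerLeft_id X.as Y.as)
  id_whiskerRight X Y := congrArg (cls k) (MonoidalCategory.id_whiskerRight X.as Y.as)
  associator_naturality {X₁ X₂ X₃ Y₁ Y₂ Y₃} f₁ f₂ f₃ := by
    obtain ⟨f₁, rfl⟩ := cls_surjective f₁
    obtain ⟨f₂, rfl⟩ := cls_surjective f₂
    obtain ⟨f₃, rfl⟩ := cls_surjective f₃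
    refine congrArg (cls k) (?_ : ((f₁ ▷ X₂.as ≫ Y₁.as ◁ f₂) ▷ X₃.as ≫ (Y₁.as ⊗ Y₂.as) ◁ f₃) ≫
      (α_ Y₁.as Y₂.as Y₃.as).hom = (α_ X₁.as X₂.as X₃.as).hom ≫
        (f₁ ▷ (X₂.as ⊗ X₃.as) ≫ Y₁.as ◁ (f₂ ▷ X₃.as ≫ Y₂.as ◁ f₃)))
    simp
  leftUnitor_naturality f := by
    obtain ⟨f, rfl⟩ := cls_surjective f
    exact congrArg (cls k) (leftUnitor_naturality f)
  rightUnitor_naturality f := by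
    obtain ⟨f, rfl⟩ := cls_surjective f
    exact congrArg (cls k) (rightUnitor_naturality f)
  pentagon W X Y Z := congrArg (cls k) (pentagon W.as X.as Y.as Z.as)
  triangle X Y := congrArg (cls k) (triangle X.as Y.as)

instance : SymmetricCategory (Semisimplification k C) where
  braiding X Y := (semisimplify k C).mapIso (β_ X.as Y.as)
  braiding_naturality_right X Y Z f := by
    obtain ⟨f, rfl⟩ := cls_surjective f
    exact congrArg (cls k) (BraidedCategory.braiding_naturality_right X.as f)
  braiding_naturality_left f Z := by
    obtain ⟨f, rfl⟩ := cls_surjective f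
    exact congrArg (cls k) (BraidedCategory.braiding_naturality_left f Z.as)
  hexagon_forward X Y Z := congrArg (cls k) (BraidedCategory.hexagon_forward X.as Y.as Z.as)
  hexagon_reverse X Y Z := congrArg (cls k) (BraidedCategory.hexagon_reverse X.as Y.as Z.as)
  symmetry X Y := congrArg (cls k) (SymmetricCategory.symmetry X.as Y.as)

instance : MonoidalPreadditive (Semisimplification k C) where
  whiskerLeft_zero := congrArg (cls k) MonoidalPreadditive.whiskerLeft_zero
  zero_whiskerRight := congrArg (cls k) MonoidalPreadditive.zero_whiskerRight
  whiskerLeft_add f g := by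
    obtain ⟨f, rfl⟩ := cls_surjective f
    obtain ⟨g, rfl⟩ := cls_surjective g
    exact congrArg (cls k) (MonoidalPreadditive.whiskerLeft_add f g)
  add_whiskerRight f g := by
    obtain ⟨f, rfl⟩ := cls_surjective f
    obtain ⟨g, rfl⟩ := cls_surjective g
    exact congrArg (cls k) (MonoidalPreadditive.add_whiskerRight f g)

instance : MonoidalLinear k (Semisimplification k C) where
  whiskerLeft_smul X _ _ c f := by
    obtain ⟨f, rfl⟩ := cls_surjective f
    exact congrArg (cls k) (MonoidalLinear.whiskerLeft_smul X.as c f)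
  smul_whiskerRight c _ _ f X := by
    obtain ⟨f, rfl⟩ := cls_surjective f
    exact congrArg (cls k) (MonoidalLinear.smul_whiskerRight c f X.as)

variable (k C) in
/-- The semisimplification functor is strictly monoidal. -/
def semisimplifyCore : (semisimplify k C).CoreMonoidal where
  εIso := Iso.refl _
  μIso X Y := Iso.refl _
  μIso_hom_natural_left f X := (Category.comp_id _).trans (Category.id_comp _).symm
  μIso_hom_natural_right X f := (Category.comp_id _).trans (Category.id_comp _).symm
  associativity X Y Z := congrArg (cls k) (by simp :
    𝟙 (X ⊗ Y) ▷ Z ≫ 𝟙 ((X ⊗ Y) ⊗ Z) ≫ (α_ X Y Z).hom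
      = (α_ X Y Z).hom ≫ X ◁ 𝟙 (Y ⊗ Z) ≫ 𝟙 (X ⊗ (Y ⊗ Z)))
  left_unitality X := congrArg (cls k) (by simp :
    (λ_ X).hom = 𝟙 (𝟙_ C) ▷ X ≫ 𝟙 (𝟙_ C ⊗ X) ≫ (λ_ X).hom)
  right_unitality X := congrArg (cls k) (by simp :
    (ρ_ X).hom = X ◁ 𝟙 (𝟙_ C) ≫ 𝟙 (X ⊗ 𝟙_ C) ≫ (ρ_ X).hom)

instance : (semisimplify k C).Monoidal := (semisimplifyCore k C).toMonoidal

instance : (semisimplify k C).Braided where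
  braided X Y := (Category.id_comp _).trans (Category.comp_id _).symm

end semisimplification

end

section

variable (k : Type u) [Field k]

/-! ### The supergroups `G_a^{(1|1)}` and `OSp(1|2)` -/

section even

variable {A : Type u} [Ring A] [Algebra k A] [SuperCommAlgebra k A]

lemma even_commute {a : A} (ha : a ∈ gr k A 0) (b : A) : a * b = b * a := by
  refine hom_induction (k := k) (p := fun b => a * b = b * a)
    (fun x y hx hy => by rw [mul_add, add_mul, hx, hy]) (fun j b hb => ?_) b
  rw [SuperCommAlgebra.super_comm ha hb, koszul_zero_left, one_smul]

lemma odd_anticomm {a b : A} (ha : a ∈ gr k A 1) (hb : b ∈ gr k A 1) : a * b = -(b * a) := by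
  rw [SuperCommAlgebra.super_comm ha hb, koszul_one_one, neg_one_smul]

lemma odd_mul_odd {a b : A} (ha : a ∈ gr k A 1) (hb : b ∈ gr k A 1) : a * b ∈ gr k A 0 :=
  SuperCommAlgebra.mul_mem ha hb

lemma odd_sq [CharZero k] {a : A} (ha : a ∈ gr k A 1) : a * a = 0 := by
  have h := odd_anticomm k ha ha
  have h2 : (2 : k) • (a * a) = 0 := by
    rw [two_smul]; nth_rewrite 1 [h]; simp
  exact (smul_eq_zero.1 h2).resolve_left two_ne_zero

variable (A) in
/-- The even part of a supercommutative superalgebra. -/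
def evenSub : Subalgebra k A where
  carrier := gr k A 0
  mul_mem' ha hb := by simpa using SuperCommAlgebra.mul_mem ha hb
  add_mem' ha hb := add_mem ha hb
  algebraMap_mem' c := by
    rw [Algebra.algebraMap_eq_smul_one]
    exact Submodule.smul_mem _ _ SuperCommAlgebra.one_mem

instance : CommRing (evenSub k A) where
  mul_comm a b := Subtype.ext (even_commute k a.2 b.1)

instance : Algebra (evenSub k A) A where
  algebraMap := (evenSub k A).val.toRingHom
  commutes' a b := even_commute k a.2 b
  smul_def' a b := rfl

end even

/-- The points of `G_a^{(1|1)}` over `A`: pairs of an even and an odd element. -/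
@[ext]
structure Ga11Pts (A : SAlg k) where
  s : A
  σ : A
  hs : s ∈ gr k A 0
  hσ : σ ∈ gr k A 1

variable {k} in
instance [CharZero k] (A : SAlg k) : Group (Ga11Pts k A) where
  mul g h := ⟨g.s + h.s - g.σ * h.σ, g.σ + h.σ,
    sub_mem (add_mem g.hs h.hs) (odd_mul_odd k g.hσ h.hσ), add_mem g.hσ h.hσ⟩
  one := ⟨0, 0, zero_mem _, zero_mem _⟩
  inv g := ⟨-g.s, -g.σ, neg_mem g.hs, neg_mem g.hσ⟩
  mul_assoc g h l := Ga11Pts.ext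
    (show g.s + h.s - g.σ * h.σ + l.s - (g.σ + h.σ) * l.σ
      = g.s + (h.s + l.s - h.σ * l.σ) - g.σ * (h.σ + l.σ) by noncomm_ring)
    (add_assoc g.σ h.σ l.σ)
  one_mul g := Ga11Pts.ext (show 0 + g.s - 0 * g.σ = g.s by simp) (zero_add g.σ)
  mul_one g := Ga11Pts.ext (show g.s + 0 - g.σ * 0 = g.s by simp) (add_zero g.σ)
  inv_mul_cancel g := Ga11Pts.ext
    (show -g.s + g.s - -g.σ * g.σ = 0 by simp [odd_sq k g.hσ]) (neg_add_cancel g.σ)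

namespace Ga11Pts
variable {k} [CharZero k] {A : SAlg k}
@[simp] lemma mul_s (g h : Ga11Pts k A) : (g * h).s = g.s + h.s - g.σ * h.σ := rfl
@[simp] lemma mul_σ (g h : Ga11Pts k A) : (g * h).σ = g.σ + h.σ := rfl
@[simp] lemma one_s : (1 : Ga11Pts k A).s = 0 := rfl
@[simp] lemma one_σ : (1 : Ga11Pts k A).σ = 0 := rfl
end Ga11Pts

/-- The supergroup `G_a^{(1|1)}`: the affine superspace `𝔸^{1|1}` with the group law
`(s, σ)(t, τ) = (s + t - στ, σ + τ)`. Its even part is `G_a`, and its Lie superalgebra has a basis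
`x, [x, x]` with `x` odd. The point `(s, σ)` is `exp(s x²)(1 + x σ)`. -/
def Ga11 [CharZero k] : Supergroup k where
  obj A := GrpCat.of (Ga11Pts k A)
  map {A B} f := GrpCat.ofHom (MonoidHom.mk'
    (fun g => (⟨SAlg.algHom f g.s, SAlg.algHom f g.σ, SAlg.algHom_even f 0 _ g.hs,
      SAlg.algHom_even f 1 _ g.hσ⟩ : Ga11Pts k B))
    fun g h => Ga11Pts.ext (by simp) (by simp))
  map_id A := by ext <;> rfl
  map_comp f g := by ext <;> rfl

section osp

/-- The parities of the standard basis `e₀, e₁, e₂` of `k^{1|2}`. -/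
def par : Fin 3 → ZMod 2 := ![0, 1, 1]

variable {A : Type u} [Ring A] [Algebra k A] [SuperCommAlgebra k A]

/-- The supertranspose of a matrix which represents an even endomorphism. -/
def superTranspose (g : Matrix (Fin 3) (Fin 3) A) : Matrix (Fin 3) (Fin 3) A :=
  fun i j => koszul k (par i + par j) (par j) • g j i

variable (A) in
/-- The Gram matrix of the supersymmetric form on `k^{1|2}` with `B(e₀, e₀) = 1`,
`B(e₁, e₂) = 1 = -B(e₂, e₁)`. -/
def formMatrix : Matrix (Fin 3) (Fin 3) A := !![1, 0, 0; 0, 0, 1; 0, -1, 0]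

/-- The Berezinian `det(a - β D⁻¹ γ) det(D)⁻¹` of an even invertible matrix `(a β; γ D)`. -/
def berezinian (g : Matrix (Fin 3) (Fin 3) A) : A :=
  (g 0 0 - (g 0 1 * (g 2 2 * g 1 0 - g 1 2 * g 2 0) + g 0 2 * (g 1 1 * g 2 0 - g 2 1 * g 1 0)) *
    Ring.inverse (g 1 1 * g 2 2 - g 1 2 * g 2 1)) *
      Ring.inverse (g 1 1 * g 2 2 - g 1 2 * g 2 1)

/-- The matrix `g` is even, preserves the form and has Berezinian one. In coordinates
`B(g eᵢ, g eⱼ) = B(eᵢ, eⱼ)` reads `gˢᵗ J g = J`. -/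
structure IsOSp (g : Matrix (Fin 3) (Fin 3) A) : Prop where
  even : ∀ i j, g i j ∈ gr k A (par i + par j)
  form : superTranspose k g * formMatrix A * g = formMatrix A
  ber : berezinian g = 1

lemma superTranspose_one : superTranspose k (1 : Matrix (Fin 3) (Fin 3) A) = 1 := by
  ext i j
  by_cases h : i = j
  · subst h
    have : par i + par i = 0 := by generalize par i = x; revert x; decide
    simp [superTranspose, this, koszul_zero_left]
  · simp [superTranspose, Matrix.one_apply_ne h, Matrix.one_apply_ne (Ne.symm h)]

lemma superTranspose_mul {g h : Matrix (Fin 3) (Fin 3) A}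
    (hg : ∀ i j, g i j ∈ gr k A (par i + par j)) (hh : ∀ i j, h i j ∈ gr k A (par i + par j)) :
    superTranspose k (g * h) = superTranspose k h * superTranspose k g := by
  ext i j
  simp only [superTranspose, Matrix.mul_apply, Finset.smul_sum]
  refine Finset.sum_congr rfl fun m _ => ?_
  rw [SuperCommAlgebra.super_comm (hg j m) (hh m i), smul_mul_smul_comm, smul_smul]
  congr 1
  generalize par i = x
  generalize par j = y
  generalize par m = z
  rcases zmod_two x with rfl | rfl <;> rcases zmod_two y with rfl | rfl <;>
    rcases zmod_two z with rfl | rfl <;>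
    simp [koszul_zero_left, koszul_zero_right, koszul_one_one, one_add_one]

lemma even_mul {g h : Matrix (Fin 3) (Fin 3) A}
    (hg : ∀ i j, g i j ∈ gr k A (par i + par j)) (hh : ∀ i j, h i j ∈ gr k A (par i + par j))
    (i j : Fin 3) : (g * h) i j ∈ gr k A (par i + par j) := by
  rw [Matrix.mul_apply]
  refine Submodule.sum_mem _ fun m _ => ?_
  have := SuperCommAlgebra.mul_mem (hg i m) (hh m j)
  rwa [show par i + par m + (par m + par j) = par i + par j by
    generalize par i = x; generalize par j = y; generalize par m = z; revert x y z; decide] at this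

lemma odd_prod_sq [CharZero k] {x y : A} (hx : x ∈ gr k A 1) (hy : y ∈ gr k A 1) :
    x * y * (x * y) = 0 := by
  have h : x * y * (x * y) = -(x * x) * (y * y) := by
    have := odd_anticomm k hy hx
    calc x * y * (x * y) = x * (y * x) * y := by noncomm_ring
      _ = -(x * x) * (y * y) := by rw [this]; noncomm_ring
  rw [h, odd_sq k hx]; simp

lemma odd_expand [CharZero k] {x y : A} (hx : x ∈ gr k A 1) (hy : y ∈ gr k A 1)
    (c d e f : evenSub k A) :
    (c • x + d • y) * (e • x + f • y) = (c * f - d * e) • (x * y) := by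
  have h1 := odd_sq k hx
  have h2 := odd_sq k hy
  have h3 := odd_anticomm k hy hx
  simp only [add_mul, mul_add, smul_mul_smul_comm, h1, h2, h3]
  module

/-- The scalar identities behind the description of the group. -/
lemma osp_entries [CharZero k] {g : Matrix (Fin 3) (Fin 3) A}
    (hg : ∀ i j, g i j ∈ gr k A (par i + par j))
    (hf : superTranspose k g * formMatrix A * g = formMatrix A) :
    ∃ (a p q r t G b X : evenSub k A), (a : A) = g 0 0 ∧ (p : A) = g 1 1 ∧ (q : A) = g 1 2 ∧
      (r : A) = g 2 1 ∧ (t : A) = g 2 2 ∧ (G : A) = g 1 0 * g 2 0 ∧ (b : A) = g 0 1 * g 0 2 ∧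
      (X : A) = g 0 1 * (g 2 2 * g 1 0 - g 1 2 * g 2 0) +
        g 0 2 * (g 1 1 * g 2 0 - g 2 1 * g 1 0) ∧
      a * a = 1 + 2 * G ∧ p * t - q * r = 1 - b ∧ b = G ∧ G * G = 0 ∧
      a * X = 2 * (p * t - q * r) * G ∧
      g 0 0 * g 0 1 = g 1 0 * g 2 1 - g 2 0 * g 1 1 ∧
      g 0 0 * g 0 2 = g 1 0 * g 2 2 - g 2 0 * g 1 2 := by
  have h00 : g 0 0 ∈ gr k A 0 := hg 0 0
  have h11 : g 1 1 ∈ gr k A 0 := hg 1 1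
  have h12 : g 1 2 ∈ gr k A 0 := hg 1 2
  have h21 : g 2 1 ∈ gr k A 0 := hg 2 1
  have h22 : g 2 2 ∈ gr k A 0 := hg 2 2
  have h01 : g 0 1 ∈ gr k A 1 := hg 0 1
  have h02 : g 0 2 ∈ gr k A 1 := hg 0 2
  have h10 : g 1 0 ∈ gr k A 1 := hg 1 0
  have h20 : g 2 0 ∈ gr k A 1 := hg 2 0
  have F00 := congrFun (congrFun hf 0) 0
  have F01 := congrFun (congrFun hf 0) 1
  have F02 := congrFun (congrFun hf 0) 2
  have F12 := congrFun (congrFun hf 1) 2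
  simp [Matrix.mul_apply, Fin.sum_univ_three, formMatrix, superTranspose, par, koszul] at F00 F01 F02 F12
  let a : evenSub k A := ⟨g 0 0, h00⟩
  let p : evenSub k A := ⟨g 1 1, h11⟩
  let q : evenSub k A := ⟨g 1 2, h12⟩
  let r : evenSub k A := ⟨g 2 1, h21⟩
  let t : evenSub k A := ⟨g 2 2, h22⟩
  let G : evenSub k A := ⟨g 1 0 * g 2 0, odd_mul_odd k h10 h20⟩
  let b : evenSub k A := ⟨g 0 1 * g 0 2, odd_mul_odd k h01 h02⟩
  have hy1 : g 2 2 * g 1 0 - g 1 2 * g 2 0 = t • g 1 0 + (-q) • g 2 0 := by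
    rw [neg_smul, sub_eq_add_neg]; rfl
  have hy2 : g 1 1 * g 2 0 - g 2 1 * g 1 0 = (-r) • g 1 0 + p • g 2 0 := by
    rw [neg_smul, sub_eq_neg_add]; rfl
  have odd_smul : ∀ (c : evenSub k A) {x : A}, x ∈ gr k A 1 → c • x ∈ gr k A 1 :=
    fun c x hx => by
      have := SuperCommAlgebra.mul_mem c.2 hx
      rwa [zero_add] at this
  let X : evenSub k A := ⟨g 0 1 * (g 2 2 * g 1 0 - g 1 2 * g 2 0) +
      g 0 2 * (g 1 1 * g 2 0 - g 2 1 * g 1 0), by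
    rw [hy1, hy2]
    exact add_mem (odd_mul_odd k h01 (add_mem (odd_smul _ h10) (odd_smul _ h20)))
      (odd_mul_odd k h02 (add_mem (odd_smul _ h10) (odd_smul _ h20)))⟩
  have F01' : g 0 0 * g 0 1 = g 1 0 * g 2 1 - g 2 0 * g 1 1 :=
    eq_of_sub_eq_zero (by rw [← F01]; abel)
  have F02' : g 0 0 * g 0 2 = g 1 0 * g 2 2 - g 2 0 * g 1 2 :=
    eq_of_sub_eq_zero (by rw [← F02]; abel)
  have hb1 : a • g 0 1 = r • g 1 0 + (-p) • g 2 0 := by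
    change g 0 0 * g 0 1 = _
    rw [F01', ← even_commute k h21, ← even_commute k h11, neg_smul, sub_eq_add_neg]; rfl
  have hb2 : a • g 0 2 = t • g 1 0 + (-q) • g 2 0 := by
    change g 0 0 * g 0 2 = _
    rw [F02', ← even_commute k h22, ← even_commute k h12, neg_smul, sub_eq_add_neg]; rfl
  have e1 : a * a = 1 + 2 * G := by
    have : g 0 0 * g 0 0 = 1 + 2 * (g 1 0 * g 2 0) := by
      rw [← F00, odd_anticomm k h20 h10]; noncomm_ring
    exact Subtype.ext this
  have e2 : p * t - q * r = 1 - b := by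
    have : g 1 1 * g 2 2 - g 1 2 * g 2 1 = 1 - g 0 1 * g 0 2 := by
      rw [← F12, even_commute k h12]; abel
    exact Subtype.ext this
  have e3 : G * G = 0 := Subtype.ext (odd_prod_sq k h10 h20)
  have e4 : b * b = 0 := Subtype.ext (odd_prod_sq k h01 h02)
  have e5 : a * a * b = (p * t - q * r) * G := by
    refine Subtype.ext ?_
    have h := odd_expand k h10 h20 r (-p) t (-q)
    rw [← hb1, ← hb2, smul_mul_smul_comm] at h
    exact h.trans (congrArg (fun c : evenSub k A => c • (g 1 0 * g 2 0)) (by ring :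
      r * -q - -p * t = p * t - q * r))
  have e6 : b = G := by
    have h1 : b + 3 * G * b = G := by
      rw [e1, e2] at e5
      linear_combination e5
    have h2 : G * b = 0 := by linear_combination b * h1 * (-1) + (1 + 3 * G) * e4
    linear_combination h1 - 3 * h2
  have e7 : a * X = 2 * (p * t - q * r) * G := by
    refine Subtype.ext ?_
    have h := odd_expand k h10 h20 r (-p) t (-q)
    have h' := odd_expand k h10 h20 t (-q) (-r) p
    rw [← hb1, smul_mul_assoc] at h
    rw [← hb2, smul_mul_assoc] at h'
    have h'' : a • (X : A) = (2 * (p * t - q * r)) • (g 1 0 * g 2 0) := by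
      change a • (g 0 1 * (g 2 2 * g 1 0 - g 1 2 * g 2 0) +
        g 0 2 * (g 1 1 * g 2 0 - g 2 1 * g 1 0)) = _
      rw [hy1, hy2, smul_add, h, h', ← add_smul]
      congr 1; ring
    exact h''
  exact ⟨a, p, q, r, t, G, b, X, rfl, rfl, rfl, rfl, rfl, rfl, rfl, rfl, e1, e2, e6, e3, e7,
    F01', F02'⟩

/-- For a matrix that preserves the form, the Berezinian is one iff `a = 1 + γ₁γ₂`. -/
lemma berezinian_eq_one_iff [CharZero k] {g : Matrix (Fin 3) (Fin 3) A}
    (hg : ∀ i j, g i j ∈ gr k A (par i + par j))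
    (hf : superTranspose k g * formMatrix A * g = formMatrix A) :
    berezinian g = 1 ↔ g 0 0 = 1 + g 1 0 * g 2 0 := by
  obtain ⟨a, p, q, r, t, G, b, X, ha, hp, hq, hr, ht, hG, hb, hX, e1, e2, e3, e4, e5, -, -⟩ :=
    osp_entries k hg hf
  subst e3
  have hd : (p * t - q * r) * (1 + b) = 1 := by rw [e2]; linear_combination -e4
  have hinv : Ring.inverse (g 1 1 * g 2 2 - g 1 2 * g 2 1) = ((1 + b : evenSub k A) : A) := by
    rw [← hp, ← hq, ← hr, ← ht]
    have h1 : ((p : A) * t - q * r) * ((1 + b : evenSub k A) : A) = 1 := congrArg Subtype.val hd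
    have h2 : ((1 + b : evenSub k A) : A) * ((p : A) * t - q * r) = 1 :=
      congrArg Subtype.val ((mul_comm _ _).trans hd)
    exact Ring.inverse_unit ⟨_, _, h1, h2⟩
  rw [berezinian, hinv, ← hX, ← ha, ← hG]
  have : ((a : A) - X * ((1 + b : evenSub k A) : A)) * ((1 + b : evenSub k A) : A)
      = (((a - X * (1 + b)) * (1 + b) : evenSub k A) : A) := rfl
  rw [this]
  constructor
  · intro h
    have h1 : (a - X * (1 + b)) * (1 + b) = 1 := Subtype.ext h
    have h2 : a = 1 + b := by
      rw [e2] at e5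
      linear_combination (-a) * h1 + (1 + b) * e1 - (1 + b) ^ 2 * e5 +
        (2 * b ^ 2 * (1 + b) + 2 * b - 2 * b ^ 3) * e4
    exact congrArg Subtype.val h2
  · intro h
    have h1 : a = 1 + b := Subtype.ext h
    have h2 : (a - X * (1 + b)) * (1 + b) = 1 := by
      rw [e2, h1] at e5
      rw [h1]
      linear_combination (-(1 + b)) * e5 + (1 + 2 * b) * e4
    exact congrArg Subtype.val h2

lemma isOSp_one [CharZero k] : IsOSp k (1 : Matrix (Fin 3) (Fin 3) A) := by
  have he : ∀ i j, (1 : Matrix (Fin 3) (Fin 3) A) i j ∈ gr k A (par i + par j) := by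
    intro i j
    by_cases h : i = j
    · subst h
      rw [show par i + par i = 0 by generalize par i = x; revert x; decide, Matrix.one_apply_eq]
      exact SuperCommAlgebra.one_mem
    · rw [Matrix.one_apply_ne h]; exact zero_mem _
  have hf : superTranspose k (1 : Matrix (Fin 3) (Fin 3) A) * formMatrix A * 1
      = formMatrix A := by
    rw [superTranspose_one, one_mul, mul_one]
  exact ⟨he, hf, by rw [berezinian_eq_one_iff k he hf]; simp⟩

lemma IsOSp.mul [CharZero k] {g h : Matrix (Fin 3) (Fin 3) A} (hg : IsOSp k g) (hh : IsOSp k h) :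
    IsOSp k (g * h) := by
  have he := even_mul k hg.even hh.even
  have hf : superTranspose k (g * h) * formMatrix A * (g * h) = formMatrix A := by
    rw [superTranspose_mul k hg.even hh.even]
    calc superTranspose k h * superTranspose k g * formMatrix A * (g * h)
        = superTranspose k h * (superTranspose k g * formMatrix A * g) * h := by noncomm_ring
      _ = _ := by rw [hg.form, hh.form]
  refine ⟨he, hf, ?_⟩
  rw [berezinian_eq_one_iff k he hf]
  have h1 := (berezinian_eq_one_iff k hg.even hg.form).1 hg.ber
  have h2 := (berezinian_eq_one_iff k hh.even hh.form).1 hh.ber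
  obtain ⟨a, p, q, r, t, G, b, -, ha, hp, hq, hr, ht, hG, hb, -, e1, e2, e3, e4, -, i1, i2⟩ :=
    osp_entries k hg.even hg.form
  obtain ⟨a', -, -, -, -, G', -, -, ha', -, -, -, -, hG', -, -, e1', -, -, e4', -, -, -⟩ :=
    osp_entries k hh.even hh.form
  subst e3
  have h01 : g 0 1 ∈ gr k A 1 := hg.even 0 1
  have h02 : g 0 2 ∈ gr k A 1 := hg.even 0 2
  have h10 : g 1 0 ∈ gr k A 1 := hg.even 1 0
  have h20 : g 2 0 ∈ gr k A 1 := hg.even 2 0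
  have k10 : h 1 0 ∈ gr k A 1 := hh.even 1 0
  have k20 : h 2 0 ∈ gr k A 1 := hh.even 2 0
  let m11 : evenSub k A := ⟨g 1 0 * h 1 0, odd_mul_odd k h10 k10⟩
  let m12 : evenSub k A := ⟨g 1 0 * h 2 0, odd_mul_odd k h10 k20⟩
  let m21 : evenSub k A := ⟨g 2 0 * h 1 0, odd_mul_odd k h20 k10⟩
  let m22 : evenSub k A := ⟨g 2 0 * h 2 0, odd_mul_odd k h20 k20⟩
  let S : evenSub k A := ⟨g 0 1 * h 1 0 + g 0 2 * h 2 0,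
    add_mem (odd_mul_odd k h01 k10) (odd_mul_odd k h02 k20)⟩
  have ha1 : a = 1 + b := Subtype.ext (by rw [ha, h1, ← hG]; rfl)
  have ha1' : a' = 1 + G' := Subtype.ext (by rw [ha', h2, ← hG']; rfl)
  have hS : a * S = r * m11 - p * m21 + (t * m12 - q * m22) := by
    refine Subtype.ext ?_
    change (a : A) * (g 0 1 * h 1 0 + g 0 2 * h 2 0)
      = r * (g 1 0 * h 1 0) - p * (g 2 0 * h 1 0)
        + (t * (g 1 0 * h 2 0) - q * (g 2 0 * h 2 0))
    rw [mul_add, ← mul_assoc, ← mul_assoc, ha, i1, i2, ← hr, ← hp, ← ht, ← hq,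
      ← even_commute k r.2, ← even_commute k p.2, ← even_commute k t.2, ← even_commute k q.2]
    noncomm_ring
  have sq : ∀ {x y z : A}, x ∈ gr k A 1 → y ∈ gr k A 1 → x * y * (x * z) = 0 := by
    intro x y z hx hy
    calc x * y * (x * z) = x * (y * x) * z := by noncomm_ring
      _ = -(x * x) * (y * z) := by rw [odd_anticomm k hy hx]; noncomm_ring
      _ = 0 := by rw [odd_sq k hx]; simp
  have sq' : ∀ {x y z : A}, y ∈ gr k A 1 → x * y * (y * z) = 0 := by
    intro x y z hy
    calc x * y * (y * z) = x * (y * y) * z := by noncomm_ring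
      _ = 0 := by rw [odd_sq k hy]; simp
  have z11 : b * m11 = 0 := Subtype.ext (by
    change (b : A) * (g 1 0 * h 1 0) = 0
    rw [hG]; exact sq h10 h20)
  have z12 : b * m12 = 0 := Subtype.ext (by
    change (b : A) * (g 1 0 * h 2 0) = 0
    rw [hG]; exact sq h10 h20)
  have z21 : b * m21 = 0 := Subtype.ext (by
    change (b : A) * (g 2 0 * h 1 0) = 0
    rw [hG]; exact sq' h20)
  have z22 : b * m22 = 0 := Subtype.ext (by
    change (b : A) * (g 2 0 * h 2 0) = 0
    rw [hG]; exact sq' h20)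
  have sq2 : ∀ {x y z : A}, x ∈ gr k A 1 → y ∈ gr k A 1 → z * x * (x * y) = 0 ∧
      z * y * (x * y) = 0 := by
    intro x y z hx hy
    refine ⟨sq' hx, ?_⟩
    rw [odd_anticomm k hx hy, mul_neg, sq' hy, neg_zero]
  have hSG : S * G' = 0 := Subtype.ext (by
    change (g 0 1 * h 1 0 + g 0 2 * h 2 0) * (G' : A) = 0
    rw [hG', add_mul, (sq2 k10 k20).1, (sq2 k10 k20).2, add_zero])
  have hSb : b * S = 0 := by
    have h3 : a * (b * S) = 0 := by
      linear_combination b * hS + r * z11 - p * z21 + t * z12 - q * z22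
    rw [ha1] at h3
    linear_combination (1 - b) * h3 + b * S * e4
  have key : (1 + b) * (1 + G') + S = 1 + (b * a' ^ 2 + a' * (a * S) + (1 - b) * G') := by
    rw [ha1, ha1']
    linear_combination (-1 : evenSub k A) * hSb - (b + 1) * hSG - b * e4'
  have hγ : (g * h) 1 0 * (g * h) 2 0
      = ((b * a' ^ 2 + a' * (a * S) + (p * t - q * r) * G' : evenSub k A) : A) := by
    have x1 : (g * h) 1 0 = a' • g 1 0 + (p • h 1 0 + q • h 2 0) := by
      rw [Matrix.mul_apply, Fin.sum_univ_three, ← ha', ← hp, ← hq, ← even_commute k a'.2,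
        add_assoc]
      rfl
    have x2 : (g * h) 2 0 = a' • g 2 0 + (r • h 1 0 + t • h 2 0) := by
      rw [Matrix.mul_apply, Fin.sum_univ_three, ← ha', ← hr, ← ht, ← even_commute k a'.2,
        add_assoc]
      rfl
    have x3 := odd_expand k k10 k20 p q r t
    have c1 := odd_anticomm k k10 h20
    have c2 := odd_anticomm k k20 h20
    have x4 : ∀ x y z w : A, (x + y) * (z + w) = x * z + y * z + x * w + y * w := by
      intros; noncomm_ring
    rw [x1, x2, x4, x3, hS]
    simp only [add_mul (_ : A), mul_add (_ : A), smul_mul_smul_comm, c1, c2]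
    have cast : ∀ c : evenSub k A, (c : A) = c • (1 : A) := fun c => (mul_one _).symm
    rw [cast]
    have y1 : g 1 0 * g 2 0 = b • (1 : A) := by rw [← hG]; exact (mul_one _).symm
    have y2 : h 1 0 * h 2 0 = G' • (1 : A) := by rw [← hG']; exact (mul_one _).symm
    have y3 : g 1 0 * h 1 0 = m11 • (1 : A) := (mul_one _).symm
    have y4 : g 1 0 * h 2 0 = m12 • (1 : A) := (mul_one _).symm
    have y5 : g 2 0 * h 1 0 = m21 • (1 : A) := (mul_one _).symm
    have y6 : g 2 0 * h 2 0 = m22 • (1 : A) := (mul_one _).symm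
    rw [y1, y2, y3, y4, y5, y6]
    module
  have h0 : (g * h) 0 0 = (((1 + b) * (1 + G') + S : evenSub k A) : A) := by
    rw [Matrix.mul_apply, Fin.sum_univ_three, ← ha, ← ha', ha1, ha1', add_assoc]
    rfl
  rw [h0, hγ, key, e2]
  rfl

lemma IsOSp.inv [CharZero k] (g : (Matrix (Fin 3) (Fin 3) A)ˣ) (hg : IsOSp k g.1) :
    IsOSp k (g⁻¹).1 := by
  let J := formMatrix A
  let J' : Matrix (Fin 3) (Fin 3) A := !![1, 0, 0; 0, 0, -1; 0, 1, 0]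
  have hJ : J' * J = 1 := by
    ext i j
    fin_cases i <;> fin_cases j <;>
      simp [J, J', formMatrix, Matrix.mul_apply, Fin.sum_univ_three]
  have h1 : (g⁻¹).1 = J' * superTranspose k g.1 * J := by
    have : J' * superTranspose k g.1 * J * g.1 = 1 := by
      rw [mul_assoc, mul_assoc, ← mul_assoc (superTranspose k g.1), hg.form, hJ]
    exact (left_inv_eq_right_inv this g.mul_inv).symm
  have e00 : (g⁻¹).1 0 0 = g.1 0 0 := by
    rw [h1]
    simp [J, J', formMatrix, Matrix.mul_apply, Fin.sum_univ_three, superTranspose, par, koszul,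
      Matrix.vecMul, dotProduct]
  have e10 : (g⁻¹).1 1 0 = - g.1 0 2 := by
    rw [h1]
    simp [J, J', formMatrix, Matrix.mul_apply, Fin.sum_univ_three, superTranspose, par, koszul,
      Matrix.vecMul, dotProduct]
  have e20 : (g⁻¹).1 2 0 = g.1 0 1 := by
    rw [h1]
    simp [J, J', formMatrix, Matrix.mul_apply, Fin.sum_univ_three, superTranspose, par, koszul,
      Matrix.vecMul, dotProduct]
  have hst : ∀ i j, superTranspose k g.1 i j ∈ gr k A (par i + par j) := fun i j => by
    rw [add_comm]; exact Submodule.smul_mem _ _ (hg.even j i)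
  have hz : ∀ n : ZMod 2, (0 : A) ∈ gr k A n := fun n => zero_mem _
  have h1' : (1 : A) ∈ gr k A 0 := SuperCommAlgebra.one_mem
  have hJe : ∀ i j, J i j ∈ gr k A (par i + par j) := by
    intro i j
    fin_cases i <;> fin_cases j <;> simp [J, formMatrix, par, one_add_one, h1']
  have hJe' : ∀ i j, J' i j ∈ gr k A (par i + par j) := by
    intro i j
    fin_cases i <;> fin_cases j <;> simp [J', par, one_add_one, h1']
  have he : ∀ i j, (g⁻¹).1 i j ∈ gr k A (par i + par j) := by
    rw [h1]; exact even_mul k (even_mul k hJe' hst) hJe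
  have hf : superTranspose k (g⁻¹).1 * formMatrix A * (g⁻¹).1 = formMatrix A := by
    have h2 : superTranspose k (g⁻¹).1 * superTranspose k g.1 = 1 := by
      rw [← superTranspose_mul k hg.even he, Units.mul_inv, superTranspose_one]
    calc superTranspose k (g⁻¹).1 * formMatrix A * (g⁻¹).1
        = superTranspose k (g⁻¹).1 * (superTranspose k g.1 * formMatrix A * g.1) * (g⁻¹).1 := by
          rw [hg.form]
      _ = (superTranspose k (g⁻¹).1 * superTranspose k g.1) * formMatrix A *
            (g.1 * (g⁻¹).1) := by noncomm_ring
      _ = _ := by rw [h2, Units.mul_inv]; simp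
  refine ⟨he, hf, ?_⟩
  rw [berezinian_eq_one_iff k he hf, e00, e10, e20]
  have h3 := (berezinian_eq_one_iff k hg.even hg.form).1 hg.ber
  obtain ⟨a, p, q, r, t, G, b, -, ha, hp, hq, hr, ht, hG, hb, -, e1, e2, e3, e4, -, i1, i2⟩ :=
    osp_entries k hg.even hg.form
  have h4 : g.1 0 2 * g.1 0 1 = -(g.1 0 1 * g.1 0 2) :=
    odd_anticomm k (hg.even 0 2) (hg.even 0 1)
  rw [h3, neg_mul, h4, neg_neg, ← hG, ← hb, e3]

variable (A) in
/-- The points of `OSp(1|2)` over `A`. -/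
def OSp12Pts [CharZero k] : Subgroup (Matrix (Fin 3) (Fin 3) A)ˣ where
  carrier := {g | IsOSp k g.1}
  mul_mem' hg hh := hg.mul k hh
  one_mem' := isOSp_one k
  inv_mem' {g} hg := IsOSp.inv k g hg

lemma IsOSp.map [CharZero k] {B : Type u} [Ring B] [Algebra k B] [SuperCommAlgebra k B]
    {f : A →ₐ[k] B} (hf : IsEven (k := k) f.toLinearMap) {g : Matrix (Fin 3) (Fin 3) A}
    (hg : IsOSp k g) : IsOSp k (f.mapMatrix g) := by
  have he : ∀ i j, f.mapMatrix g i j ∈ gr k B (par i + par j) := fun i j =>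
    hf _ _ (hg.even i j)
  have hst : superTranspose k (f.mapMatrix g) = f.mapMatrix (superTranspose k g) := by
    ext i j
    simp [superTranspose]
  have hJ : f.mapMatrix (formMatrix A) = formMatrix B := by
    ext i j
    fin_cases i <;> fin_cases j <;> simp [formMatrix]
  have hF : superTranspose k (f.mapMatrix g) * formMatrix B * f.mapMatrix g = formMatrix B := by
    rw [hst, ← hJ, ← map_mul, ← map_mul, hg.form]
  refine ⟨he, hF, ?_⟩
  rw [berezinian_eq_one_iff k he hF]
  have h := (berezinian_eq_one_iff k hg.even hg.form).1 hg.ber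
  have h' := congrArg f h
  simpa using h'

end osp

/-- The supergroup `OSp(1|2)`: automorphisms of `k^{1|2}` which preserve the supersymmetric form
and have Berezinian one. -/
def OSp12 [CharZero k] : Supergroup k where
  obj A := GrpCat.of (OSp12Pts k A)
  map {A B} f := GrpCat.ofHom
    (((Units.map (SAlg.algHom f).mapMatrix.toMonoidHom).comp (OSp12Pts k A).subtype).codRestrict
      (OSp12Pts k B) fun g => IsOSp.map k (SAlg.algHom_even f) g.2)
  map_id A := by ext; rfl
  map_comp f g := by ext; rfl

end

section

variable (k : Type u) [Field k] [CharZero k]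

section embedding

/-- The matrix of `exp(s x²)(1 + x σ)`, for the odd operator `x : e₁ ↦ e₀ ↦ e₂ ↦ 0` on `k^{1|2}`. -/
def embMatrix (A : SAlg k) : Ga11Pts k A →* Matrix (Fin 3) (Fin 3) A where
  toFun g := !![1, -g.σ, 0; 0, 1, 0; g.σ, g.s, 1]
  map_one' := by
    ext i j
    fin_cases i <;> fin_cases j <;> simp
  map_mul' g h := by
    ext i j
    fin_cases i <;> fin_cases j <;> simp [Matrix.mul_apply, Fin.sum_univ_three]
    abel

lemma embMatrix_isOSp (A : SAlg k) (g : Ga11Pts k A) : IsOSp k (embMatrix k A g) := by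
  have h1 : (1 : A) ∈ gr k A 0 := SuperCommAlgebra.one_mem
  have he : ∀ i j, embMatrix k A g i j ∈ gr k A (par i + par j) := by
    intro i j
    fin_cases i <;> fin_cases j <;> simp [embMatrix, par, one_add_one, h1, g.hs, g.hσ]
  have hf : superTranspose k (embMatrix k A g) * formMatrix A * embMatrix k A g
      = formMatrix A := by
    have h2 := odd_sq k g.hσ
    ext i j
    fin_cases i <;> fin_cases j <;>
      simp [embMatrix, Matrix.mul_apply, Fin.sum_univ_three, formMatrix, superTranspose, par,
        koszul, h2]
  refine ⟨he, hf, ?_⟩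
  rw [berezinian_eq_one_iff k he hf]
  simp [embMatrix]

/-- The embedding `G_a^{(1|1)} ⟶ OSp(1|2)` given by the odd element `x : e₁ ↦ e₀ ↦ e₂ ↦ 0` of the
Lie superalgebra of `OSp(1|2)`, whose square `½[x, x]` is the lower triangular nilpotent matrix
`e₁ ↦ e₂ ↦ 0` of `sl₂`. -/
def emb : Ga11 k ⟶ OSp12 k where
  app A := GrpCat.ofHom ((embMatrix k A).toHomUnits.codRestrict (OSp12Pts k A)
    fun g => embMatrix_isOSp k A g)
  naturality A B f := by
    ext g
    refine Subtype.ext (Units.ext ?_)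
    change embMatrix k B _ = (SAlg.algHom f).mapMatrix (embMatrix k A g)
    ext i j
    fin_cases i <;> fin_cases j <;> simp [embMatrix] <;> rfl

end embedding

section nilpotent

variable {k} {V : Type u} [AddCommGroup V] [Module k V] [SuperSpace k V]
  {A B : Type u} [Ring A] [Algebra k A] [SuperCommAlgebra k A]
  [Ring B] [Algebra k B] [SuperCommAlgebra k B]

variable (k V) in
/-- The parity operator `v ↦ (-1)^{|v|} v`. -/
def parityOp : V →ₗ[k] V := LinearMap.id - (2 : k) • oddProj k V

lemma parityOp_apply {i : ZMod 2} {v : V} (hv : v ∈ gr k V i) :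
    parityOp k V v = koszul k i i • v := by
  rcases zmod_two i with rfl | rfl
  · simp [parityOp, oddProj_of_even hv, koszul_zero_left]
  · simp [parityOp, oddProj_of_odd hv, koszul_one_one]; module

/-- An odd linear map. -/
def IsOdd (x : V →ₗ[k] V) : Prop := ∀ (i : ZMod 2), ∀ v ∈ gr k V i, x v ∈ gr k V (i + 1)

/-- The operator `f ⊗ a` on `V ⊗ A`. -/
def opT (f : V →ₗ[k] V) (a : A) : Module.End k (V ⊗[k] A) :=
  TensorProduct.map f (LinearMap.mulLeft k a)

lemma opT_tmul (f : V →ₗ[k] V) (a b : A) (v : V) : opT f a (v ⊗ₜ b) = f v ⊗ₜ (a * b) := rfl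

lemma opT_mul (f f' : V →ₗ[k] V) (a a' : A) :
    opT f a * opT f' a' = opT (f ∘ₗ f') (a * a') := by
  refine TensorProduct.ext' fun v b => ?_
  simp [opT_tmul, mul_assoc]

lemma opT_add (f : V →ₗ[k] V) (a a' : A) : opT f (a + a') = opT f a + opT f a' := by
  refine TensorProduct.ext' fun v b => ?_
  simp [opT_tmul, add_mul, TensorProduct.tmul_add]

lemma opT_neg (f : V →ₗ[k] V) (a : A) : opT f (-a) = -opT f a := by
  refine TensorProduct.ext' fun v b => ?_
  simp [opT_tmul, TensorProduct.tmul_neg]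

lemma opT_zero (f : V →ₗ[k] V) : opT f (0 : A) = 0 := by
  refine TensorProduct.ext' fun v b => ?_
  simp [opT_tmul]

lemma opT_pow (f : V →ₗ[k] V) (a : A) (n : ℕ) : opT f a ^ n = opT (f ^ n) (a ^ n) := by
  induction n with
  | zero => refine TensorProduct.ext' fun v b => ?_; simp [opT_tmul]
  | succ n ih => rw [pow_succ, ih, opT_mul, pow_succ, pow_succ]; rfl

lemma opT_nilpotent {f : V →ₗ[k] V} (hf : IsNilpotent f) (a : A) : IsNilpotent (opT f a) := by
  obtain ⟨n, hn⟩ := hf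
  refine ⟨n, ?_⟩
  rw [opT_pow, hn]
  refine TensorProduct.ext' fun v b => ?_
  simp [opT_tmul]

/-- The action of `ℚ` on endomorphisms. -/
@[reducible] def ratModule (k : Type u) [Field k] [CharZero k] (W : Type u) [AddCommGroup W]
    [Module k W] : Module ℚ (Module.End k W) :=
  Module.compHom _ (algebraMap ℚ k)

attribute [local instance] ratModule

lemma exp_mem {W : Type u} [AddCommGroup W] [Module k W] (S : Subalgebra k (Module.End k W))
    {f : Module.End k W} (hf : f ∈ S) : IsNilpotent.exp f ∈ S :=
  Subalgebra.sum_mem _ fun i _ => S.smul_mem (S.pow_mem hf i) _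

lemma ofNat_smul_end {W : Type u} [AddCommGroup W] [Module k W] (q : ℚ) (f : Module.End k W)
    (w : W) : (q • f) w = (q : k) • f w := by
  rw [← eq_ratCast (algebraMap ℚ k)]; rfl

/-- The operator `exp(s x²)(1 + x σ)` on `V ⊗ A`, where `(x σ)(v) = (-1)^{|v|} x(v) σ`. -/
def nilOp (x : V →ₗ[k] V) (s σ : A) : Module.End k (V ⊗[k] A) :=
  IsNilpotent.exp (opT (x ∘ₗ x) s) * (1 + opT (x ∘ₗ parityOp k V) σ)

variable (k V A) in
/-- The algebra of even operators. -/
def evenOps : Subalgebra k (Module.End k (V ⊗[k] A)) where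
  carrier := {T | IsEven (k := k) (V := V ⊗[k] A) (W := V ⊗[k] A) T}
  mul_mem' ha hb := IsEven.comp ha hb
  add_mem' ha hb := fun i v hv => add_mem (ha i v hv) (hb i v hv)
  algebraMap_mem' c := fun i v hv => Submodule.smul_mem _ c hv

lemma opT_mem_evenOps {i : ZMod 2} {f : V →ₗ[k] V}
    (hf : ∀ (j : ZMod 2), ∀ v ∈ gr k V j, f v ∈ gr k V (j + i)) {a : A} (ha : a ∈ gr k A i) :
    opT f a ∈ evenOps k V A :=
  isEven_tensor fun j l v hv b hb => by
    rw [opT_tmul]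
    refine tmul_mem ?_ (hf j v hv) (SuperCommAlgebra.mul_mem ha hb)
    clear hf ha hv hb; revert i j l; decide

lemma parity_odd {x : V →ₗ[k] V} (hx : IsOdd x) (j : ZMod 2) (v : V) (hv : v ∈ gr k V j) :
    (x ∘ₗ parityOp k V) v ∈ gr k V (j + 1) := by
  rw [LinearMap.comp_apply, parityOp_apply hv, map_smul]
  exact Submodule.smul_mem _ _ (hx j v hv)

lemma sq_even {x : V →ₗ[k] V} (hx : IsOdd x) (j : ZMod 2) (v : V) (hv : v ∈ gr k V j) :
    (x ∘ₗ x) v ∈ gr k V (j + 0) := by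
  have := hx _ _ (hx j v hv)
  rwa [add_assoc, one_add_one] at this

lemma nilOp_isEven {x : V →ₗ[k] V} (hx : IsOdd x) {s σ : A} (hs : s ∈ gr k A 0)
    (hσ : σ ∈ gr k A 1) : nilOp x s σ ∈ evenOps k V A :=
  mul_mem (exp_mem _ (opT_mem_evenOps (sq_even hx) hs))
    (add_mem (one_mem _) (opT_mem_evenOps (parity_odd hx) hσ))

lemma opT_mem_centralizer (f : V →ₗ[k] V) (a b : A) :
    opT f a ∈ Subalgebra.centralizer k {(rmul (k := k) (V := V) b : Module.End k (V ⊗[k] A))} := by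
  rw [Subalgebra.mem_centralizer_iff]
  rintro _ rfl
  refine TensorProduct.ext' fun v c => ?_
  simp [opT_tmul, mul_assoc]

lemma nilOp_rmul (x : V →ₗ[k] V) (s σ : A) (b : A) (y : V ⊗[k] A) :
    nilOp x s σ (rmul b y) = rmul b (nilOp x s σ y) := by
  have : nilOp x s σ ∈
      Subalgebra.centralizer k {(rmul (k := k) (V := V) b : Module.End k (V ⊗[k] A))} :=
    mul_mem (exp_mem _ (opT_mem_centralizer _ _ _))
      (add_mem (one_mem _) (opT_mem_centralizer _ _ _))
  exact (LinearMap.congr_fun ((Subalgebra.mem_centralizer_iff k).1 this _ rfl) y).symm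

lemma extend_nilOp (x : V →ₗ[k] V) (s σ : A) (y : V ⊗[k] A) :
    extend (nilOp x s σ ∘ₗ unitMap k V A) y = nilOp x s σ y := by
  have : extend (nilOp x s σ ∘ₗ unitMap k V A) = nilOp x s σ :=
    TensorProduct.ext' fun v a => by
      rw [extend_tmul, LinearMap.comp_apply, ← nilOp_rmul, unitMap_apply, rmul_tmul, one_mul]
  exact LinearMap.congr_fun this y

lemma nilOp_zero (x : V →ₗ[k] V) : nilOp x (0 : A) 0 = 1 := by
  rw [nilOp, opT_zero, opT_zero, IsNilpotent.exp_zero, add_zero, mul_one]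

lemma parity_comp {x : V →ₗ[k] V} (hx : IsOdd x) :
    (x ∘ₗ parityOp k V) ∘ₗ (x ∘ₗ parityOp k V) = -(x ∘ₗ x) := by
  refine super_ext (k := k) fun i v hv => ?_
  simp only [LinearMap.comp_apply, parityOp_apply hv, map_smul, parityOp_apply (hx i v hv),
    LinearMap.neg_apply, smul_smul]
  rcases zmod_two i with rfl | rfl <;>
    simp [koszul_zero_left, koszul_one_one, one_add_one]

lemma opT_commute {f f' : V →ₗ[k] V} (h : f ∘ₗ f' = f' ∘ₗ f) {a a' : A} (ha : a * a' = a' * a) :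
    Commute (opT f a) (opT f' a') := by
  rw [commute_iff_eq, opT_mul, opT_mul, h, ha]

lemma nilOp_mul {x : V →ₗ[k] V} (hx : IsOdd x) (hn : IsNilpotent x) {s t σ τ : A}
    (hs : s ∈ gr k A 0) (ht : t ∈ gr k A 0) (hσ : σ ∈ gr k A 1) (hτ : τ ∈ gr k A 1) :
    nilOp x s σ * nilOp x t τ = nilOp x (s + t - σ * τ) (σ + τ) := by
  have hn2 : IsNilpotent (x ∘ₗ x) := by
    have := Commute.isNilpotent_mul_right (Commute.refl x) hn
    exact this
  have hστ := odd_mul_odd k hσ hτ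
  have hxx : (x ∘ₗ x) ∘ₗ (x ∘ₗ parityOp k V) = (x ∘ₗ parityOp k V) ∘ₗ (x ∘ₗ x) := by
    refine super_ext (k := k) fun i v hv => ?_
    have h2 : x (x v) ∈ gr k V i := by simpa using sq_even hx i v hv
    simp only [LinearMap.comp_apply, parityOp_apply hv, map_smul, parityOp_apply h2]
  have c1 : Commute (1 + opT (x ∘ₗ parityOp k V) σ) (IsNilpotent.exp (opT (x ∘ₗ x) t)) := by
    have h : opT (x ∘ₗ x) t ∈ Subalgebra.centralizer k
        {(1 + opT (x ∘ₗ parityOp k V) σ : Module.End k (V ⊗[k] A))} := by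
      rw [Subalgebra.mem_centralizer_iff]
      rintro _ rfl
      exact ((Commute.one_left _).add_left
        (opT_commute hxx (even_commute k ht σ)).symm).eq
    exact (Subalgebra.mem_centralizer_iff k).1 (exp_mem _ h) _ rfl
  have c2 : Commute (opT (x ∘ₗ x) s) (opT (x ∘ₗ x) t) := opT_commute rfl (even_commute k hs t)
  have c3 : Commute (opT (x ∘ₗ x) (s + t)) (opT (x ∘ₗ x) (-(σ * τ))) :=
    opT_commute rfl (even_commute k (add_mem hs ht) _)
  have e1 : IsNilpotent.exp (opT (x ∘ₗ x) (-(σ * τ))) = 1 + opT (x ∘ₗ x) (-(σ * τ)) := by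
    have h0 : opT (x ∘ₗ x) (-(σ * τ)) ^ 2 = 0 := by
      rw [pow_two, opT_mul, neg_mul_neg, odd_prod_sq k hσ hτ, opT_zero]
    rw [IsNilpotent.exp_eq_sum h0]
    refine LinearMap.ext fun w => ?_
    simp [Finset.sum_range_succ]
  have e2 : (1 + opT (x ∘ₗ parityOp k V) σ) * (1 + opT (x ∘ₗ parityOp k V) τ)
      = (1 + opT (x ∘ₗ x) (-(σ * τ))) * (1 + opT (x ∘ₗ parityOp k V) (σ + τ)) := by
    have h1 : opT ((x ∘ₗ x) ∘ₗ (x ∘ₗ parityOp k V)) (-(σ * τ) * (σ + τ)) = 0 := by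
      have : -(σ * τ) * (σ + τ) = 0 := by
        have h2 : σ * τ * σ = 0 := by
          rw [mul_assoc, odd_anticomm k hτ hσ, mul_neg, ← mul_assoc, odd_sq k hσ]; simp
        have h3 : σ * τ * τ = 0 := by rw [mul_assoc, odd_sq k hτ, mul_zero]
        rw [mul_add, neg_mul, neg_mul, h2, h3]; simp
      rw [this, opT_zero]
    have h4 : opT (x ∘ₗ parityOp k V) σ * opT (x ∘ₗ parityOp k V) τ
        = opT (x ∘ₗ x) (-(σ * τ)) := by
      rw [opT_mul, parity_comp hx]
      refine TensorProduct.ext' fun v b => ?_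
      simp [opT_tmul, TensorProduct.tmul_neg, TensorProduct.neg_tmul]
    have h5 : opT (x ∘ₗ x) (-(σ * τ)) * opT (x ∘ₗ parityOp k V) (σ + τ) = 0 := by
      rw [opT_mul, h1]
    have h6 : ∀ p q r t : Module.End k (V ⊗[k] A), p * q = r → r * t = 0 → t = p + q →
        (1 + p) * (1 + q) = (1 + r) * (1 + t) := by
      intro p q r t e e' e''
      rw [mul_add, add_mul, add_mul, mul_add, add_mul, add_mul, e, e', e'']
      noncomm_ring
    exact h6 _ _ _ _ h4 h5 (opT_add _ _ _)
  calc nilOp x s σ * nilOp x t τ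
      = IsNilpotent.exp (opT (x ∘ₗ x) s) * ((1 + opT (x ∘ₗ parityOp k V) σ) *
          IsNilpotent.exp (opT (x ∘ₗ x) t)) * (1 + opT (x ∘ₗ parityOp k V) τ) := by
        simp only [nilOp, mul_assoc]
    _ = (IsNilpotent.exp (opT (x ∘ₗ x) s) * IsNilpotent.exp (opT (x ∘ₗ x) t)) *
          ((1 + opT (x ∘ₗ parityOp k V) σ) * (1 + opT (x ∘ₗ parityOp k V) τ)) := by
        rw [c1.eq]; simp only [mul_assoc]
    _ = IsNilpotent.exp (opT (x ∘ₗ x) (s + t)) * IsNilpotent.exp (opT (x ∘ₗ x) (-(σ * τ))) *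
          (1 + opT (x ∘ₗ parityOp k V) (σ + τ)) := by
        rw [← IsNilpotent.exp_add_of_commute c2 (opT_nilpotent hn2 _) (opT_nilpotent hn2 _),
          ← opT_add, e2, e1, mul_assoc]
    _ = _ := by
        rw [← IsNilpotent.exp_add_of_commute c3 (opT_nilpotent hn2 _) (opT_nilpotent hn2 _),
          ← opT_add, ← sub_eq_add_neg, nilOp]

lemma lTensor_opT (F : A →ₐ[k] B) (f : V →ₗ[k] V) (a : A) (y : V ⊗[k] A) :
    F.toLinearMap.lTensor V (opT f a y) = opT f (F a) (F.toLinearMap.lTensor V y) := by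
  have : F.toLinearMap.lTensor V ∘ₗ opT f a = opT f (F a) ∘ₗ F.toLinearMap.lTensor V :=
    TensorProduct.ext' fun v b => by simp [opT_tmul]
  exact LinearMap.congr_fun this y

lemma lTensor_nilOp (F : A →ₐ[k] B) {x : V →ₗ[k] V} (hn : IsNilpotent x) (s σ : A)
    (y : V ⊗[k] A) : F.toLinearMap.lTensor V (nilOp x s σ y)
      = nilOp x (F s) (F σ) (F.toLinearMap.lTensor V y) := by
  obtain ⟨n, hn2⟩ : IsNilpotent (x ∘ₗ x) := Commute.isNilpotent_mul_right (Commute.refl x) hn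
  have h0 : ∀ (A : Type u) [Ring A] [Algebra k A] [SuperCommAlgebra k A] (a : A),
      opT (x ∘ₗ x) a ^ n = 0 := by
    intro A _ _ _ a
    rw [opT_pow, hn2]
    exact TensorProduct.ext' fun v b => by simp [opT_tmul]
  simp only [nilOp, IsNilpotent.exp_eq_sum (h0 _ _), Module.End.mul_apply, LinearMap.sum_apply,
    map_sum, ofNat_smul_end, map_smul, opT_pow, lTensor_opT, map_pow, LinearMap.add_apply,
    Module.End.one_apply, map_add]

end nilpotent

namespace SRep

variable {k}

/-- The representation of `G_a^{(1|1)}` given by a nilpotent odd operator `x`: the point `(s, σ)`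
acts by `exp(s x²)(1 + x σ)`. -/
@[reducible] def ofNilpotent (V : Type u) [AddCommGroup V] [Module k V] [Module.Finite k V]
    (super : SuperSpace k V) (x : V →ₗ[k] V) (hx : IsOdd x) (hn : IsNilpotent x) :
    SRep (Ga11 k) where
  V := V
  act A g := nilOp x g.s g.σ ∘ₗ unitMap k V A
  act_even A g := IsEven.comp (nilOp_isEven hx g.hs g.hσ) unitMap_isEven
  act_one A := by
    change nilOp x (0 : A) 0 ∘ₗ _ = _
    rw [nilOp_zero]; rfl
  act_mul A g h := by
    refine LinearMap.ext fun v => ?_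
    refine Eq.trans ?_ (extend_nilOp x g.s g.σ (nilOp x h.s h.σ (v ⊗ₜ 1))).symm
    have := nilOp_mul hx hn g.hs h.hs g.hσ h.hσ
    exact (LinearMap.congr_fun this (v ⊗ₜ 1)).symm
  act_map {A B} f g := by
    refine LinearMap.ext fun v => ?_
    have := lTensor_nilOp (SAlg.algHom f) hn g.s g.σ (v ⊗ₜ[k] (1 : A))
    rw [LinearMap.lTensor_tmul, AlgHom.toLinearMap_apply, map_one] at this
    exact this.symm

variable (k) in
/-- The superspace with basis `a₀, …, aₙ`, where `aⱼ` has parity `j`. -/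
@[reducible] def stringSuper (n : ℕ) : SuperSpace k (Fin (n + 1) → k) where
  grade i :=
    { carrier := {v | ∀ j : Fin (n + 1), ((j : ℕ) : ZMod 2) ≠ i → v j = 0}
      add_mem' := fun ha hb j hj => by rw [Pi.add_apply, ha j hj, hb j hj, add_zero]
      zero_mem' := fun j _ => rfl
      smul_mem' := fun c v hv j hj => by rw [Pi.smul_apply, hv j hj, smul_zero] }
  isCompl := by
    constructor
    · rw [Submodule.disjoint_def]
      intro v h0 h1
      funext j
      rcases zmod_two ((j : ℕ) : ZMod 2) with h | h
      · exact h1 j (by rw [h]; decide)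
      · exact h0 j (by rw [h]; decide)
    · rw [codisjoint_iff, eq_top_iff]
      intro v _
      rw [Submodule.mem_sup]
      refine ⟨fun j => if ((j : ℕ) : ZMod 2) = 0 then v j else 0, fun j hj => if_neg hj,
        fun j => if ((j : ℕ) : ZMod 2) = 0 then 0 else v j, fun j hj => ?_, ?_⟩
      · rcases zmod_two ((j : ℕ) : ZMod 2) with h | h
        · exact if_pos h
        · exact absurd h hj
      · funext j
        by_cases h : ((j : ℕ) : ZMod 2) = 0 <;> simp [h]

variable (k) in
/-- The operator `aⱼ ↦ aⱼ₊₁`, `aₙ ↦ 0`. -/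
def stringOp (n : ℕ) : (Fin (n + 1) → k) →ₗ[k] (Fin (n + 1) → k) where
  toFun v j := if (j : ℕ) = 0 then 0 else v ⟨j - 1, by omega⟩
  map_add' v w := by
    funext j
    simp only [Pi.add_apply]
    split_ifs <;> simp
  map_smul' c v := by
    funext j
    simp only [Pi.smul_apply, RingHom.id_apply]
    split_ifs <;> simp

lemma stringOp_single (n : ℕ) (i j : Fin (n + 1)) (h : (j : ℕ) = i + 1) :
    stringOp k n (Pi.single i 1) = Pi.single j 1 := by
  funext l
  change (if (l : ℕ) = 0 then (0 : k) else (Pi.single i 1 : Fin (n + 1) → k) ⟨l - 1, by omega⟩) = _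
  simp only [Pi.single_apply, Fin.ext_iff]
  split_ifs <;> first | rfl | omega

lemma stringOp_odd (n : ℕ) :
    @IsOdd k _ (Fin (n + 1) → k) _ _ (stringSuper k n) (stringOp k n) := by
  intro i v hv j hj
  change (if (j : ℕ) = 0 then (0 : k) else v ⟨j - 1, by omega⟩) = 0
  split_ifs with h
  · rfl
  · refine hv _ fun h2 => hj ?_
    rw [← h2]
    have h3 : ((((j : ℕ) - 1 + 1 : ℕ)) : ZMod 2) = ((j : ℕ) : ZMod 2) := by
      congr 1; omega
    rw [← h3]; push_cast; rfl

lemma stringOp_nilpotent (n : ℕ) : IsNilpotent (stringOp k n) := by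
  have h : ∀ (m : ℕ) (v : Fin (n + 1) → k) (j : Fin (n + 1)), (j : ℕ) < m →
      (stringOp k n ^ m) v j = 0 := by
    intro m
    induction m with
    | zero => intro v j hj; omega
    | succ m ih =>
      intro v j hj
      rw [pow_succ', Module.End.mul_apply]
      change (if (j : ℕ) = 0 then (0 : k) else (stringOp k n ^ m) v ⟨j - 1, by omega⟩) = 0
      split_ifs with h0
      · rfl
      · exact ih v _ (by simp only; omega)
  exact ⟨n + 1, LinearMap.ext fun v => funext fun j => h (n + 1) v j j.2⟩

variable (k) in
/-- The indecomposable representation `Mₙ` with basis `a₀, …, aₙ`, `|aⱼ| = j`, `x aⱼ = aⱼ₊₁`. -/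
@[reducible] def M (n : ℕ) : SRep (Ga11 k) :=
  ofNilpotent (Fin (n + 1) → k) (stringSuper k n) (stringOp k n) (stringOp_odd n)
    (stringOp_nilpotent n)

end SRep

end

section

/-! ### Tensor categories -/

section tensorCategory

universe v w v' w'

/-- A `k`-linear symmetric monoidal category with bilinear tensor product is a tensor category if
it is abelian and rigid, its tensor product is biexact, and `End(𝟙) = k`. -/
structure IsTensorCategory (k : Type u) [Field k] (C : Type v) [Category.{w} C]
    [hC : Preadditive C] [Linear k C] [MonoidalCategory C] [SymmetricCategory C]
    [MonoidalPreadditive C] [MonoidalLinear k C] : Prop where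
  abelian : ∃ a : Abelian C, a.toPreadditive = hC
  rigid : Nonempty (RigidCategory C)
  exact_left : ∀ X : C, Limits.PreservesFiniteLimits (tensorLeft X) ∧
    Limits.PreservesFiniteColimits (tensorLeft X)
  exact_right : ∀ X : C, Limits.PreservesFiniteLimits (tensorRight X) ∧
    Limits.PreservesFiniteColimits (tensorRight X)
  end_unit : Function.Bijective fun c : k => c • 𝟙 (𝟙_ C)

/-- A `k`-linear symmetric monoidal functor is a tensor equivalence if it is exact and an
equivalence of categories. -/
structure IsTensorEquivalence (k : Type u) [Field k] {C : Type v} [Category.{w} C]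
    [Preadditive C] [Linear k C] [MonoidalCategory C] [SymmetricCategory C]
    {D : Type v'} [Category.{w'} D] [Preadditive D] [Linear k D] [MonoidalCategory D]
    [SymmetricCategory D] (F : C ⥤ D) [F.Braided] : Prop where
  additive : F.Additive
  linear : F.Linear k
  preservesFiniteLimits : Limits.PreservesFiniteLimits F
  preservesFiniteColimits : Limits.PreservesFiniteColimits F
  isEquivalence : F.IsEquivalence

end tensorCategory

end

end SuperRep

end

/-!
# `Rep(OSp(1|2))` as the semisimplification of `Rep(G_a^{(1|1)})`

The functor `resSemi`, restriction to `G_a^{(1|1)}` followed by semisimplification, is shown to be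
fully faithful and essentially surjective; all assertions follow from this and from the knowledge
of the indecomposable representations of `G_a^{(1|1)}`.

*Lie algebras.* A tangent vector, a point over the dual numbers, acts on a representation by a
linear operator (`SRep.deriv`). For `G_a^{(1|1)}` this gives a nilpotent odd operator (`dOp`) which
determines the morphisms (`homOfDOp`). The group `OSp(1|2)` contains `G_a^{(1|1)}` in two opposite
ways, as a lower and as an upper unipotent subgroup, and these give odd operators `x` and `y` with
the relations `[h, x] = -x` and `[h, y] = y` for `h = xy + yx` (`isOspPair`). Parity-preserving
maps that commute with `x` and `y` are morphisms (`commutes_of_comm`), because the two subgroups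
generate: over a localization, a matrix of `SL₂` is a product of unipotent ones.

*Full faithfulness.* For finite-dimensional modules over `osp(1|2)` two facts are needed: the
kernel of `x` is the sum of the invariants and of a part of the image of `x` (`exists_invariant`),
and no non-zero invariant is in the image of `x` (`invariant_eq_zero`). Both come from the operator
`R = xy - yx`. It satisfies `x R = (1 - R) x` and `y R = (1 - R) y`, so that `x` and `y` exchange its
generalized eigenspaces for `0` and `1`; the traces of `R` on the two are opposite, hence the second
is zero. Apply this to `Hom_k(M, N)`, on which `x` acts by the supercommutator. A morphism of
restrictions is an element of the kernel of `x`, and a supercommutator with `x` is negligible, since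
its products with morphisms have supertrace zero; therefore the functor is full (`exists_res_map`).
An invariant outside of the image of `x` pairs non-trivially with a morphism of restrictions, and is
therefore not negligible; so the functor is faithful (`eq_zero_of_negligible`).

*Strings.* A representation of `G_a^{(1|1)}` is a direct sum of strings `Mₙ` and `ΠMₙ`
(`string_induction`). An endomorphism of a string is a scalar up to a nilpotent map, so that in the
semisimplification a string is zero or simple according to whether its superdimension vanishes
(`IsCyclic.isZero`, `IsCyclic.simple`), that is, according to the parity of `n`.

*Essential surjectivity.* The relation `y x²ⁱ = x²ⁱ y - i x²ⁱ⁻¹` shows that no string of even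
dimension occurs in a restriction from `OSp(1|2)` (`isEmpty_retract_res`). On the `n`-th tensor power
of the standard representation the operator `x²` has nilpotency index `n + 1`, so that the longest
string has dimension `2n + 1` (`exists_retract_res`). A fully faithful functor from an abelian
category has an essential image that is closed under direct summands.

The tensor structure is transported along the equivalence, and the functor `T` is the
semisimplification followed by a quasi-inverse of `resSemi`. As strings of even dimension do not
occur in restrictions, an object of `Rep(OSp(1|2))` with the same image as `M₂ₙ` restricts to `M₂ₙ`
itself (`nonempty_res_iso`).
-/

noncomputable section

set_option linter.unusedSectionVars false
set_option linter.unusedVariables false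
set_option linter.unusedSimpArgs false

namespace SuperRep

/-! ### The abelian category of representations -/

section abelian

variable {k : Type u} [Field k] {G : Supergroup k}
variable {V W : Type u} [AddCommGroup V] [Module k V] [AddCommGroup W] [Module k W]

lemma ne_add_one (i : ZMod 2) : i ≠ i + 1 := by
  revert i; decide

lemma exists_gr_add [SuperSpace k V] (i : ZMod 2) (v : V) :
    ∃ a ∈ gr k V i, ∃ b ∈ gr k V (i + 1), a + b = v := by
  obtain ⟨a, ha, b, hb, hab⟩ := exists_decomp (k := k) v
  rcases zmod_two i with rfl | rfl
  · exact ⟨a, ha, b, by simpa using hb, hab⟩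
  · exact ⟨b, hb, a, by simpa [one_add_one] using ha, by rw [add_comm, hab]⟩

/-- The homogeneous components of an element are unique. -/
lemma gr_add_unique [SuperSpace k V] {i : ZMod 2} {a a' b b' : V} (ha : a ∈ gr k V i)
    (hb : b ∈ gr k V (i + 1)) (ha' : a' ∈ gr k V i) (hb' : b' ∈ gr k V (i + 1))
    (h : a + b = a' + b') : a = a' ∧ b = b' := by
  have h1 : a - a' = b' - b := by
    rw [sub_eq_sub_iff_add_eq_add, h, add_comm]
  have h2 : a - a' = 0 := eq_zero_of_mem_gr (k := k) (i := i) (j := i + 1)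
    (ne_add_one i) (sub_mem ha ha') (h1 ▸ sub_mem hb' hb)
  refine ⟨sub_eq_zero.1 h2, ?_⟩
  rw [h2] at h1
  exact (sub_eq_zero.1 h1.symm).symm

/-- An injective even map reflects homogeneity. -/
lemma IsEven.mem_of_injective [SuperSpace k V] [SuperSpace k W] {f : V →ₗ[k] W} (hf : IsEven f)
    (hi : Function.Injective f) {i : ZMod 2} {v : V} (hv : f v ∈ gr k W i) : v ∈ gr k V i := by
  obtain ⟨a, ha, b, hb, rfl⟩ := exists_gr_add (k := k) i v
  have h := (gr_add_unique (k := k) (i := i) (hf _ _ ha) (hf _ _ hb) hv (zero_mem _)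
    (by rw [← map_add, add_zero])).2
  rw [(map_eq_zero_iff f hi).1 h, add_zero]
  exact ha

/-- A surjective even map lifts homogeneous elements to homogeneous elements. -/
lemma IsEven.exists_mem_of_surjective [SuperSpace k V] [SuperSpace k W] {f : V →ₗ[k] W}
    (hf : IsEven f) (hs : Function.Surjective f) {i : ZMod 2} {w : W} (hw : w ∈ gr k W i) :
    ∃ v ∈ gr k V i, f v = w := by
  obtain ⟨v, rfl⟩ := hs w
  obtain ⟨a, ha, b, hb, rfl⟩ := exists_gr_add (k := k) i v
  exact ⟨a, ha, (gr_add_unique (k := k) (i := i) (hf _ _ ha) (hf _ _ hb) hw (zero_mem _)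
    (by rw [← map_add, add_zero])).1⟩

lemma isEven_of_comp_injective {U : Type u} [AddCommGroup U] [Module k U] [SuperSpace k V]
    [SuperSpace k W] [SuperSpace k U] {f : V →ₗ[k] W} {g : U →ₗ[k] V} (hf : IsEven f)
    (hi : Function.Injective f) (h : IsEven (f ∘ₗ g)) : IsEven g := fun i v hv =>
  hf.mem_of_injective hi (h i v hv)

lemma isEven_of_comp_surjective {U : Type u} [AddCommGroup U] [Module k U] [SuperSpace k V]
    [SuperSpace k W] [SuperSpace k U] {f : V →ₗ[k] W} {g : W →ₗ[k] U} (hf : IsEven f)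
    (hs : Function.Surjective f) (h : IsEven (g ∘ₗ f)) : IsEven g := fun i w hw => by
  obtain ⟨v, hv, rfl⟩ := hf.exists_mem_of_surjective hs hw
  exact h i v hv

lemma rTensor_isEven {A : Type u} [Ring A] [Algebra k A] [SuperCommAlgebra k A] [SuperSpace k V]
    [SuperSpace k W] {f : V →ₗ[k] W} (hf : IsEven f) : IsEven (f.rTensor A) :=
  hf.tensorMap .id

lemma rTensor_injective (A : Type u) [Ring A] [Algebra k A] {f : V →ₗ[k] W}
    (hf : Function.Injective f) : Function.Injective (f.rTensor A) :=
  Module.Flat.rTensor_preserves_injective_linearMap f hf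

lemma rTensor_congr {X : Type u} [AddCommGroup X] [Module k X] {A : Type u} [Ring A] [Algebra k A]
    {f : V →ₗ[k] W} {g : W →ₗ[k] X} {h : V →ₗ[k] X} (e : g ∘ₗ f = h) (x : V ⊗[k] A) :
    g.rTensor A (f.rTensor A x) = h.rTensor A x := by
  rw [← e, LinearMap.rTensor_comp_apply]

/-- The kernel of an even map, with the induced grading. -/
@[reducible] def kerSuper [SuperSpace k V] [SuperSpace k W] (f : V →ₗ[k] W) (hf : IsEven f) :
    SuperSpace k (LinearMap.ker f) where
  grade i := (gr k V i).comap (LinearMap.ker f).subtype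
  isCompl := by
    constructor
    · rw [Submodule.disjoint_def]
      intro v h0 h1
      exact Subtype.ext (eq_zero_of_mem_gr (k := k) (zero_ne_one (α := ZMod 2)) h0 h1)
    · rw [codisjoint_iff, eq_top_iff]
      rintro ⟨v, hv⟩ -
      obtain ⟨a, ha, b, hb, rfl⟩ := exists_gr_add (k := k) 0 v
      rw [LinearMap.mem_ker, map_add] at hv
      obtain ⟨h1, h2⟩ := gr_add_unique (k := k) (i := 0) (hf _ _ ha) (hf _ _ hb) (zero_mem _)
        (zero_mem _) (hv.trans (add_zero 0).symm)
      exact Submodule.mem_sup.2 ⟨⟨a, h1⟩, ha, ⟨b, h2⟩, hb, rfl⟩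

/-- The cokernel of an even map, with the induced grading. -/
@[reducible] def cokerSuper [SuperSpace k V] [SuperSpace k W] (f : V →ₗ[k] W) (hf : IsEven f) :
    SuperSpace k (W ⧸ LinearMap.range f) where
  grade i := (gr k W i).map (LinearMap.range f).mkQ
  isCompl := by
    constructor
    · rw [Submodule.disjoint_def]
      rintro _ ⟨a, ha, rfl⟩ ⟨b, hb, hab⟩
      rw [Submodule.mkQ_apply, Submodule.mkQ_apply, Submodule.Quotient.eq] at hab
      obtain ⟨v, hv⟩ := hab
      obtain ⟨c, hc, d, hd, rfl⟩ := exists_gr_add (k := k) 0 v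
      rw [map_add] at hv
      obtain ⟨h1, -⟩ := gr_add_unique (k := k) (i := 0) (hf _ _ hc) (hf _ _ hd)
        (neg_mem ha) (by simpa using hb) (by rw [hv]; abel)
      rw [Submodule.mkQ_apply, Submodule.Quotient.mk_eq_zero]
      exact ⟨-c, by rw [map_neg, h1, neg_neg]⟩
    · rw [codisjoint_iff, eq_top_iff]
      intro w _
      obtain ⟨w, rfl⟩ := Submodule.mkQ_surjective _ w
      obtain ⟨a, ha, b, hb, rfl⟩ := exists_decomp (k := k) w
      rw [map_add]
      exact Submodule.add_mem_sup ⟨a, ha, rfl⟩ ⟨b, hb, rfl⟩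

lemma rTensor_lTensor {A B : Type u} [Ring A] [Algebra k A] [Ring B] [Algebra k B]
    (f : V →ₗ[k] W) (g : A →ₗ[k] B) (x : V ⊗[k] A) :
    f.rTensor B (g.lTensor V x) = g.lTensor W (f.rTensor A x) := by
  rw [← LinearMap.comp_apply, ← LinearMap.comp_apply, LinearMap.rTensor_comp_lTensor,
    LinearMap.lTensor_comp_rTensor]

namespace SRep

/-- A graded subspace that is stable under the action is a representation. -/
@[reducible] def ofInjective (M : SRep G) (V : Type u) [AddCommGroup V] [Module k V]
    [Module.Finite k V] [SuperSpace k V] (ι : V →ₗ[k] M.V) (r : M.V →ₗ[k] V)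
    (inj : Function.Injective ι) (he : IsEven ι)
    (h : ∀ (A : SAlg k) (g : G.obj A) (v : V),
      ι.rTensor A (r.rTensor A (M.act A g (ι v))) = M.act A g (ι v)) : SRep G where
  V := V
  act A g := r.rTensor A ∘ₗ M.act A g ∘ₗ ι
  act_even A g := isEven_of_comp_injective (rTensor_isEven he) (rTensor_injective A inj)
    fun i v hv => by
      rw [LinearMap.comp_apply, LinearMap.comp_apply, LinearMap.comp_apply, h]
      exact M.act_even A g i _ (he i v hv)
  act_one A := LinearMap.ext fun v => rTensor_injective A inj (by
    rw [LinearMap.comp_apply, LinearMap.comp_apply, h, M.act_one]; simp)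
  act_mul A g g' := LinearMap.ext fun v => rTensor_injective A inj (by
    have : ι.rTensor A ∘ₗ r.rTensor A ∘ₗ M.act A g ∘ₗ ι = M.act A g ∘ₗ ι :=
      LinearMap.ext fun v => h A g v
    rw [LinearMap.comp_apply, LinearMap.comp_apply, h, M.act_mul, LinearMap.comp_apply,
      LinearMap.comp_apply, rTensor_extend, this, ← extend_rTensor, LinearMap.comp_apply,
      LinearMap.comp_apply, h])
  act_map f g := LinearMap.ext fun v => by
    rw [M.act_map]
    exact rTensor_lTensor _ _ _

/-- The quotient by a graded subspace that is stable under the action is a representation. -/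
@[reducible] def ofSurjective (M : SRep G) (V : Type u) [AddCommGroup V] [Module k V]
    [Module.Finite k V] [SuperSpace k V] (q : M.V →ₗ[k] V) (s : V →ₗ[k] M.V)
    (surj : Function.Surjective q) (he : IsEven q)
    (h : ∀ (A : SAlg k) (g : G.obj A) (v : M.V),
      q.rTensor A (M.act A g (s (q v))) = q.rTensor A (M.act A g v)) : SRep G where
  V := V
  act A g := q.rTensor A ∘ₗ M.act A g ∘ₗ s
  act_even A g := isEven_of_comp_surjective he surj fun i v hv => by
    rw [LinearMap.comp_apply, LinearMap.comp_apply, LinearMap.comp_apply, h]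
    exact rTensor_isEven he i _ (M.act_even A g i v hv)
  act_one A := LinearMap.ext fun v => by
    obtain ⟨v, rfl⟩ := surj v
    rw [LinearMap.comp_apply, LinearMap.comp_apply, h, M.act_one]; simp
  act_mul A g g' := LinearMap.ext fun v => by
    have : (q.rTensor A ∘ₗ M.act A g ∘ₗ s) ∘ₗ q = q.rTensor A ∘ₗ M.act A g :=
      LinearMap.ext fun v => h A g v
    obtain ⟨v, rfl⟩ := surj v
    rw [LinearMap.comp_apply, LinearMap.comp_apply, h, M.act_mul, LinearMap.comp_apply,
      LinearMap.comp_apply, LinearMap.comp_apply, LinearMap.comp_apply, h, rTensor_extend,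
      extend_rTensor, this]
  act_map f g := LinearMap.ext fun v => by
    rw [M.act_map]
    exact rTensor_lTensor _ _ _

/-- A morphism whose image lies in that of an injective morphism factors through it. -/
lemma exists_lift {L M N : SRep G} (f : M ⟶ N) (hf : Function.Injective (lin f)) (h : L ⟶ N)
    (hr : LinearMap.range (lin h) ≤ LinearMap.range (lin f)) : ∃ l : L ⟶ M, l ≫ f = h := by
  obtain ⟨l, hl⟩ : ∃ l : L.V →ₗ[k] M.V, lin f ∘ₗ l = lin h := by
    obtain ⟨r, hr'⟩ := (lin f).exists_leftInverse_of_injective (LinearMap.ker_eq_bot.2 hf)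
    refine ⟨r ∘ₗ lin h, LinearMap.ext fun v => ?_⟩
    obtain ⟨m, hm⟩ := hr ⟨v, rfl⟩
    have := LinearMap.congr_fun hr' m
    simp only [LinearMap.comp_apply, LinearMap.id_apply] at this ⊢
    rw [← hm, this]
  refine ⟨mkHom l (isEven_of_comp_injective (lin_even f) hf (hl ▸ lin_even h)) fun A g =>
    LinearMap.ext fun v => rTensor_injective A hf ?_, hom_ext hl⟩
  have h1 := LinearMap.congr_fun (lin_equivariant f A g) (l v)
  have h2 := LinearMap.congr_fun (lin_equivariant h A g) v
  simp only [LinearMap.comp_apply] at h1 h2 ⊢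
  rw [h1, rTensor_congr hl, h2, ← hl, LinearMap.comp_apply]

/-- A morphism that kills the kernel of a surjective morphism factors through it. -/
lemma exists_desc {L M N : SRep G} (f : L ⟶ M) (hf : Function.Surjective (lin f)) (h : L ⟶ N)
    (hr : LinearMap.ker (lin f) ≤ LinearMap.ker (lin h)) : ∃ l : M ⟶ N, f ≫ l = h := by
  obtain ⟨l, hl⟩ : ∃ l : M.V →ₗ[k] N.V, l ∘ₗ lin f = lin h := by
    obtain ⟨s, hs⟩ := (lin f).exists_rightInverse_of_surjective (LinearMap.range_eq_top.2 hf)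
    refine ⟨lin h ∘ₗ s, LinearMap.ext fun v => ?_⟩
    have h1 : s (lin f v) - v ∈ LinearMap.ker (lin f) := by
      have := LinearMap.congr_fun hs (lin f v)
      simp only [LinearMap.comp_apply, LinearMap.id_apply] at this
      rw [LinearMap.mem_ker, map_sub, this, sub_self]
    exact sub_eq_zero.1 ((map_sub (lin h) _ _).symm.trans (hr h1))
  refine ⟨mkHom l (isEven_of_comp_surjective (lin_even f) hf (hl ▸ lin_even h)) fun A g =>
    LinearMap.ext fun v => ?_, hom_ext hl⟩
  obtain ⟨v, rfl⟩ := hf v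
  have h1 := LinearMap.congr_fun (lin_equivariant f A g) v
  have h2 := LinearMap.congr_fun (lin_equivariant h A g) v
  simp only [LinearMap.comp_apply] at h1 h2 ⊢
  rw [← h1, rTensor_congr hl, h2, ← hl, LinearMap.comp_apply]

lemma exists_ker {M N : SRep G} (f : M ⟶ N) : ∃ (K : SRep G) (ι : K ⟶ M),
    Function.Injective (lin ι) ∧ LinearMap.range (lin ι) = LinearMap.ker (lin f) := by
  let _ := kerSuper (lin f) (lin_even f)
  obtain ⟨r, hr⟩ := (LinearMap.ker (lin f)).subtype.exists_leftInverse_of_injective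
    (Submodule.ker_subtype _)
  have key : ∀ (A : SAlg k) (g : G.obj A) (v : LinearMap.ker (lin f)),
      (LinearMap.ker (lin f)).subtype.rTensor A (r.rTensor A (M.act A g
        ((LinearMap.ker (lin f)).subtype v))) = M.act A g ((LinearMap.ker (lin f)).subtype v) := by
    intro A g v
    have h1 := LinearMap.congr_fun (lin_equivariant f A g) v.1
    rw [LinearMap.comp_apply, LinearMap.comp_apply, LinearMap.mem_ker.1 v.2, map_zero] at h1
    have h2 := (Module.Flat.rTensor_exact (M := A) (f := (LinearMap.ker (lin f)).subtype)
      (g := lin f) (LinearMap.exact_subtype_ker_map _)) (M.act A g v.1)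
    obtain ⟨y, hy⟩ := h2.1 h1
    change _ = M.act A g v.1
    rw [Submodule.subtype_apply, ← hy, rTensor_congr hr, LinearMap.rTensor_id]; rfl
  refine ⟨ofInjective M (LinearMap.ker (lin f)) (LinearMap.ker (lin f)).subtype r
    (Submodule.injective_subtype _) (fun i v hv => hv) key,
    mkHom (M := ofInjective M (LinearMap.ker (lin f)) (LinearMap.ker (lin f)).subtype r
    (Submodule.injective_subtype _) (fun i v hv => hv) key) (LinearMap.ker (lin f)).subtype
    (fun i v hv => hv) fun A g => LinearMap.ext fun v => key A g v,
    Submodule.injective_subtype _, Submodule.range_subtype _⟩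

lemma exists_coker {M N : SRep G} (f : M ⟶ N) : ∃ (K : SRep G) (q : N ⟶ K),
    Function.Surjective (lin q) ∧ LinearMap.ker (lin q) = LinearMap.range (lin f) := by
  let _ := cokerSuper (lin f) (lin_even f)
  set q := (LinearMap.range (lin f)).mkQ with hq
  have surj : Function.Surjective q := Submodule.mkQ_surjective _
  have hqf : q ∘ₗ lin f = 0 := LinearMap.ext fun v => by
    rw [hq, LinearMap.comp_apply, Submodule.mkQ_apply, LinearMap.zero_apply,
      Submodule.Quotient.mk_eq_zero]
    exact ⟨v, rfl⟩
  obtain ⟨s, hs⟩ := q.exists_rightInverse_of_surjective (LinearMap.range_eq_top.2 surj)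
  have he : IsEven q := fun i v hv => ⟨v, hv, rfl⟩
  have key : ∀ (A : SAlg k) (g : G.obj A) (v : N.V),
      q.rTensor A (N.act A g (s (q v))) = q.rTensor A (N.act A g v) := by
    intro A g v
    have h1 : s (q v) - v ∈ LinearMap.range (lin f) := by
      have := LinearMap.congr_fun hs (q v)
      simp only [LinearMap.comp_apply, LinearMap.id_apply] at this
      refine (Submodule.Quotient.mk_eq_zero _).1 (?_ : q _ = 0)
      rw [map_sub, this, sub_self]
    obtain ⟨m, hm⟩ := h1
    have h2 := LinearMap.congr_fun (lin_equivariant f A g) m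
    simp only [LinearMap.comp_apply] at h2
    rw [← sub_eq_zero, ← map_sub, ← map_sub, ← hm, ← h2, rTensor_congr hqf]
    simp
  exact ⟨ofSurjective N _ q s surj he key, mkHom (N := ofSurjective N _ q s surj he key) q he
    fun A g => LinearMap.ext fun v => (key A g v).symm, surj, Submodule.ker_mkQ _⟩

lemma injective_of_mono {M N : SRep G} (f : M ⟶ N) [Mono f] : Function.Injective (lin f) := by
  obtain ⟨K, ι, hι, hr⟩ := exists_ker f
  have h : ι ≫ f = 0 := hom_ext (LinearMap.ext fun v => by
    have : lin ι v ∈ LinearMap.ker (lin f) := hr ▸ ⟨v, rfl⟩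
    simpa using this)
  have h0 : ι = 0 := (cancel_mono f).1 (by rw [h, Limits.zero_comp])
  rw [← LinearMap.ker_eq_bot, ← hr, h0, lin_zero, LinearMap.range_zero]

lemma surjective_of_epi {M N : SRep G} (f : M ⟶ N) [Epi f] : Function.Surjective (lin f) := by
  obtain ⟨K, q, hq, hr⟩ := exists_coker f
  have h : f ≫ q = 0 := hom_ext (LinearMap.ext fun v => by
    have : lin f v ∈ LinearMap.ker (lin q) := hr ▸ ⟨v, rfl⟩
    simpa using this)
  have h0 : q = 0 := (cancel_epi f).1 (by rw [h, Limits.comp_zero])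
  rw [← LinearMap.range_eq_top, ← hr, h0, lin_zero, LinearMap.ker_zero]

lemma comp_eq_zero_iff {L M N : SRep G} (f : L ⟶ M) (g : M ⟶ N) :
    f ≫ g = 0 ↔ LinearMap.range (lin f) ≤ LinearMap.ker (lin g) := by
  rw [LinearMap.range_le_ker_iff]
  exact ⟨fun h => congrArg lin h, fun h => hom_ext h⟩

lemma mono_of_injective {M N : SRep G} (f : M ⟶ N) (hf : Function.Injective (lin f)) : Mono f :=
  ⟨fun g h e => hom_ext (LinearMap.ext fun v => hf (LinearMap.congr_fun (congrArg lin e) v))⟩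

lemma epi_of_surjective {M N : SRep G} (f : M ⟶ N) (hf : Function.Surjective (lin f)) : Epi f :=
  ⟨fun g h e => hom_ext (LinearMap.ext fun v => by
    obtain ⟨v, rfl⟩ := hf v
    exact LinearMap.congr_fun (congrArg lin e) v)⟩

/-- An injective morphism onto the kernel of `g` is a categorical kernel of `g`. -/
def isKernel {L M N : SRep G} (f : L ⟶ M) (g : M ⟶ N) (hf : Function.Injective (lin f))
    (h : LinearMap.range (lin f) = LinearMap.ker (lin g)) :
    Limits.IsLimit (Limits.KernelFork.ofι f ((comp_eq_zero_iff f g).2 h.le)) :=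
  haveI := mono_of_injective f hf
  Limits.KernelFork.IsLimit.ofι' f _ fun l hl =>
    ⟨(exists_lift f hf l (h ▸ (comp_eq_zero_iff l g).1 hl)).choose,
      (exists_lift f hf l (h ▸ (comp_eq_zero_iff l g).1 hl)).choose_spec⟩

/-- A surjective morphism whose kernel is the image of `f` is a categorical cokernel of `f`. -/
def isCokernel {L M N : SRep G} (f : L ⟶ M) (g : M ⟶ N) (hg : Function.Surjective (lin g))
    (h : LinearMap.range (lin f) = LinearMap.ker (lin g)) :
    Limits.IsColimit (Limits.CokernelCofork.ofπ g ((comp_eq_zero_iff f g).2 h.le)) :=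
  haveI := epi_of_surjective g hg
  Limits.CokernelCofork.IsColimit.ofπ' g _ fun l hl =>
    ⟨(exists_desc g hg l (h ▸ (comp_eq_zero_iff f l).1 hl)).choose,
      (exists_desc g hg l (h ▸ (comp_eq_zero_iff f l).1 hl)).choose_spec⟩

instance : Limits.HasKernels (SRep G) where
  has_limit f := by
    obtain ⟨K, ι, hι, hr⟩ := exists_ker f
    exact ⟨⟨_, isKernel ι f hι hr⟩⟩

instance : Limits.HasCokernels (SRep G) where
  has_colimit f := by
    obtain ⟨K, q, hq, hr⟩ := exists_coker f
    exact ⟨⟨_, isCokernel f q hq hr.symm⟩⟩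

instance : IsNormalMonoCategory (SRep G) where
  normalMonoOfMono f _ := by
    obtain ⟨K, q, hq, hr⟩ := exists_coker f
    exact ⟨⟨K, q, _, isKernel f q (injective_of_mono f) hr.symm⟩⟩

instance : IsNormalEpiCategory (SRep G) where
  normalEpiOfEpi f _ := by
    obtain ⟨K, ι, hι, hr⟩ := exists_ker f
    exact ⟨⟨K, ι, _, isCokernel ι f (surjective_of_epi f) hr⟩⟩

/-- The direct sum of two superspaces. -/
@[reducible] def prodSuper (V W : Type u) [AddCommGroup V] [Module k V] [AddCommGroup W]
    [Module k W] [SuperSpace k V] [SuperSpace k W] : SuperSpace k (V × W) where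
  grade i := (gr k V i).prod (gr k W i)
  isCompl := by
    constructor
    · rw [Submodule.disjoint_def]
      rintro ⟨v, w⟩ ⟨h0, h0'⟩ ⟨h1, h1'⟩
      exact Prod.ext (eq_zero_of_mem_gr (k := k) (zero_ne_one (α := ZMod 2)) h0 h1)
        (eq_zero_of_mem_gr (k := k) (zero_ne_one (α := ZMod 2)) h0' h1')
    · rw [codisjoint_iff, eq_top_iff]
      rintro ⟨v, w⟩ -
      obtain ⟨a, ha, b, hb, rfl⟩ := exists_decomp (k := k) v
      obtain ⟨c, hc, d, hd, rfl⟩ := exists_decomp (k := k) w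
      exact Submodule.mem_sup.2 ⟨(a, c), ⟨ha, hc⟩, (b, d), ⟨hb, hd⟩, rfl⟩

attribute [local instance] prodSuper

lemma inl_isEven (V W : Type u) [AddCommGroup V] [Module k V] [AddCommGroup W] [Module k W]
    [SuperSpace k V] [SuperSpace k W] : IsEven (LinearMap.inl k V W) := fun i v hv =>
  (⟨hv, zero_mem _⟩ : (v, (0 : W)) ∈ (gr k V i).prod (gr k W i))

lemma inr_isEven (V W : Type u) [AddCommGroup V] [Module k V] [AddCommGroup W] [Module k W]
    [SuperSpace k V] [SuperSpace k W] : IsEven (LinearMap.inr k V W) := fun i w hw =>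
  (⟨zero_mem _, hw⟩ : ((0 : V), w) ∈ (gr k V i).prod (gr k W i))

/-- The direct sum of two representations. -/
@[reducible] def prod (M N : SRep G) : SRep G where
  V := M.V × N.V
  super := prodSuper M.V N.V
  act A g := (LinearMap.inl k M.V N.V).rTensor A ∘ₗ M.act A g ∘ₗ LinearMap.fst k M.V N.V +
    (LinearMap.inr k M.V N.V).rTensor A ∘ₗ N.act A g ∘ₗ LinearMap.snd k M.V N.V
  act_even A g i v hv := add_mem
    (rTensor_isEven (inl_isEven M.V N.V) i _ (M.act_even A g i _ hv.1))
    (rTensor_isEven (inr_isEven M.V N.V) i _ (N.act_even A g i _ hv.2))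
  act_one A := by
    refine LinearMap.ext fun v => ?_
    simp [M.act_one, N.act_one, ← TensorProduct.add_tmul]
  act_mul A g h := by
    refine LinearMap.prod_ext (LinearMap.ext fun v => ?_) (LinearMap.ext fun v => ?_)
    · simp only [M.act_mul, LinearMap.comp_apply, LinearMap.add_apply, LinearMap.inl_apply,
        LinearMap.fst_apply, LinearMap.snd_apply, map_zero, add_zero, rTensor_extend,
        extend_rTensor]
      congr 2
      refine LinearMap.ext fun w => ?_
      simp
    · simp only [N.act_mul, LinearMap.comp_apply, LinearMap.add_apply, LinearMap.inr_apply,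
        LinearMap.fst_apply, LinearMap.snd_apply, map_zero, zero_add, rTensor_extend,
        extend_rTensor]
      congr 2
      refine LinearMap.ext fun w => ?_
      simp
  act_map f g := by
    refine LinearMap.ext fun v => ?_
    simp only [M.act_map, N.act_map, LinearMap.comp_apply, LinearMap.add_apply, map_add,
      rTensor_lTensor]

instance : Limits.HasZeroObject (SRep G) := by
  obtain ⟨K, ι, hι, hr⟩ := exists_ker (𝟙 (unit G))
  refine ⟨K, (Limits.IsZero.iff_id_eq_zero K).2 (hom_ext (LinearMap.ext fun v => hι ?_))⟩
  have : lin ι v ∈ LinearMap.ker (lin (𝟙 (unit G))) := hr ▸ ⟨v, rfl⟩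
  rw [lin_zero, LinearMap.zero_apply, map_zero]
  exact this

instance : Limits.HasBinaryBiproducts (SRep G) where
  has_binary_biproduct M N := Limits.hasBinaryBiproduct_of_total
    { pt := prod M N
      fst := mkHom (M := prod M N) (N := M) (LinearMap.fst k M.V N.V) (fun i v hv => hv.1)
        fun A g => by
          refine LinearMap.ext fun v => ?_
          simp only [LinearMap.comp_apply, LinearMap.add_apply, map_add]
          rw [rTensor_congr (LinearMap.fst_comp_inl k M.V N.V),
            rTensor_congr (LinearMap.fst_comp_inr k M.V N.V)]
          simp
      snd := mkHom (M := prod M N) (N := N) (LinearMap.snd k M.V N.V) (fun i v hv => hv.2)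
        fun A g => by
          refine LinearMap.ext fun v => ?_
          simp only [LinearMap.comp_apply, LinearMap.add_apply, map_add]
          rw [rTensor_congr (LinearMap.snd_comp_inl k M.V N.V),
            rTensor_congr (LinearMap.snd_comp_inr k M.V N.V)]
          simp
      inl := mkHom (M := M) (N := prod M N) (LinearMap.inl k M.V N.V)
        (inl_isEven M.V N.V) fun A g => by
          refine LinearMap.ext fun v => ?_
          simp
      inr := mkHom (M := N) (N := prod M N) (LinearMap.inr k M.V N.V)
        (inr_isEven M.V N.V) fun A g => by
          refine LinearMap.ext fun v => ?_
          simp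
      inl_fst := hom_ext (LinearMap.fst_comp_inl k M.V N.V)
      inl_snd := hom_ext (LinearMap.snd_comp_inl k M.V N.V)
      inr_fst := hom_ext (LinearMap.fst_comp_inr k M.V N.V)
      inr_snd := hom_ext (LinearMap.snd_comp_inr k M.V N.V) }
    (hom_ext (LinearMap.ext fun v => by
      change ((v : M.V × N.V).1, (0 : N.V)) + ((0 : M.V), (v : M.V × N.V).2) = v
      simp))

instance : Limits.HasFiniteProducts (SRep G) := hasFiniteProducts_of_has_binary_and_terminal

instance : Abelian (SRep G) where

end SRep
end abelian

/-! ### Tensor categories and equivalences -/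

section tensorCategory

universe v w v' w'

variable {C : Type v} [Category.{w} C] [MonoidalCategory C] [SymmetricCategory C]
  {D : Type v'} [Category.{w'} D] [MonoidalCategory D] [SymmetricCategory D]

/-- In a rigid category tensoring with an object has adjoints on both sides, so it is exact. -/
lemma tensor_exact [RigidCategory C] (X : C) :
    (Limits.PreservesFiniteLimits (tensorLeft X) ∧
      Limits.PreservesFiniteColimits (tensorLeft X)) ∧
    Limits.PreservesFiniteLimits (tensorRight X) ∧
      Limits.PreservesFiniteColimits (tensorRight X) := by
  have h1 := (tensorLeftAdjunction X Xᘁ).rightAdjoint_preservesLimits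
  have h2 := (tensorLeftAdjunction (ᘁX) X).leftAdjoint_preservesColimits
  have h3 := (tensorRightAdjunction (ᘁX) X).rightAdjoint_preservesLimits
  have h4 := (tensorRightAdjunction X Xᘁ).leftAdjoint_preservesColimits
  exact ⟨⟨inferInstance, inferInstance⟩, inferInstance, inferInstance⟩

open Functor.LaxMonoidal Functor.OplaxMonoidal in
/-- The inverse of a symmetric monoidal equivalence is symmetric monoidal. -/
lemma exists_braided_inverse (e : C ≌ D) [e.functor.Braided] :
    ∃ (_ : e.inverse.Braided), NatTrans.IsMonoidal e.counit := by
  let _ : e.inverse.Monoidal := e.inverseMonoidal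
  have _ : e.IsMonoidal := ⟨rfl, fun _ _ => rfl⟩
  refine ⟨{ braided := fun X Y => ?_ }, inferInstance⟩
  apply e.functor.map_injective
  rw [← cancel_mono (e.counit.app (Y ⊗ X)), Functor.map_comp, Functor.map_comp, Category.assoc,
    Category.assoc, e.functor_map_μ_inverse_comp_counit_app_tensor]
  have h := e.counit.naturality (β_ X Y).hom
  simp only [Functor.comp_map, Functor.id_map] at h
  rw [h, e.functor_map_μ_inverse_comp_counit_app_tensor_assoc]
  simp

/-- A `k`-linear symmetric monoidal category that is equivalent to a tensor category is a tensor
category. -/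
lemma IsTensorCategory.of_equivalence {k : Type u} [Field k] [Preadditive C] [Linear k C]
    [MonoidalPreadditive C] [MonoidalLinear k C] [Preadditive D] [Linear k D]
    [MonoidalPreadditive D] [MonoidalLinear k D] (hC : IsTensorCategory k C) (e : C ≌ D)
    [e.functor.Braided] [e.functor.Additive] [e.functor.Linear k] : IsTensorCategory k D := by
  obtain ⟨⟨a, rfl⟩, ⟨hr⟩, -, -, hu⟩ := hC
  obtain ⟨_, _⟩ := exists_braided_inverse e
  let r : RigidCategory D := rigidCategoryOfEquivalence e.symm.toAdjunction
  refine ⟨⟨?_, ?_⟩, ⟨r⟩, fun X => (tensor_exact X).1, fun X => (tensor_exact X).2, ?_⟩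
  · have : Limits.HasFiniteProducts D := ⟨fun n =>
      Adjunction.hasLimitsOfShape_of_equivalence e.inverse⟩
    exact abelianOfEquivalence e.inverse
  · rfl
  · let i : 𝟙_ D ≅ e.functor.obj (𝟙_ C) := Functor.Monoidal.εIso e.functor
    have key : ∀ c : k, e.functor.map (c • 𝟙 (𝟙_ C)) = i.inv ≫ (c • 𝟙 (𝟙_ D)) ≫ i.hom := fun c => by
      simp
    constructor
    · intro c c' h
      refine hu.1 (e.functor.map_injective ?_)
      rw [key, key]
      exact congrArg (fun t => i.inv ≫ t ≫ i.hom) h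
    · intro f
      obtain ⟨g, hg⟩ := e.functor.map_surjective (i.inv ≫ f ≫ i.hom)
      obtain ⟨c, rfl⟩ := hu.2 g
      refine ⟨c, ?_⟩
      rw [key, Iso.cancel_iso_inv_left] at hg
      exact (Iso.cancel_iso_hom_right _ _ i).1 hg

end tensorCategory

section semisimplification

variable {k : Type u} [Field k] {G : Supergroup k}

lemma SRep.isTensorCategory (G : Supergroup k) : IsTensorCategory k (SRep G) := by
  let r : RigidCategory (SRep G) := BraidedCategory.rigidCategoryOfRightRigidCategory
  refine ⟨⟨inferInstance, rfl⟩, ⟨r⟩, fun X => (tensor_exact X).1, fun X => (tensor_exact X).2,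
    fun c c' h => ?_, fun f => ⟨lin f (1 : k), hom_ext (LinearMap.ext_ring ?_)⟩⟩
  · have := LinearMap.congr_fun (congrArg lin h) (1 : k)
    change c • (1 : k) = c' • (1 : k) at this
    simpa using this
  · change lin f (1 : k) • (1 : k) = _
    rw [smul_eq_mul, mul_one]

end semisimplification

/-! ### Tangent vectors of a supergroup acting on representations -/

section dualNumbers

open TrivSqZeroExt

variable {k : Type u} [Field k]

/-- A commutative algebra, regarded as a purely even superalgebra. -/
def evenAlg (k : Type u) [Field k] (R : Type u) [CommRing R] [Algebra k R] :
    SAlg k where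
  carrier := R
  super :=
    { grade := fun i => if i = 0 then ⊤ else ⊥
      isCompl := by simpa using isCompl_top_bot
      one_mem := by simp
      mul_mem := by
        intro i j a b ha hb
        rcases zmod_two i with rfl | rfl <;> rcases zmod_two j with rfl | rfl <;>
          simp_all [one_add_one]
      super_comm := by
        intro i j a b ha hb
        rcases zmod_two i with rfl | rfl <;> rcases zmod_two j with rfl | rfl <;>
          simp_all [koszul, mul_comm] }

section evenAlg

variable {R : Type u} [CommRing R] [Algebra k R]

variable (k R) in
/-- The tautological map from an algebra to the corresponding purely even superalgebra. -/
def toEven : R →ₐ[k] evenAlg k R := AlgHom.id k R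

variable (k R) in
/-- The tautological map from a purely even superalgebra to the underlying algebra. -/
def ofEven : evenAlg k R →ₐ[k] R := AlgHom.id k R

@[simp] lemma ofEven_toEven (r : R) : ofEven k R (toEven k R r) = r := rfl

lemma mem_evenAlg (r : evenAlg k R) : r ∈ gr k (evenAlg k R) 0 := by
  change ofEven k R r ∈ (if (0 : ZMod 2) = 0 then (⊤ : Submodule k R) else ⊥)
  simp

lemma mem_evenAlg_one {r : evenAlg k R} (hr : r ∈ gr k (evenAlg k R) 1) : r = 0 := by
  have : ofEven k R r ∈ (if (1 : ZMod 2) = 0 then (⊤ : Submodule k R) else ⊥) := hr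
  rw [if_neg one_ne_zero, Submodule.mem_bot] at this
  exact this

/-- A morphism from a purely even superalgebra. -/
def evenHom {A : SAlg k} (f : R →ₐ[k] A) (hf : ∀ r, f r ∈ gr k A 0) : evenAlg k R ⟶ A :=
  SAlg.Hom.mk (A := evenAlg k R) (f.comp (ofEven k R)) fun i r hr => by
    rcases zmod_two i with rfl | rfl
    · exact hf _
    · rw [mem_evenAlg_one hr, map_zero]; exact zero_mem _

end evenAlg

/-- The dual numbers `R[ε]` over a commutative algebra, with `ε` of parity `p`. -/
def dualAlg (k : Type u) [Field k] (R : Type u) [CommRing R] [Algebra k R]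
    (p : ZMod 2) : SAlg k where
  carrier := DualNumber R
  super :=
    { grade := fun i =>
        { carrier := {z | (i ≠ 0 → z.fst = 0) ∧ (i ≠ p → z.snd = 0)}
          add_mem' := fun ha hb => ⟨fun h => by rw [fst_add, ha.1 h, hb.1 h, add_zero],
            fun h => by rw [snd_add, ha.2 h, hb.2 h, add_zero]⟩
          zero_mem' := ⟨fun _ => rfl, fun _ => rfl⟩
          smul_mem' := fun c z hz => ⟨fun h => by rw [fst_smul, hz.1 h, smul_zero],
            fun h => by rw [snd_smul, hz.2 h, smul_zero]⟩ }
      isCompl := by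
        constructor
        · rw [Submodule.disjoint_def]
          intro z h0 h1
          rcases zmod_two p with rfl | rfl
          · exact TrivSqZeroExt.ext (h1.1 one_ne_zero) (h1.2 one_ne_zero)
          · exact TrivSqZeroExt.ext (h1.1 one_ne_zero) (h0.2 zero_ne_one)
        · rw [codisjoint_iff, eq_top_iff]
          intro z _
          rw [Submodule.mem_sup]
          rcases zmod_two p with rfl | rfl
          · exact ⟨z, ⟨fun h => absurd rfl h, fun h => absurd rfl h⟩, 0, zero_mem _, add_zero z⟩
          · exact ⟨inl z.fst, ⟨fun h => absurd rfl h, fun _ => rfl⟩, inr z.snd,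
              ⟨fun _ => rfl, fun h => absurd rfl h⟩, inl_fst_add_inr_snd_eq z⟩
      one_mem := ⟨fun h => absurd rfl h, fun _ => rfl⟩
      mul_mem := by
        intro i j a b ha hb
        have h1 := ha.1
        have h2 := ha.2
        have h3 := hb.1
        have h4 := hb.2
        constructor <;> intro h <;> rcases zmod_two i with rfl | rfl <;>
          rcases zmod_two j with rfl | rfl <;> rcases zmod_two p with rfl | rfl <;>
          simp_all [one_add_one, mul_comm]
      super_comm := by
        intro i j a b ha hb
        by_cases h : i = 1 ∧ j = 1
        · obtain ⟨rfl, rfl⟩ := h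
          have h1 := ha.1 one_ne_zero
          have h2 := hb.1 one_ne_zero
          have : ∀ x y : DualNumber R, x.fst = 0 → y.fst = 0 → x * y = 0 := fun x y hx hy =>
            TrivSqZeroExt.ext (by simp [hx]) (by simp [hx, hy])
          rw [this a b h1 h2, this b a h2 h1, smul_zero]
        · rw [koszul, if_neg h, one_smul, mul_comm] }

section dualAlg

variable {R : Type u} [CommRing R] [Algebra k R] {p : ZMod 2}

variable (k R p) in
/-- The constant term of a dual number. -/
def dualFst : dualAlg k R p →ₐ[k] R := fstHom k R R

variable (k R p) in
/-- The coefficient of `ε` of a dual number. -/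
def dualSnd : dualAlg k R p →ₗ[k] R := (sndHom R R).restrictScalars k

variable (k R p) in
/-- The inclusion of the constants into the dual numbers. -/
def dualInl : R →ₐ[k] dualAlg k R p := inlAlgHom k R R

variable (k R p) in
/-- The map `r ↦ r ε`. -/
def dualInr : R →ₗ[k] dualAlg k R p := (inrHom R R).restrictScalars k

lemma dual_ext {a b : dualAlg k R p} (h1 : dualFst k R p a = dualFst k R p b)
    (h2 : dualSnd k R p a = dualSnd k R p b) : a = b := TrivSqZeroExt.ext h1 h2

@[simp] lemma dualFst_inl (r : R) : dualFst k R p (dualInl k R p r) = r := rfl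
@[simp] lemma dualFst_inr (r : R) : dualFst k R p (dualInr k R p r) = 0 := rfl
@[simp] lemma dualSnd_inl (r : R) : dualSnd k R p (dualInl k R p r) = 0 := rfl
@[simp] lemma dualSnd_inr (r : R) : dualSnd k R p (dualInr k R p r) = r := rfl
@[simp] lemma dualSnd_one : dualSnd k R p 1 = 0 := rfl

@[simp] lemma dualSnd_mul (a b : dualAlg k R p) : dualSnd k R p (a * b)
    = dualFst k R p a * dualSnd k R p b + dualSnd k R p a * dualFst k R p b := by
  change TrivSqZeroExt.snd (_ : DualNumber R) = _
  exact (DualNumber.snd_mul _ _)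

lemma mem_dualAlg {i : ZMod 2} {z : dualAlg k R p} : z ∈ gr k (dualAlg k R p) i ↔
    (i ≠ 0 → dualFst k R p z = 0) ∧ (i ≠ p → dualSnd k R p z = 0) := Iff.rfl

lemma dualInr_mem (r : R) : dualInr k R p r ∈ gr k (dualAlg k R p) p :=
  mem_dualAlg.2 ⟨fun _ => rfl, fun h => absurd rfl h⟩

lemma dualInl_mem (r : R) : dualInl k R p r ∈ gr k (dualAlg k R p) 0 :=
  mem_dualAlg.2 ⟨fun h => absurd rfl h, fun _ => rfl⟩

lemma dualInr_mul_dualInr (r r' : R) : dualInr k R p r * dualInr k R p r' = 0 :=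
  dual_ext (by simp) (by simp)

end dualAlg

/-- The morphism `k[ε] ⟶ A` that sends `ε` to an element of square zero. -/
def dualHom {A : SAlg k} {p : ZMod 2} {c : A} (hc : c ∈ gr k A p) (h2 : c * c = 0) :
    dualAlg k k p ⟶ A :=
  SAlg.Hom.mk (AlgHom.ofLinearMap
    ((dualFst k k p).toLinearMap.smulRight (1 : A) + (dualSnd k k p).smulRight c) (by simp)
    (fun a b => by
      simp only [LinearMap.add_apply, LinearMap.smulRight_apply, AlgHom.toLinearMap_apply, map_mul,
        dualSnd_mul, mul_add, add_mul, smul_mul_smul_comm, one_mul, mul_one, h2]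
      module))
    fun i z hz => by
      rw [mem_dualAlg] at hz
      refine add_mem ?_ ?_
      · by_cases h : i = 0
        · subst h; exact Submodule.smul_mem _ _ SuperCommAlgebra.one_mem
        · rw [LinearMap.smulRight_apply, AlgHom.toLinearMap_apply, hz.1 h, zero_smul]
          exact zero_mem _
      · by_cases h : i = p
        · subst h; exact Submodule.smul_mem _ _ hc
        · rw [LinearMap.smulRight_apply, hz.2 h, zero_smul]; exact zero_mem _

lemma dualHom_apply {A : SAlg k} {p : ZMod 2} {c : A} (hc : c ∈ gr k A p) (h2 : c * c = 0)
    (z : dualAlg k k p) : SAlg.algHom (dualHom hc h2) z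
      = dualFst k k p z • (1 : A) + dualSnd k k p z • c := rfl

variable (k) in
/-- The augmentation `k[ε] ⟶ k`. -/
def dualAug (p : ZMod 2) : dualAlg k k p ⟶ evenAlg k k :=
  SAlg.Hom.mk (B := evenAlg k k) ((toEven k k).comp (dualFst k k p)) fun i z hz => by
    rcases zmod_two i with rfl | rfl
    · exact mem_evenAlg _
    · rw [AlgHom.toLinearMap_apply, AlgHom.comp_apply, (mem_dualAlg.1 hz).1 one_ne_zero, map_zero]
      exact zero_mem _

section coefficient

variable {V W : Type u} [AddCommGroup V] [Module k V] [AddCommGroup W] [Module k W]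
  {A : Type u} [Ring A] [Algebra k A]

/-- The coefficient `v ⊗ a ↦ φ(a) v`. -/
def coef (V : Type u) [AddCommGroup V] [Module k V] (φ : A →ₗ[k] k) : V ⊗[k] A →ₗ[k] V :=
  (TensorProduct.rid k V).toLinearMap ∘ₗ φ.lTensor V

@[simp] lemma coef_tmul (φ : A →ₗ[k] k) (v : V) (a : A) : coef V φ (v ⊗ₜ a) = φ a • v := by
  simp [coef]

lemma coef_rTensor (φ : A →ₗ[k] k) (f : V →ₗ[k] W) (y : V ⊗[k] A) :
    coef W φ (f.rTensor A y) = f (coef V φ y) := by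
  have : coef W φ ∘ₗ f.rTensor A = f ∘ₗ coef V φ := TensorProduct.ext' fun v a => by simp
  exact LinearMap.congr_fun this y

lemma coef_lTensor {B : Type u} [Ring B] [Algebra k B] (φ : B →ₗ[k] k) (f : A →ₗ[k] B)
    (y : V ⊗[k] A) : coef V φ (f.lTensor V y) = coef V (φ ∘ₗ f) y := by
  have : coef V φ ∘ₗ f.lTensor V = coef V (φ ∘ₗ f) := TensorProduct.ext' fun v a => by simp
  exact LinearMap.congr_fun this y

lemma dual_expand {p : ZMod 2} (y : V ⊗[k] dualAlg k k p) :
    coef V (dualFst k k p).toLinearMap y ⊗ₜ 1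
      + coef V (dualSnd k k p) y ⊗ₜ dualInr k k p 1 = y := by
  induction y using TensorProduct.induction_on with
  | zero => simp
  | tmul v z =>
    simp only [coef_tmul, TensorProduct.smul_tmul, ← TensorProduct.tmul_add]
    congr 1
    exact dual_ext (by simp) (by simp)
  | add x y hx hy =>
    rw [map_add, map_add, TensorProduct.add_tmul, TensorProduct.add_tmul]
    nth_rewrite 3 [← hx]
    nth_rewrite 3 [← hy]
    abel

end coefficient

namespace SRep

variable {G : Supergroup k}

lemma act_mul_apply (M : SRep G) (A : SAlg k) (g h : G.obj A) (v : M.V) :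
    M.act A (g * h) v = extend (M.act A g) (M.act A h v) := by
  rw [M.act_mul, LinearMap.comp_apply]

/-- The operator by which a tangent vector, a point over `k[ε]`, acts on a representation. -/
def deriv (M : SRep G) {p : ZMod 2} (g : G.obj (dualAlg k k p)) : M.V →ₗ[k] M.V :=
  coef M.V (dualSnd k k p) ∘ₗ M.act (dualAlg k k p) g

lemma act_dualAlg (M : SRep G) {p : ZMod 2} {g : G.obj (dualAlg k k p)}
    (hg : G.map (dualAug k p) g = 1) (v : M.V) :
    M.act _ g v = v ⊗ₜ 1 + M.deriv g v ⊗ₜ dualInr k k p 1 := by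
  rw [← dual_expand (M.act (dualAlg k k p) g v)]
  congr 2
  have h := LinearMap.congr_fun (M.act_map (dualAug k p) g) v
  rw [hg, M.act_one] at h
  have h1 := congrArg (coef M.V (ofEven k k).toLinearMap) h
  rw [LinearMap.comp_apply, coef_lTensor] at h1
  refine h1.symm.trans ?_
  rw [unitMap_apply, coef_tmul, AlgHom.toLinearMap_apply, map_one, one_smul]

/-- A point that is trivial modulo `c`, with `c² = 0`, acts through its tangent vector. -/
lemma act_dualHom (M : SRep G) {p : ZMod 2} {g : G.obj (dualAlg k k p)}
    (hg : G.map (dualAug k p) g = 1) {A : SAlg k} {c : A} (hc : c ∈ gr k A p) (h2 : c * c = 0)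
    (v : M.V) : M.act A (G.map (dualHom hc h2) g) v = v ⊗ₜ 1 + M.deriv g v ⊗ₜ c := by
  rw [M.act_map, LinearMap.comp_apply, act_dualAlg M hg, map_add, LinearMap.lTensor_tmul,
    LinearMap.lTensor_tmul, AlgHom.toLinearMap_apply, AlgHom.toLinearMap_apply, dualHom_apply,
    dualHom_apply]
  simp

lemma add_add_self (i j : ZMod 2) : i + j + j = i := by
  revert i j; decide

lemma lin_deriv {M N : SRep G} (f : M ⟶ N) {p : ZMod 2} (g : G.obj (dualAlg k k p)) (v : M.V) :
    lin f (M.deriv g v) = N.deriv g (lin f v) := by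
  have := LinearMap.congr_fun (lin_equivariant f _ g) v
  rw [LinearMap.comp_apply, LinearMap.comp_apply] at this
  rw [deriv, deriv, LinearMap.comp_apply, LinearMap.comp_apply, ← this, coef_rTensor]

lemma deriv_mem (M : SRep G) {p : ZMod 2} (g : G.obj (dualAlg k k p)) {i : ZMod 2} {v : M.V}
    (hv : v ∈ gr k M.V i) : M.deriv g v ∈ gr k M.V (i + p) := by
  have h := M.act_even _ g i v hv
  rw [deriv, LinearMap.comp_apply]
  refine tensor_gr_induction (k := k)
    (p := fun y => coef M.V (dualSnd k k p) y ∈ gr k M.V (i + p)) (by simp)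
    (fun a b ha hb => by rw [map_add]; exact add_mem ha hb)
    (fun c a ha => by rw [map_smul]; exact Submodule.smul_mem _ _ ha) ?_ h
  rintro i' j rfl w hw z hz
  rw [coef_tmul]
  by_cases hj : j = p
  · subst hj
    rw [add_add_self]
    exact Submodule.smul_mem _ _ hw
  · rw [(mem_dualAlg.1 hz).2 hj, zero_smul]; exact zero_mem _

end SRep

end dualNumbers

/-! ### The exterior algebra in two variables -/

section lam

variable {k : Type u} [Field k]

/-- The underlying space of the exterior algebra `Λ[σ, τ]`: coefficients of `1, σ, τ, στ`. -/
def Lam (k : Type u) : Type u := k × k × k × k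

namespace Lam

instance : AddCommGroup (Lam k) := inferInstanceAs (AddCommGroup (k × k × k × k))
instance : Module k (Lam k) := inferInstanceAs (Module k (k × k × k × k))

/-- The coefficient of `1`. -/
def c0 : Lam k →ₗ[k] k := LinearMap.fst k k (k × k × k)
/-- The coefficient of `σ`. -/
def c1 : Lam k →ₗ[k] k := LinearMap.fst k k (k × k) ∘ₗ LinearMap.snd k k (k × k × k)
/-- The coefficient of `τ`. -/
def c2 : Lam k →ₗ[k] k :=
  LinearMap.fst k k k ∘ₗ LinearMap.snd k k (k × k) ∘ₗ LinearMap.snd k k (k × k × k)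
/-- The coefficient of `στ`. -/
def c3 : Lam k →ₗ[k] k :=
  LinearMap.snd k k k ∘ₗ LinearMap.snd k k (k × k) ∘ₗ LinearMap.snd k k (k × k × k)

/-- The element with the given coefficients. -/
def mk (a b c d : k) : Lam k := (a, b, c, d)

@[simp] lemma c0_mk (a b c d : k) : c0 (mk a b c d) = a := rfl
@[simp] lemma c1_mk (a b c d : k) : c1 (mk a b c d) = b := rfl
@[simp] lemma c2_mk (a b c d : k) : c2 (mk a b c d) = c := rfl
@[simp] lemma c3_mk (a b c d : k) : c3 (mk a b c d) = d := rfl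

lemma ext {x y : Lam k} (h0 : c0 x = c0 y) (h1 : c1 x = c1 y) (h2 : c2 x = c2 y)
    (h3 : c3 x = c3 y) : x = y := Prod.ext h0 (Prod.ext h1 (Prod.ext h2 h3))

instance : One (Lam k) := ⟨mk 1 0 0 0⟩
instance : Mul (Lam k) := ⟨fun x y => mk (c0 x * c0 y) (c0 x * c1 y + c1 x * c0 y)
  (c0 x * c2 y + c2 x * c0 y) (c0 x * c3 y + c3 x * c0 y + c1 x * c2 y - c2 x * c1 y)⟩

@[simp] lemma c0_one : c0 (1 : Lam k) = 1 := rfl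
@[simp] lemma c1_one : c1 (1 : Lam k) = 0 := rfl
@[simp] lemma c2_one : c2 (1 : Lam k) = 0 := rfl
@[simp] lemma c3_one : c3 (1 : Lam k) = 0 := rfl
@[simp] lemma c0_mul (x y : Lam k) : c0 (x * y) = c0 x * c0 y := rfl
@[simp] lemma c1_mul (x y : Lam k) : c1 (x * y) = c0 x * c1 y + c1 x * c0 y := rfl
@[simp] lemma c2_mul (x y : Lam k) : c2 (x * y) = c0 x * c2 y + c2 x * c0 y := rfl
@[simp] lemma c3_mul (x y : Lam k) :
    c3 (x * y) = c0 x * c3 y + c3 x * c0 y + c1 x * c2 y - c2 x * c1 y := rfl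

instance : Ring (Lam k) :=
  { (inferInstance : AddCommGroup (Lam k)) with
    mul := (· * ·)
    one := 1
    left_distrib := fun x y z => by apply ext <;> simp <;> ring
    right_distrib := fun x y z => by apply ext <;> simp <;> ring
    zero_mul := fun x => by apply ext <;> simp
    mul_zero := fun x => by apply ext <;> simp
    mul_assoc := fun x y z => by apply ext <;> simp <;> ring
    one_mul := fun x => by apply ext <;> simp
    mul_one := fun x => by apply ext <;> simp }

instance : Algebra k (Lam k) := Algebra.ofModule
  (fun r x y => by apply ext <;> simp <;> ring) (fun r x y => by apply ext <;> simp <;> ring)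

/-- The parity of the exterior algebra. -/
instance : SuperCommAlgebra k (Lam k) where
  grade i := if i = 0 then LinearMap.ker c1 ⊓ LinearMap.ker c2
    else LinearMap.ker c0 ⊓ LinearMap.ker c3
  isCompl := by
    rw [if_pos rfl, if_neg one_ne_zero]
    constructor
    · rw [Submodule.disjoint_def]
      rintro x ⟨h1, h2⟩ ⟨h0, h3⟩
      exact ext h0 h1 h2 h3
    · rw [codisjoint_iff, eq_top_iff]
      intro x _
      exact Submodule.mem_sup.2 ⟨mk (c0 x) 0 0 (c3 x), ⟨rfl, rfl⟩, mk 0 (c1 x) (c2 x) 0,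
        ⟨rfl, rfl⟩, by apply ext <;> simp⟩
  one_mem := ⟨rfl, rfl⟩
  mul_mem := by
    intro i j a b ha hb
    rcases zmod_two i with rfl | rfl <;> rcases zmod_two j with rfl | rfl <;>
      simp_all [one_add_one]
  super_comm := by
    intro i j a b ha hb
    rcases zmod_two i with rfl | rfl <;> rcases zmod_two j with rfl | rfl <;>
      simp_all [koszul] <;> apply ext <;> simp_all <;> ring

variable (k) in
/-- The exterior algebra in two variables, as an object of the category of superalgebras. -/
def alg : SAlg k where
  carrier := Lam k

/-- The first generator. -/
def sig : alg k := mk 0 1 0 0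
/-- The second generator. -/
def tau : alg k := mk 0 0 1 0

/-- The coefficient of `στ`, as a functional on `alg k`. -/
def top : alg k →ₗ[k] k := c3

lemma sig_mem : (sig : alg k) ∈ gr k (alg k) 1 := ⟨rfl, rfl⟩
lemma tau_mem : (tau : alg k) ∈ gr k (alg k) 1 := ⟨rfl, rfl⟩

lemma top_one : top (1 : alg k) = 0 := rfl
lemma top_sig : top (sig : alg k) = 0 := rfl
lemma top_tau : top (tau : alg k) = 0 := rfl
lemma top_sig_tau : top (sig * tau : alg k) = 1 := by
  exact (c3_mul (mk 0 1 0 0 : Lam k) (mk 0 0 1 0)).trans (by simp)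
lemma top_tau_sig : top (tau * sig : alg k) = -1 := by
  exact (c3_mul (mk 0 0 1 0 : Lam k) (mk 0 1 0 0)).trans (by simp)

end Lam

end lam

/-! ### Representations of the supergroup of dimension `(1|1)` -/

section ga

open Polynomial

variable {k : Type u} [Field k] [CharZero k]

/-- The even point `(s, 0)`. -/
def evenPt {A : SAlg k} (s : A) (hs : s ∈ gr k A 0) : (Ga11 k).obj A :=
  (⟨s, 0, hs, zero_mem _⟩ : Ga11Pts k A)

/-- The odd point `(0, σ)`. -/
def oddPt {A : SAlg k} (σ : A) (hσ : σ ∈ gr k A 1) : (Ga11 k).obj A :=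
  (⟨0, σ, zero_mem _, hσ⟩ : Ga11Pts k A)

lemma pt_ext {A : SAlg k} {g h : (Ga11 k).obj A} (h1 : Ga11Pts.s (k := k) (A := A) g = Ga11Pts.s h)
    (h2 : Ga11Pts.σ (k := k) (A := A) g = Ga11Pts.σ h) : g = h := Ga11Pts.ext h1 h2

lemma evenPt_mul_oddPt {A : SAlg k} (g : Ga11Pts k A) :
    evenPt g.s g.hs * oddPt g.σ g.hσ = (show (Ga11 k).obj A from g) :=
  pt_ext (show g.s + 0 - 0 * g.σ = g.s by simp) (zero_add g.σ)

lemma evenPt_mul_evenPt {A : SAlg k} {s t : A} (hs : s ∈ gr k A 0) (ht : t ∈ gr k A 0) :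
    evenPt s hs * evenPt t ht = evenPt (s + t) (add_mem hs ht) :=
  pt_ext (show s + t - 0 * 0 = s + t by simp) (zero_add (0 : A))

lemma oddPt_mul_oddPt {A : SAlg k} {σ τ : A} (hσ : σ ∈ gr k A 1) (hτ : τ ∈ gr k A 1) :
    oddPt σ hσ * oddPt τ hτ = evenPt (-(σ * τ)) (neg_mem (odd_mul_odd k hσ hτ)) *
      oddPt (σ + τ) (add_mem hσ hτ) :=
  pt_ext (show 0 + 0 - σ * τ = -(σ * τ) + 0 - 0 * (σ + τ) by simp)
    (show σ + τ = 0 + (σ + τ) by simp)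

lemma map_evenPt {A B : SAlg k} (f : A ⟶ B) {s : A} (hs : s ∈ gr k A 0) :
    (Ga11 k).map f (evenPt s hs) = evenPt (SAlg.algHom f s) (SAlg.algHom_even f 0 _ hs) :=
  pt_ext rfl (map_zero (SAlg.algHom f))

lemma map_oddPt {A B : SAlg k} (f : A ⟶ B) {σ : A} (hσ : σ ∈ gr k A 1) :
    (Ga11 k).map f (oddPt σ hσ) = oddPt (SAlg.algHom f σ) (SAlg.algHom_even f 1 _ hσ) :=
  pt_ext (map_zero (SAlg.algHom f)) rfl

lemma evenPt_zero {A : SAlg k} (h : (0 : A) ∈ gr k A 0) : evenPt 0 h = 1 := rfl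

variable (k) in
/-- The odd tangent vector. -/
def oddTangent : (Ga11 k).obj (dualAlg k k 1) := oddPt (dualInr k k 1 1) (dualInr_mem 1)

variable (k) in
/-- The even tangent vector. -/
def evenTangent : (Ga11 k).obj (dualAlg k k 0) := evenPt (dualInr k k 0 1) (dualInr_mem 1)

lemma map_dualAug_oddTangent : (Ga11 k).map (dualAug k 1) (oddTangent k) = 1 := by
  rw [oddTangent, map_oddPt]; rfl

lemma map_dualAug_evenTangent : (Ga11 k).map (dualAug k 0) (evenTangent k) = 1 := by
  rw [evenTangent, map_evenPt]; rfl

namespace SRep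

variable (M : SRep (Ga11 k))

/-- The action of the odd tangent vector. On a representation given by the odd operator `x` this
is `v ↦ (-1)^{|v|} x v`. -/
def dOp : M.V →ₗ[k] M.V := M.deriv (oddTangent k)

/-- The action of the even tangent vector. -/
def nOp : M.V →ₗ[k] M.V := M.deriv (evenTangent k)

lemma dOp_mem {i : ZMod 2} {v : M.V} (hv : v ∈ gr k M.V i) : M.dOp v ∈ gr k M.V (i + 1) :=
  M.deriv_mem _ hv

lemma act_oddPt {A : SAlg k} {σ : A} (hσ : σ ∈ gr k A 1) (v : M.V) :
    M.act A (oddPt σ hσ) v = v ⊗ₜ 1 + M.dOp v ⊗ₜ σ := by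
  rw [dOp, ← act_dualHom M map_dualAug_oddTangent hσ (odd_sq k hσ), oddTangent, map_oddPt]
  congr 2
  exact pt_ext rfl (by change σ = SAlg.algHom _ _; rw [dualHom_apply]; simp)

lemma act_evenPt {A : SAlg k} {s : A} (hs : s ∈ gr k A 0) (h2 : s * s = 0) (v : M.V) :
    M.act A (evenPt s hs) v = v ⊗ₜ 1 + M.nOp v ⊗ₜ s := by
  rw [nOp, ← act_dualHom M map_dualAug_evenTangent hs h2, evenTangent, map_evenPt]
  congr 2
  exact pt_ext (by change s = SAlg.algHom _ _; rw [dualHom_apply]; simp) rfl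

/-- The square of the odd tangent vector is the negative of the even one: compare the coefficients
of `στ` in `(0, σ) (0, τ) = (-στ, 0) (0, σ + τ)`. -/
lemma dOp_dOp (v : M.V) : M.dOp (M.dOp v) = -M.nOp v := by
  have h := congrArg (fun g => coef M.V Lam.top (M.act (Lam.alg k) g v))
    (oddPt_mul_oddPt (Lam.sig_mem (k := k)) Lam.tau_mem)
  have hst : (Lam.sig * Lam.tau : Lam.alg k) ∈ gr k (Lam.alg k) 0 :=
    odd_mul_odd k Lam.sig_mem Lam.tau_mem
  have h2 : -(Lam.sig * Lam.tau) * -(Lam.sig * Lam.tau) = (0 : Lam.alg k) := by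
    rw [neg_mul_neg, odd_prod_sq k Lam.sig_mem Lam.tau_mem]
  have h3 : Lam.top (Lam.sig * Lam.tau * (Lam.sig + Lam.tau) : Lam.alg k) = 0 := by
    rw [mul_add, mul_assoc, odd_anticomm k Lam.tau_mem Lam.sig_mem, mul_assoc, mul_neg,
      ← mul_assoc, odd_sq k Lam.sig_mem, odd_sq k Lam.tau_mem]
    simp
  simp only [act_mul_apply, act_oddPt, act_evenPt M _ h2, map_add, extend_tmul, rmul_tmul,
    coef_tmul, one_mul, mul_one, Lam.top_one, Lam.top_sig, Lam.top_tau, Lam.top_sig_tau, map_neg,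
    neg_mul, h3, zero_smul, zero_add, add_zero, one_smul, neg_smul, neg_zero] at h
  exact h

end SRep

end ga

/-! ### The even part acts by an exponential; morphisms in terms of the odd operator -/

section polynomialPoints

open Polynomial

variable {k : Type u} [Field k] [CharZero k]

lemma eq_zero_of_coef {V : Type u} [AddCommGroup V] [Module k V] {A : Type u} [Ring A]
    [Algebra k A] {ι : Type*} (b : Module.Basis ι k A) {y : V ⊗[k] A}
    (h : ∀ i, coef V (b.coord i) y = 0) : y = 0 := by
  classical
  apply (TensorProduct.equivFinsuppOfBasisRight b).injective
  ext i
  rw [map_zero, Finsupp.zero_apply, TensorProduct.equivFinsuppOfBasisRight_apply]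
  exact h i

variable (k) in
/-- The linear isomorphism between a purely even superalgebra and the underlying algebra. -/
def ofEvenEquiv (R : Type u) [CommRing R] [Algebra k R] : evenAlg k R ≃ₗ[k] R :=
  LinearEquiv.ofLinearMap (ofEven k R).toLinearMap (toEven k R).toLinearMap rfl rfl

lemma coef_rmul {V : Type u} [AddCommGroup V] [Module k V] {A : Type u} [Ring A]
    [Algebra k A] (φ : A →ₗ[k] k) (a : A) (y : V ⊗[k] A) :
    coef V φ (rmul a y) = coef V (φ ∘ₗ LinearMap.mulRight k a) y := by
  rw [rmul, coef_lTensor]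

variable (k) in
/-- The point `(X, 0)` over the polynomial ring. -/
def polyPt : (Ga11 k).obj (evenAlg k k[X]) := evenPt (toEven k k[X] X) (mem_evenAlg _)

lemma aeval_mem_even {A : SAlg k} {s : A} (hs : s ∈ gr k A 0) (p : k[X]) :
    aeval s p ∈ gr k A 0 :=
  (Algebra.adjoin_le (S := evenSub k A) (Set.singleton_subset_iff.2 hs))
    (aeval_mem_adjoin_singleton k s)

/-- The morphism `k[X] ⟶ A` that sends `X` to an even element. -/
def polyHom {A : SAlg k} {s : A} (hs : s ∈ gr k A 0) : evenAlg k k[X] ⟶ A :=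
  evenHom (aeval s) (aeval_mem_even hs)

lemma polyHom_apply {A : SAlg k} {s : A} (hs : s ∈ gr k A 0) (p : evenAlg k k[X]) :
    SAlg.algHom (polyHom hs) p = aeval s (ofEven k k[X] p) := rfl

lemma map_polyPt {A : SAlg k} {s : A} (hs : s ∈ gr k A 0) :
    (Ga11 k).map (polyHom hs) (polyPt k) = evenPt s hs := by
  rw [polyPt, map_evenPt]
  exact pt_ext ((polyHom_apply hs _).trans ((congrArg _ (ofEven_toEven X)).trans (aeval_X s))) rfl

namespace SRep

variable (M : SRep (Ga11 k))

/-- The coefficient of `X ^ i` in the action of the point `(X, 0)` over the polynomial ring. -/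
def rho (i : ℕ) : M.V →ₗ[k] M.V :=
  coef M.V (lcoeff k i ∘ₗ (ofEven k k[X]).toLinearMap) ∘ₗ M.act _ (polyPt k)

lemma rho_zero (v : M.V) : M.rho 0 v = v := by
  have h := LinearMap.congr_fun (M.act_map (polyHom (A := evenAlg k k) (s := 0) (zero_mem _))
    (polyPt k)) v
  rw [map_polyPt, evenPt_zero, M.act_one] at h
  have h1 := congrArg (coef M.V (ofEven k k).toLinearMap) h
  rw [LinearMap.comp_apply, coef_lTensor, unitMap_apply, coef_tmul] at h1
  have e : (ofEven k k).toLinearMap ∘ₗ (SAlg.algHom (polyHom (A := evenAlg k k) (s := 0)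
      (zero_mem _))).toLinearMap = lcoeff k 0 ∘ₗ (ofEven k k[X]).toLinearMap := by
    refine LinearMap.ext fun p => ?_
    simp only [LinearMap.comp_apply, AlgHom.toLinearMap_apply, polyHom_apply, lcoeff_apply]
    generalize ofEven k k[X] p = q
    rw [← aeval_algHom_apply, map_zero, coeff_zero_eq_aeval_zero]
  rw [e, AlgHom.toLinearMap_apply, map_one, one_smul] at h1
  exact h1.symm

lemma dualSnd_aeval (p : k[X]) : dualSnd k k[X] 0
    (aeval (dualInl k k[X] 0 X + dualInr k k[X] 0 1) p) = derivative p := by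
  have h1 : ∀ p : k[X], dualFst k k[X] 0
      (aeval (dualInl k k[X] 0 X + dualInr k k[X] 0 1) p) = p := fun p => by
    rw [← aeval_algHom_apply]; simp
  induction p using Polynomial.induction_on' with
  | add p q hp hq => rw [map_add, map_add, hp, hq, map_add]
  | monomial n a =>
    induction n generalizing a with
    | zero => simp [Algebra.algebraMap_eq_smul_one]
    | succ n ih =>
      rw [← monomial_mul_X, map_mul, dualSnd_mul, h1, ih, derivative_mul]
      simp [add_comm]

/-- The action of `(X, 0)` is the exponential series in the even tangent vector: compare the
coefficients of `ε` in `(X + ε, 0) = (X, 0) (ε, 0)`. -/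
lemma rho_succ (i : ℕ) (v : M.V) : ((i : k) + 1) • M.rho (i + 1) v = M.rho i (M.nOp v) := by
  set B := dualAlg k k[X] 0
  have hX : dualInl k k[X] 0 X ∈ gr k B 0 := dualInl_mem X
  have hε : dualInr k k[X] 0 1 ∈ gr k B 0 := dualInr_mem 1
  have h := congrArg (fun g => coef M.V (lcoeff k i ∘ₗ dualSnd k k[X] 0) (M.act B g v))
    (evenPt_mul_evenPt hX hε)
  have a1 : ∀ {s : B} (hs : s ∈ gr k B 0) (w : M.V), M.act B (evenPt s hs) w
      = (SAlg.algHom (polyHom hs)).toLinearMap.lTensor M.V (M.act _ (polyPt k) w) := fun hs w => by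
    rw [← map_polyPt hs, M.act_map, LinearMap.comp_apply]
  simp only [act_mul_apply, act_evenPt M hε (dualInr_mul_dualInr 1 1), map_add, extend_tmul,
    rmul_one] at h
  rw [a1, a1, a1, coef_lTensor, coef_lTensor, coef_rmul, coef_lTensor] at h
  have e1 : (lcoeff k i ∘ₗ dualSnd k k[X] 0) ∘ₗ (SAlg.algHom (polyHom (add_mem hX hε))).toLinearMap
      = ((i : k) + 1) • (lcoeff k (i + 1) ∘ₗ (ofEven k k[X]).toLinearMap) :=
    LinearMap.ext fun p => by
      simp only [LinearMap.comp_apply, AlgHom.toLinearMap_apply, polyHom_apply,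
        lcoeff_apply, LinearMap.smul_apply, smul_eq_mul]
      refine (congrArg (coeff · i) (dualSnd_aeval (ofEven k k[X] p))).trans ?_
      rw [coeff_derivative, mul_comm]
  have e0 : ∀ p, SAlg.algHom (polyHom hX) p = dualInl k k[X] 0 (ofEven k k[X] p) := fun p => by
    rw [polyHom_apply, aeval_algHom_apply, aeval_X_left_apply]
  have e2 : (lcoeff k i ∘ₗ dualSnd k k[X] 0) ∘ₗ (SAlg.algHom (polyHom hX)).toLinearMap = 0 :=
    LinearMap.ext fun p => by
      simp only [LinearMap.comp_apply, AlgHom.toLinearMap_apply, e0, dualSnd_inl, map_zero,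
        LinearMap.zero_apply]
  have e3 : ((lcoeff k i ∘ₗ dualSnd k k[X] 0) ∘ₗ LinearMap.mulRight k (dualInr k k[X] 0 1)) ∘ₗ
      (SAlg.algHom (polyHom hX)).toLinearMap = lcoeff k i ∘ₗ (ofEven k k[X]).toLinearMap :=
    LinearMap.ext fun p => by
      simp only [LinearMap.comp_apply, AlgHom.toLinearMap_apply, e0, LinearMap.mulRight_apply,
        dualSnd_mul, dualFst_inl, dualSnd_inr, dualSnd_inl, mul_one, zero_mul, add_zero]
  rw [e1, e2, e3] at h
  have z : coef M.V (0 : evenAlg k k[X] →ₗ[k] k) = 0 := by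
    simp [coef]
  rw [z, LinearMap.zero_apply, zero_add] at h
  rw [rho, rho, LinearMap.comp_apply, LinearMap.comp_apply, h]
  simp [coef, LinearMap.lTensor_smul]

lemma nOp_pow (i : ℕ) (v : M.V) : (M.nOp ^ i) v = (i.factorial : k) • M.rho i v := by
  induction i generalizing v with
  | zero => simp [rho_zero]
  | succ i ih =>
    rw [pow_succ, Module.End.mul_apply, ih, ← rho_succ, smul_smul, Nat.factorial_succ]
    push_cast
    rw [mul_comm]

/-- The action of `(X, 0)` on a vector is a polynomial, so that the exponential series is finite. -/
lemma nOp_nilpotent : IsNilpotent M.nOp := by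
  rw [Module.End.isNilpotent_iff_of_finite]
  intro v
  have h : ∀ y : M.V ⊗[k] evenAlg k k[X], ∃ N : ℕ, ∀ i, N ≤ i →
      coef M.V (lcoeff k i ∘ₗ (ofEven k k[X]).toLinearMap) y = 0 := by
    intro y
    induction y using TensorProduct.induction_on with
    | zero => exact ⟨0, fun i _ => map_zero _⟩
    | tmul v p =>
      refine ⟨natDegree (ofEven k k[X] p) + 1, fun i hi => ?_⟩
      rw [coef_tmul]
      change coeff (ofEven k k[X] p) i • v = 0
      rw [coeff_eq_zero_of_natDegree_lt (by omega), zero_smul]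
    | add x y hx hy =>
      obtain ⟨N, hN⟩ := hx
      obtain ⟨N', hN'⟩ := hy
      exact ⟨max N N', fun i hi => by
        rw [map_add, hN i (le_trans (le_max_left _ _) hi),
          hN' i (le_trans (le_max_right _ _) hi), add_zero]⟩
  obtain ⟨N, hN⟩ := h (M.act _ (polyPt k) v)
  refine ⟨N, ?_⟩
  rw [nOp_pow, rho, LinearMap.comp_apply, hN N le_rfl, smul_zero]

lemma dOp_sq : M.dOp ^ 2 = -M.nOp := by
  refine LinearMap.ext fun v => ?_
  rw [pow_two, Module.End.mul_apply, dOp_dOp, LinearMap.neg_apply]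

lemma dOp_nilpotent : IsNilpotent M.dOp := by
  obtain ⟨n, hn⟩ := M.nOp_nilpotent.neg
  exact ⟨2 * n, by rw [pow_mul, dOp_sq, hn]⟩

variable {M} {N : SRep (Ga11 k)}

lemma rTensor_act_evenPt {f : M.V →ₗ[k] N.V} (hf : ∀ v, f (M.nOp v) = N.nOp (f v)) {A : SAlg k}
    {s : A} (hs : s ∈ gr k A 0) :
    f.rTensor A ∘ₗ M.act A (evenPt s hs) = N.act A (evenPt s hs) ∘ₗ f := by
  have hp : ∀ i v, f ((M.nOp ^ i) v) = (N.nOp ^ i) (f v) := fun i => by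
    induction i with
    | zero => simp
    | succ i ih =>
      intro v
      rw [pow_succ, pow_succ, Module.End.mul_apply, Module.End.mul_apply, ih, hf]
  have h : ∀ v, f.rTensor _ (M.act _ (polyPt k) v) = N.act _ (polyPt k) (f v) := fun v => by
    rw [← sub_eq_zero]
    refine eq_zero_of_coef
      ((Polynomial.basisMonomials k).map (ofEvenEquiv k k[X]).symm) fun i => ?_
    have hc : ((Polynomial.basisMonomials k).map (ofEvenEquiv k k[X]).symm).coord i
        = lcoeff k i ∘ₗ (ofEven k k[X]).toLinearMap := by
      refine LinearMap.ext fun p => ?_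
      rfl
    have h1 := hp i v
    rw [nOp_pow, nOp_pow, map_smul] at h1
    have h2 := smul_right_injective _ (Nat.cast_ne_zero.2 (Nat.factorial_ne_zero i)) h1
    rw [hc, map_sub, sub_eq_zero, coef_rTensor]
    exact h2
  refine LinearMap.ext fun v => ?_
  rw [LinearMap.comp_apply, LinearMap.comp_apply, ← map_polyPt hs, M.act_map, N.act_map,
    LinearMap.comp_apply, LinearMap.comp_apply, ← h]
  exact (rTensor_lTensor _ _ _)

/-- Parity-preserving maps which commute with the odd tangent vector are morphisms. -/
def homOfDOp (f : M.V →ₗ[k] N.V) (he : IsEven f) (hf : ∀ v, f (M.dOp v) = N.dOp (f v)) : M ⟶ N :=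
  mkHom f he fun A g => by
    have hn : ∀ v, f (M.nOp v) = N.nOp (f v) := fun v => by
      have := hf (M.dOp v)
      rw [dOp_dOp, hf, dOp_dOp, map_neg] at this
      exact neg_injective this
    have h1 : ∀ v, f.rTensor A (M.act A (oddPt _ (Ga11Pts.hσ (A := A) g)) v)
        = N.act A (oddPt _ (Ga11Pts.hσ (A := A) g)) (f v) := fun v => by
      rw [act_oddPt, act_oddPt, map_add, LinearMap.rTensor_tmul, LinearMap.rTensor_tmul, hf]
    refine LinearMap.ext fun v => ?_
    have e := evenPt_mul_oddPt (A := A) g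
    change _ = g at e
    rw [← e, LinearMap.comp_apply, LinearMap.comp_apply, act_mul_apply, act_mul_apply, ← h1,
      rTensor_extend, extend_rTensor, rTensor_act_evenPt hn]

lemma lin_dOp (f : M ⟶ N) (v : M.V) : lin f (M.dOp v) = N.dOp (lin f v) := lin_deriv f _ v

end SRep

end polynomialPoints

/-! ### Points of `OSp(1|2)` -/

section ospPoints

variable {k : Type u} [Field k] [CharZero k]

section mat

variable {A B : SAlg k}

/-- The matrix of a point of `OSp(1|2)`. -/
def mat (g : (OSp12 k).obj A) : Matrix (Fin 3) (Fin 3) A :=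
  ((show OSp12Pts k A from g) : (Matrix (Fin 3) (Fin 3) A)ˣ).1

lemma mat_isOSp (g : (OSp12 k).obj A) : IsOSp k (mat g) := (show OSp12Pts k A from g).2

lemma mat_mul (g h : (OSp12 k).obj A) : mat (g * h) = mat g * mat h := rfl

lemma mat_injective {g h : (OSp12 k).obj A} (e : mat g = mat h) : g = h :=
  Subtype.ext (Units.ext e)

lemma mat_map (f : A ⟶ B) (g : (OSp12 k).obj A) :
    mat ((OSp12 k).map f g) = (SAlg.algHom f).mapMatrix (mat g) := rfl

/-- The point `(1, D)` of the even subgroup `SL₂`, where `D = (a b; c d)`. -/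
def leviPt (a b c d : evenSub k A) (h : a * d - b * c = 1) : (OSp12 k).obj A := by
  have h0 : (a : A) * d - b * c = 1 := congrArg Subtype.val h
  have hc : ∀ x y : evenSub k A, (x : A) * y = y * x := fun x y => even_commute k x.2 y
  have h1 : (d : A) * a - b * c = 1 := by rw [hc d a]; exact h0
  have h2 : (a : A) * d - c * b = 1 := by rw [hc c b]; exact h0
  have h3 : (d : A) * a - c * b = 1 := by rw [hc c b]; exact h1
  refine (⟨⟨!![1, 0, 0; 0, (a : A), b; 0, c, d], !![1, 0, 0; 0, (d : A), -b; 0, -c, a], ?_, ?_⟩,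
    ?_⟩ : OSp12Pts k A)
  · ext i j
    fin_cases i <;> fin_cases j <;> simp [Matrix.mul_apply, Fin.sum_univ_three] <;>
      first | (rw [← sub_eq_add_neg]; assumption) |
        (rw [add_comm, ← sub_eq_add_neg]; assumption) | (rw [hc]; exact neg_add_cancel _) |
        (rw [hc]; exact add_neg_cancel _)
  · ext i j
    fin_cases i <;> fin_cases j <;> simp [Matrix.mul_apply, Fin.sum_univ_three] <;>
      first | (rw [← sub_eq_add_neg]; assumption) |
        (rw [add_comm, ← sub_eq_add_neg]; assumption) | (rw [hc]; exact neg_add_cancel _) |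
        (rw [hc]; exact add_neg_cancel _)
  · have he : ∀ i j, !![1, 0, 0; 0, (a : A), b; 0, c, d] i j ∈ gr k A (par i + par j) := by
      intro i j
      have := SuperCommAlgebra.one_mem (k := k) (A := A)
      have ha := a.2
      have hb := b.2
      have hc := c.2
      have hd := d.2
      fin_cases i <;> fin_cases j <;> simp [par, one_add_one] <;> assumption
    have hf : superTranspose k !![1, 0, 0; 0, (a : A), b; 0, c, d] * formMatrix A *
        !![1, 0, 0; 0, (a : A), b; 0, c, d] = formMatrix A := by
      ext i j
      fin_cases i <;> fin_cases j <;>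
        simp [Matrix.mul_apply, Fin.sum_univ_three, formMatrix, superTranspose, par, koszul,
          one_add_one]
      · rw [hc c a, neg_add_cancel]
      · rwa [add_comm, ← sub_eq_add_neg]
      · rw [← h1, neg_sub, sub_eq_neg_add]
      · rw [hc d b, neg_add_cancel]
    exact ⟨he, hf, by rw [berezinian_eq_one_iff k he hf]; simp⟩

lemma mat_leviPt (a b c d : evenSub k A) (h : a * d - b * c = 1) :
    mat (leviPt a b c d h) = !![1, 0, 0; 0, (a : A), b; 0, c, d] := rfl

variable (k) in
/-- The matrix of `exp(s y²)(1 + y σ)`, for the odd operator `y : e₂ ↦ e₀ ↦ -e₁ ↦ 0`. -/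
def negMatrix (A : SAlg k) : Ga11Pts k A →* Matrix (Fin 3) (Fin 3) A where
  toFun g := !![1, 0, -g.σ; -g.σ, 1, -g.s; 0, 0, 1]
  map_one' := by
    ext i j
    fin_cases i <;> fin_cases j <;> simp
  map_mul' g h := by
    ext i j
    fin_cases i <;> fin_cases j <;> simp [Matrix.mul_apply, Fin.sum_univ_three]
    all_goals abel

lemma negMatrix_isOSp (g : Ga11Pts k A) : IsOSp k (negMatrix k A g) := by
  have h1 : (1 : A) ∈ gr k A 0 := SuperCommAlgebra.one_mem
  have he : ∀ i j, negMatrix k A g i j ∈ gr k A (par i + par j) := by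
    intro i j
    fin_cases i <;> fin_cases j <;> simp [negMatrix, par, one_add_one, h1, g.hs, g.hσ]
  have hf : superTranspose k (negMatrix k A g) * formMatrix A * negMatrix k A g
      = formMatrix A := by
    have h2 := odd_sq k g.hσ
    ext i j
    fin_cases i <;> fin_cases j <;>
      simp [negMatrix, Matrix.mul_apply, Fin.sum_univ_three, formMatrix, superTranspose, par,
        koszul, h2]
  refine ⟨he, hf, ?_⟩
  rw [berezinian_eq_one_iff k he hf]
  simp [negMatrix]

variable (k) in
/-- The embedding of `G_a^{(1|1)}` in `OSp(1|2)` opposite to `emb`. -/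
def embNeg : Ga11 k ⟶ OSp12 k where
  app A := GrpCat.ofHom ((negMatrix k A).toHomUnits.codRestrict (OSp12Pts k A)
    fun g => negMatrix_isOSp g)
  naturality A B f := by
    ext g
    refine Subtype.ext (Units.ext ?_)
    change negMatrix k B _ = (SAlg.algHom f).mapMatrix (negMatrix k A g)
    ext i j
    fin_cases i <;> fin_cases j <;> simp [negMatrix] <;> rfl

lemma mat_emb (g : (Ga11 k).obj A) : mat ((emb k).app A g)
    = !![1, -Ga11Pts.σ (A := A) g, 0; 0, 1, 0; Ga11Pts.σ (A := A) g, Ga11Pts.s (A := A) g, 1] := rfl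

lemma mat_embNeg (g : (Ga11 k).obj A) : mat ((embNeg k).app A g)
    = !![1, 0, -Ga11Pts.σ (A := A) g; -Ga11Pts.σ (A := A) g, 1, -Ga11Pts.s (A := A) g; 0, 0, 1] :=
  rfl

end mat

/-- The point `diag(1, 1 + c, 1 - c)`, where `c` is even of square zero. -/
def torusPt {A : SAlg k} {c : A} (hc : c ∈ gr k A 0) (h2 : c * c = 0) : (OSp12 k).obj A :=
  leviPt (1 + ⟨c, hc⟩) 0 0 (1 - ⟨c, hc⟩) (by
    refine Subtype.ext ?_
    change (1 + c) * (1 - c) - 0 * 0 = 1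
    rw [mul_sub, add_mul, add_mul, h2]
    simp)

lemma mat_torusPt {A : SAlg k} {c : A} (hc : c ∈ gr k A 0) (h2 : c * c = 0) :
    mat (torusPt hc h2) = !![1, 0, 0; 0, 1 + c, 0; 0, 0, 1 - c] := rfl

lemma map_torusPt {A B : SAlg k} (f : A ⟶ B) {c : A} (hc : c ∈ gr k A 0) (h2 : c * c = 0)
    {c' : B} (hc' : c' ∈ gr k B 0) (h2' : c' * c' = 0) (h : SAlg.algHom f c = c') :
    (OSp12 k).map f (torusPt hc h2) = torusPt hc' h2' := by
  refine mat_injective ?_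
  rw [mat_map, mat_torusPt, mat_torusPt]
  ext i j
  fin_cases i <;> fin_cases j <;> simp [h]

lemma torusPt_zero {A : SAlg k} (hc : (0 : A) ∈ gr k A 0) (h2 : (0 : A) * 0 = 0) :
    torusPt hc h2 = 1 := by
  refine mat_injective ?_
  rw [mat_torusPt]
  change _ = (1 : Matrix (Fin 3) (Fin 3) A)
  ext i j
  fin_cases i <;> fin_cases j <;> simp

variable (k) in
/-- The tangent vector of the diagonal torus `diag(1, t, t⁻¹)` at `t = 1`. -/
def torusTangent : (OSp12 k).obj (dualAlg k k 0) :=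
  torusPt (dualInr_mem 1) (dualInr_mul_dualInr 1 1)

lemma map_torusTangent {A : SAlg k} {c : A} (hc : c ∈ gr k A 0) (h2 : c * c = 0) :
    (OSp12 k).map (dualHom hc h2) (torusTangent k) = torusPt hc h2 :=
  map_torusPt _ _ _ _ _ (by rw [dualHom_apply]; simp)

lemma map_dualAug_torusTangent : (OSp12 k).map (dualAug k 0) (torusTangent k) = 1 := by
  rw [torusTangent, map_torusPt (dualAug k 0) _ _ (zero_mem _) (zero_mul 0) rfl, torusPt_zero]

namespace SRep

variable (M : SRep (OSp12 k))

/-- The action of the odd lowering operator of `osp(1|2)`. -/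
def xOp : M.V →ₗ[k] M.V := dOp (resObj (emb k) M)

/-- The action of the odd raising operator of `osp(1|2)`. -/
def yOp : M.V →ₗ[k] M.V := dOp (resObj (embNeg k) M)

/-- The action of the Cartan element of `osp(1|2)`. -/
def hOp : M.V →ₗ[k] M.V := M.deriv (torusTangent k)

lemma act_emb_oddPt {A : SAlg k} {σ : A} (hσ : σ ∈ gr k A 1) (v : M.V) :
    M.act A ((emb k).app A (oddPt σ hσ)) v = v ⊗ₜ 1 + M.xOp v ⊗ₜ σ :=
  act_oddPt (resObj (emb k) M) hσ v

lemma act_embNeg_oddPt {A : SAlg k} {σ : A} (hσ : σ ∈ gr k A 1) (v : M.V) :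
    M.act A ((embNeg k).app A (oddPt σ hσ)) v = v ⊗ₜ 1 + M.yOp v ⊗ₜ σ :=
  act_oddPt (resObj (embNeg k) M) hσ v

lemma act_torusPt {A : SAlg k} {c : A} (hc : c ∈ gr k A 0) (h2 : c * c = 0) (v : M.V) :
    M.act A (torusPt hc h2) v = v ⊗ₜ 1 + M.hOp v ⊗ₜ c := by
  rw [hOp, ← act_dualHom M map_dualAug_torusTangent hc h2, map_torusTangent]

lemma emb_mul_embNeg {A : SAlg k} {σ τ : A} (hσ : σ ∈ gr k A 1) (hτ : τ ∈ gr k A 1) :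
    (emb k).app A (oddPt σ hσ) * (embNeg k).app A (oddPt τ hτ)
      = (embNeg k).app A (oddPt τ hτ) * (emb k).app A (oddPt σ hσ) *
        torusPt (odd_mul_odd k hσ hτ) (odd_prod_sq k hσ hτ) := by
  refine mat_injective ?_
  rw [mat_mul, mat_mul, mat_mul, mat_emb, mat_embNeg, mat_torusPt]
  change !![1, -σ, 0; 0, 1, 0; σ, 0, 1] * !![1, 0, -τ; -τ, 1, -0; 0, 0, 1]
    = !![1, 0, -τ; -τ, 1, -0; 0, 0, 1] * !![1, -σ, 0; 0, 1, 0; σ, 0, 1] *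
      !![1, 0, 0; 0, 1 + σ * τ, 0; 0, 0, 1 - σ * τ]
  have h1 := odd_anticomm k hτ hσ
  have h2 := odd_sq k hσ
  have h3 := odd_sq k hτ
  have h4 := odd_prod_sq k hσ hτ
  have h5 : σ * (σ * τ) = 0 := by rw [← mul_assoc, h2, zero_mul]
  have h6 : τ * (σ * τ) = 0 := by rw [← mul_assoc, h1, neg_mul, mul_assoc, h3]; simp
  ext i j
  fin_cases i <;> fin_cases j <;>
    simp [Matrix.mul_apply, Fin.sum_univ_three, mul_add, mul_sub, add_mul, h1, h4, h5, h6,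
      sub_eq_neg_add]

/-- `h` is the anticommutator of `x` and `y`: compare the coefficients of `στ` in
`emb_mul_embNeg`. -/
lemma x_y (v : M.V) : M.xOp (M.yOp v) = M.hOp v - M.yOp (M.xOp v) := by
  have h := congrArg (fun g => coef M.V Lam.top (M.act (Lam.alg k) g v))
    (emb_mul_embNeg (Lam.sig_mem (k := k)) Lam.tau_mem)
  have h2 : (Lam.sig * (Lam.sig * Lam.tau) : Lam.alg k) = 0 := by
    rw [← mul_assoc, odd_sq k Lam.sig_mem, zero_mul]
  have h3 : (Lam.tau * (Lam.sig * Lam.tau) : Lam.alg k) = 0 := by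
    rw [← mul_assoc, odd_anticomm k Lam.tau_mem Lam.sig_mem, neg_mul, mul_assoc,
      odd_sq k Lam.tau_mem, mul_zero, neg_zero]
  have h4 : (Lam.tau * Lam.sig * (Lam.sig * Lam.tau) : Lam.alg k) = 0 := by
    rw [mul_assoc, h2, mul_zero]
  simp only [act_mul_apply, act_emb_oddPt, act_embNeg_oddPt, act_torusPt, map_add, extend_tmul,
    rmul_tmul, coef_tmul, one_mul, mul_one, Lam.top_one, Lam.top_sig, Lam.top_tau,
    Lam.top_sig_tau, Lam.top_tau_sig, h2, h3, h4, map_zero, TensorProduct.tmul_zero,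
    zero_smul, zero_add, add_zero, one_smul, neg_smul] at h
  rw [h]; abel

/-- The superalgebra `k[ε, σ]` with `ε` even, `σ` odd and `ε² = σ² = 0`. The conjugate of an odd
point with parameter `σ` by the point `1 + ε` of the torus computes the commutator of `h` with
the odd operators. -/
abbrev epsSig (k : Type u) [Field k] : SAlg k := dualAlg k (DualNumber k) 1

lemma epsSig_even : dualInl k (DualNumber k) 1 DualNumber.eps ∈ gr k (epsSig k) 0 :=
  dualInl_mem _

lemma epsSig_odd (a : DualNumber k) : dualInr k (DualNumber k) 1 a ∈ gr k (epsSig k) 1 :=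
  dualInr_mem _

lemma epsSig_sq : dualInl k (DualNumber k) 1 DualNumber.eps *
    dualInl k (DualNumber k) 1 DualNumber.eps = (0 : epsSig k) := by
  rw [← map_mul, DualNumber.eps_mul_eps, map_zero]

lemma torusPt_mul_emb : torusPt epsSig_even epsSig_sq * (emb k).app (epsSig k)
      (oddPt (dualInr k (DualNumber k) 1 1) (epsSig_odd 1))
    = (emb k).app (epsSig k) (oddPt (dualInr k (DualNumber k) 1 (1 - DualNumber.eps))
      (epsSig_odd (1 - DualNumber.eps))) * torusPt epsSig_even epsSig_sq := by
  refine mat_injective ?_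
  rw [mat_mul, mat_mul, mat_emb, mat_emb, mat_torusPt]
  set e : epsSig k := dualInl k (DualNumber k) 1 DualNumber.eps
  set s : epsSig k := dualInr k (DualNumber k) 1 1
  set s' : epsSig k := dualInr k (DualNumber k) 1 (1 - DualNumber.eps)
  change !![1, 0, 0; 0, 1 + e, 0; 0, 0, 1 - e] * !![1, -s, 0; 0, 1, 0; s, 0, 1]
    = !![1, -s', 0; 0, 1, 0; s', 0, 1] * !![1, 0, 0; 0, 1 + e, 0; 0, 0, 1 - e]
  have h1 : (1 - e) * s = s' := dual_ext (by simp [e, s, s']) (by simp [e, s, s'])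
  have h2 : s' * (1 + e) = s := dual_ext (by simp [e, s, s'])
    (by simp [e, s, s', mul_add, sub_mul])
  ext i j
  fin_cases i <;> fin_cases j <;> simp [Matrix.mul_apply, Fin.sum_univ_three, h1, h2]

lemma torusPt_mul_embNeg : torusPt epsSig_even epsSig_sq * (embNeg k).app (epsSig k)
      (oddPt (dualInr k (DualNumber k) 1 1) (epsSig_odd 1))
    = (embNeg k).app (epsSig k) (oddPt (dualInr k (DualNumber k) 1 (1 + DualNumber.eps))
      (epsSig_odd (1 + DualNumber.eps))) * torusPt epsSig_even epsSig_sq := by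
  refine mat_injective ?_
  rw [mat_mul, mat_mul, mat_embNeg, mat_embNeg, mat_torusPt]
  set e : epsSig k := dualInl k (DualNumber k) 1 DualNumber.eps
  set s : epsSig k := dualInr k (DualNumber k) 1 1
  set s' : epsSig k := dualInr k (DualNumber k) 1 (1 + DualNumber.eps)
  change !![1, 0, 0; 0, 1 + e, 0; 0, 0, 1 - e] * !![1, 0, -s; -s, 1, -0; 0, 0, 1]
    = !![1, 0, -s'; -s', 1, -0; 0, 0, 1] * !![1, 0, 0; 0, 1 + e, 0; 0, 0, 1 - e]
  have h1 : (1 + e) * s = s' := dual_ext (by simp [e, s, s']) (by simp [e, s, s'])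
  have h2 : s' * (1 - e) = s := dual_ext (by simp [e, s, s'])
    (by simp [e, s, s', mul_sub, add_mul])
  ext i j
  fin_cases i <;> fin_cases j <;> simp [Matrix.mul_apply, Fin.sum_univ_three, h1, h2]

lemma hOp_comm_aux {c : k} {g g' : (OSp12 k).obj (epsSig k)} {z : M.V →ₗ[k] M.V}
    (hg : ∀ v, M.act _ g v = v ⊗ₜ 1 + z v ⊗ₜ dualInr k (DualNumber k) 1 1)
    (hg' : ∀ v, M.act _ g' v
      = v ⊗ₜ 1 + z v ⊗ₜ dualInr k (DualNumber k) 1 (1 + c • DualNumber.eps))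
    (e : torusPt epsSig_even epsSig_sq * g = g' * torusPt epsSig_even epsSig_sq) (v : M.V) :
    M.hOp (z v) = z (M.hOp v) + c • z v := by
  have h := congrArg (fun g => coef M.V ((TrivSqZeroExt.sndHom k k) ∘ₗ dualSnd k (DualNumber k) 1)
    (M.act (epsSig k) g v)) e
  simp only [act_mul_apply, hg, hg', act_torusPt, map_add, extend_tmul,
    rmul_tmul, coef_tmul, one_mul, mul_one, LinearMap.comp_apply, dualSnd_one, dualSnd_mul,
    dualSnd_inl, dualSnd_inr, dualFst_inl, dualFst_inr] at h
  simpa [add_comm] using h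

lemma h_x (v : M.V) : M.hOp (M.xOp v) = M.xOp (M.hOp v) - M.xOp v := by
  rw [hOp_comm_aux M (c := -1) (M.act_emb_oddPt (epsSig_odd 1))
    (by rw [neg_one_smul, ← sub_eq_add_neg]; exact M.act_emb_oddPt (epsSig_odd _))
    torusPt_mul_emb, neg_one_smul, sub_eq_add_neg]

lemma h_y (v : M.V) : M.hOp (M.yOp v) = M.yOp (M.hOp v) + M.yOp v := by
  rw [hOp_comm_aux M (c := 1) (M.act_embNeg_oddPt (epsSig_odd 1))
    (by rw [one_smul]; exact M.act_embNeg_oddPt (epsSig_odd _))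
    torusPt_mul_embNeg, one_smul]

end SRep

end ospPoints

/-! ### The action of `osp(1|2)` determines the morphisms of representations -/

section ospMorphisms

open Polynomial

variable {k : Type u} [Field k]

namespace SRep

section commutes

variable {G : Supergroup k} {M N : SRep G}

/-- The linear map `f` commutes with the action of the point `g`. -/
def Commutes (f : M.V →ₗ[k] N.V) {A : SAlg k} (g : G.obj A) : Prop :=
  ∀ v, f.rTensor A (M.act A g v) = N.act A g (f v)

variable {f : M.V →ₗ[k] N.V} {A B : SAlg k}

lemma Commutes.mul {g h : G.obj A} (hg : Commutes f g) (hh : Commutes f h) :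
    Commutes f (g * h) := fun v => by
  rw [act_mul_apply, act_mul_apply, ← hh, rTensor_extend, extend_rTensor]
  congr 2
  exact LinearMap.ext hg

lemma Commutes.map {g : G.obj A} (hg : Commutes f g) (φ : A ⟶ B) :
    Commutes f (G.map φ g) := fun v => by
  rw [M.act_map, N.act_map, LinearMap.comp_apply, LinearMap.comp_apply, ← hg, rTensor_lTensor]

lemma Commutes.of_map {g : G.obj A} {φ : A ⟶ B} (hφ : Function.Injective (SAlg.algHom φ))
    (hg : Commutes f (G.map φ g)) : Commutes f g := fun v => by
  have h := hg v
  rw [M.act_map, N.act_map, LinearMap.comp_apply, LinearMap.comp_apply, rTensor_lTensor] at h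
  exact Module.Flat.lTensor_preserves_injective_linearMap (M := N.V)
    (SAlg.algHom φ).toLinearMap hφ h

end commutes

variable [CharZero k]

section even

variable {R R' : Type u} [CommRing R] [Algebra k R] [CommRing R'] [Algebra k R']

/-- The points of `SL₂ ⊂ OSp(1|2)` over a commutative algebra. -/
def slPt (a b c d : R) (h : a * d - b * c = 1) : (OSp12 k).obj (evenAlg k R) :=
  leviPt ⟨toEven k R a, mem_evenAlg (R := R) _⟩ ⟨toEven k R b, mem_evenAlg (R := R) _⟩
    ⟨toEven k R c, mem_evenAlg (R := R) _⟩ ⟨toEven k R d, mem_evenAlg (R := R) _⟩ (Subtype.ext (by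
      change toEven k R a * toEven k R d - toEven k R b * toEven k R c = 1
      rw [← map_mul, ← map_mul, ← map_sub, h, map_one]))

lemma mat_slPt (a b c d : R) (h : a * d - b * c = 1) : mat (slPt (k := k) a b c d h)
    = !![1, 0, 0; 0, toEven k R a, toEven k R b; 0, toEven k R c, toEven k R d] := rfl

lemma slPt_mul {a b c d a' b' c' d' : R} (h : a * d - b * c = 1) (h' : a' * d' - b' * c' = 1)
    (h'' : (a * a' + b * c') * (c * b' + d * d') - (a * b' + b * d') * (c * a' + d * c') = 1) :
    slPt (k := k) a b c d h * slPt a' b' c' d' h'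
      = slPt (a * a' + b * c') (a * b' + b * d') (c * a' + d * c') (c * b' + d * d') h'' := by
  refine mat_injective ?_
  rw [mat_mul, mat_slPt, mat_slPt, mat_slPt]
  ext i j
  fin_cases i <;> fin_cases j <;> simp [Matrix.mul_apply, Fin.sum_univ_three]

lemma map_slPt (φ : R →ₐ[k] R') {a b c d : R} (h : a * d - b * c = 1) :
    (OSp12 k).map (evenHom (A := evenAlg k R') ((toEven k R').comp φ) fun _ => mem_evenAlg _)
      (slPt (k := k) a b c d h) = slPt (φ a) (φ b) (φ c) (φ d)
        (by rw [← map_mul, ← map_mul, ← map_sub, h, map_one]) := by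
  refine mat_injective ?_
  rw [mat_map, mat_slPt, mat_slPt]
  ext i j
  fin_cases i <;> fin_cases j <;> simp <;> rfl

end even

variable {M N : SRep (OSp12 k)} {f : M.V →ₗ[k] N.V}

lemma commutes_emb (he : IsEven f) (hx : ∀ v, f (M.xOp v) = N.xOp (f v)) {A : SAlg k}
    (g : (Ga11 k).obj A) : Commutes f ((emb k).app A g) := fun v =>
  LinearMap.congr_fun (lin_equivariant
    (homOfDOp (M := resObj (emb k) M) (N := resObj (emb k) N) f he hx) A g) v

lemma commutes_embNeg (he : IsEven f) (hy : ∀ v, f (M.yOp v) = N.yOp (f v)) {A : SAlg k}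
    (g : (Ga11 k).obj A) : Commutes f ((embNeg k).app A g) := fun v =>
  LinearMap.congr_fun (lin_equivariant
    (homOfDOp (M := resObj (embNeg k) M) (N := resObj (embNeg k) N) f he hy) A g) v

section sl

variable {R : Type u} [CommRing R] [Algebra k R]

lemma commutes_lower (he : IsEven f) (hx : ∀ v, f (M.xOp v) = N.xOp (f v)) (s : R)
    (h : (1 : R) * 1 - 0 * s = 1) : Commutes f (slPt (k := k) 1 0 s 1 h) := by
  have : slPt (k := k) 1 0 s 1 h = (emb k).app _ (evenPt (toEven k R s) (mem_evenAlg _)) := by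
    refine mat_injective ?_
    rw [mat_slPt, mat_emb]
    change _ = !![1, -0, 0; 0, 1, 0; 0, toEven k R s, 1]
    simp
  rw [this]
  exact commutes_emb he hx _

lemma commutes_upper (he : IsEven f) (hy : ∀ v, f (M.yOp v) = N.yOp (f v)) (s : R)
    (h : (1 : R) * 1 - s * 0 = 1) : Commutes f (slPt (k := k) 1 s 0 1 h) := by
  have : slPt (k := k) 1 s 0 1 h = (embNeg k).app _ (evenPt (toEven k R (-s)) (mem_evenAlg _)) := by
    refine mat_injective ?_
    rw [mat_slPt, mat_embNeg]
    change _ = !![1, 0, -0; -0, 1, -toEven k R (-s); 0, 0, 1]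
    simp
  rw [this]
  exact commutes_embNeg he hy _

/-- A matrix of determinant one whose lower left entry is invertible is a product of unipotent
matrices. -/
lemma commutes_bigCell (he : IsEven f) (hx : ∀ v, f (M.xOp v) = N.xOp (f v))
    (hy : ∀ v, f (M.yOp v) = N.yOp (f v)) {a b c d i : R} (hi : c * i = 1)
    (h : a * d - b * c = 1) : Commutes f (slPt (k := k) a b c d h) := by
  have h1 := commutes_upper (R := R) he hy ((a - 1) * i) (by ring)
  have h2 := commutes_lower (R := R) he hx c (by ring)
  have h3 := commutes_upper (R := R) he hy ((d - 1) * i) (by ring)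
  have h4 := (h1.mul h2).mul h3
  rw [slPt_mul _ _ (by ring), slPt_mul _ _ (by ring)] at h4
  convert h4 using 2
  · linear_combination (1 - a) * hi
  · linear_combination (-b - (a - 1) * (d - 1) * i) * hi - i * h
  · ring
  · linear_combination (1 - d) * hi

/-- The general case reduces to the previous one: multiply by the lower triangular matrix with
entry `T` over the localization of `R[T]` at the lower left entry `c + d T` of the product. -/
lemma commutes_slPt (he : IsEven f) (hx : ∀ v, f (M.xOp v) = N.xOp (f v))
    (hy : ∀ v, f (M.yOp v) = N.yOp (f v)) {a b c d : R}
    (h : a * d - b * c = 1) : Commutes f (slPt (k := k) a b c d h) := by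
  set P : R[X] := C c + C d * X with hP
  -- `a d - b c = 1`, so that `c` and `d` have no common annihilator
  have hreg : P ∈ nonZeroDivisors R[X] := by
    by_contra hn
    obtain ⟨r, hr, hr0⟩ := Polynomial.notMem_nonZeroDivisors_iff.1 hn
    have e0 := congrArg (coeff · 0) hr0
    have e1 := congrArg (coeff · 1) hr0
    simp [hP] at e0 e1
    exact hr (by linear_combination (-r) * h + a * e1 - b * e0)
  let R' := Localization.Away P
  let j : R →ₐ[k] R' := (IsScalarTower.toAlgHom k R[X] R').comp Polynomial.CAlgHom
  have hj : Function.Injective j := by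
    have h1 : Function.Injective (algebraMap R[X] R') :=
      IsLocalization.injective R' (Submonoid.powers_le.2 hreg)
    exact h1.comp Polynomial.C_injective
  let t : R' := algebraMap R[X] R' X
  have hP' : algebraMap R[X] R' P = j c + j d * t := by
    change algebraMap R[X] R' (C c + C d * X) = _
    rw [map_add, map_mul]; rfl
  obtain ⟨i, hi⟩ : ∃ i, (j c + j d * t) * i = 1 := by
    rw [← hP']
    exact ⟨_, IsLocalization.Away.mul_invSelf P⟩
  have hdet : j a * j d - j b * j c = 1 := by rw [← map_mul, ← map_mul, ← map_sub, h, map_one]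
  refine Commutes.of_map (φ := evenHom (A := evenAlg k R') ((toEven k R').comp j)
    fun _ => mem_evenAlg _) hj ?_
  rw [map_slPt]
  have h1 := commutes_bigCell (R := R') he hx hy (a := j a + j b * t) (b := j b) (d := j d) hi
    (by linear_combination hdet)
  have h2 := h1.mul (commutes_lower (R := R') he hx (-t) (by ring))
  rw [slPt_mul _ _ (by linear_combination hdet)] at h2
  convert h2 using 2
  · ring
  · ring
  · ring
  · ring

end sl

lemma commutes_leviPt (he : IsEven f) (hx : ∀ v, f (M.xOp v) = N.xOp (f v))
    (hy : ∀ v, f (M.yOp v) = N.yOp (f v)) {A : SAlg k} {a b c d : evenSub k A}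
    (h : a * d - b * c = 1) : Commutes f (leviPt a b c d h) := by
  have e : (OSp12 k).map (evenHom (A := A) (evenSub k A).val fun r => r.2) (slPt a b c d h)
      = leviPt a b c d h := by
    refine mat_injective ?_
    rw [mat_map, mat_slPt, mat_leviPt]
    ext i j
    fin_cases i <;> fin_cases j <;> simp <;> rfl
  rw [← e]
  exact (commutes_slPt he hx hy h).map _

/-- A point of `OSp(1|2)` that fixes the even basis vector lies in `SL₂`. -/
lemma exists_leviPt {A : SAlg k} {g : (OSp12 k).obj A} (h0 : mat g 0 0 = 1) (h1 : mat g 1 0 = 0)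
    (h2 : mat g 2 0 = 0) : ∃ (a b c d : evenSub k A) (h : a * d - b * c = 1),
      g = leviPt a b c d h := by
  have hf := (mat_isOSp g).form
  have he := (mat_isOSp g).even
  have e1 := congrFun (congrFun hf 0) 1
  have e2 := congrFun (congrFun hf 0) 2
  have e3 := congrFun (congrFun hf 1) 2
  simp [Matrix.mul_apply, Fin.sum_univ_three, formMatrix, superTranspose, par, koszul,
    one_add_one, h0, h1, h2] at e1 e2 e3
  simp [e1, e2] at e3
  refine ⟨⟨mat g 1 1, he 1 1⟩, ⟨mat g 1 2, he 1 2⟩, ⟨mat g 2 1, he 2 1⟩, ⟨mat g 2 2, he 2 2⟩,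
    Subtype.ext ?_, mat_injective ?_⟩
  · change mat g 1 1 * mat g 2 2 - mat g 1 2 * mat g 2 1 = 1
    rw [even_commute k (he 1 2 : _ ∈ gr k A 0), ← e3]
    abel
  · rw [mat_leviPt]
    ext i j
    fin_cases i <;> fin_cases j <;> simp [h0, h1, h2, e1, e2]

/-- Parity-preserving maps that commute with `x` and `y` are morphisms. The unipotent subgroups
`emb` and `embNeg` move the even basis vector to an arbitrary first column, hence together with
`SL₂` they generate. -/
lemma commutes_of_comm (he : IsEven f) (hx : ∀ v, f (M.xOp v) = N.xOp (f v))
    (hy : ∀ v, f (M.yOp v) = N.yOp (f v)) {A : SAlg k} (g : (OSp12 k).obj A) : Commutes f g := by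
  have h1 : mat g 1 0 ∈ gr k A 1 := (mat_isOSp g).even 1 0
  have h2 : mat g 2 0 ∈ gr k A 1 := (mat_isOSp g).even 2 0
  have h0 := (berezinian_eq_one_iff k (mat_isOSp g).even (mat_isOSp g).form).1 (mat_isOSp g).ber
  set p := mat g 1 0
  set q := mat g 2 0
  have hqp := odd_anticomm k h2 h1
  have hq := odd_sq k h2
  set g₁ := (embNeg k).app A (oddPt p h1) with hg₁
  set g₂ := (emb k).app A (oddPt (-q) (neg_mem h2)) with hg₂
  have m1 : mat g₁ = !![1, 0, -p; -p, 1, -0; 0, 0, 1] := rfl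
  have m2 : mat g₂ = !![1, -(-q), 0; 0, 1, 0; -q, 0, 1] := rfl
  have hqq : q * (p * q) = 0 := by rw [← mul_assoc, hqp, neg_mul, mul_assoc, hq]; simp
  have hp : mat g 1 0 = p := rfl
  have hq' : mat g 2 0 = q := rfl
  -- `g₂` clears the entry `q`, and then `g₁` the entry `p`
  have c0 : mat (g₂ * g) 0 0 = 1 := by
    rw [mat_mul, Matrix.mul_apply, Fin.sum_univ_three, m2, h0, hp, hq']
    simp [hqp]
  have c1 : mat (g₂ * g) 1 0 = p := by
    rw [mat_mul, Matrix.mul_apply, Fin.sum_univ_three, m2, hp]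
    simp
  have c2 : mat (g₂ * g) 2 0 = 0 := by
    rw [mat_mul, Matrix.mul_apply, Fin.sum_univ_three, m2, h0, hp, hq']
    simp [mul_add, hqq]
  obtain ⟨a, b, c, d, h, e⟩ := exists_leviPt (g := g₁ * (g₂ * g))
    (by rw [mat_mul, Matrix.mul_apply, Fin.sum_univ_three, m1, c0, c1, c2]; simp)
    (by rw [mat_mul, Matrix.mul_apply, Fin.sum_univ_three, m1, c0, c1, c2]; simp)
    (by rw [mat_mul, Matrix.mul_apply, Fin.sum_univ_three, m1, c0, c1, c2]; simp)
  have e' : g = g₂⁻¹ * (g₁⁻¹ * leviPt a b c d h) := by rw [← e]; group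
  rw [e', hg₁, hg₂, ← map_inv, ← map_inv]
  exact (commutes_emb he hx _).mul ((commutes_embNeg he hy _).mul (commutes_leviPt he hx hy h))

end SRep

end ospMorphisms

/-! ### Linear algebra of `osp(1|2)`-modules -/

section ospLinear

open Module Module.End

variable {K V : Type*} [Field K] [CharZero K] [AddCommGroup V] [Module K V]
  [FiniteDimensional K V]

/-- Two operators generating an action of `osp(1|2)`: for `h = xy + yx`, the relations say that
`[h, x] = -x` and `[h, y] = y`. -/
structure IsOspPair (x y : End K V) : Prop where
  y_x_x (v : V) : y (x (x v)) = x (x (y v)) - x v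
  x_y_y (v : V) : x (y (y v)) = y (y (x v)) + y v

namespace IsOspPair

variable {x y : End K V}

lemma x_mul_comm (H : IsOspPair x y) : x * (x * y - y * x) = (1 - (x * y - y * x)) * x := by
  ext v
  simp [H.y_x_x]
  abel

lemma y_mul_comm (H : IsOspPair x y) : y * (x * y - y * x) = (1 - (x * y - y * x)) * y := by
  ext v
  simp [H.x_y_y]
  abel

end IsOspPair

lemma exists_isCompl_ker_range_pow {K V : Type*} [Field K] [AddCommGroup V] [Module K V]
    [FiniteDimensional K V] (R : End K V) :
    ∃ n : ℕ, IsCompl (LinearMap.ker (R ^ (n + 1))) (LinearMap.range (R ^ (n + 1))) := by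
  obtain ⟨n, hn⟩ := Filter.eventually_atTop.1 (LinearMap.eventually_isCompl_ker_pow_range_pow R)
  exact ⟨n, hn (n + 1) (Nat.le_succ n)⟩

lemma mapsTo_maxGenEigenspace {x R : End K V} (h : x * R = (1 - R) * x) (μ : K) {v : V}
    (hv : v ∈ maxGenEigenspace R μ) : x v ∈ maxGenEigenspace R (1 - μ) := by
  rw [mem_maxGenEigenspace] at hv ⊢
  obtain ⟨n, hn⟩ := hv
  refine ⟨n, ?_⟩
  have h1 : (R - (1 - μ) • (1 : End K V)) * x = -(x * (R - μ • (1 : End K V))) := by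
    rw [mul_sub, h, sub_smul, one_smul]
    simp only [sub_mul, one_mul, smul_mul_assoc, mul_smul_comm, mul_one]
    abel
  have h2 : ∀ n : ℕ, ∃ c : K, (R - (1 - μ) • (1 : End K V)) ^ n * x
      = c • (x * (R - μ • (1 : End K V)) ^ n) := fun n => by
    induction n with
    | zero => exact ⟨1, by simp⟩
    | succ n ih =>
      obtain ⟨c, hc⟩ := ih
      refine ⟨-c, ?_⟩
      rw [pow_succ, mul_assoc, h1, mul_neg, ← mul_assoc, hc, smul_mul_assoc, mul_assoc,
        ← pow_succ, neg_smul]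
  obtain ⟨c, hc⟩ := h2 n
  rw [← Module.End.mul_apply, hc, LinearMap.smul_apply, Module.End.mul_apply, hn, map_zero,
    smul_zero]

lemma trace_restrict_maxGenEigenspace (R : End K V) (μ : K)
    (h : ∀ v ∈ maxGenEigenspace R μ, R v ∈ maxGenEigenspace R μ) :
    LinearMap.trace K _ (R.restrict h) = μ * finrank K (maxGenEigenspace R μ) := by
  have h1 : IsNilpotent (R.restrict h - algebraMap K _ μ) := by
    have := isNilpotent_restrict_maxGenEigenspace_sub_algebraMap R μ
    exact this
  have h2 := (LinearMap.isNilpotent_trace_of_isNilpotent h1).eq_zero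
  rw [map_sub, sub_eq_zero] at h2
  rw [h2, Algebra.algebraMap_eq_smul_one, map_smul, LinearMap.trace_one, smul_eq_mul]

namespace IsOspPair

variable {x y : End K V}

/-- The operator `[x, y] = xy - yx` does not have the eigenvalue `1`: the operators `x` and `y`
exchange its generalized eigenspaces for `1` and `0`, so that the traces of `xy - yx` on the two
are opposite. -/
lemma maxGenEigenspace_one (H : IsOspPair x y) : maxGenEigenspace (x * y - y * x) (1 : K) = ⊥ := by
  set R := x * y - y * x with hR
  have hx1 : ∀ v ∈ maxGenEigenspace R (1 : K), x v ∈ maxGenEigenspace R (0 : K) := fun v hv => by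
    simpa using mapsTo_maxGenEigenspace H.x_mul_comm 1 hv
  have hy1 : ∀ v ∈ maxGenEigenspace R (1 : K), y v ∈ maxGenEigenspace R (0 : K) := fun v hv => by
    simpa using mapsTo_maxGenEigenspace H.y_mul_comm 1 hv
  have hx0 : ∀ v ∈ maxGenEigenspace R (0 : K), x v ∈ maxGenEigenspace R (1 : K) := fun v hv => by
    simpa using mapsTo_maxGenEigenspace H.x_mul_comm 0 hv
  have hy0 : ∀ v ∈ maxGenEigenspace R (0 : K), y v ∈ maxGenEigenspace R (1 : K) := fun v hv => by
    simpa using mapsTo_maxGenEigenspace H.y_mul_comm 0 hv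
  have e1 := trace_restrict_maxGenEigenspace R 1 (fun v hv => by
    exact sub_mem (hx0 _ (hy1 _ hv)) (hy0 _ (hx1 _ hv)))
  have e0 := trace_restrict_maxGenEigenspace R 0 (fun v hv => by
    exact sub_mem (hx1 _ (hy0 _ hv)) (hy1 _ (hx0 _ hv)))
  have s1 : R.restrict (fun v hv => by
      exact sub_mem (hx0 _ (hy1 _ hv)) (hy0 _ (hx1 _ hv)) :
      ∀ v ∈ maxGenEigenspace R (1 : K), R v ∈ maxGenEigenspace R (1 : K))
      = x.restrict hx0 ∘ₗ y.restrict hy1 - y.restrict hy0 ∘ₗ x.restrict hx1 := rfl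
  have s0 : R.restrict (fun v hv => by
      exact sub_mem (hx1 _ (hy0 _ hv)) (hy1 _ (hx0 _ hv)) :
      ∀ v ∈ maxGenEigenspace R (0 : K), R v ∈ maxGenEigenspace R (0 : K))
      = x.restrict hx1 ∘ₗ y.restrict hy0 - y.restrict hy1 ∘ₗ x.restrict hx0 := rfl
  rw [s1, map_sub] at e1
  rw [s0, map_sub, LinearMap.trace_comp_comm' (y.restrict hy0),
    LinearMap.trace_comp_comm' (x.restrict hx0)] at e0
  have : (finrank K (maxGenEigenspace R (1 : K)) : K) = 0 := by linear_combination -e1 - e0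
  exact Submodule.finrank_eq_zero.1 (Nat.cast_eq_zero.1 this)

lemma injective_one_sub (H : IsOspPair x y) :
    Function.Injective (1 - (x * y - y * x) : End K V) := by
  rw [← LinearMap.ker_eq_bot, eq_bot_iff, ← H.maxGenEigenspace_one]
  intro v hv
  rw [mem_maxGenEigenspace]
  refine ⟨1, ?_⟩
  rw [pow_one, one_smul, ← neg_sub, LinearMap.neg_apply, LinearMap.mem_ker.1 hv, neg_zero]

lemma injective_one_sub_pow (H : IsOspPair x y) (n : ℕ) :
    Function.Injective ((1 - (x * y - y * x) : End K V) ^ n) := by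
  rw [Module.End.coe_pow]
  exact H.injective_one_sub.iterate n

lemma x_mul_pow (H : IsOspPair x y) (n : ℕ) :
    x * (x * y - y * x) ^ n = (1 - (x * y - y * x)) ^ n * x := by
  exact (SemiconjBy.pow_right (show SemiconjBy x _ _ from H.x_mul_comm) n).eq

lemma y_mul_pow (H : IsOspPair x y) (n : ℕ) :
    y * (x * y - y * x) ^ n = (1 - (x * y - y * x)) ^ n * y := by
  exact (SemiconjBy.pow_right (show SemiconjBy y _ _ from H.y_mul_comm) n).eq

/-- The kernel of `x` is spanned by invariants and elements of the image of `x`. The operator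
`R = xy - yx` satisfies `x R = (1 - R) x` and `y R = (1 - R) y`, where `1 - R` is injective, so that
`x` and `y` kill the generalized kernel of `R`. The other Fitting component is in the image of `R`,
and `R` agrees with `xy` on the kernel of `x`. -/
lemma exists_invariant (H : IsOspPair x y) {v : V} (hv : x v = 0) :
    ∃ w u, v = w + x u ∧ x w = 0 ∧ y w = 0 := by
  set R := x * y - y * x with hR
  obtain ⟨n, hn⟩ := exists_isCompl_ker_range_pow R
  have htop : v ∈ LinearMap.ker (R ^ (n + 1)) ⊔ LinearMap.range (R ^ (n + 1)) := by
    rw [hn.sup_eq_top]; trivial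
  obtain ⟨w, hw, _, ⟨u, rfl⟩, rfl⟩ := Submodule.mem_sup.1 htop
  have hw' : (R ^ (n + 1)) w = 0 := hw
  have hxw : x w = 0 := H.injective_one_sub_pow (n + 1) (by
    rw [← Module.End.mul_apply, ← H.x_mul_pow, Module.End.mul_apply, hw', map_zero, map_zero])
  have hyw : y w = 0 := H.injective_one_sub_pow (n + 1) (by
    rw [← Module.End.mul_apply, ← H.y_mul_pow, Module.End.mul_apply, hw', map_zero, map_zero])
  rw [map_add, hxw, zero_add, pow_succ', Module.End.mul_apply, ← Module.End.mul_apply,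
    H.x_mul_comm, Module.End.mul_apply] at hv
  have hv' : x ((R ^ n) u) = 0 := H.injective_one_sub (by rw [hv, map_zero])
  refine ⟨w, y ((R ^ n) u), ?_, hxw, hyw⟩
  rw [pow_succ', Module.End.mul_apply]
  nth_rewrite 1 [hR]
  rw [LinearMap.sub_apply, Module.End.mul_apply, Module.End.mul_apply, hv', map_zero, sub_zero]

/-- An invariant in the image of `x` vanishes: such a vector `x u` lies in the kernel of
`R = xy - yx`, while `x` kills the generalized kernel of `R` and maps the other Fitting component
to itself. -/
lemma invariant_eq_zero (H : IsOspPair x y) {u : V} (hx : x (x u) = 0) (hy : y (x u) = 0) :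
    x u = 0 := by
  set R := x * y - y * x with hR
  obtain ⟨n, hn⟩ := exists_isCompl_ker_range_pow R
  have hRw : R (x u) = 0 := by
    rw [hR, LinearMap.sub_apply, Module.End.mul_apply, Module.End.mul_apply, hx, hy, map_zero,
      map_zero, sub_zero]
  have htop : u ∈ LinearMap.ker (R ^ (n + 1)) ⊔ LinearMap.range (R ^ (n + 1)) := by
    rw [hn.sup_eq_top]; trivial
  obtain ⟨w, hw, _, ⟨z, rfl⟩, rfl⟩ := Submodule.mem_sup.1 htop
  have hw' : (R ^ (n + 1)) w = 0 := hw
  have hxw : x w = 0 := H.injective_one_sub_pow (n + 1) (by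
    rw [← Module.End.mul_apply, ← H.x_mul_pow, Module.End.mul_apply, hw', map_zero, map_zero])
  rw [map_add, hxw, zero_add] at hRw ⊢
  obtain ⟨z, rfl⟩ := (LinearMap.injective_iff_surjective.1 (H.injective_one_sub_pow (n + 1))) z
  have hc : Commute R ((1 - R) ^ (n + 1)) :=
    ((Commute.one_right R).sub_right (Commute.refl R)).pow_right _
  have e : x ((R ^ (n + 1)) (((1 - R) ^ (n + 1)) z)) = ((1 - R) ^ (n + 1)) ((R ^ (n + 1)) (x z)) := by
    have h1 : SemiconjBy x (1 - R) R := by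
      change x * (1 - R) = R * x
      rw [mul_sub, H.x_mul_comm, ← hR]
      noncomm_ring
    have h2 : x * (1 - R) ^ (n + 1) = R ^ (n + 1) * x := (h1.pow_right (n + 1)).eq
    calc x ((R ^ (n + 1)) (((1 - R) ^ (n + 1)) z))
        = (x * R ^ (n + 1)) (((1 - R) ^ (n + 1)) z) := rfl
      _ = ((1 - R) ^ (n + 1)) ((x * (1 - R) ^ (n + 1)) z) := by rw [H.x_mul_pow]; rfl
      _ = _ := by rw [h2]; rfl
  rw [e] at hRw ⊢
  rw [← Module.End.mul_apply, hc.eq, Module.End.mul_apply] at hRw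
  have h1 : R ((R ^ (n + 1)) (x z)) = 0 := H.injective_one_sub_pow (n + 1) (by rw [hRw, map_zero])
  have h2 : (R ^ (n + 1)) (x z) ∈ LinearMap.ker (R ^ (n + 1)) := by
    rw [LinearMap.mem_ker]
    nth_rewrite 1 [pow_succ]
    rw [Module.End.mul_apply, h1, map_zero]
  rw [Submodule.disjoint_def.1 hn.disjoint _ h2 ⟨_, rfl⟩, map_zero]

end IsOspPair

end ospLinear

/-! ### Supertraces -/

section supertrace

open Module

variable {k : Type u} [Field k] [CharZero k]
variable {V W U : Type u} [AddCommGroup V] [Module k V] [AddCommGroup W] [Module k W]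
  [AddCommGroup U] [Module k U] [SuperSpace k V] [SuperSpace k W] [SuperSpace k U]

lemma parityOp_parityOp (v : V) : parityOp k V (parityOp k V v) = v := by
  refine hom_induction (k := k) (p := fun v => parityOp k V (parityOp k V v) = v)
    (fun a b ha hb => by rw [map_add, map_add, ha, hb]) (fun i v hv => ?_) v
  rw [parityOp_apply hv, map_smul, parityOp_apply hv, smul_smul, koszul_mul_self, one_smul]

lemma parityOp_comm_even {f : V →ₗ[k] W} (hf : IsEven f) (v : V) :
    parityOp k W (f v) = f (parityOp k V v) := by
  refine hom_induction (k := k) (p := fun v => parityOp k W (f v) = f (parityOp k V v))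
    (fun a b ha hb => by simp only [map_add, ha, hb]) (fun i v hv => ?_) v
  rw [parityOp_apply hv, map_smul, parityOp_apply (hf i v hv)]

lemma isEven_of_parityOp_comm {f : V →ₗ[k] W}
    (h : ∀ v, parityOp k W (f v) = f (parityOp k V v)) : IsEven f := by
  intro i v hv
  have h1 := h v
  obtain ⟨a, ha, b, hb, hab⟩ := exists_decomp (k := k) (f v)
  rw [parityOp_apply hv, map_smul, ← hab, map_add, parityOp_apply ha, parityOp_apply hb,
    koszul_zero_left, koszul_one_one, one_smul, neg_one_smul] at h1
  rw [← hab]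
  rcases zmod_two i with rfl | rfl
  · rw [koszul_zero_left, one_smul] at h1
    have : (2 : k) • b = 0 := by
      have h2 : -b = b := add_left_cancel h1
      rw [two_smul]
      nth_rewrite 1 [← h2]
      exact neg_add_cancel b
    rw [(smul_eq_zero.1 this).resolve_left two_ne_zero, add_zero]
    exact ha
  · rw [koszul_one_one, neg_one_smul] at h1
    have : (2 : k) • a = 0 := by
      rw [neg_add] at h1
      have h2 : a = -a := add_right_cancel h1
      rw [two_smul]
      nth_rewrite 1 [h2]
      exact neg_add_cancel a
    rw [(smul_eq_zero.1 this).resolve_left two_ne_zero, zero_add]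
    exact hb

lemma parityOp_anticomm_odd {x : V →ₗ[k] V} (hx : IsOdd x) (v : V) :
    parityOp k V (x v) = -x (parityOp k V v) := by
  refine hom_induction (k := k) (p := fun v => parityOp k V (x v) = -x (parityOp k V v))
    (fun a b ha hb => by simp only [map_add, ha, hb, neg_add]) (fun i v hv => ?_) v
  rw [parityOp_apply hv, map_smul, parityOp_apply (hx i v hv)]
  rcases zmod_two i with rfl | rfl <;> simp [koszul, one_add_one]

variable (k) in
/-- The supertrace. -/
def str (f : V →ₗ[k] V) : k := LinearMap.trace k V (parityOp k V ∘ₗ f)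

lemma trace_eq_sum_coord {ι : Type*} [Fintype ι] [DecidableEq ι] (b : Basis ι k V)
    (f : V →ₗ[k] V) : LinearMap.trace k V f = ∑ i, b.coord i (f (b i)) := by
  rw [LinearMap.trace_eq_matrix_trace k b, Matrix.trace]
  simp [LinearMap.toMatrix_apply]

/-- Evaluation after the symmetry is contraction twisted by the parity operator. -/
lemma contract_superBraid (x : V ⊗[k] Dual k V) :
    contractLeft k V (superBraid k V (Dual k V) x)
      = contractLeft k V (TensorProduct.comm k V (Dual k V)
        ((parityOp k V).rTensor _ x)) := by
  have : contractLeft k V ∘ₗ superBraid k V (Dual k V) = contractLeft k V ∘ₗ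
      (TensorProduct.comm k V (Dual k V)).toLinearMap ∘ₗ (parityOp k V).rTensor _ := by
    refine tensor_super_ext fun i j v hv ξ hξ => ?_
    simp only [LinearMap.comp_apply, superBraid_tmul hv hξ, LinearMap.rTensor_tmul,
      parityOp_apply hv, map_smul, LinearEquiv.coe_coe, TensorProduct.comm_tmul,
      contractLeft_apply, TensorProduct.smul_tmul', LinearMap.smul_apply]
    by_cases h : i = j
    · rw [h]
    · have : ξ v = 0 := (Submodule.mem_dualAnnihilator ξ).1 hξ v (by
        have hij : i = j + 1 := by clear hv hξ; revert i j; decide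
        rwa [← hij])
      rw [this, smul_zero, smul_zero]
  exact LinearMap.congr_fun this x

namespace SRep

variable {G : Supergroup k}

/-- The categorical trace is the supertrace. -/
lemma lin_trace {M : SRep G} (f : M ⟶ M) : lin (trace f) (1 : k) = str k (lin f) := by
  classical
  have h : lin (trace f) (1 : k) = contractLeft k M.V (superBraid k M.V (Dual k M.V)
      ((lin f).rTensor (Dual k M.V) (coevaluation k M.V 1))) := rfl
  rw [h, contract_superBraid, coevaluation_apply_one, str,
    trace_eq_sum_coord (Basis.ofVectorSpace k M.V)]
  simp [map_sum]

lemma negligible_iff_str {M N : SRep G} (f : M ⟶ N) :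
    Negligible f ↔ ∀ g : N ⟶ M, str k (lin g ∘ₗ lin f) = 0 := by
  refine forall_congr' fun g => ?_
  rw [← lin_comp, ← lin_trace]
  constructor
  · intro h; rw [h]; rfl
  · intro h
    refine hom_ext (LinearMap.ext_ring ?_)
    rw [h]; rfl

end SRep

/-- Every functional on a space of linear maps is a trace pairing. -/
lemma trace_pairing [Module.Finite k V] (φ : (V →ₗ[k] W) →ₗ[k] k) :
    ∃ s : W →ₗ[k] V, ∀ f : V →ₗ[k] W, φ f = LinearMap.trace k V (s ∘ₗ f) := by
  classical
  let b := Basis.ofVectorSpace k V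
  refine ⟨∑ i, (φ ∘ₗ LinearMap.smulRightₗ (b.coord i)).smulRight (b i), fun f => ?_⟩
  rw [trace_eq_sum_coord b]
  have hf : f = ∑ i, (b.coord i).smulRight (f (b i)) := by
    refine b.ext fun j => ?_
    simp [Finsupp.single_apply]
  nth_rewrite 1 [hf]
  simp [map_sum, Finsupp.single_apply]

lemma eq_zero_of_trace [Module.Finite k V] {s : W →ₗ[k] V}
    (h : ∀ f : V →ₗ[k] W, LinearMap.trace k V (s ∘ₗ f) = 0) : s = 0 := by
  classical
  let b := Basis.ofVectorSpace k V
  refine LinearMap.ext fun w => b.ext_elem fun j => ?_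
  have h1 := h ((b.coord j).smulRight w)
  rw [trace_eq_sum_coord b] at h1
  rw [Finset.sum_eq_single j (fun i _ hi => by simp [Finsupp.single_apply, hi]) (by simp)] at h1
  simpa using h1

end supertrace

/-! ### Restriction followed by semisimplification is fully faithful -/

section fullyFaithful

open Module

variable {k : Type u} [Field k] [CharZero k]
variable {V W : Type u} [AddCommGroup V] [Module k V] [AddCommGroup W] [Module k W]
  [SuperSpace k V] [SuperSpace k W]

variable (k V W) in
/-- Conjugation by the parity operators; `f` is even if it is fixed, odd if it changes sign. -/
def conjParity : (V →ₗ[k] W) →ₗ[k] (V →ₗ[k] W) where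
  toFun f := parityOp k W ∘ₗ f ∘ₗ parityOp k V
  map_add' f g := by ext; simp
  map_smul' c f := by ext; simp

lemma conjParity_apply (f : V →ₗ[k] W) (v : V) :
    conjParity k V W f v = parityOp k W (f (parityOp k V v)) := rfl

lemma conjParity_conjParity (f : V →ₗ[k] W) : conjParity k V W (conjParity k V W f) = f := by
  ext v
  rw [conjParity_apply, conjParity_apply, parityOp_parityOp, parityOp_parityOp]

lemma conjParity_of_even {f : V →ₗ[k] W} (hf : IsEven f) : conjParity k V W f = f := by
  ext v
  rw [conjParity_apply, parityOp_comm_even hf, parityOp_parityOp]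

lemma isEven_of_conjParity {f : V →ₗ[k] W} (h : conjParity k V W f = f) : IsEven f :=
  isEven_of_parityOp_comm fun v => by
    nth_rewrite 1 [← h]
    rw [conjParity_apply, parityOp_parityOp]

/-- The supercommutator `f ↦ x f - (-1)^{|f|} f x` with odd operators `x` on source and target. -/
def superComm (xW : End k W) (xV : End k V) : End k (V →ₗ[k] W) where
  toFun f := xW ∘ₗ f - conjParity k V W f ∘ₗ xV
  map_add' f g := by rw [LinearMap.comp_add, map_add, LinearMap.add_comp]; abel
  map_smul' c f := by
    rw [LinearMap.comp_smul, map_smul, LinearMap.smul_comp, ← smul_sub, RingHom.id_apply]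

lemma superComm_apply (xW : End k W) (xV : End k V) (f : V →ₗ[k] W) (v : V) :
    superComm xW xV f v = xW (f v) - parityOp k W (f (parityOp k V (xV v))) := rfl

lemma superComm_conjParity {xW : End k W} {xV : End k V} (hW : IsOdd xW) (hV : IsOdd xV)
    (f : V →ₗ[k] W) :
    superComm xW xV (conjParity k V W f) = -conjParity k V W (superComm xW xV f) := by
  ext v
  simp only [superComm_apply, conjParity_apply, LinearMap.neg_apply, map_sub, parityOp_parityOp,
    parityOp_anticomm_odd hW, parityOp_anticomm_odd hV, map_neg]
  abel

lemma IsOspPair.superComm {xW yW : End k W} {xV yV : End k V} (HW : IsOspPair xW yW)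
    (HV : IsOspPair xV yV) (hxW : IsOdd xW) (hyW : IsOdd yW) (hxV : IsOdd xV) (hyV : IsOdd yV) :
    IsOspPair (superComm xW xV) (SuperRep.superComm yW yV) := by
  constructor <;> intro f <;> ext v <;>
  · simp only [superComm_apply, LinearMap.sub_apply, LinearMap.add_apply, map_sub, map_neg,
      parityOp_parityOp, parityOp_anticomm_odd hxW, parityOp_anticomm_odd hxV,
      parityOp_anticomm_odd hyW, parityOp_anticomm_odd hyV, HW.y_x_x, HW.x_y_y, HV.y_x_x,
      HV.x_y_y, map_add]
    abel

namespace SRep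

variable (M N : SRep (OSp12 k))

lemma isOdd_dOp (X : SRep (Ga11 k)) : IsOdd X.dOp := fun _ _ hv => X.dOp_mem hv

lemma isOdd_xOp : IsOdd M.xOp := isOdd_dOp _
lemma isOdd_yOp : IsOdd M.yOp := isOdd_dOp _

lemma isOspPair : IsOspPair M.xOp M.yOp := by
  have hh : ∀ v, M.hOp v = M.xOp (M.yOp v) + M.yOp (M.xOp v) := fun v => by
    rw [M.x_y]; abel
  constructor <;> intro v
  · have h := M.h_x v
    rw [hh, hh, map_add] at h
    have h' := eq_sub_of_add_eq' h
    rw [h']; abel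
  · have h := M.h_y v
    rw [hh, hh, map_add] at h
    have h' := eq_sub_of_add_eq h
    rw [h']; abel

variable {M N}

lemma superComm_eq_zero {X Y : SRep (Ga11 k)} {f : X.V →ₗ[k] Y.V} (he : IsEven f) :
    superComm Y.dOp X.dOp f = 0 ↔ ∀ v, f (X.dOp v) = Y.dOp (f v) := by
  have h : ∀ v, superComm Y.dOp X.dOp f v = Y.dOp (f v) - f (X.dOp v) := fun v => by
    rw [superComm_apply, parityOp_comm_even he, parityOp_parityOp]
  rw [LinearMap.ext_iff]
  simp only [h, LinearMap.zero_apply, sub_eq_zero]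
  exact forall_congr' fun v => eq_comm

/-- The supercommutator of the odd tangent vector with an odd map is negligible. -/
lemma negligible_superComm {X Y : SRep (Ga11 k)} (f : X ⟶ Y) {u : X.V →ₗ[k] Y.V}
    (hu : conjParity k _ _ u = -u) (hf : lin f = superComm Y.dOp X.dOp u) : Negligible f := by
  rw [negligible_iff_str]
  intro g
  have hg : ∀ v, lin g (Y.dOp v) = X.dOp (lin g v) := lin_dOp g
  have e : parityOp k X.V ∘ₗ lin g ∘ₗ lin f
      = (parityOp k X.V ∘ₗ lin g ∘ₗ u) ∘ₗ X.dOp - X.dOp ∘ₗ (parityOp k X.V ∘ₗ lin g ∘ₗ u) := by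
    ext v
    have h1 : superComm Y.dOp X.dOp u v = Y.dOp (u v) - conjParity k _ _ u (X.dOp v) := rfl
    rw [LinearMap.comp_apply, LinearMap.comp_apply, hf, h1, hu]
    simp [hg, parityOp_anticomm_odd (isOdd_dOp X)]
    abel
  rw [str, e, map_sub, LinearMap.trace_comp_comm', sub_self]

lemma half_add_half {E : Type*} [AddCommGroup E] [Module k E] (a : E) :
    (2⁻¹ : k) • (a + a) = a := by
  rw [← two_smul k, smul_smul, inv_mul_cancel₀ two_ne_zero, one_smul]

/-- Every morphism between restrictions from `OSp(1|2)` is equivariant up to a negligible one. -/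
lemma exists_res_map (f : (res (emb k)).obj M ⟶ (res (emb k)).obj N) :
    ∃ g : M ⟶ N, Negligible (f - (res (emb k)).map g) := by
  set l : M.V →ₗ[k] N.V := lin (M := resObj (emb k) M) (N := resObj (emb k) N) f
  have hl : IsEven l := lin_even (M := resObj (emb k) M) (N := resObj (emb k) N) f
  have H := IsOspPair.superComm N.isOspPair M.isOspPair N.isOdd_xOp N.isOdd_yOp M.isOdd_xOp
    M.isOdd_yOp
  -- `l` is killed by the supercommutator with `x`, hence `l = w + [x, u]` with `w` invariant
  obtain ⟨w, u, hwu, hxw, hyw⟩ := H.exists_invariant (v := l)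
    ((superComm_eq_zero (X := resObj (emb k) M) (Y := resObj (emb k) N) hl).2
      (lin_dOp (M := resObj (emb k) M) (N := resObj (emb k) N) f))
  -- replace `w` by its even part and `u` by its odd part
  set w' := (2⁻¹ : k) • (w + conjParity k M.V N.V w) with hw'
  set u' := (2⁻¹ : k) • (u - conjParity k M.V N.V u) with hu'
  have e1 : l = w' + superComm N.xOp M.xOp u' := by
    have h := conjParity_of_even hl
    rw [hwu, map_add, ← neg_eq_iff_eq_neg.2
      (superComm_conjParity N.isOdd_xOp M.isOdd_xOp u)] at h
    rw [← half_add_half (k := k) l, hw', hu', map_smul, ← smul_add, map_sub]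
    congr 1
    exact (congrArg₂ (· + ·) hwu (hwu.trans h.symm)).trans (by abel)
  have hcw : conjParity k M.V N.V w' = w' := by
    rw [hw', map_smul, map_add, conjParity_conjParity, add_comm]
  have hcu : conjParity k M.V N.V u' = -u' := by
    rw [hu', map_smul, map_sub, conjParity_conjParity, ← smul_neg, neg_sub]
  have hew : IsEven w' := isEven_of_conjParity hcw
  have hx' : superComm N.xOp M.xOp w' = 0 := by
    rw [hw', map_smul, map_add, superComm_conjParity N.isOdd_xOp M.isOdd_xOp, hxw]; simp
  have hy' : superComm N.yOp M.yOp w' = 0 := by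
    rw [hw', map_smul, map_add, superComm_conjParity N.isOdd_yOp M.isOdd_yOp, hyw]; simp
  let g : M ⟶ N := mkHom w' hew fun A g => LinearMap.ext
    (commutes_of_comm hew
      ((superComm_eq_zero (X := resObj (emb k) M) (Y := resObj (emb k) N) hew).1 hx')
      ((superComm_eq_zero (X := resObj (embNeg k) M) (Y := resObj (embNeg k) N) hew).1 hy') g)
  refine ⟨g, negligible_superComm (X := resObj (emb k) M) (Y := resObj (emb k) N)
    (f - (res (emb k)).map g) hcu ?_⟩
  change lin (M := resObj (emb k) M) (N := resObj (emb k) N)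
    (f - (res (emb k)).map g) = superComm N.xOp M.xOp u'
  have : lin (M := resObj (emb k) M) (N := resObj (emb k) N) (f - (res (emb k)).map g)
      = l - w' := by
    rw [sub_eq_add_neg, sub_eq_add_neg]; rfl
  rw [this, e1, add_sub_cancel_left]

/-- A morphism of representations of `OSp(1|2)` with negligible restriction is zero. It is an
invariant for the supercommutators, so that it vanishes if it is itself a supercommutator with `x`;
otherwise it pairs non-trivially with a morphism of representations of `G_a^{(1|1)}`. -/
lemma eq_zero_of_negligible (g : M ⟶ N) (hg : Negligible ((res (emb k)).map g)) : g = 0 := by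
  have H := IsOspPair.superComm N.isOspPair M.isOspPair N.isOdd_xOp N.isOdd_yOp M.isOdd_xOp
    M.isOdd_yOp
  have hev := lin_even g
  have hx : superComm N.xOp M.xOp (lin g) = 0 :=
    (superComm_eq_zero (X := resObj (emb k) M) (Y := resObj (emb k) N) hev).2
      (lin_dOp ((res (emb k)).map g))
  have hy : superComm N.yOp M.yOp (lin g) = 0 :=
    (superComm_eq_zero (X := resObj (embNeg k) M) (Y := resObj (embNeg k) N) hev).2
      (lin_dOp ((res (embNeg k)).map g))
  by_cases hr : lin g ∈ LinearMap.range (superComm N.xOp M.xOp)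
  · obtain ⟨u, hu⟩ := hr
    rw [← hu] at hx hy
    refine hom_ext ?_
    rw [← hu, H.invariant_eq_zero hx hy]; rfl
  exfalso
  -- a functional that kills the supercommutators is the pairing with a morphism of `G_a^{(1|1)}`
  obtain ⟨φ, hφ0, hφ⟩ := Submodule.exists_le_ker_of_notMem hr
  obtain ⟨s, hs⟩ := trace_pairing φ
  have hsd : ∀ v, s (N.xOp v) = -M.xOp (parityOp k M.V (s (parityOp k N.V v))) := fun v => by
    have h1 : s ∘ₗ N.xOp - parityOp k M.V ∘ₗ M.xOp ∘ₗ s ∘ₗ parityOp k N.V = 0 := by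
      refine eq_zero_of_trace fun u => ?_
      have h2 : φ (superComm N.xOp M.xOp u) = 0 := hφ ⟨u, rfl⟩
      have h3 : s ∘ₗ superComm N.xOp M.xOp u = (s ∘ₗ N.xOp) ∘ₗ u
          - (s ∘ₗ parityOp k N.V ∘ₗ u) ∘ₗ (parityOp k M.V ∘ₗ M.xOp) := by
        ext v
        simp [superComm_apply]
      rw [hs, h3, map_sub, LinearMap.trace_comp_comm' (parityOp k M.V ∘ₗ M.xOp)] at h2
      rw [LinearMap.sub_comp, map_sub]
      exact h2
    have h2 := LinearMap.congr_fun (sub_eq_zero.1 h1) v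
    rw [LinearMap.comp_apply] at h2
    rw [h2]
    simp [parityOp_anticomm_odd M.isOdd_xOp]
  set h := parityOp k M.V ∘ₗ s with hh
  set h' := (2⁻¹ : k) • (h + conjParity k N.V M.V h) with hh'
  have he : IsEven h' := isEven_of_conjParity (by
    rw [hh', map_smul, map_add, conjParity_conjParity, add_comm])
  have hc : ∀ v, h' (N.xOp v) = M.xOp (h' v) := fun v => by
    simp [hh', hh, conjParity_apply, hsd, parityOp_anticomm_odd M.isOdd_xOp,
      parityOp_anticomm_odd N.isOdd_xOp, parityOp_parityOp, add_comm]
  let q : resObj (emb k) N ⟶ resObj (emb k) M := homOfDOp h' he hc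
  have h0 : LinearMap.trace k M.V (parityOp k M.V ∘ₗ h' ∘ₗ lin g) = 0 :=
    (negligible_iff_str _).1 hg q
  have h1 : parityOp k M.V ∘ₗ h' ∘ₗ lin g
      = (2⁻¹ : k) • (s ∘ₗ lin g + (parityOp k M.V ∘ₗ s ∘ₗ lin g) ∘ₗ parityOp k M.V) := by
    ext v
    simp [hh', hh, conjParity_apply, parityOp_parityOp, parityOp_comm_even hev]
  have h2 : parityOp k M.V ∘ₗ parityOp k M.V ∘ₗ s ∘ₗ lin g = s ∘ₗ lin g := by
    ext v
    simp [parityOp_parityOp]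
  rw [h1, map_smul, map_add, LinearMap.trace_comp_comm' (parityOp k M.V), h2,
    ← hs, half_add_half] at h0
  exact hφ0 h0

end SRep

end fullyFaithful

/-! ### Representations of `G_a^{(1|1)}` generated by one vector -/

section cyclic

open Module

variable {k : Type u} [Field k] [CharZero k]

namespace SRep

lemma str_comm {V W : Type u} [AddCommGroup V] [Module k V] [AddCommGroup W] [Module k W]
    [SuperSpace k V] [SuperSpace k W] [Module.Finite k V] [Module.Finite k W]
    {f : V →ₗ[k] W} (hf : IsEven f) (g : W →ₗ[k] V) : str k (g ∘ₗ f) = str k (f ∘ₗ g) := by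
  have h : parityOp k W ∘ₗ f ∘ₗ g = f ∘ₗ parityOp k V ∘ₗ g := by
    ext v
    simp [parityOp_comm_even hf]
  rw [str, str, h, ← LinearMap.comp_assoc, LinearMap.trace_comp_comm']

/-- The superdimension, as an element of the field. -/
def sdim {G : Supergroup k} (M : SRep G) : k := str k (LinearMap.id : M.V →ₗ[k] M.V)

variable {X Y : SRep (Ga11 k)}

/-- The representation is generated by one vector. -/
def IsCyclic (X : SRep (Ga11 k)) : Prop :=
  ∃ e : X.V, ∀ v : X.V, v ∈ Submodule.span k (Set.range fun i : ℕ => (X.dOp ^ i) e)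

/-- An endomorphism of a cyclic representation is a scalar up to a multiple of `d`. -/
lemma IsCyclic.exists_scalar (hX : IsCyclic X) (f : X ⟶ X) :
    ∃ (c : k) (q : End k X.V), Commute q X.dOp ∧ lin f = c • (1 : End k X.V) + X.dOp * q := by
  obtain ⟨e, he⟩ := hX
  have hf : Commute (lin f : End k X.V) X.dOp := LinearMap.ext (lin_dOp f)
  obtain ⟨c, q, hq, h⟩ : ∃ (c : k) (q : End k X.V), Commute q X.dOp ∧
      lin f e = (c • (1 : End k X.V) + X.dOp * q) e := by
    refine Submodule.span_induction (p := fun v _ => ∃ (c : k) (q : End k X.V),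
      Commute q X.dOp ∧ v = (c • (1 : End k X.V) + X.dOp * q) e) ?_ ?_ ?_ ?_ (he (lin f e))
    · rintro _ ⟨i, rfl⟩
      cases i with
      | zero => exact ⟨1, 0, Commute.zero_left _, by simp⟩
      | succ i => exact ⟨0, X.dOp ^ i, (Commute.refl _).pow_left i, by simp [pow_succ']⟩
    · exact ⟨0, 0, Commute.zero_left _, by simp⟩
    · rintro _ _ _ _ ⟨c, q, hq, rfl⟩ ⟨c', q', hq', rfl⟩
      refine ⟨c + c', q + q', hq.add_left hq', ?_⟩
      simp only [LinearMap.add_apply, mul_add, add_smul]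
      abel
    · rintro a _ _ ⟨c, q, hq, rfl⟩
      exact ⟨a * c, a • q, hq.smul_left a, by simp [mul_smul]⟩
  refine ⟨c, q, hq, ?_⟩
  have hc : Commute (c • (1 : End k X.V) + X.dOp * q) X.dOp :=
    ((Commute.one_left _).smul_left c).add_left ((Commute.refl _).mul_left hq)
  refine LinearMap.ext fun v => ?_
  induction he v using Submodule.span_induction with
  | mem v hv =>
    obtain ⟨i, rfl⟩ := hv
    change (lin f * X.dOp ^ i) e = ((c • (1 : End k X.V) + X.dOp * q) * X.dOp ^ i) e
    rw [(hf.pow_right i).eq, (hc.pow_right i).eq, Module.End.mul_apply, Module.End.mul_apply, h]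
  | zero => rw [map_zero, map_zero]
  | add a b _ _ ha hb => rw [map_add, map_add, ha, hb]
  | smul a v _ hv => rw [map_smul, map_smul, hv]

lemma str_of_nilpotent {V : Type u} [AddCommGroup V] [Module k V] [SuperSpace k V]
    {f : End k V} (hf : IsEven f) (hn : IsNilpotent f) : str k f = 0 := by
  have h : Commute (parityOp k V : End k V) f := LinearMap.ext fun v => parityOp_comm_even hf v
  exact (LinearMap.isNilpotent_trace_of_isNilpotent (h.isNilpotent_mul_left hn)).eq_zero

lemma str_scalar_add {f : X ⟶ X} {c : k} {q : End k X.V} (hq : Commute q X.dOp)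
    (h : lin f = c • (1 : End k X.V) + X.dOp * q) :
    str k (lin f) = c * X.sdim := by
  have hn : IsNilpotent (X.dOp * q) := hq.symm.isNilpotent_mul_right X.dOp_nilpotent
  have he : IsEven (X.dOp * q : End k X.V) := by
    have : X.dOp * q = lin (f - c • 𝟙 X) := by
      rw [sub_eq_add_neg, ← neg_smul, lin_add, lin_smul, h, lin_id, neg_smul]
      change _ = c • (1 : End k X.V) + X.dOp * q + -(c • (1 : End k X.V))
      abel
    rw [this]; exact lin_even _
  have e : parityOp k X.V ∘ₗ (c • (1 : End k X.V) + X.dOp * q)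
      = c • (parityOp k X.V ∘ₗ LinearMap.id) + parityOp k X.V ∘ₗ (X.dOp * q) := by
    rw [LinearMap.comp_add, LinearMap.comp_smul]; rfl
  rw [h, str, e, map_add, map_smul, smul_eq_mul]
  have := str_of_nilpotent he hn
  rw [str] at this
  rw [this, add_zero, sdim, str]

/-- A cyclic representation of superdimension zero vanishes in the semisimplification: its
endomorphisms are scalars up to nilpotent ones, so that their supertraces vanish. -/
lemma IsCyclic.isZero (hX : IsCyclic X) (h : X.sdim = 0) :
    Limits.IsZero ((semisimplify k _).obj X) := by
  rw [Limits.IsZero.iff_id_eq_zero, ← CategoryTheory.Functor.map_id, ← (semisimplify k _).map_zero,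
    semisimplify_map_eq_iff, sub_zero, negligible_iff_str]
  intro g
  obtain ⟨c, q, hq, hg⟩ := hX.exists_scalar g
  rw [lin_id, LinearMap.comp_id, str_scalar_add hq hg, h, mul_zero]

lemma isIso_of_bijective {G : Supergroup k} {M N : SRep G} (f : M ⟶ N)
    (h : Function.Bijective (lin f)) : IsIso f := by
  have := mono_of_injective f h.1
  have := epi_of_surjective f h.2
  exact isIso_of_mono_of_epi f

lemma isIso_of_scalar_add {f : X ⟶ X} {c : k} {q : End k X.V} (hq : Commute q X.dOp) (hc : c ≠ 0)
    (hf : lin f = c • (1 : End k X.V) + X.dOp * q) : IsIso f := by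
  have hn : IsNilpotent (X.dOp * q) := hq.symm.isNilpotent_mul_right X.dOp_nilpotent
  have hu : IsUnit (lin f : End k X.V) := by
    rw [hf]
    have h1 : IsUnit (c • (1 : End k X.V)) := by
      rw [← Algebra.algebraMap_eq_smul_one]
      exact (IsUnit.mk0 c hc).map _
    exact hn.isUnit_add_left_of_commute h1 ((Commute.one_right _).smul_right c)
  exact isIso_of_bijective f ((Module.End.isUnit_iff _).1 hu)

/-- An endomorphism of a cyclic representation is an isomorphism or negligible. -/
lemma IsCyclic.isIso_or_negligible (hX : IsCyclic X) (f : X ⟶ X) : IsIso f ∨ Negligible f := by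
  obtain ⟨c, q, hq, hf⟩ := hX.exists_scalar f
  by_cases hc : c = 0
  · right
    rw [negligible_iff_str]
    intro g
    have hg : Commute (lin g : End k X.V) X.dOp := LinearMap.ext (lin_dOp g)
    have e : lin (f ≫ g) = (0 : k) • (1 : End k X.V) + X.dOp * ((lin g : End k X.V) * q) := by
      rw [lin_comp, hf, hc, zero_smul, zero_add, zero_add, ← mul_assoc, ← hg.eq, mul_assoc]; rfl
    rw [← lin_comp, str_scalar_add (hg.mul_left hq) e, zero_mul]
  · exact Or.inl (isIso_of_scalar_add hq hc hf)

/-- If `f` is not negligible, then some composition of `f` with a morphism `g` in the opposite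
direction has non-zero supertrace, and then neither composition is negligible. -/
lemma negligible_comp_comm {f : X ⟶ Y} (hf : ¬ Negligible f) :
    ∃ g : Y ⟶ X, ¬ Negligible (g ≫ f) ∧ ¬ Negligible (f ≫ g) := by
  rw [negligible_iff_str] at hf
  push Not at hf
  obtain ⟨g, hg⟩ := hf
  refine ⟨g, fun h => hg ?_, fun h => hg ?_⟩
  · have := (negligible_iff_str _).1 h (𝟙 Y)
    rw [lin_id, LinearMap.id_comp, lin_comp] at this
    rw [str_comm (lin_even f), this]
  · have := (negligible_iff_str _).1 h (𝟙 X)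
    rwa [lin_id, LinearMap.id_comp, lin_comp] at this

lemma semisimplify_map_ne_zero {f : X ⟶ Y} :
    (semisimplify k _).map f ≠ 0 ↔ ¬ Negligible f := by
  rw [← (semisimplify k _).map_zero, Ne, semisimplify_map_eq_iff, sub_zero]

lemma not_negligible_id (h : X.sdim ≠ 0) : ¬ Negligible (𝟙 X) :=
  fun h' => h (by simpa [sdim] using (negligible_iff_str _).1 h' (𝟙 X))

lemma IsCyclic.simple (hX : IsCyclic X) (h : X.sdim ≠ 0) :
    Simple ((semisimplify k _).obj X) where
  mono_isIso_iff_nonzero {Y} m hm := by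
    constructor
    · rintro _ rfl
      have h1 : 𝟙 ((semisimplify k _).obj X) = 0 := by
        rw [← IsIso.inv_hom_id (0 : Y ⟶ (semisimplify k _).obj X), Limits.comp_zero]
      rw [← CategoryTheory.Functor.map_id] at h1
      exact semisimplify_map_ne_zero.2 (not_negligible_id h) h1
    · intro h0
      obtain ⟨Y, rfl⟩ : ∃ Y', (semisimplify k (SRep (Ga11 k))).obj Y' = Y := ⟨Y.as, rfl⟩
      obtain ⟨f, rfl⟩ : ∃ f : Y ⟶ X, (semisimplify k _).map f = m :=
        semisimplify_map_surjective m
      obtain ⟨g, hg, -⟩ := negligible_comp_comm (semisimplify_map_ne_zero.1 h0)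
      have hi : IsIso (g ≫ f) := (hX.isIso_or_negligible _).resolve_right hg
      have : IsSplitEpi ((semisimplify k _).map f) :=
        ⟨⟨⟨(semisimplify k _).map (inv (g ≫ f) ≫ g), by
          rw [← Functor.map_comp, Category.assoc, IsIso.inv_hom_id, CategoryTheory.Functor.map_id]⟩⟩⟩
      exact isIso_of_mono_of_isSplitEpi _

/-- Cyclic representations of non-zero superdimension are isomorphic if they are so in the
semisimplification. -/
lemma IsCyclic.nonempty_iso (hX : IsCyclic X) (hY : IsCyclic Y)
    (h : X.sdim ≠ 0) (h' : Y.sdim ≠ 0)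
    (e : (semisimplify k _).obj X ≅ (semisimplify k _).obj Y) : Nonempty (X ≅ Y) := by
  obtain ⟨f, hf⟩ : ∃ f : X ⟶ Y, (semisimplify k _).map f = e.hom :=
    semisimplify_map_surjective e.hom
  obtain ⟨g, hg⟩ : ∃ g : Y ⟶ X, (semisimplify k _).map g = e.inv :=
    semisimplify_map_surjective e.inv
  have h1 : IsIso (f ≫ g) := by
    refine (hX.isIso_or_negligible _).resolve_right fun hn => not_negligible_id h ?_
    rw [← sub_zero (f ≫ g), ← semisimplify_map_eq_iff (k := k), CategoryTheory.Functor.map_comp] at hn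
    rw [← sub_zero (𝟙 X), ← semisimplify_map_eq_iff (k := k), ← hn, CategoryTheory.Functor.map_id]
    exact ((congrArg₂ (· ≫ ·) hf hg).trans e.hom_inv_id).symm
  have h2 : IsIso (g ≫ f) := by
    refine (hY.isIso_or_negligible _).resolve_right fun hn => not_negligible_id h' ?_
    rw [← sub_zero (g ≫ f), ← semisimplify_map_eq_iff (k := k), CategoryTheory.Functor.map_comp] at hn
    rw [← sub_zero (𝟙 Y), ← semisimplify_map_eq_iff (k := k), ← hn, CategoryTheory.Functor.map_id]
    exact ((congrArg₂ (· ≫ ·) hg hf).trans e.inv_hom_id).symm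
  have : Mono f := mono_of_mono f g
  have : Epi f := epi_of_epi g f
  have : IsIso f := isIso_of_mono_of_epi f
  exact ⟨asIso f⟩

end SRep

end cyclic

/-! ### The representations `Mₙ` -/

section strings

open Module

variable {k : Type u} [Field k] [CharZero k]

attribute [local instance] SRep.stringSuper ratModule

/-- The supertrace of the identity is the difference of the dimensions of the even and the odd
part. -/
lemma str_id_add (V : Type u) [AddCommGroup V] [Module k V] [SuperSpace k V] [Module.Finite k V] :
    str k (LinearMap.id : V →ₗ[k] V) + finrank k (gr k V 1) = finrank k (gr k V 0) := by
  have h1 : LinearMap.trace k V (oddProj k V) = finrank k (gr k V 1) :=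
    LinearMap.IsProj.trace ⟨fun v => by
      obtain ⟨a, ha, b, hb, rfl⟩ := exists_decomp (k := k) v
      rw [map_add, oddProj_of_even ha, oddProj_of_odd hb, zero_add]
      exact hb, fun v hv => oddProj_of_odd hv⟩
  have h2 := Submodule.finrank_add_eq_of_isCompl (SuperSpace.isCompl (k := k) (V := V))
  rw [str, LinearMap.comp_id, parityOp, map_sub, map_smul, h1, LinearMap.trace_id, ← h2]
  push_cast
  rw [smul_eq_mul]
  ring

lemma parityOp_shiftSuper (V : Type u) [AddCommGroup V] [Module k V] [SuperSpace k V] :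
    @parityOp k _ V _ _ (SRep.shiftSuper V) = -parityOp k V := by
  refine super_ext (k := k) (V := V) fun i v hv => ?_
  have hv' : v ∈ @gr k _ V _ _ (SRep.shiftSuper V) (i + 1) := by
    change v ∈ gr k V (i + 1 + 1)
    rwa [add_assoc, one_add_one, add_zero]
  have := @parityOp_apply k _ _ V _ _ (SRep.shiftSuper V) _ _ hv'
  rw [LinearMap.neg_apply, parityOp_apply hv, this]
  rcases zmod_two i with rfl | rfl
  · rw [zero_add, koszul_one_one, koszul_zero_left, one_smul, neg_one_smul]
  · rw [one_add_one, koszul_one_one, koszul_zero_left, one_smul, neg_one_smul, neg_neg]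

namespace SRep

lemma hasSuperDim_of_sdim {G : Supergroup k} {M : SRep G} {n : ℕ}
    (h : M.sdim = 1) (hn : finrank k M.V = 2 * n + 1) :
    M.HasSuperDim (n + 1) n := by
  have h1 := str_id_add (k := k) M.V
  have h2 := Submodule.finrank_add_eq_of_isCompl (SuperSpace.isCompl (k := k) (V := M.V))
  change M.sdim + _ = _ at h1
  rw [h] at h1
  have h3 : 1 + finrank k (gr k M.V 1) = finrank k (gr k M.V 0) := by exact_mod_cast h1
  change finrank k (gr k M.V 0) + finrank k (gr k M.V 1) = _ at h2
  exact ⟨by omega, by omega⟩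

lemma sdim_parityShift {G : Supergroup k} (M : SRep G) : M.parityShift.sdim = -M.sdim := by
  have := parityOp_shiftSuper (k := k) M.V
  change LinearMap.trace k M.V (@parityOp k _ M.V _ _ (shiftSuper M.V)) =
    -LinearMap.trace k M.V (parityOp k M.V)
  rw [parityOp_shiftSuper, map_neg]

lemma dOp_ofNilpotent (V : Type u) [AddCommGroup V] [Module k V] [Module.Finite k V]
    (super : SuperSpace k V) (x : V →ₗ[k] V) (hx : IsOdd x) (hn : IsNilpotent x) :
    (ofNilpotent V super x hx hn).dOp = x ∘ₗ parityOp k V := by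
  refine LinearMap.ext fun v => ?_
  have h : (ofNilpotent V super x hx hn).act _ (oddTangent k) v
      = v ⊗ₜ[k] 1 + x (parityOp k V v) ⊗ₜ (dualInr k k 1 1) := by
    change nilOp x (0 : dualAlg k k 1) (dualInr k k 1 1) (v ⊗ₜ[k] 1) = _
    rw [nilOp, opT_zero, IsNilpotent.exp_zero, one_mul, LinearMap.add_apply, opT_tmul, mul_one]
    rfl
  rw [dOp, deriv, LinearMap.comp_apply, h, map_add, coef_tmul, coef_tmul, dualSnd_one,
    dualSnd_inr, zero_smul, zero_add, one_smul]
  rfl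

lemma single_mem (n : ℕ) (j : Fin (n + 1)) :
    (Pi.single j 1 : Fin (n + 1) → k) ∈ gr k (Fin (n + 1) → k) ((j : ℕ) : ZMod 2) := by
  intro l hl
  rw [Pi.single_apply, if_neg]
  rintro rfl
  exact hl rfl

lemma dOp_M_single (n : ℕ) (i j : Fin (n + 1)) (h : (j : ℕ) = i + 1) :
    (M k n).dOp (Pi.single i 1) = koszul k (i : ℕ) (i : ℕ) • Pi.single j 1 := by
  rw [dOp_ofNilpotent, LinearMap.comp_apply, parityOp_apply (single_mem n i), map_smul,
    stringOp_single n i j h]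

lemma isCyclic_M (n : ℕ) : IsCyclic (M k n) := by
  refine ⟨(Pi.single 0 1 : Fin (n + 1) → k), fun v => ?_⟩
  set W := Submodule.span k (Set.range fun i : ℕ =>
    ((M k n).dOp ^ i) (Pi.single 0 1 : Fin (n + 1) → k))
  have hW : ∀ w ∈ W, (M k n).dOp w ∈ W := by
    intro w hw
    induction hw using Submodule.span_induction with
    | mem w hw =>
      obtain ⟨i, rfl⟩ := hw
      exact Submodule.subset_span ⟨i + 1, by simp only [pow_succ', Module.End.mul_apply]⟩
    | zero => rw [map_zero]; exact zero_mem _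
    | add a b _ _ ha hb => rw [map_add]; exact add_mem ha hb
    | smul c a _ ha => rw [map_smul]; exact Submodule.smul_mem _ _ ha
  have hs : ∀ (i : ℕ) (hi : i < n + 1), (Pi.single ⟨i, hi⟩ 1 : Fin (n + 1) → k) ∈ W := by
    intro i
    induction i with
    | zero => intro hi; exact Submodule.subset_span ⟨0, rfl⟩
    | succ i ih =>
      intro hi
      have h := hW _ (ih (by omega))
      rw [dOp_M_single n ⟨i, by omega⟩ ⟨i + 1, hi⟩ rfl] at h
      have := Submodule.smul_mem W (koszul k (i : ZMod 2) (i : ZMod 2)) h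
      rwa [smul_smul, koszul_mul_self, one_smul] at this
  have hv : v = ∑ i, (show Fin (n + 1) → k from v) i • (Pi.single i 1 : Fin (n + 1) → k) := by
    rw [← pi_eq_sum_univ']
  rw [hv]
  exact Submodule.sum_mem _ fun i _ => Submodule.smul_mem _ _ (hs i i.2)

lemma IsCyclic.parityShift {X : SRep (Ga11 k)} (hX : IsCyclic X) : IsCyclic X.parityShift := hX

lemma sum_koszul (n : ℕ) : ∑ i ∈ Finset.range (2 * n), koszul k (i : ZMod 2) (i : ZMod 2) = 0 := by
  induction n with
  | zero => rfl
  | succ n ih =>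
    have h : ((2 * n : ℕ) : ZMod 2) = 0 := (ZMod.natCast_eq_zero_iff _ _).2 ⟨n, rfl⟩
    rw [show 2 * (n + 1) = 2 * n + 1 + 1 from rfl, Finset.sum_range_succ, Finset.sum_range_succ, ih,
      Nat.cast_succ, h, zero_add, zero_add, koszul_zero_left, koszul_one_one, add_neg_cancel]

lemma sdim_M (n : ℕ) : (M k n).sdim
    = ∑ i ∈ Finset.range (n + 1), koszul k (i : ZMod 2) (i : ZMod 2) := by
  change LinearMap.trace k _ (parityOp k (Fin (n + 1) → k)) = _
  rw [trace_eq_sum_coord (Pi.basisFun k (Fin (n + 1))), ← Fin.sum_univ_eq_sum_range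
    (fun i => koszul k (i : ZMod 2) (i : ZMod 2))]
  refine Finset.sum_congr rfl fun i _ => ?_
  rw [Pi.basisFun_apply]
  have := parityOp_apply (single_mem (k := k) n i)
  rw [this, map_smul, ← Pi.basisFun_apply, Basis.coord_apply, Basis.repr_self,
    Finsupp.single_eq_same, smul_eq_mul, mul_one]

lemma sdim_M_odd (n : ℕ) : (M k (2 * n + 1)).sdim = 0 := by
  rw [sdim_M]; exact sum_koszul (n + 1)

lemma sdim_M_even (n : ℕ) : (M k (2 * n)).sdim = 1 := by
  have h : ((2 * n : ℕ) : ZMod 2) = 0 := (ZMod.natCast_eq_zero_iff _ _).2 ⟨n, rfl⟩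
  rw [sdim_M, Finset.sum_range_succ, sum_koszul, h, koszul_zero_left, zero_add]

lemma finrank_eq_of_iso {G : Supergroup k} {M N : SRep G} (e : M ≅ N) :
    finrank k M.V = finrank k N.V := by
  refine LinearEquiv.finrank_eq (LinearEquiv.ofLinearMap (lin e.hom) (lin e.inv) ?_ ?_)
  · rw [← lin_comp, e.inv_hom_id, lin_id]
  · rw [← lin_comp, e.hom_inv_id, lin_id]

lemma sdim_eq_of_iso {G : Supergroup k} {M N : SRep G} (e : M ≅ N) : M.sdim = N.sdim := by
  rw [sdim, sdim, ← lin_id, ← lin_id, ← e.hom_inv_id, ← e.inv_hom_id, lin_comp, lin_comp,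
    str_comm (lin_even _)]

end SRep

end strings

/-! ### Decomposition into the representations `Mₙ` and their parity shifts -/

section decomposition

open Module

variable {k : Type u} [Field k] [CharZero k]

attribute [local instance] SRep.stringSuper

/-- A retract in a preadditive category with kernels is a direct summand. -/
lemma exists_complement {C : Type*} [Category C] [Preadditive C] [Limits.HasKernels C] {X Y : C}
    (h : Retract Y X) : ∃ (Z : C) (h' : Retract Z X), h.r ≫ h.i + h'.r ≫ h'.i = 𝟙 X ∧
      h'.i ≫ h.r = 0 := by
  have h0 : (𝟙 X - h.r ≫ h.i) ≫ h.r = 0 := by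
    rw [Preadditive.sub_comp, Category.id_comp, Category.assoc, h.retract, Category.comp_id,
      sub_self]
  refine ⟨Limits.kernel h.r, ⟨Limits.kernel.ι h.r, Limits.kernel.lift _ _ h0, ?_⟩, ?_,
    Limits.kernel.condition _⟩
  · rw [← cancel_mono (Limits.kernel.ι h.r), Category.assoc, Limits.kernel.lift_ι,
      Preadditive.comp_sub, Limits.kernel.condition_assoc, Limits.zero_comp, sub_zero,
      Category.comp_id, Category.id_comp]
  · rw [Limits.kernel.lift_ι, add_sub_cancel]

/-- A non-zero homogeneous vector is detected by a homogeneous functional. -/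
lemma exists_functional {V : Type u} [AddCommGroup V] [Module k V] [SuperSpace k V] {m : ZMod 2}
    {v : V} (hv : v ∈ gr k V m) (h0 : v ≠ 0) :
    ∃ φ : V →ₗ[k] k, φ v = 1 ∧ ∀ j ≠ m, ∀ w ∈ gr k V j, φ w = 0 := by
  obtain ⟨ψ, hψ⟩ : ∃ ψ : Dual k V, ψ v ≠ 0 := by
    by_contra! h
    exact h0 ((forall_dual_apply_eq_zero_iff k v).1 h)
  have hj : ∀ j ≠ m, j = m + 1 := by
    clear hv; revert m; decide
  rcases zmod_two m with rfl | rfl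
  · refine ⟨(ψ v)⁻¹ • ψ ∘ₗ (LinearMap.id - oddProj k V), ?_, fun j h w hw => ?_⟩
    · simp [oddProj_of_even hv, hψ]
    · obtain rfl : j = 1 := hj j h
      simp [oddProj_of_odd hw]
  · refine ⟨(ψ v)⁻¹ • ψ ∘ₗ oddProj k V, ?_, fun j h w hw => ?_⟩
    · simp [oddProj_of_odd hv, hψ]
    · obtain rfl : j = 0 := hj j h
      simp [oddProj_of_even hw]

namespace SRep

/-- The untwisted version of `dOp`, for which the identity holds without signs: on `Mₙ` it is the
operator `aⱼ ↦ aⱼ₊₁`. -/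
def sOp (X : SRep (Ga11 k)) : End k X.V := X.dOp ∘ₗ parityOp k X.V

variable {X Y : SRep (Ga11 k)}

lemma sOp_parityOp (v : X.V) : X.sOp (parityOp k X.V v) = X.dOp v := by
  rw [sOp, LinearMap.comp_apply, parityOp_parityOp]

lemma sOp_mem {i : ZMod 2} {v : X.V} (hv : v ∈ gr k X.V i) : X.sOp v ∈ gr k X.V (i + 1) := by
  rw [sOp, LinearMap.comp_apply, parityOp_apply hv, map_smul]
  exact Submodule.smul_mem _ _ (X.dOp_mem hv)

lemma sOp_pow_mem {i : ZMod 2} {v : X.V} (hv : v ∈ gr k X.V i) (n : ℕ) :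
    (X.sOp ^ n) v ∈ gr k X.V (i + n) := by
  induction n with
  | zero => simpa using hv
  | succ n ih =>
    rw [pow_succ', Module.End.mul_apply, Nat.cast_succ, ← add_assoc]
    exact sOp_mem ih

lemma sOp_sq : X.sOp ^ 2 = X.nOp := by
  refine LinearMap.ext fun v => ?_
  rw [pow_two, Module.End.mul_apply, sOp, LinearMap.comp_apply, LinearMap.comp_apply,
    parityOp_anticomm_odd (isOdd_dOp X), parityOp_parityOp, map_neg, dOp_dOp, neg_neg]

lemma sOp_nilpotent : IsNilpotent X.sOp := by
  obtain ⟨n, h⟩ := X.nOp_nilpotent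
  rw [← sOp_sq, ← pow_mul] at h
  exact ⟨_, h⟩

lemma sOp_M (n : ℕ) : (M k n).sOp = stringOp k n := by
  refine LinearMap.ext fun v => ?_
  change (M k n).dOp (parityOp k (Fin (n + 1) → k) v) = _
  rw [dOp_ofNilpotent]
  change stringOp k n (parityOp k (Fin (n + 1) → k) (parityOp k (Fin (n + 1) → k) v)) = _
  rw [parityOp_parityOp]

/-- Parity-preserving maps which commute with `sOp` are morphisms. -/
def homOfSOp (f : X.V →ₗ[k] Y.V) (he : IsEven f) (hf : ∀ v, f (X.sOp v) = Y.sOp (f v)) : X ⟶ Y :=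
  homOfDOp f he fun v => by
    rw [← sOp_parityOp, hf, ← parityOp_comm_even he, sOp_parityOp]

/-- The morphism `Mₙ ⟶ X`, `aⱼ ↦ sʲ a`. -/
lemma exists_from_M {n : ℕ} (hX : X.sOp ^ (n + 1) = 0) {a : X.V} (ha : a ∈ gr k X.V 0) :
    ∃ f : M k n ⟶ X, lin f (Pi.single 0 1 : Fin (n + 1) → k) = a := by
  let f : (Fin (n + 1) → k) →ₗ[k] X.V :=
    Fintype.linearCombination k fun j : Fin (n + 1) => (X.sOp ^ (j : ℕ)) a
  have hf : ∀ v, f v = ∑ j : Fin (n + 1), v j • (X.sOp ^ (j : ℕ)) a := fun v => rfl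
  have he : IsEven f := by
    intro m v hv
    rw [hf]
    refine Submodule.sum_mem _ fun j _ => ?_
    by_cases hj : ((j : ℕ) : ZMod 2) = m
    · refine Submodule.smul_mem _ _ ?_
      have := sOp_pow_mem ha j
      rwa [zero_add, hj] at this
    · rw [hv j hj, zero_smul]; exact zero_mem _
  refine ⟨homOfSOp (X := M k n) f he fun v => ?_, ?_⟩
  · rw [sOp_M, hf, hf, map_sum, Fin.sum_univ_succ, Fin.sum_univ_castSucc]
    have h0 : stringOp k n v 0 = 0 := rfl
    have h1 : ∀ j : Fin n, stringOp k n v j.succ = v j.castSucc := fun j => rfl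
    rw [h0, zero_smul, zero_add, map_smul, ← Module.End.mul_apply, ← pow_succ']
    have h2 : X.sOp ^ ((Fin.last n : Fin (n + 1)) + 1 : ℕ) = 0 := hX
    rw [h2, LinearMap.zero_apply, smul_zero, add_zero]
    refine Finset.sum_congr rfl fun j _ => ?_
    rw [h1, map_smul, ← Module.End.mul_apply, ← pow_succ']
    rfl
  · change f (Pi.single 0 1) = a
    rw [Fintype.linearCombination_apply_single]
    simp

/-- The morphism `X ⟶ Mₙ` whose last coordinate is `φ`. -/
lemma exists_to_M {n : ℕ} (hX : X.sOp ^ (n + 1) = 0) {φ : X.V →ₗ[k] k}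
    (hφ : ∀ j ≠ (n : ZMod 2), ∀ w ∈ gr k X.V j, φ w = 0) :
    ∃ f : X ⟶ M k n, ∀ v, (lin f v : Fin (n + 1) → k) 0 = φ ((X.sOp ^ n) v) := by
  let f : X.V →ₗ[k] (Fin (n + 1) → k) := LinearMap.pi fun i => φ ∘ₗ (X.sOp ^ (n - (i : ℕ)))
  have hf : ∀ v i, f v i = φ ((X.sOp ^ (n - (i : ℕ))) v) := fun v i => rfl
  have he : IsEven f := by
    intro m v hv i hi
    refine hφ _ (fun h => hi ?_) _ (sOp_pow_mem hv _)
    rw [Nat.cast_sub (by omega : (i : ℕ) ≤ n), add_sub, sub_eq_iff_eq_add, add_comm] at h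
    exact (add_left_cancel h).symm
  refine ⟨homOfSOp (Y := M k n) f he fun v => ?_, fun v => hf v 0⟩
  rw [sOp_M]
  funext i
  rw [hf, ← Module.End.mul_apply, ← pow_succ]
  change _ = if (i : ℕ) = 0 then (0 : k) else f v ⟨i - 1, by omega⟩
  split_ifs with h
  · rw [h, Nat.sub_zero, hX, LinearMap.zero_apply, map_zero]
  · rw [hf]
    congr 3
    simp only
    omega

/-- If `sⁿ⁺¹ = 0` and `sⁿ a ≠ 0` with `a` even, then `Mₙ` is a direct summand. -/
lemma exists_retract_M {n : ℕ} (hX : X.sOp ^ (n + 1) = 0) {a : X.V} (ha : a ∈ gr k X.V 0)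
    (hn : (X.sOp ^ n) a ≠ 0) : Nonempty (Retract (M k n) X) := by
  have ha' := sOp_pow_mem ha n
  rw [zero_add] at ha'
  obtain ⟨φ, h1, hφ⟩ := exists_functional ha' hn
  obtain ⟨i, hi⟩ := exists_from_M hX ha
  obtain ⟨p, hp⟩ := exists_to_M hX hφ
  obtain ⟨c, q, hq, h⟩ := (isCyclic_M n).exists_scalar (i ≫ p)
  have hd : ∀ w : Fin (n + 1) → k, ((M k n).dOp w : Fin (n + 1) → k) 0 = 0 := fun w => by
    rw [dOp_ofNilpotent]; rfl
  have hc : c = 1 := by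
    have e := hp a
    rw [h1, ← hi, ← LinearMap.comp_apply, ← lin_comp, h] at e
    have e' : (c • (Pi.single 0 1 : Fin (n + 1) → k) + (M k n).dOp (q (Pi.single 0 1 :
        Fin (n + 1) → k)) : Fin (n + 1) → k) 0 = 1 := e
    rw [Pi.add_apply] at e'
    rw [hd, Pi.smul_apply, Pi.single_eq_same, smul_eq_mul, mul_one, add_zero] at e'
    exact e'
  have := isIso_of_scalar_add hq (hc ▸ one_ne_zero) h
  exact ⟨⟨i, p ≫ inv (i ≫ p), by rw [← Category.assoc, IsIso.hom_inv_id]⟩⟩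

/-- The parity shift of a morphism. -/
def shiftHom {G : Supergroup k} {M N : SRep G} (f : M ⟶ N) : M.parityShift ⟶ N.parityShift :=
  mkHom (M := M.parityShift) (N := N.parityShift) (lin (M := M) (N := N) f)
    (fun i => lin_even (M := M) (N := N) f (i + 1))
    (lin_equivariant (M := M) (N := N) f)

/-- The parity shift of a retract. -/
def shiftRetract {G : Supergroup k} {M N : SRep G} (h : Retract M N) :
    Retract M.parityShift N.parityShift where
  i := shiftHom h.i
  r := shiftHom h.r
  retract := hom_ext (M := M.parityShift) (N := M.parityShift) (by
    have := congrArg lin h.retract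
    rw [lin_comp] at this
    exact this)

/-- Shifting the parity twice changes nothing. -/
def shiftShift {G : Supergroup k} (M : SRep G) : M.parityShift.parityShift ≅ M :=
  have h : ∀ i : ZMod 2, i + 1 + 1 = i := fun i => by rw [add_assoc, one_add_one, add_zero]
  mkIso (M := M.parityShift.parityShift) (N := M) (LinearEquiv.refl k M.V)
    (fun i v hv => by
      change v ∈ gr k M.V (i + 1 + 1) at hv
      rw [h] at hv; exact hv)
    (fun i v hv => by
      change v ∈ gr k M.V (i + 1 + 1)
      rw [h]; exact hv)
    fun A g => by
      change LinearMap.rTensor A (LinearMap.id (R := k) (M := M.V)) ∘ₗ M.act A g = M.act A g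
      rw [LinearMap.rTensor_id]; rfl

/-- One of the representations `Mₙ`, `ΠMₙ`. -/
def IsString (n : ℕ) (Y : SRep (Ga11 k)) : Prop := Y = M k n ∨ Y = (M k n).parityShift

/-- If the nilpotency index of `s` is `n + 1`, then `Mₙ` or `ΠMₙ` is a direct summand. -/
lemma exists_retract_string {n : ℕ} (hX : X.sOp ^ (n + 1) = 0) (hn : X.sOp ^ n ≠ 0) :
    ∃ Y, IsString n Y ∧ Nonempty (Retract Y X) := by
  obtain ⟨i, a, ha, h⟩ : ∃ i, ∃ a ∈ gr k X.V i, (X.sOp ^ n) a ≠ 0 := by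
    by_contra! h
    exact hn (super_ext (k := k) fun i a ha => h i a ha)
  rcases zmod_two i with rfl | rfl
  · exact ⟨_, Or.inl rfl, exists_retract_M hX ha h⟩
  · have hs : X.parityShift.sOp = -X.sOp := by
      change X.dOp ∘ₗ (@parityOp k _ X.V _ _ (shiftSuper X.V)) = _
      rw [parityOp_shiftSuper, LinearMap.comp_neg]; rfl
    obtain ⟨r⟩ := exists_retract_M (X := X.parityShift) (n := n) (a := a)
      (by rw [hs, neg_pow]; exact mul_eq_zero_of_right _ hX)
      (by change a ∈ gr k X.V (0 + 1); rwa [zero_add])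
      (by
        rw [hs, neg_pow]
        rcases neg_one_pow_eq_or (End k X.V) n with e | e <;> rw [e]
        · simpa using h
        · simpa using h)
    exact ⟨_, Or.inr rfl, ⟨(shiftRetract r).trans (Retract.ofIso (shiftShift X))⟩⟩

/-- Every representation of `G_a^{(1|1)}` is a direct sum of representations `Mₙ` and `ΠMₙ`,
in the form of an induction principle: split off a string of maximal length. -/
lemma string_induction {P : SRep (Ga11 k) → Prop} (hz : ∀ X, Limits.IsZero X → P X)
    (hadd : ∀ (X Y Z : SRep (Ga11 k)) (n : ℕ) (h : Retract Y X) (h' : Retract Z X), IsString n Y →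
      h.r ≫ h.i + h'.r ≫ h'.i = 𝟙 X → P Z → P X) (X : SRep (Ga11 k)) : P X := by
  induction hd : finrank k X.V using Nat.strong_induction_on generalizing X with
  | _ d ih =>
  by_cases h1 : (1 : End k X.V) = 0
  · refine hz X ((Limits.IsZero.iff_id_eq_zero X).2 (hom_ext ?_))
    rw [lin_id, lin_zero]
    exact h1
  · obtain ⟨n, hn, hn'⟩ : ∃ n, X.sOp ^ (n + 1) = 0 ∧ X.sOp ^ n ≠ 0 := by
      classical
      have h := sOp_nilpotent (X := X)
      have hp : Nat.find h ≠ 0 := fun h0 => h1 (by simpa [h0] using Nat.find_spec h)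
      obtain ⟨n, e⟩ := Nat.exists_eq_succ_of_ne_zero hp
      exact ⟨n, by rw [← Nat.succ_eq_add_one, ← e]; exact Nat.find_spec h,
        Nat.find_min h (by omega)⟩
    obtain ⟨Y, hY, ⟨r⟩⟩ := exists_retract_string hn hn'
    obtain ⟨Z, r', h, h0⟩ := exists_complement r
    refine hadd X Y Z n r r' hY h (ih _ ?_ Z rfl)
    have hinj : Function.Injective (lin r'.i) := injective_of_mono _
    rw [← hd, ← LinearMap.finrank_range_of_inj hinj]
    refine Submodule.finrank_lt (fun ht => ?_)
    have e1 : r.r = 0 := hom_ext (LinearMap.ext fun v => by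
      obtain ⟨z, rfl⟩ := LinearMap.range_eq_top.1 ht v
      rw [← LinearMap.comp_apply, ← lin_comp, h0, lin_zero, LinearMap.zero_apply, lin_zero,
        LinearMap.zero_apply])
    have e2 : 𝟙 Y = 0 := by rw [← r.retract, e1, Limits.comp_zero]
    have e3 : (1 : Fin (n + 1) → k) = 0 := by
      have := congrArg lin e2
      rw [lin_id, lin_zero] at this
      rcases hY with rfl | rfl <;> exact LinearMap.congr_fun this (1 : Fin (n + 1) → k)
    exact one_ne_zero (congrFun e3 0)

end SRep

end decomposition

/-! ### Restrictions of representations of `OSp(1|2)` -/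

section realization

open Module

variable {k : Type u} [Field k] [CharZero k]

attribute [local instance] SRep.stringSuper

lemma IsOspPair.y_mul_x_pow {V : Type u} [AddCommGroup V] [Module k V] {x y : End k V}
    (H : IsOspPair x y) (i : ℕ) :
    y * x ^ (2 * (i + 1)) = x ^ (2 * (i + 1)) * y - ((i : k) + 1) • x ^ (2 * i + 1) := by
  have h : y * x ^ 2 = x ^ 2 * y - x := LinearMap.ext fun v => by
    simpa [pow_two] using H.y_x_x v
  induction i with
  | zero => simpa using h
  | succ i ih =>
    have e : (2 * (i + 1 + 1)) = 2 * (i + 1) + 2 := by ring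
    rw [e, pow_add, ← mul_assoc, ih, sub_mul, mul_assoc, h, smul_mul_assoc, ← pow_add, mul_sub,
      ← mul_assoc, ← pow_succ, ← pow_add]
    have e' : 2 * i + 1 + 2 = 2 * (i + 1) + 1 := by ring
    rw [e']
    push_cast
    module

namespace SRep

lemma dOp_M_apply (n : ℕ) (v : Fin (n + 1) → k) (j : Fin (n + 1)) :
    ((M k n).dOp v : Fin (n + 1) → k) j
      = if (j : ℕ) = 0 then 0 else parityOp k (Fin (n + 1) → k) v ⟨j - 1, by omega⟩ := by
  rw [dOp_ofNilpotent]; rfl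

lemma exists_dOp_pow_single (n i : ℕ) (hi : i < n + 1) :
    ∃ c : k, c ≠ 0 ∧ ((M k n).dOp ^ i) (Pi.single 0 1 : Fin (n + 1) → k)
      = c • (Pi.single ⟨i, hi⟩ 1 : Fin (n + 1) → k) := by
  induction i with
  | zero => exact ⟨1, one_ne_zero, by rw [one_smul]; rfl⟩
  | succ i ih =>
    obtain ⟨c, hc, h⟩ := ih (by omega)
    refine ⟨c * koszul k i i, mul_ne_zero hc (fun h0 => ?_), ?_⟩
    · have := koszul_mul_self k i i
      rw [h0, zero_mul] at this
      exact zero_ne_one this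
    · rw [pow_succ', Module.End.mul_apply, h, map_smul,
        dOp_M_single n ⟨i, by omega⟩ ⟨i + 1, hi⟩ rfl, smul_smul]

lemma dOp_pow_M (n : ℕ) : (M k n).dOp ^ (n + 1) = 0 := by
  have h : ∀ (m : ℕ) (v : Fin (n + 1) → k) (j : Fin (n + 1)), (j : ℕ) < m →
      (((M k n).dOp ^ m) v : Fin (n + 1) → k) j = 0 := by
    intro m
    induction m with
    | zero => intro v j hj; omega
    | succ m ih =>
      intro v j hj
      have hc : Commute (M k n).dOp ((M k n).dOp ^ m) := (Commute.refl _).pow_right m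
      rw [pow_succ', Module.End.mul_apply, dOp_M_apply]
      split_ifs with h0
      · rfl
      · have hw := ih v ⟨j - 1, by omega⟩ (by simp only; omega)
        generalize (((M k n).dOp ^ m) v : Fin (n + 1) → k) = w at hw
        obtain ⟨a, ha, b, hb, rfl⟩ := exists_decomp (k := k) w
        rw [map_add, parityOp_apply ha, parityOp_apply hb, koszul_zero_left, koszul_one_one,
          one_smul, neg_one_smul, Pi.add_apply, Pi.neg_apply]
        rw [Pi.add_apply] at hw
        by_cases hp : ((((⟨j - 1, by omega⟩ : Fin (n + 1)) : ℕ)) : ZMod 2) = 0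
        · have hb0 := hb ⟨j - 1, by omega⟩ (by rw [hp]; decide)
          rw [hb0, add_zero] at hw
          rw [hw, hb0, neg_zero, add_zero]
        · have ha0 := ha ⟨j - 1, by omega⟩ hp
          rw [ha0, zero_add] at hw
          rw [hw, ha0, neg_zero, add_zero]
  exact LinearMap.ext fun v => funext fun j => h (n + 1) v j j.2

lemma IsString.dOp_pow {n : ℕ} {Y : SRep (Ga11 k)} (h : IsString n Y) :
    Y.dOp ^ (n + 1) = 0 ∧ ∃ e, (Y.dOp ^ n) e ≠ 0 := by
  have h1 : (M k n).dOp ^ (n + 1) = 0 ∧ ∃ e, ((M k n).dOp ^ n) e ≠ 0 := by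
    refine ⟨dOp_pow_M n, (Pi.single 0 1 : Fin (n + 1) → k), ?_⟩
    obtain ⟨c, hc, e⟩ := exists_dOp_pow_single (k := k) n n (by omega)
    rw [e]
    exact smul_ne_zero hc (by simp)
  rcases h with rfl | rfl
  · exact h1
  · exact h1

lemma dOp_pow_lin {X Y : SRep (Ga11 k)} (f : X ⟶ Y) (n : ℕ) (v : X.V) :
    lin f ((X.dOp ^ n) v) = (Y.dOp ^ n) (lin f v) := by
  induction n generalizing v with
  | zero => rfl
  | succ n ih => rw [pow_succ, Module.End.mul_apply, ih, lin_dOp, pow_succ, Module.End.mul_apply]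

/-- Only strings of odd dimension occur in restrictions from `OSp(1|2)`: by the relation
`y x²ⁱ = x²ⁱ y - i x²ⁱ⁻¹`, the operator `x²ⁱ⁻¹` maps the kernel of `x²ⁱ` into the image of `x²ⁱ`. -/
lemma isEmpty_retract_res (N : SRep (OSp12 k)) {n : ℕ} {Y : SRep (Ga11 k)}
    (hY : IsString (2 * n + 1) Y) (r : Retract Y ((res (emb k)).obj N)) : False := by
  obtain ⟨h0, e, he⟩ := hY.dOp_pow
  have H := N.isOspPair
  obtain ⟨u, hu⟩ : ∃ u : N.V, u = lin r.i e := ⟨_, rfl⟩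
  have h1 : (N.xOp ^ (2 * (n + 1))) u = 0 := by
    have := dOp_pow_lin r.i (2 * n + 1 + 1) e
    rw [h0, LinearMap.zero_apply, map_zero, ← hu] at this
    exact this.symm
  have h2 := LinearMap.congr_fun (H.y_mul_x_pow n) u
  rw [Module.End.mul_apply, h1, map_zero, LinearMap.sub_apply, LinearMap.smul_apply,
    Module.End.mul_apply] at h2
  have h3 : lin r.r ((N.xOp ^ (2 * (n + 1))) (N.yOp u))
      = ((n : k) + 1) • lin r.r ((N.xOp ^ (2 * n + 1)) u) :=
    (congrArg (lin r.r) (sub_eq_zero.1 h2.symm)).trans (map_smul (lin r.r) _ _)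
  have h4 := dOp_pow_lin r.r (2 * n + 1 + 1) (N.yOp u)
  rw [h0, LinearMap.zero_apply] at h4
  have h5 := dOp_pow_lin r.r (2 * n + 1) (lin r.i e)
  have h5' : lin r.r (lin r.i e) = e := by
    rw [← LinearMap.comp_apply, ← lin_comp, r.retract, lin_id, LinearMap.id_apply]
  rw [h5'] at h5
  have h6 : ((n : k) + 1) • (Y.dOp ^ (2 * n + 1)) e = 0 := by
    rw [← h5, ← hu]; exact h3.symm.trans h4
  exact he ((smul_eq_zero.1 h6).resolve_left (by exact_mod_cast Nat.succ_ne_zero n))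

/-- The superspace `k^{1|2}`. -/
@[reducible] def stdSuper (k : Type u) [Field k] : SuperSpace k (Fin 3 → k) where
  grade i :=
    { carrier := {v | ∀ j, par j ≠ i → v j = 0}
      add_mem' := fun ha hb j hj => by rw [Pi.add_apply, ha j hj, hb j hj, add_zero]
      zero_mem' := fun j _ => rfl
      smul_mem' := fun c v hv j hj => by rw [Pi.smul_apply, hv j hj, smul_zero] }
  isCompl := by
    constructor
    · rw [Submodule.disjoint_def]
      intro v h0 h1
      funext j
      rcases zmod_two (par j) with h | h
      · exact h1 j (by rw [h]; decide)
      · exact h0 j (by rw [h]; decide)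
    · rw [codisjoint_iff, eq_top_iff]
      intro v _
      rw [Submodule.mem_sup]
      refine ⟨fun j => if par j = 0 then v j else 0, fun j hj => if_neg hj,
        fun j => if par j = 0 then 0 else v j, fun j hj => ?_, ?_⟩
      · rcases zmod_two (par j) with h | h
        · exact if_pos h
        · exact absurd h hj
      · funext j
        by_cases h : par j = 0 <;> simp [h]

/-- The matrix `g` as a map `k^{1|2} → k^{1|2} ⊗ A`. -/
def stdAct {A : Type u} [Ring A] [Algebra k A] (g : Matrix (Fin 3) (Fin 3) A) :
    (Fin 3 → k) →ₗ[k] (Fin 3 → k) ⊗[k] A :=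
  Fintype.linearCombination k fun j => ∑ i, (Pi.single i 1 : Fin 3 → k) ⊗ₜ g i j

lemma stdAct_single {A : Type u} [Ring A] [Algebra k A] (g : Matrix (Fin 3) (Fin 3) A)
    (j : Fin 3) : stdAct g (Pi.single j 1 : Fin 3 → k)
      = ∑ i, (Pi.single i 1 : Fin 3 → k) ⊗ₜ g i j := by
  rw [stdAct, Fintype.linearCombination_apply_single, one_smul]

lemma fin_three_ext {W : Type*} [AddCommGroup W] [Module k W] {f g : (Fin 3 → k) →ₗ[k] W}
    (h : ∀ j, f (Pi.single j 1) = g (Pi.single j 1)) : f = g :=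
  (Pi.basisFun k (Fin 3)).ext fun j => by rw [Pi.basisFun_apply, h]

lemma extend_stdAct {A : Type u} [Ring A] [Algebra k A] (g h : Matrix (Fin 3) (Fin 3) A) :
    extend (stdAct g) ∘ₗ stdAct (k := k) h = stdAct (g * h) := by
  refine fin_three_ext fun j => ?_
  rw [LinearMap.comp_apply, stdAct_single, stdAct_single, map_sum]
  simp only [extend_tmul, stdAct_single, map_sum, rmul_tmul, Matrix.mul_apply,
    TensorProduct.tmul_sum]
  exact Finset.sum_comm

lemma stdAct_one {A : Type u} [Ring A] [Algebra k A] :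
    stdAct (1 : Matrix (Fin 3) (Fin 3) A) = unitMap k (Fin 3 → k) A := by
  refine fin_three_ext fun j => ?_
  rw [stdAct_single, Finset.sum_eq_single j, unitMap_apply]
  · rw [Matrix.one_apply_eq]
  · intro i _ h; rw [Matrix.one_apply_ne h, TensorProduct.tmul_zero]
  · simp

lemma lTensor_stdAct {A B : Type u} [Ring A] [Algebra k A] [Ring B] [Algebra k B] (f : A →ₐ[k] B)
    (g : Matrix (Fin 3) (Fin 3) A) :
    f.toLinearMap.lTensor (Fin 3 → k) ∘ₗ stdAct g = stdAct (f.mapMatrix g) := by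
  refine fin_three_ext fun j => ?_
  rw [LinearMap.comp_apply, stdAct_single, stdAct_single, map_sum]
  rfl

attribute [local instance] stdSuper

lemma stdAct_isEven {A : Type u} [Ring A] [Algebra k A] [SuperCommAlgebra k A]
    {g : Matrix (Fin 3) (Fin 3) A} (hg : ∀ i j, g i j ∈ gr k A (par i + par j)) :
    IsEven (stdAct (k := k) g) := by
  intro m v hv
  have : stdAct g v = ∑ j, v j • ∑ i, (Pi.single i 1 : Fin 3 → k) ⊗ₜ g i j := rfl
  rw [this]
  refine Submodule.sum_mem _ fun j _ => ?_
  by_cases hj : par j = m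
  · refine Submodule.smul_mem _ _ (Submodule.sum_mem _ fun i _ => ?_)
    refine tmul_mem (i := par i) (j := par i + par j) ?_ ?_ (hg i j)
    · rw [← hj, add_comm (par i) (par j), add_comm (par i), add_add_self]
    · intro l hl
      rw [Pi.single_apply, if_neg]
      rintro rfl
      exact hl rfl
  · rw [hv j hj, zero_smul]; exact zero_mem _

/-- The standard representation of `OSp(1|2)` on `k^{1|2}`. -/
@[reducible] def stdRep (k : Type u) [Field k] [CharZero k] : SRep (OSp12 k) where
  V := Fin 3 → k
  super := stdSuper k
  act A g := stdAct (mat g)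
  act_even A g := stdAct_isEven (mat_isOSp g).even
  act_one A := stdAct_one
  act_mul A g h := (extend_stdAct (mat g) (mat h)).symm
  act_map {A B} f g := lTensor_stdAct (SAlg.algHom f) (mat g)

lemma nOp_std (v : Fin 3 → k) :
    ((res (emb k)).obj (stdRep k)).nOp v = v 1 • (Pi.single 2 1 : Fin 3 → k) := by
  let f : (Fin 3 → k) →ₗ[k] (Fin 3 → k) := coef (Fin 3 → k) (dualSnd k k 0) ∘ₗ
    stdAct (embMatrix k (dualAlg k k 0) (show Ga11Pts k (dualAlg k k 0) from evenTangent k))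
  let p : (Fin 3 → k) →ₗ[k] k := LinearMap.proj 1
  have : f = p.smulRight (Pi.single 2 1 : Fin 3 → k) := by
    refine fin_three_ext fun j => ?_
    rw [LinearMap.comp_apply, stdAct_single, map_sum, Fin.sum_univ_three]
    fin_cases j <;> simp [embMatrix, evenTangent, evenPt, p]
  exact LinearMap.congr_fun this v

lemma nOp_tensor (X Y : SRep (Ga11 k)) :
    ((tensor X Y).nOp : X.V ⊗[k] Y.V →ₗ[k] X.V ⊗[k] Y.V)
      = X.nOp.rTensor Y.V + Y.nOp.lTensor X.V := by
  refine tensor_super_ext fun i j v hv w hw => ?_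
  have hs : dualInr k k 0 1 * dualInr k k 0 1 = 0 :=
    dualInr_mul_dualInr _ _
  have hs0 : dualInr k k 0 1 ∈ gr k (dualAlg k k 0) 0 := dualInr_mem 1
  have h1 : (1 : dualAlg k k 0) ∈ gr k (dualAlg k k 0) 0 := SuperCommAlgebra.one_mem
  have hn : Y.nOp w ∈ gr k Y.V (j + 0) := Y.deriv_mem _ hw
  change coef _ (dualSnd k k 0) (superMul k X.V Y.V _
    (X.act _ (evenPt _ hs0) v ⊗ₜ Y.act _ (evenPt _ hs0) w)) = _
  rw [act_evenPt X hs0 hs, act_evenPt Y hs0 hs, TensorProduct.add_tmul, TensorProduct.tmul_add,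
    TensorProduct.tmul_add, map_add, map_add, map_add, map_add, map_add, superMul_tmul _ h1 hw,
    superMul_tmul _ h1 hn, superMul_tmul _ hs0 hw, superMul_tmul _ hs0 hn]
  simp only [koszul_zero_left, one_smul, one_mul, mul_one, hs, map_add, coef_tmul, dualSnd_one,
    dualSnd_inr, TensorProduct.tmul_zero, map_zero, zero_smul, zero_add, add_zero,
    LinearMap.add_apply, LinearMap.rTensor_tmul, LinearMap.lTensor_tmul]
  exact add_comm _ _

lemma add_pow_of_sq {R : Type*} [Ring R] {a b : R} (h : Commute a b) (hb : b * b = 0) (m : ℕ) :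
    (a + b) ^ (m + 1) = a ^ (m + 1) + (m + 1) • (a ^ m * b) := by
  induction m with
  | zero => simp
  | succ m ih =>
    rw [pow_succ, ih, mul_add, add_mul, add_mul, smul_mul_assoc, smul_mul_assoc, mul_assoc _ b b,
      hb, mul_zero, smul_zero, add_zero, mul_assoc, ← h.eq, ← mul_assoc, ← pow_succ, ← pow_succ,
      add_smul (m + 1) 1, one_smul]
    abel

lemma rTensor_add_lTensor_pow {V W : Type u} [AddCommGroup V] [Module k V] [AddCommGroup W]
    [Module k W] (f : End k V) {g : End k W} (hg : g * g = 0) (m : ℕ) :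
    (f.rTensor W + g.lTensor V : End k (V ⊗[k] W)) ^ (m + 1)
      = (f ^ (m + 1)).rTensor W + (m + 1) • TensorProduct.map (f ^ m) g := by
  have hc : Commute (f.rTensor W : End k (V ⊗[k] W)) (g.lTensor V) :=
    TensorProduct.ext' fun v w => rfl
  have hg' : (g.lTensor V : End k (V ⊗[k] W)) * g.lTensor V = 0 :=
    (LinearMap.lTensor_mul V g g).symm.trans (by rw [hg, LinearMap.lTensor_zero])
  rw [add_pow_of_sq hc hg', LinearMap.rTensor_pow, LinearMap.rTensor_pow]
  congr 2
  exact LinearMap.rTensor_comp_lTensor ..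

/-- In the `n`-th tensor power of the standard representation, `nOp` has nilpotency index exactly
`n + 1`. -/
lemma exists_nOp_pow (n : ℕ) : ∃ N : SRep (OSp12 k),
    ((res (emb k)).obj N).nOp ^ n ≠ 0 ∧ ((res (emb k)).obj N).nOp ^ (n + 1) = 0 := by
  induction n with
  | zero =>
    refine ⟨unit _, fun h => ?_, ?_⟩
    · exact one_ne_zero (α := k) (LinearMap.congr_fun h (1 : k))
    · rw [zero_add, pow_one]
      refine LinearMap.ext_ring ?_
      change coef k (dualSnd k k 0) ((1 : k) ⊗ₜ[k] (1 : dualAlg k k 0)) = 0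
      rw [coef_tmul, dualSnd_one, zero_smul]
  | succ n ih =>
    obtain ⟨N, h1, h2⟩ := ih
    let f : End k N.V := ((res (emb k)).obj N).nOp
    let g : End k (Fin 3 → k) := ((res (emb k)).obj (stdRep k)).nOp
    have hg : ∀ w, g w = w 1 • (Pi.single 2 1 : Fin 3 → k) := nOp_std
    have hgg : g * g = 0 := LinearMap.ext fun w => by
      rw [Module.End.mul_apply, hg w, map_smul, hg]; simp
    let S : End k (N.V ⊗[k] (Fin 3 → k)) := ((res (emb k)).obj (tensor N (stdRep k))).nOp
    have e : ∀ m, S ^ (m + 1)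
        = (f ^ (m + 1)).rTensor (Fin 3 → k) + (m + 1) • TensorProduct.map (f ^ m) g := fun m =>
      (congrArg (fun a : End k (N.V ⊗[k] (Fin 3 → k)) => a ^ (m + 1))
        (nOp_tensor ((res (emb k)).obj N) ((res (emb k)).obj (stdRep k)))).trans
        (rTensor_add_lTensor_pow f hgg m)
    have hf : f ^ (n + 1) = 0 := h2
    refine ⟨tensor N (stdRep k), show S ^ (n + 1) ≠ 0 from ?_, show S ^ (n + 1 + 1) = 0 from ?_⟩
    · rw [e, hf, LinearMap.rTensor_zero, zero_add]
      intro h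
      obtain ⟨v, hv⟩ : ∃ v, (f ^ n) v ≠ 0 := by
        by_contra! h0
        exact h1 (LinearMap.ext h0)
      have h3 : (n + 1) • ((f ^ n) v ⊗ₜ[k] g (Pi.single 1 1)) = 0 :=
        LinearMap.congr_fun h (v ⊗ₜ (Pi.single 1 1 : Fin 3 → k))
      rw [hg, Pi.single_eq_same, one_smul, ← Nat.cast_smul_eq_nsmul k, smul_eq_zero] at h3
      rcases h3 with h3 | h3
      · exact Nat.succ_ne_zero n (by exact_mod_cast h3)
      · let p : (Fin 3 → k) →ₗ[k] k := LinearMap.proj 2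
        have h4 := congrArg (fun t => TensorProduct.rid k N.V (p.lTensor N.V t)) h3
        exact hv (by simpa [p] using h4)
    · rw [e, pow_succ, hf, zero_mul, LinearMap.rTensor_zero, TensorProduct.map_zero_left, smul_zero,
        zero_add]

/-- Each string of odd dimension is a direct summand of the restriction of a representation of
`OSp(1|2)`: since strings of dimension `2n + 2` are excluded, the longest strings in the `n`-th
tensor power of the standard representation have dimension `2n + 1`. -/
lemma exists_retract_res (n : ℕ) {Y : SRep (Ga11 k)} (hY : IsString (2 * n) Y) :
    ∃ N : SRep (OSp12 k), Nonempty (Retract Y ((res (emb k)).obj N)) := by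
  obtain ⟨N, h1, h2⟩ := exists_nOp_pow (k := k) n
  set X := (res (emb k)).obj N with hX
  rw [← sOp_sq, ← pow_mul] at h1 h2
  have h3 : X.sOp ^ (2 * n + 1) = 0 := by
    by_contra h
    obtain ⟨Z, hZ, ⟨r⟩⟩ := exists_retract_string h2 h
    exact isEmpty_retract_res N hZ r
  obtain ⟨Z, hZ, ⟨r⟩⟩ := exists_retract_string h3 h1
  rcases hY with rfl | rfl <;> rcases hZ with rfl | rfl
  · exact ⟨N, ⟨r⟩⟩
  · exact ⟨N.parityShift, ⟨(Retract.ofIso (shiftShift _).symm).trans (shiftRetract r)⟩⟩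
  · exact ⟨N.parityShift, ⟨shiftRetract r⟩⟩
  · exact ⟨N, ⟨r⟩⟩

end SRep

end realization

/-! ### Restriction followed by semisimplification is an equivalence -/

section equivalence

open Module

variable {k : Type u} [Field k] [CharZero k]

/-- A quasi-inverse of a braided equivalence, as a braided functor. -/
lemma exists_braided_quasiInverse {C D : Type*} [Category C] [Category D] [MonoidalCategory C]
    [SymmetricCategory C] [MonoidalCategory D] [SymmetricCategory D] [Preadditive C] [Linear k C]
    [Preadditive D] [Linear k D] (F : C ⥤ D) [hF : F.Braided] [hA : F.Additive] [hL : F.Linear k]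
    [F.IsEquivalence] : ∃ (I : D ⥤ C) (_ : I.Braided) (e : I ⋙ F ≅ 𝟭 D),
      NatTrans.IsMonoidal e.hom ∧ I.Additive ∧ I.Linear k ∧ I.IsEquivalence := by
  let _ : F.asEquivalence.functor.Braided := hF
  have _ : F.asEquivalence.functor.Additive := hA
  have _ : F.asEquivalence.functor.Linear k := hL
  obtain ⟨h, hm⟩ := exists_braided_inverse F.asEquivalence
  exact ⟨F.asEquivalence.inverse, h, F.asEquivalence.counitIso, hm,
    Equivalence.inverse_additive _, Equivalence.inverseLinear k _, inferInstance⟩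

/-- A fully faithful functor from an idempotent complete category has an essential image which is
closed under retracts. -/
lemma mem_essImage_of_retract {C D : Type*} [Category C] [Category D] [IsIdempotentComplete C]
    (F : C ⥤ D) [F.Full] [F.Faithful] {X : D} {N : C} (r : Retract X (F.obj N)) :
    F.essImage X := by
  obtain ⟨N', i, p, h1, h2⟩ := IsIdempotentComplete.idempotents_split N (F.preimage (r.r ≫ r.i))
    (F.map_injective (by simp))
  have h3 : F.map p ≫ F.map i = r.r ≫ r.i := by rw [← F.map_comp, h2, F.map_preimage]
  have h4 : (F.map i ≫ r.r) ≫ r.i ≫ F.map p = 𝟙 _ := by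
    calc (F.map i ≫ r.r) ≫ r.i ≫ F.map p = F.map i ≫ (r.r ≫ r.i) ≫ F.map p := by
          simp only [Category.assoc]
      _ = F.map (i ≫ p) ≫ F.map (i ≫ p) := by
          rw [← h3, F.map_comp]; simp only [Category.assoc]
      _ = 𝟙 _ := by rw [h1, F.map_id, Category.comp_id]
  have h5 : (r.i ≫ F.map p) ≫ F.map i ≫ r.r = 𝟙 _ := by
    calc (r.i ≫ F.map p) ≫ F.map i ≫ r.r = r.i ≫ (F.map p ≫ F.map i) ≫ r.r := by
          simp only [Category.assoc]
      _ = 𝟙 _ := by rw [h3, Category.assoc, r.retract_assoc, r.retract]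
  exact ⟨N', ⟨⟨F.map i ≫ r.r, r.i ≫ F.map p, h4, h5⟩⟩⟩

namespace SRep

variable (k) in
/-- The semisimplification functor of `Rep(G_a^{(1|1)})`. -/
abbrev semi : SRep (Ga11 k) ⥤ Semisimplification k (SRep (Ga11 k)) := semisimplify k _

variable (k) in
/-- Restriction from `OSp(1|2)` to `G_a^{(1|1)}`, followed by semisimplification. -/
abbrev resSemi : SRep (OSp12 k) ⥤ Semisimplification k (SRep (Ga11 k)) :=
  res (emb k) ⋙ semi k

lemma IsString.isCyclic {n : ℕ} {Y : SRep (Ga11 k)} (h : IsString n Y) : IsCyclic Y := by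
  rcases h with rfl | rfl
  · exact isCyclic_M n
  · exact (isCyclic_M n).parityShift

lemma IsString.sdim_odd {n : ℕ} {Y : SRep (Ga11 k)} (h : IsString (2 * n + 1) Y) : Y.sdim = 0 := by
  rcases h with rfl | rfl
  · exact sdim_M_odd n
  · rw [sdim_parityShift, sdim_M_odd, neg_zero]

lemma IsString.sdim_even {n : ℕ} {Y : SRep (Ga11 k)} (h : IsString (2 * n) Y) : Y.sdim ≠ 0 := by
  rcases h with rfl | rfl
  · rw [sdim_M_even]; exact one_ne_zero
  · rw [sdim_parityShift, sdim_M_even]; exact neg_ne_zero.2 one_ne_zero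

lemma IsString.isZero {n : ℕ} {Y : SRep (Ga11 k)} (h : IsString (2 * n + 1) Y) :
    Limits.IsZero ((semi k).obj Y) := h.isCyclic.isZero h.sdim_odd

lemma IsString.simple {n : ℕ} {Y : SRep (Ga11 k)} (h : IsString (2 * n) Y) :
    Simple ((semi k).obj Y) := h.isCyclic.simple h.sdim_even

instance : (resSemi k).Full where
  map_surjective {M N} f := by
    obtain ⟨f, rfl⟩ : ∃ f' : (res (emb k)).obj M ⟶ (res (emb k)).obj N, (semi k).map f' = f :=
      semisimplify_map_surjective f
    obtain ⟨g, hg⟩ := exists_res_map f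
    exact ⟨g, ((semisimplify_map_eq_iff (k := k) _ _).2 hg).symm⟩

instance : (resSemi k).Faithful where
  map_injective {M N} f g h := by
    have h' : Negligible ((res (emb k)).map f - (res (emb k)).map g) :=
      (semisimplify_map_eq_iff (k := k) _ _).1 h
    rw [← (res (emb k)).map_sub] at h'
    exact sub_eq_zero.1 (eq_zero_of_negligible _ h')

lemma exists_retract_sum {N₁ N₂ : SRep (OSp12 k)} {A B X : Semisimplification k (SRep (Ga11 k))}
    (rA : Retract A ((resSemi k).obj N₁)) (rB : Retract B ((resSemi k).obj N₂))
    (a : Retract A X) (b : Retract B X)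
    (h : a.r ≫ a.i + b.r ≫ b.i = 𝟙 X) : Nonempty (Retract X ((resSemi k).obj (N₁ ⊞ N₂))) := by
  refine ⟨⟨a.r ≫ rA.i ≫ (resSemi k).map Limits.biprod.inl +
      b.r ≫ rB.i ≫ (resSemi k).map Limits.biprod.inr,
    (resSemi k).map Limits.biprod.fst ≫ rA.r ≫ a.i +
      (resSemi k).map Limits.biprod.snd ≫ rB.r ≫ b.i, ?_⟩⟩
  have e : ∀ {P Q R : SRep (OSp12 k)} (f : P ⟶ Q) (g : Q ⟶ R) {Z} (h : (resSemi k).obj R ⟶ Z),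
      (resSemi k).map f ≫ (resSemi k).map g ≫ h = (resSemi k).map (f ≫ g) ≫ h := fun f g Z h => by
    rw [← Category.assoc, ← (resSemi k).map_comp]
  simp only [Preadditive.add_comp, Preadditive.comp_add, Category.assoc, e, Limits.biprod.inl_fst,
    Limits.biprod.inl_snd, Limits.biprod.inr_fst, Limits.biprod.inr_snd, (resSemi k).map_zero,
    Limits.zero_comp, Limits.comp_zero, add_zero, zero_add, CategoryTheory.Functor.map_id,
    Category.id_comp, Retract.retract_assoc]
  exact h

/-- Every object of the semisimplification is a direct summand of the image of a representation of
`OSp(1|2)`. -/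
lemma exists_retract_obj (X : SRep (Ga11 k)) :
    ∃ N, Nonempty (Retract ((semi k).obj X) ((resSemi k).obj N)) := by
  have hzero : ∀ {A : Semisimplification k (SRep (Ga11 k))}, Limits.IsZero A →
      Retract A ((resSemi k).obj (unit _)) := fun hA => ⟨0, 0, hA.eq_of_src _ _⟩
  induction X using string_induction with
  | hz X hX => exact ⟨_, ⟨hzero ((semi k).map_isZero hX)⟩⟩
  | hadd X Y Z n h h' hY e ih =>
    obtain ⟨N₂, ⟨r₂⟩⟩ := ih
    obtain ⟨N₁, ⟨r₁⟩⟩ : ∃ N, Nonempty (Retract ((semi k).obj Y) ((resSemi k).obj N)) := by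
      obtain ⟨m, rfl | rfl⟩ := Nat.even_or_odd' n
      · obtain ⟨N, ⟨r⟩⟩ := exists_retract_res m hY
        exact ⟨N, ⟨r.map (semi k)⟩⟩
      · exact ⟨_, ⟨hzero hY.isZero⟩⟩
    refine ⟨_, exists_retract_sum r₁ r₂ (h.map (semi k)) (h'.map (semi k)) ?_⟩
    have := congrArg (semi k).map e
    rw [(semi k).map_add, (semi k).map_comp, (semi k).map_comp, (semi k).map_id] at this
    exact this

/-- The essential image is closed under direct summands, since `Rep(OSp(1|2))` is abelian and the
functor is fully faithful. -/
instance : (resSemi k).EssSurj where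
  mem_essImage X := by
    have := Idempotents.isIdempotentComplete_of_abelian (SRep (OSp12 k))
    obtain ⟨N, ⟨r⟩⟩ := exists_retract_obj X.as
    exact mem_essImage_of_retract (resSemi k) r

instance : (resSemi k).IsEquivalence where

/-- If the image of a representation in the semisimplification is simple, then it is the image of
one of its strings. -/
lemma exists_retract_isIso (X : SRep (Ga11 k)) : Simple ((semi k).obj X) →
    ∃ n Y, IsString (2 * n) Y ∧ ∃ r : Retract Y X, IsIso ((semi k).map r.i) := by
  induction X using string_induction with
  | hz X hX => exact fun h => absurd ((semi k).map_isZero hX) (Simple.not_isZero _)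
  | hadd X Y Z n h h' hY e ih =>
    intro hX
    obtain ⟨m, rfl | rfl⟩ := Nat.even_or_odd' n
    · have hs := hY.simple
      have h1 := (h.map (semi k)).retract
      have : IsSplitMono ((semi k).map h.i) := ⟨⟨⟨(semi k).map h.r, h1⟩⟩⟩
      refine ⟨m, Y, hY, h, isIso_of_mono_of_nonzero fun h0 => id_nonzero ((semi k).obj Y) ?_⟩
      rw [← h1]
      exact (congrArg (· ≫ (semi k).map h.r) h0).trans Limits.zero_comp
    · have e' := congrArg (semi k).map e
      rw [(semi k).map_add, (semi k).map_comp, (semi k).map_comp, (semi k).map_id,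
        hY.isZero.eq_of_src ((semi k).map h.i) 0,
        Limits.comp_zero, zero_add] at e'
      have hi : IsIso ((semi k).map h'.i) := ⟨(semi k).map h'.r, (h'.map (semi k)).retract, e'⟩
      have hZ : Simple ((semi k).obj Z) := Simple.of_iso (asIso ((semi k).map h'.i))
      obtain ⟨n', Y', hY', r, hr⟩ := ih hZ
      refine ⟨n', Y', hY', r.trans h', ?_⟩
      have : (semi k).map (r.trans h').i = (semi k).map r.i ≫ (semi k).map h'.i :=
        (semi k).map_comp _ _
      rw [this]
      infer_instance

/-- A representation without strings of even dimension whose image in the semisimplification is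
zero vanishes. -/
lemma isZero_of_isZero {X : SRep (Ga11 k)}
    (hX : ∀ n Y, IsString (2 * n + 1) Y → IsEmpty (Retract Y X))
    (h0 : Limits.IsZero ((semi k).obj X)) : Limits.IsZero X := by
  revert hX h0
  induction X using string_induction with
  | hz X hX => exact fun _ _ => hX
  | hadd X Y Z n h h' hY e ih =>
    intro hX h0
    obtain ⟨m, rfl | rfl⟩ := Nat.even_or_odd' n
    · have := hY.simple
      refine absurd ?_ (id_nonzero ((semi k).obj Y))
      rw [← (h.map (semi k)).retract]
      exact (congrArg (· ≫ (semi k).map h.r) (h0.eq_of_tgt ((semi k).map h.i) 0)).trans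
        Limits.zero_comp
    · exact ((hX m Y hY).false h).elim

/-- A representation without strings of even dimension whose image in the semisimplification is
simple is itself a string. -/
lemma exists_iso_of_simple {X : SRep (Ga11 k)}
    (hX : ∀ n Y, IsString (2 * n + 1) Y → IsEmpty (Retract Y X)) (hs : Simple ((semi k).obj X)) :
    ∃ n Y, IsString (2 * n) Y ∧ Nonempty (Y ≅ X) := by
  obtain ⟨n, Y, hY, r, hr⟩ := exists_retract_isIso X hs
  obtain ⟨Z, r', h, -⟩ := exists_complement r
  have h1 : r.i ≫ r'.r = 0 := by
    have := congrArg (fun f => r.i ≫ f ≫ r'.r) h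
    simp only [Preadditive.add_comp, Preadditive.comp_add, Category.assoc, r'.retract,
      r.retract_assoc, Category.comp_id, Category.id_comp] at this
    exact add_eq_left.1 this
  have h2 : (semi k).map r'.r = 0 := by
    rw [← cancel_epi ((semi k).map r.i), Limits.comp_zero, ← (semi k).map_comp, h1,
      (semi k).map_zero]
  have h3 : Limits.IsZero ((semi k).obj Z) := by
    rw [Limits.IsZero.iff_id_eq_zero, ← (r'.map (semi k)).retract]
    exact (congrArg ((semi k).map r'.i ≫ ·) h2).trans Limits.comp_zero
  have hZ : Limits.IsZero Z := isZero_of_isZero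
    (fun m W hW => ⟨fun t => (hX m W hW).false (t.trans r')⟩) h3
  rw [hZ.eq_of_tgt r'.r 0, Limits.zero_comp, add_zero] at h
  exact ⟨n, Y, hY, ⟨⟨r.i, r.r, r.retract, h⟩⟩⟩

/-- If `N` and `M₂ₙ` become isomorphic in the semisimplification, they are isomorphic over
`G_a^{(1|1)}`. -/
lemma nonempty_res_iso {n : ℕ} {N : SRep (OSp12 k)}
    (e : (resSemi k).obj N ≅ (semi k).obj (M k (2 * n))) :
    Nonempty ((res (emb k)).obj N ≅ M k (2 * n)) := by
  have hM : IsString (2 * n) (M k (2 * n)) := Or.inl rfl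
  have := hM.simple
  obtain ⟨m, Y, hY, ⟨i⟩⟩ := exists_iso_of_simple
    (fun _ _ hY => ⟨fun r => isEmpty_retract_res N hY r⟩) (Simple.of_iso e)
  obtain ⟨j⟩ := hY.isCyclic.nonempty_iso hM.isCyclic hY.sdim_even hM.sdim_even
    ((semi k).mapIso i ≪≫ e)
  exact ⟨i.symm ≪≫ j⟩

lemma eq_of_iso_M {m n : ℕ} (e : (semi k).obj (M k (2 * m)) ≅ (semi k).obj (M k (2 * n))) :
    m = n := by
  have hm : IsString (2 * m) (M k (2 * m)) := Or.inl rfl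
  have hn : IsString (2 * n) (M k (2 * n)) := Or.inl rfl
  obtain ⟨i⟩ := hm.isCyclic.nonempty_iso hn.isCyclic hm.sdim_even hn.sdim_even e
  have h : finrank k (Fin (2 * m + 1) → k) = finrank k (Fin (2 * n + 1) → k) := finrank_eq_of_iso i
  rw [finrank_fin_fun, finrank_fin_fun] at h
  omega

lemma isEmpty_iso_M (m n : ℕ) :
    IsEmpty ((semi k).obj (M k (2 * m)) ≅ (semi k).obj (M k (2 * n)).parityShift) := by
  refine ⟨fun e => ?_⟩
  have hm : IsString (2 * m) (M k (2 * m)) := Or.inl rfl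
  have hn : IsString (2 * n) (M k (2 * n)).parityShift := Or.inr rfl
  obtain ⟨i⟩ := hm.isCyclic.nonempty_iso hn.isCyclic hm.sdim_even hn.sdim_even e
  have h := sdim_eq_of_iso i
  rw [sdim_parityShift, sdim_M_even, sdim_M_even] at h
  have h2 : (2 : k) = 0 := by linear_combination h
  exact two_ne_zero h2

lemma exists_iso_M (L : Semisimplification k (SRep (Ga11 k))) (hL : Simple L) : ∃ n : ℕ,
    Nonempty (L ≅ (semi k).obj (M k (2 * n))) ∨
    Nonempty (L ≅ (semi k).obj (M k (2 * n)).parityShift) := by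
  obtain ⟨n, Y, hY, r, hr⟩ := exists_retract_isIso L.as hL
  refine ⟨n, ?_⟩
  rcases hY with rfl | rfl
  · exact Or.inl ⟨(asIso ((semi k).map r.i)).symm⟩
  · exact Or.inr ⟨(asIso ((semi k).map r.i)).symm⟩

/-- The parity shift of an isomorphism. -/
def shiftIso {G : Supergroup k} {M N : SRep G} (e : M ≅ N) : M.parityShift ≅ N.parityShift where
  hom := shiftHom e.hom
  inv := shiftHom e.inv
  hom_inv_id := (shiftRetract (Retract.ofIso e)).retract
  inv_hom_id := (shiftRetract (Retract.ofIso e.symm)).retract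

end SRep

end equivalence

end SuperRep

end

theorem mainTheorem3 {k : Type u} [Field k] [IsAlgClosed k] [CharZero k] :
    SuperRep.IsTensorCategory k (SuperRep.SRep (SuperRep.OSp12 k)) ∧
    SuperRep.IsTensorCategory k
      (SuperRep.Semisimplification k (SuperRep.SRep (SuperRep.Ga11 k))) ∧
    -- the composition of restriction and semisimplification is a tensor equivalence
    SuperRep.IsTensorEquivalence k
      (SuperRep.SRep.res (SuperRep.emb k) ⋙
        SuperRep.semisimplify k (SuperRep.SRep (SuperRep.Ga11 k))) ∧
    -- the images of the `M n` in the semisimplification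
    (∀ n : ℕ, Limits.IsZero ((SuperRep.semisimplify k _).obj (SuperRep.SRep.M k (2 * n + 1)))) ∧
    (∀ n : ℕ, Limits.IsZero
      ((SuperRep.semisimplify k _).obj (SuperRep.SRep.M k (2 * n + 1)).parityShift)) ∧
    (∀ n : ℕ, Simple ((SuperRep.semisimplify k _).obj (SuperRep.SRep.M k (2 * n)))) ∧
    (∀ n : ℕ, Simple ((SuperRep.semisimplify k _).obj (SuperRep.SRep.M k (2 * n)).parityShift)) ∧
    (∀ L : SuperRep.Semisimplification k (SuperRep.SRep (SuperRep.Ga11 k)), Simple L → ∃ n : ℕ,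
      Nonempty (L ≅ (SuperRep.semisimplify k _).obj (SuperRep.SRep.M k (2 * n))) ∨
      Nonempty (L ≅ (SuperRep.semisimplify k _).obj (SuperRep.SRep.M k (2 * n)).parityShift)) ∧
    (∀ m n : ℕ, Nonempty ((SuperRep.semisimplify k _).obj (SuperRep.SRep.M k (2 * m)) ≅
      (SuperRep.semisimplify k _).obj (SuperRep.SRep.M k (2 * n))) → m = n) ∧
    (∀ m n : ℕ, IsEmpty ((SuperRep.semisimplify k _).obj (SuperRep.SRep.M k (2 * m)) ≅
      (SuperRep.semisimplify k _).obj (SuperRep.SRep.M k (2 * n)).parityShift)) ∧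
    -- `Rep(OSp(1|2))` is the semisimplification of `Rep(G_a^{(1|1)})`
    ∃ (T : SuperRep.SRep (SuperRep.Ga11 k) ⥤ SuperRep.SRep (SuperRep.OSp12 k)) (_ : T.Braided),
      T.Additive ∧ T.Linear k ∧
      (∃ e : T ⋙ SuperRep.SRep.res (SuperRep.emb k) ⋙
          SuperRep.semisimplify k (SuperRep.SRep (SuperRep.Ga11 k)) ≅
          SuperRep.semisimplify k (SuperRep.SRep (SuperRep.Ga11 k)),
        NatTrans.IsMonoidal e.hom) ∧
      (∀ n : ℕ, Limits.IsZero (T.obj (SuperRep.SRep.M k (2 * n + 1)))) ∧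
      (∀ n : ℕ, Simple (T.obj (SuperRep.SRep.M k (2 * n))) ∧
        (T.obj (SuperRep.SRep.M k (2 * n))).HasSuperDim (n + 1) n ∧
        Nonempty ((SuperRep.SRep.res (SuperRep.emb k)).obj (T.obj (SuperRep.SRep.M k (2 * n))) ≅
          SuperRep.SRep.M k (2 * n))) ∧
      (∀ N : SuperRep.SRep (SuperRep.OSp12 k), Simple N → ∃ n : ℕ,
        Nonempty (N ≅ T.obj (SuperRep.SRep.M k (2 * n))) ∨
        Nonempty (N ≅ (T.obj (SuperRep.SRep.M k (2 * n))).parityShift)) := by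
  have hO := SuperRep.SRep.isTensorCategory (SuperRep.OSp12 k)
  have hM : ∀ n, SuperRep.SRep.IsString n (SuperRep.SRep.M k n) := fun n => Or.inl rfl
  have hM' : ∀ n, SuperRep.SRep.IsString n (SuperRep.SRep.M k n).parityShift := fun n => Or.inr rfl
  let F := SuperRep.SRep.resSemi k
  let S := SuperRep.SRep.semi k
  obtain ⟨I, hI, c, hc, hA, hL, hE⟩ := SuperRep.exists_braided_quasiInverse (k := k) F
  -- the counit identifies the image of `T X` in the semisimplification with that of `X`
  have hT : ∀ X, F.obj ((S ⋙ I).obj X) ≅ S.obj X := fun X => c.app (S.obj X)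
  have hres : ∀ n, Nonempty ((SuperRep.SRep.res (SuperRep.emb k)).obj
      ((S ⋙ I).obj (SuperRep.SRep.M k (2 * n))) ≅ SuperRep.SRep.M k (2 * n)) := fun n =>
    SuperRep.SRep.nonempty_res_iso (hT _)
  have hU : SuperRep.IsTensorCategory k
      (SuperRep.Semisimplification k (SuperRep.SRep (SuperRep.Ga11 k))) := by
    have : F.asEquivalence.functor.Braided := show F.Braided from inferInstance
    have : F.asEquivalence.functor.Additive := show F.Additive from inferInstance
    have : F.asEquivalence.functor.Linear k := show F.Linear k from inferInstance
    exact hO.of_equivalence F.asEquivalence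
  refine ⟨hO, hU, ⟨inferInstance, inferInstance, inferInstance, inferInstance, inferInstance⟩,
    fun n => (hM _).isZero, fun n => (hM' _).isZero, fun n => (hM _).simple,
    fun n => (hM' _).simple, SuperRep.SRep.exists_iso_M,
    fun m n ⟨e⟩ => SuperRep.SRep.eq_of_iso_M e, SuperRep.SRep.isEmpty_iso_M, S ⋙ I, inferInstance,
    inferInstance, inferInstance,
    ⟨Functor.associator S I F ≪≫ Functor.isoWhiskerLeft S c ≪≫ S.rightUnitor, ?_⟩,
    fun n => I.map_isZero (hM _).isZero, fun n => ⟨?_, ?_, hres n⟩, fun N hN => ?_⟩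
  · have : NatTrans.IsMonoidal (Functor.whiskerLeft S c.hom) := inferInstance
    exact inferInstanceAs (NatTrans.IsMonoidal
      ((Functor.associator S I F).hom ≫ Functor.whiskerLeft S c.hom ≫ S.rightUnitor.hom))
  · have := (hM (2 * n)).simple
    exact simple_obj I _
  · obtain ⟨e⟩ := hres n
    refine SuperRep.SRep.hasSuperDim_of_sdim ?_ ?_
    · exact (SuperRep.SRep.sdim_eq_of_iso e).trans (SuperRep.SRep.sdim_M_even n)
    · exact (SuperRep.SRep.finrank_eq_of_iso e).trans (Module.finrank_fin_fun k)
  · obtain ⟨n, ⟨⟨e⟩⟩ | ⟨⟨e⟩⟩⟩ := SuperRep.SRep.exists_iso_M (F.obj N) (simple_obj F N)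
    · exact ⟨n, Or.inl ⟨F.preimageIso (e ≪≫ (hT _).symm)⟩⟩
    · obtain ⟨i⟩ := hres n
      exact ⟨n, Or.inr ⟨F.preimageIso (e ≪≫ (S.mapIso (SuperRep.SRep.shiftIso i)).symm)⟩⟩
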